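/- **Setting.** Let $d\ge 1$. Let $(\Omega,\mathcal F,P)$ be a complete separable probability space, $\langle\cdot\rangle=\int_\Omega\cdot\,dP$, and let $(\tau_x)_{x\in\mathbb R^d}$ be measurable maps $\tau_x:\Omega\to\Omega$ that preserve $P$, with $\tau_0=\mathrm{Id}$, $\tau_{x+y}=\tau_x\circ\tau_y$, and such that $(\omega,x)\mapsto\tau_x\omega$ is measurable with respect to the completion of $\mathcal F\otimes\mathcal L(\mathbb R^d)$ under $P\otimes dx$. Assume ergodicity: every $A\in\mathcal F$ with $\tau_xA=A$ for all $x$ has $P(A)\in\{0,1\}$. Let $p\in(1,\infty)$ and let $Q\subset\mathbb R^d$ be open and bounded. *Function spaces.* $W^{1,p}_0(Q)$ is the closure of $C_c^\infty(Q)$ in $W^{1,p}(Q)$. $L^p(\Omega)\otimes W^{1,p}_0(Q)$ is the closure of $\{\sum_{i=1}^n\varphi_i\eta_i:\varphi_i\in L^p(\Omega),\ \eta_i\in W_0^{1,p}(Q)\}$ in $L^p(\Omega;W^{1,p}(Q))$, and $\nabla$ is the gradient in $x\in Q$. For $\varphi\in L^p(\Omega)$ let $D_i\varphi=\lim_{h\to0}h^{-1}(\varphi\circ\tau_{he_i}-\varphi)$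 in $L^p(\Omega)$, if the limit exists; $L^p_{\mathrm{pot}}(\Omega)$ is the closure in $L^p(\Omega)^d$ of the set of all $D\varphi=(D_1\varphi,\dots,D_d\varphi)$, where $\varphi\in L^p(\Omega)$ is such that $D_1\varphi,\dots,D_d\varphi$ exist. $L^p_{\mathrm{pot}}(\Omega)\otimes L^p(Q)$ is the closure in $L^p(\Omega\times Q)^d$ of the finite sums $\sum_i\chi_i\eta_i$ with $\chi_i\in L^p_{\mathrm{pot}}(\Omega)$, $\eta_i\in L^p(Q)$. The unfolding operator is $(\mathcal T_\varepsilon u)(\omega,x)=u(\tau_{-x/\varepsilon}\omega,x)$, and $u_\varepsilon\overset{2}{\rightharpoonup}u$ in $L^p(\Omega\times Q)$ means that $\mathcal T_\varepsilon u_\varepsilon\rightharpoonup u$ weakly in $L^p(\Omega\times Q)$ (for vector fields likewise). Functions on $Q$ are viewed as functions on $\Omega\times Q$ that are constant in $\omega$. *Integrand.* Let $V:\Omega\times Q\times\mathbb R^d\to\mathbb R$ be such that - (A1) $V(\cdot,\cdot,F)$ is measurable with respect to the completion of $\mathcal F\otimes\mathcal L(Q)$ under $P\otimes dx$, for every $F\in\mathbb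 R^d$; - (A2) $V(\omega,x,\cdot)$ is convex for a.a. $(\omega,x)\in\Omega\times Q$; - (A3') there are $C>0$ and a random variable $\lambda\in L^1(\Omega)$, $\lambda>0$ a.s., with $\langle\lambda^{-\frac1{p-1}}\rangle^{p-1}<C$ and $$\lambda(\omega)|F|^p-C\le V(\omega,x,F)\le C(\lambda(\omega)|F|^p+1)\qquad\text{for a.a. }(\omega,x)\in\Omega\times Q\text{ and all }F\in\mathbb R^d.$$ *Functionals.* Let $\delta>0$. For $\varepsilon>0$ and $u\in L^1(\Omega\times Q)$ let $$\mathcal E_{\varepsilon,\delta}(u)=\Big\langle\int_Q V(\tau_{x/\varepsilon}\omega,x,\nabla u(\omega,x))+\delta\,|\nabla u(\omega,x)-\langle\nabla u(\cdot,x)\rangle|^p\,dx\Big\rangle\in\mathbb R\cup\{\infty\}$$ if $u\in L^p(\Omega)\otimes W^{1,p}_0(Q)$, and $\mathcal E_{\varepsilon,\delta}(u)=\infty$ otherwise. For $u\in L^1(Q)$ let $$\mathcal E_{\hom,\delta}(u)=\int_Q V_{\hom,\delta}(x,\nabla u(x))\,dx,\qquad V_{\hom,\delta}(x,F)=\inf_{\chi\in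 L^p_{\mathrm{pot}}(\Omega)}\big\langle V(\omega,x,F+\chi(\omega))+\delta|\chi(\omega)|^p\big\rangle,$$ if $u\in W^{1,p}_0(Q)$, and $\mathcal E_{\hom,\delta}(u)=\infty$ otherwise. **Theorem.** As $\varepsilon\to0$, $\mathcal E_{\varepsilon,\delta}$ Mosco converges to $\mathcal E_{\hom,\delta}$ in the following sense. In parts 1 and 2, $\varepsilon\to0$ along an arbitrary sequence of positive numbers. 1. (Compactness.) If $u_\varepsilon\in L^p(\Omega)\otimes W^{1,p}_0(Q)$ and $\limsup_{\varepsilon\to0}\mathcal E_{\varepsilon,\delta}(u_\varepsilon)<\infty$, then there are $u\in W^{1,p}_0(Q)$, $\chi\in L^p_{\mathrm{pot}}(\Omega)\otimes L^p(Q)$ and a subsequence along which $$u_\varepsilon\overset{2}{\rightharpoonup}u\ \text{ in }L^p(\Omega\times Q),\qquad \nabla u_\varepsilon\overset{2}{\rightharpoonup}\nabla u+\chi\ \text{ in }L^p(\Omega\times Q)^d.$$ 2. (Liminf inequality.) If $u_\varepsilon\in L^1(\Omega\times Q)$, $u\in L^1(Q)$ and $\mathcal T_\varepsilon u_\varepsilon\rightharpoonup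 u$ weakly in $L^1(\Omega\times Q)$, then $$\liminf_{\varepsilon\to0}\mathcal E_{\varepsilon,\delta}(u_\varepsilon)\ge\mathcal E_{\hom,\delta}(u).$$ 3. (Recovery sequences.) For every $u\in L^1(Q)$ there is a family $(u_\varepsilon)_{\varepsilon>0}$ in $L^1(\Omega\times Q)$ such that, as $\varepsilon\to0$, $$\mathcal T_\varepsilon u_\varepsilon\to u\ \text{ strongly in }L^1(\Omega\times Q),\qquad \mathcal E_{\varepsilon,\delta}(u_\varepsilon)\to\mathcal E_{\hom,\delta}(u).$$ -/

import Mathlib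

open MeasureTheory Filter Topology
open scoped ENNReal

namespace VarReg

/-- The space `ℝ^d` with its Euclidean norm. -/
abbrev Sp (d : ℕ) := EuclideanSpace ℝ (Fin d)

/-! ### The probability space and its shifts -/

/-- `(Ω, ℱ, P)` is a complete separable probability space and `τ` is a measure preserving action of
`ℝ^d` on it. Joint measurability of `(ω, x) ↦ τ_x ω` is asked with respect to the
`P ⊗ Lebesgue`-completion of the product σ-algebra, which contains `ℱ ⊗ ℒ(ℝ^d)`. -/
structure IsStationary {Ω : Type*} [MeasurableSpace Ω] {d : ℕ}
    (P : Measure Ω) (τ : Sp d → Ω → Ω) : Prop where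
  prob : IsProbabilityMeasure P
  complete : P.IsComplete
  separable : IsSeparable P
  map_zero : ∀ ω, τ 0 ω = ω
  map_add : ∀ x y ω, τ (x + y) ω = τ x (τ y ω)
  preserving : ∀ x, MeasurePreserving (τ x) P P
  jointly : ∀ A : Set Ω, MeasurableSet A →
    NullMeasurableSet {z : Ω × Sp d | τ z.2 z.1 ∈ A} (P.prod volume)

/-- Every measurable set that is invariant under all shifts has probability `0` or `1`. -/
def IsErgodic {Ω : Type*} [MeasurableSpace Ω] {d : ℕ}
    (P : Measure Ω) (τ : Sp d → Ω → Ω) : Prop :=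
  ∀ A : Set Ω, MeasurableSet A → (∀ x, τ x '' A = A) → P A = 0 ∨ P A = 1

/-! ### Function spaces

Elements of `L^p`-spaces are represented by functions; all notions below depend on them only up to
null sets. Closures in `L^p` are expressed through approximation in the `L^p`-norm. -/

/-- The measure `P ⊗ dx` on `Ω × Q`. -/
noncomputable abbrev prodMeas {Ω : Type*} [MeasurableSpace Ω] {d : ℕ}
    (P : Measure Ω) (Q : Set (Sp d)) : Measure (Ω × Sp d) :=
  P.prod (volume.restrict Q)

/-- `u ∈ W^{1,p}_0(Q)` with weak gradient `g`: the pair `(u, g)` belongs to the closure of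
`{(φ, ∇φ) : φ ∈ C_c^∞(Q)}` in `L^p(Q) × L^p(Q)^d`. -/
structure IsW10 {d : ℕ} (p : ℝ) (Q : Set (Sp d)) (u : Sp d → ℝ) (g : Sp d → Sp d) : Prop where
  memLp : MemLp u (ENNReal.ofReal p) (volume.restrict Q)
  memLp_grad : MemLp g (ENNReal.ofReal p) (volume.restrict Q)
  approx : ∀ r : ℝ≥0∞, 0 < r → ∃ φ : Sp d → ℝ,
    ContDiff ℝ ((⊤ : ℕ∞) : WithTop ℕ∞) φ ∧ HasCompactSupport φ ∧ tsupport φ ⊆ Q ∧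
    eLpNorm (fun x => u x - φ x) (ENNReal.ofReal p) (volume.restrict Q) < r ∧
    eLpNorm (fun x => g x - gradient φ x) (ENNReal.ofReal p) (volume.restrict Q) < r

/-- `u ∈ L^p(Ω) ⊗ W^{1,p}_0(Q)` with spatial gradient `G`: the pair `(u, G)` belongs to the closure
in `L^p(Ω × Q) × L^p(Ω × Q)^d` of the finite sums `∑ φ_i (η_i, ∇η_i)` with `φ_i ∈ L^p(Ω)` and
`η_i ∈ W^{1,p}_0(Q)`. The gradient `G` is determined by `u` almost everywhere. -/
structure IsLpW10 {Ω : Type*} [MeasurableSpace Ω] {d : ℕ} (p : ℝ) (P : Measure Ω)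
    (Q : Set (Sp d)) (u : Ω × Sp d → ℝ) (G : Ω × Sp d → Sp d) : Prop where
  memLp : MemLp u (ENNReal.ofReal p) (prodMeas P Q)
  memLp_grad : MemLp G (ENNReal.ofReal p) (prodMeas P Q)
  approx : ∀ r : ℝ≥0∞, 0 < r → ∃ (n : ℕ) (φ : Fin n → Ω → ℝ) (η : Fin n → Sp d → ℝ)
    (g : Fin n → Sp d → Sp d),
    (∀ i, MemLp (φ i) (ENNReal.ofReal p) P) ∧ (∀ i, IsW10 p Q (η i) (g i)) ∧
    eLpNorm (fun z => u z - ∑ i, φ i z.1 * η i z.2) (ENNReal.ofReal p) (prodMeas P Q) < r ∧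
    eLpNorm (fun z => G z - ∑ i, φ i z.1 • g i z.2) (ENNReal.ofReal p) (prodMeas P Q) < r

/-- `φ ∈ W^{1,p}(Ω)` with stochastic gradient `D φ = ψ`: for each coordinate direction `e_i`, the
difference quotients `(φ ∘ τ_{h e_i} - φ) / h` converge to `ψ_i` in `L^p(Ω)` as `h → 0`. -/
structure IsStochGrad {Ω : Type*} [MeasurableSpace Ω] {d : ℕ} (p : ℝ) (P : Measure Ω)
    (τ : Sp d → Ω → Ω) (φ : Ω → ℝ) (ψ : Ω → Sp d) : Prop where
  memLp : MemLp φ (ENNReal.ofReal p) P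
  memLp_grad : MemLp ψ (ENNReal.ofReal p) P
  tendsto : ∀ i : Fin d, Tendsto
    (fun h : ℝ => eLpNorm
      (fun ω => (φ (τ (h • EuclideanSpace.single i (1 : ℝ)) ω) - φ ω) / h - ψ ω i)
      (ENNReal.ofReal p) P)
    (𝓝[≠] 0) (𝓝 0)

/-- `L^p_pot(Ω)`: the closure in `L^p(Ω)^d` of the range of the stochastic gradient. -/
structure IsPot {Ω : Type*} [MeasurableSpace Ω] {d : ℕ} (p : ℝ) (P : Measure Ω)
    (τ : Sp d → Ω → Ω) (χ : Ω → Sp d) : Prop where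
  memLp : MemLp χ (ENNReal.ofReal p) P
  approx : ∀ r : ℝ≥0∞, 0 < r → ∃ (φ : Ω → ℝ) (ψ : Ω → Sp d), IsStochGrad p P τ φ ψ ∧
    eLpNorm (fun ω => χ ω - ψ ω) (ENNReal.ofReal p) P < r

/-- `L^p_pot(Ω) ⊗ L^p(Q)`: the closure in `L^p(Ω × Q)^d` of the finite sums `∑ η_i χ_i` with
`χ_i ∈ L^p_pot(Ω)` and `η_i ∈ L^p(Q)`. -/
structure IsPotTensor {Ω : Type*} [MeasurableSpace Ω] {d : ℕ} (p : ℝ) (P : Measure Ω)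
    (τ : Sp d → Ω → Ω) (Q : Set (Sp d)) (χ : Ω × Sp d → Sp d) : Prop where
  memLp : MemLp χ (ENNReal.ofReal p) (prodMeas P Q)
  approx : ∀ r : ℝ≥0∞, 0 < r → ∃ (n : ℕ) (ξ : Fin n → Ω → Sp d) (η : Fin n → Sp d → ℝ),
    (∀ i, IsPot p P τ (ξ i)) ∧ (∀ i, MemLp (η i) (ENNReal.ofReal p) (volume.restrict Q)) ∧
    eLpNorm (fun z => χ z - ∑ i, η i z.2 • ξ i z.1) (ENNReal.ofReal p) (prodMeas P Q) < r

/-! ### Unfolding and convergence -/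

/-- Stochastic unfolding `(T_ε u)(ω, x) = u(τ_{-x/ε} ω, x)`. -/
noncomputable def unf {Ω F : Type*} {d : ℕ} (τ : Sp d → Ω → Ω) (ε : ℝ) (u : Ω × Sp d → F) :
    Ω × Sp d → F :=
  fun z => u (τ (-(ε⁻¹ • z.2)) z.1, z.2)

/-- Weak convergence `u_n ⇀ u` in `L^r(μ; F)`, tested against the dual exponent. -/
def WeakLpTendsto {α F : Type*} [MeasurableSpace α] [NormedAddCommGroup F]
    [InnerProductSpace ℝ F] (r : ℝ≥0∞) (μ : Measure α) (u : ℕ → α → F) (u₀ : α → F) : Prop :=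
  (∀ n, MemLp (u n) r μ) ∧ MemLp u₀ r μ ∧
  ∀ q : ℝ≥0∞, ENNReal.HolderConjugate r q → ∀ ψ : α → F, MemLp ψ q μ →
    Tendsto (fun n => ∫ z, inner ℝ (u n z) (ψ z) ∂μ) atTop (𝓝 (∫ z, inner ℝ (u₀ z) (ψ z) ∂μ))

/-! ### The integrand and the functionals -/

/-- The integral of an extended real function, as positive part minus negative part. It is the
usual extended value whenever the negative part has a finite integral. -/
noncomputable def eint {α : Type*} [MeasurableSpace α] (μ : Measure α) (f : α → EReal) : EReal :=
  ((∫⁻ a, (f a).toENNReal ∂μ : ℝ≥0∞) : EReal) - ((∫⁻ a, (-f a).toENNReal ∂μ : ℝ≥0∞) : EReal)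

/-- Measurability and convexity of the integrand `V : Ω × Q × ℝ^d → ℝ`, together with degenerate
`p`-growth: for an integrable weight `lam > 0` with `⟨lam^{-1/(p-1)}⟩^{p-1} < C`,
`lam |F|^p - C ≤ V(ω, x, F) ≤ C (lam |F|^p + 1)`. The values of `V` for `x ∉ Q` play no role. -/
structure IsDegenerateIntegrand {Ω : Type*} [MeasurableSpace Ω] {d : ℕ} (p : ℝ) (P : Measure Ω)
    (Q : Set (Sp d)) (V : Ω → Sp d → Sp d → ℝ) : Prop where
  measurable : ∀ F, AEMeasurable (fun z : Ω × Sp d => V z.1 z.2 F) (prodMeas P Q)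
  convex : ∀ᵐ z ∂(prodMeas P Q), ConvexOn ℝ Set.univ (V z.1 z.2)
  growth : ∃ C : ℝ, 0 < C ∧ ∃ lam : Ω → ℝ, Integrable lam P ∧ (∀ᵐ ω ∂P, 0 < lam ω) ∧
    (∫⁻ ω, ENNReal.ofReal (lam ω) ^ (-(1 / (p - 1))) ∂P) ^ (p - 1) < ENNReal.ofReal C ∧
    ∀ᵐ z ∂(prodMeas P Q), ∀ F : Sp d,
      lam z.1 * ‖F‖ ^ p - C ≤ V z.1 z.2 F ∧ V z.1 z.2 F ≤ C * (lam z.1 * ‖F‖ ^ p + 1)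

/-- `ℰ_{ε,δ}(u) = ⟨∫_Q V(τ_{x/ε} ω, x, ∇u) + δ |∇u - ⟨∇u⟩|^p dx⟩` for `u ∈ L^p(Ω) ⊗ W^{1,p}_0(Q)`,
and `+∞` otherwise (the infimum is over the essentially unique gradient of `u`). -/
noncomputable def energy {Ω : Type*} [MeasurableSpace Ω] {d : ℕ} (p : ℝ) (P : Measure Ω)
    (τ : Sp d → Ω → Ω) (Q : Set (Sp d)) (V : Ω → Sp d → Sp d → ℝ) (ε δ : ℝ)
    (u : Ω × Sp d → ℝ) : EReal :=
  ⨅ (G : Ω × Sp d → Sp d) (_ : IsLpW10 p P Q u G),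
    eint (prodMeas P Q) fun z =>
      ((V (τ (ε⁻¹ • z.2) z.1) z.2 (G z) + δ * ‖G z - ∫ ω, G (ω, z.2) ∂P‖ ^ p : ℝ) : EReal)

/-- `V_{hom,δ}(x, F) = inf_{χ ∈ L^p_pot(Ω)} ⟨V(ω, x, F + χ(ω)) + δ |χ(ω)|^p⟩`. -/
noncomputable def Vhom {Ω : Type*} [MeasurableSpace Ω] {d : ℕ} (p : ℝ) (P : Measure Ω)
    (τ : Sp d → Ω → Ω) (V : Ω → Sp d → Sp d → ℝ) (δ : ℝ) (x F : Sp d) : EReal :=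
  ⨅ (χ : Ω → Sp d) (_ : IsPot p P τ χ),
    eint P fun ω => ((V ω x (F + χ ω) + δ * ‖χ ω‖ ^ p : ℝ) : EReal)

/-- `ℰ_{hom,δ}(u) = ∫_Q V_{hom,δ}(x, ∇u(x)) dx` for `u ∈ W^{1,p}_0(Q)`, and `+∞` otherwise. -/
noncomputable def energyHom {Ω : Type*} [MeasurableSpace Ω] {d : ℕ} (p : ℝ) (P : Measure Ω)
    (τ : Sp d → Ω → Ω) (Q : Set (Sp d)) (V : Ω → Sp d → Sp d → ℝ) (δ : ℝ)
    (u : Sp d → ℝ) : EReal :=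
  ⨅ (g : Sp d → Sp d) (_ : IsW10 p Q u g),
    eint (volume.restrict Q) fun x => Vhom p P τ V δ x (g x)

end VarReg

/-! Unfolding freezes the oscillating coefficient. The map `(ω, x) ↦ (τ_{x/ε} ω, x)` preserves `P ⊗
dx`, so up to an additive constant the energy of `u` is a functional of the unfolded gradient `Γ =
T_ε ∇u` that no longer depends on `ε`: the integral of `V(ω, x, Γ) + C + δ |Γ - ⟨Γ⟩|^p`
(`energy_eq`). Its density is nonnegative, it is convex, and it is coercive: `δ` controls the
fluctuation `Γ - ⟨Γ⟩`, while Hölder's inequality against `λ^{-1/(p-1)}` controls the mean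
(`exists_coercive`). Poincaré's inequality and weak compactness in separable spaces then give weak
limits `U` of `T_ε u` and `Γ` of `T_ε ∇u`.

To identify them, note that for an elementary tensor `u` the function `∫_Q T_ε u dx` on `Ω` has
stochastic gradient `ε ∫_Q T_ε ∇u dx` (`isStochGrad_integral_unf`). Localized by a test function
`θ`, this shows two things. Shifts change `T_ε u` by `O(ε)` in the weak sense, so `U` is shift
invariant, hence deterministic by ergodicity (`IsWeakLimit.ae_eq_avg`). Moreover every element of
`L^q(Ω)` annihilating stochastic gradients annihilates `∫_Q T_ε ∇(θ u) dx`, so `Γ(·, x) - ⟨Γ(·, x)⟩`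
is a potential field for almost every `x` (`IsWeakLimit.ae_isPot`). Linear relations satisfied by
all pairs `(η, ∇η)` pass to the averages and give `⟨U⟩ ∈ W^{1,p}_0` with gradient `⟨Γ⟩`.

The liminf inequality follows because sublevel sets of the unfolded energy are convex and strongly
closed (Fatou), hence weakly closed, and because `Γ - ⟨Γ⟩` is admissible in the cell problems
(`energyHom_le`).

For the upper bound, countably many correctors with finite norm weighted by `1 + |λ|` suffice in the
cell problems (`exists_corrector_seq`). Measurable selection and cutoffs yield a nearly optimal
field `∇u + ∑ η_i(x) χ_i(ω)`. Each `χ_i` is realized on scale `ε` by a potential `w_ε` tending to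
`0` in `L^p`, a limit of the increments `ε (φ_n(τ_{x/ε} ω) - φ_n(ω))`, which are Cauchy uniformly in
`ε` (`IsPot.exists_potential`). The test functions are `u + ∑ η_i sin w_{i,ε}`: the sine keeps their
gradients below a fixed majorant integrable with weight `λ`, so dominated convergence applies
(`exists_recovery`). A diagonal choice over energy levels gives the recovery family.

Closed subspaces are handled by duality: Riesz representation and Hahn–Banach turn membership in a
closure into vanishing pairings, and separability leaves countably many pairings, so exceptional
null sets can be united. -/

namespace VarReg

/-! ### Duality for `L^p` over a finite measure -/

section Duality

variable {α : Type*} [MeasurableSpace α] {μ : Measure α}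

open scoped Classical in
/-- The set function `A ↦ Λ(1_A)` of a continuous linear functional on `L^p`. -/
noncomputable def functionalMeasure [IsFiniteMeasure μ] {p : ℝ≥0∞} [Fact (1 ≤ p)] (hp : p ≠ ∞)
    (Λ : Lp ℝ p μ →L[ℝ] ℝ) : SignedMeasure α where
  measureOf' A := if h : MeasurableSet A then
    Λ (indicatorConstLp p h (measure_ne_top μ A) (1 : ℝ)) else 0
  empty' := by simp
  not_measurable' A hA := by simp [hA]
  m_iUnion' f hf hd := by
    have hU : MeasurableSet (⋃ i, f i) := MeasurableSet.iUnion hf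
    have hs (s : Finset ℕ) : MeasurableSet (⋃ i ∈ s, f i) :=
      s.measurableSet_biUnion fun i _ => hf i
    simp only [hf, hU, dif_pos]
    have key (s : Finset ℕ) :
        Λ (indicatorConstLp p (hs s) (measure_ne_top μ _) (1 : ℝ)) =
          ∑ i ∈ s, Λ (indicatorConstLp p (hf i) (measure_ne_top μ _) (1 : ℝ)) := by
      induction s using Finset.induction_on with
      | empty => simp
      | insert a s ha ih =>
        rw [Finset.sum_insert ha, ← ih, ← map_add,
          ← indicatorConstLp_disjoint_union (hf a) (hs s)]
        · congr 2
          rw [Finset.set_biUnion_insert]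
        · rw [Set.disjoint_iUnion₂_right]
          exact fun i hi => hd (by rintro rfl; exact ha hi)
    have hlim : Tendsto (fun s : Finset ℕ =>
        indicatorConstLp p (hs s) (measure_ne_top μ _) (1 : ℝ)) atTop
        (𝓝 (indicatorConstLp p hU (measure_ne_top μ _) (1 : ℝ))) := by
      refine tendsto_indicatorConstLp_set hp ?_
      have hm : Tendsto (fun s : Finset ℕ => μ (⋃ i, f i) - μ (⋃ i ∈ s, f i)) atTop (𝓝 0) := by
        have h1 : Tendsto (fun s : Finset ℕ => μ (⋃ i ∈ s, f i)) atTop (𝓝 (μ (⋃ i, f i))) := by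
          have : ∀ s : Finset ℕ, μ (⋃ i ∈ s, f i) = ∑ i ∈ s, μ (f i) := fun s =>
            measure_biUnion_finset (fun i _ j _ hij => hd hij) fun i _ => hf i
          simp only [this, measure_iUnion hd hf]
          exact ENNReal.summable.hasSum
        have := ENNReal.Tendsto.sub (tendsto_const_nhds (x := μ (⋃ i, f i))) h1
          (Or.inl (measure_ne_top μ _))
        simpa using this
      refine hm.congr fun s => ?_
      have hsub : (⋃ i ∈ s, f i) ⊆ ⋃ i, f i := Set.iUnion₂_subset_iUnion _ _
      rw [← measure_sdiff hsub (hs s).nullMeasurableSet (measure_ne_top μ _), symmDiff_def,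
        sdiff_eq_bot_iff.2 hsub, bot_sup_eq]
    have := (Λ.continuous.tendsto _).comp hlim
    refine this.congr fun s => ?_
    simpa using key s

theorem functionalMeasure_apply [IsFiniteMeasure μ] {p : ℝ≥0∞} [Fact (1 ≤ p)] (hp : p ≠ ∞)
    (Λ : Lp ℝ p μ →L[ℝ] ℝ) {A : Set α} (hA : MeasurableSet A) :
    functionalMeasure hp Λ A = Λ (indicatorConstLp p hA (measure_ne_top μ A) (1 : ℝ)) := by
  exact dif_pos hA

/-- Radon–Nikodym: the indicator of a null set vanishes in `L^p`, so the set function is absolutely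
continuous. -/
theorem exists_density [IsFiniteMeasure μ] {p : ℝ≥0∞} [Fact (1 ≤ p)] (hp : p ≠ ∞)
    (Λ : Lp ℝ p μ →L[ℝ] ℝ) : ∃ ψ : α → ℝ, Integrable ψ μ ∧ ∀ (A : Set α) (hA : MeasurableSet A),
      Λ (indicatorConstLp p hA (measure_ne_top μ A) (1 : ℝ)) = ∫ x in A, ψ x ∂μ := by
  have hac : functionalMeasure hp Λ ≪ᵥ μ.toENNRealVectorMeasure := by
    refine VectorMeasure.AbsolutelyContinuous.mk fun A hA h0 => ?_
    rw [Measure.toENNRealVectorMeasure_apply_measurable hA] at h0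
    have h1 : indicatorConstLp p hA (measure_ne_top μ A) (1 : ℝ) = 0 := by
      rw [← norm_eq_zero, norm_indicatorConstLp (by
        have := (Fact.out : 1 ≤ p); positivity) hp]
      have : (1 / p.toReal) ≠ 0 := by
        have h2 : (1 : ℝ≥0∞) ≤ p := Fact.out
        have := ENNReal.toReal_pos (by positivity) hp
        positivity
      simp [measureReal_def, h0, Real.zero_rpow (by simpa using this : p.toReal⁻¹ ≠ 0)]
    rw [functionalMeasure_apply hp Λ hA, h1, map_zero]
  refine ⟨(functionalMeasure hp Λ).rnDeriv μ, SignedMeasure.integrable_rnDeriv _ _, fun A hA => ?_⟩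
  rw [← withDensityᵥ_apply (SignedMeasure.integrable_rnDeriv _ _) hA,
    SignedMeasure.withDensityᵥ_rnDeriv_eq _ _ hac, functionalMeasure_apply hp Λ hA]

/-- Hölder's inequality for the duality pairing. -/
theorem memLp_inner {F : Type*} [NormedAddCommGroup F] [InnerProductSpace ℝ F] {p q : ℝ≥0∞}
    [ENNReal.HolderConjugate p q] {f ψ : α → F} (hf : MemLp f p μ) (hψ : MemLp ψ q μ) :
    Integrable (fun x => (inner ℝ (f x) (ψ x) : ℝ)) μ :=
  memLp_one_iff_integrable.1 ((innerSL ℝ).memLp_of_bilin 1 hf hψ)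

theorem abs_integral_inner_le {F : Type*} [NormedAddCommGroup F] [InnerProductSpace ℝ F]
    {p q : ℝ≥0∞} [ENNReal.HolderConjugate p q] {f ψ : α → F} (hf : MemLp f p μ)
    (hψ : MemLp ψ q μ) :
    ENNReal.ofReal |∫ x, (inner ℝ (f x) (ψ x) : ℝ) ∂μ| ≤ eLpNorm f p μ * eLpNorm ψ q μ := by
  have h1 := eLpNorm_le_eLpNorm_mul_eLpNorm'_of_norm (p := p) (q := q) (r := 1) hf.1 hψ.1
    (fun a b : F => (inner ℝ a b : ℝ)) 1 (ae_of_all μ fun x => by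
      simpa using norm_inner_le_norm (𝕜 := ℝ) (f x) (ψ x))
  rw [eLpNorm_one_eq_lintegral_enorm] at h1
  simp only [ENNReal.coe_one, one_mul] at h1
  refine le_trans ?_ h1
  rw [← Real.norm_eq_abs, ofReal_norm]
  exact enorm_integral_le_lintegral_enorm _

/-- Pairings with a fixed element of the dual exponent are continuous. -/
theorem tendsto_integral_inner {F : Type*} [NormedAddCommGroup F] [InnerProductSpace ℝ F]
    {p q : ℝ≥0∞} [ENNReal.HolderConjugate p q] {ι : Type*} {l : Filter ι} {f : ι → α → F}
    {f₀ ψ : α → F} (hf : ∀ i, MemLp (f i) p μ) (hf₀ : MemLp f₀ p μ) (hψ : MemLp ψ q μ)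
    (h : Tendsto (fun i => eLpNorm (fun x => f i x - f₀ x) p μ) l (𝓝 0)) :
    Tendsto (fun i => ∫ x, (inner ℝ (f i x) (ψ x) : ℝ) ∂μ) l
      (𝓝 (∫ x, (inner ℝ (f₀ x) (ψ x) : ℝ) ∂μ)) := by
  rw [tendsto_iff_norm_sub_tendsto_zero]
  have h2 : Tendsto (fun i => (eLpNorm (fun x => f i x - f₀ x) p μ * eLpNorm ψ q μ).toReal) l
      (𝓝 0) := by
    have := ENNReal.Tendsto.mul_const h (Or.inr hψ.2.ne : (0 : ℝ≥0∞) ≠ 0 ∨ eLpNorm ψ q μ ≠ ∞)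
    rw [zero_mul] at this
    exact (ENNReal.tendsto_toReal ENNReal.zero_ne_top).comp this
  refine squeeze_zero (fun _ => norm_nonneg _) (fun i => ?_) h2
  rw [← integral_sub (memLp_inner (hf i) hψ) (memLp_inner hf₀ hψ)]
  simp only [← inner_sub_left]
  have := abs_integral_inner_le ((hf i).sub hf₀) hψ
  simp only [Pi.sub_apply] at this
  rw [Real.norm_eq_abs, ← ENNReal.ofReal_le_iff_le_toReal]
  · exact this
  · exact ENNReal.mul_ne_top ((hf i).sub hf₀).2.ne hψ.2.ne

/-- Representation of a functional on `L^p` against simple functions. -/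
theorem functional_eq_of_simpleFunc [IsFiniteMeasure μ] {p : ℝ≥0∞} [Fact (1 ≤ p)]
    (Λ : Lp ℝ p μ →L[ℝ] ℝ) {ψ : α → ℝ} (hψ : Integrable ψ μ)
    (h : ∀ (A : Set α) (hA : MeasurableSet A),
      Λ (indicatorConstLp p hA (measure_ne_top μ A) (1 : ℝ)) = ∫ x in A, ψ x ∂μ)
    (s : SimpleFunc α ℝ) (hs : MemLp s p μ) : Λ hs.toLp = ∫ x, s x * ψ x ∂μ := by
  have hb (s : SimpleFunc α ℝ) : Integrable (fun x => s x * ψ x) μ := by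
    obtain ⟨C, hC⟩ := s.exists_forall_norm_le
    exact hψ.bdd_mul s.aestronglyMeasurable (ae_of_all _ hC)
  induction s using SimpleFunc.induction with
  | const c hA =>
    rename_i A
    have h1 : hs.toLp = c • indicatorConstLp p hA (measure_ne_top μ A) (1 : ℝ) := by
      refine Lp.ext ?_
      filter_upwards [hs.coeFn_toLp, Lp.coeFn_smul c
        (indicatorConstLp p hA (measure_ne_top μ A) (1 : ℝ)),
        indicatorConstLp_coeFn (p := p) (hs := hA) (hμs := measure_ne_top μ A) (c := (1 : ℝ))]
        with x h1 h2 h3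
      rw [h1, h2, Pi.smul_apply, h3]
      by_cases hx : x ∈ A <;> simp [hx]
    rw [h1, map_smul, h A hA, smul_eq_mul, ← integral_const_mul, ← integral_indicator hA]
    congr 1
    ext x
    by_cases hx : x ∈ A <;> simp [hx]
  | add hd hf hg =>
    rename_i f g
    have hfm : MemLp f p μ := SimpleFunc.memLp_of_isFiniteMeasure f p μ
    have hgm : MemLp g p μ := SimpleFunc.memLp_of_isFiniteMeasure g p μ
    have h1 : hs.toLp = hfm.toLp + hgm.toLp := by
      rw [← MemLp.toLp_add]
      rfl
    rw [h1, map_add, hf hfm, hg hgm, ← integral_add (hb f) (hb g)]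
    simp [add_mul]

/-- Simple approximation of an `L^p` function, with pointwise domination. -/
theorem exists_simpleFunc_approx {F : Type*} [NormedAddCommGroup F] [SecondCountableTopology F]
    {p : ℝ≥0∞} (hp : p ≠ ∞) {f : α → F} (hf : MemLp f p μ) :
    ∃ s : ℕ → SimpleFunc α F, (∀ n, MemLp (s n) p μ) ∧
      Tendsto (fun n => eLpNorm (fun x => s n x - f x) p μ) atTop (𝓝 0) ∧
      (∀ᵐ x ∂μ, ∀ n, ‖s n x‖ ≤ 2 * ‖f x‖) ∧
      ∀ᵐ x ∂μ, Tendsto (fun n => s n x) atTop (𝓝 (f x)) := by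
  borelize F
  set g := hf.1.mk f with hg
  have hgm : Measurable g := hf.1.stronglyMeasurable_mk.measurable
  have hfg : f =ᵐ[μ] g := hf.1.ae_eq_mk
  have hgL : MemLp g p μ := hf.ae_eq hfg
  refine ⟨fun n => SimpleFunc.approxOn g hgm (Set.range g ∪ {0}) 0 (by simp) n,
    fun n => SimpleFunc.memLp_approxOn_range hgm hgL n, ?_, ?_, ?_⟩
  · refine (SimpleFunc.tendsto_approxOn_range_Lp_eLpNorm hp hgm hgL.2).congr fun n => ?_
    refine eLpNorm_congr_ae ?_
    filter_upwards [hfg] with x hx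
    simp [hx]
  · filter_upwards [hfg] with x hx n
    rw [hx, two_mul]
    exact SimpleFunc.norm_approxOn_zero_le hgm (by simp) x n
  · filter_upwards [hfg] with x hx
    rw [hx]
    exact SimpleFunc.tendsto_approxOn hgm (by simp) (subset_closure (by simp))

/-- At this stage the density is only known to be integrable. Boundedness of `f` makes `2 C |ψ|` a
majorant for the simple approximations. -/
theorem functional_eq_of_bounded [IsFiniteMeasure μ] {p : ℝ≥0∞} [Fact (1 ≤ p)] (hp : p ≠ ∞)
    (Λ : Lp ℝ p μ →L[ℝ] ℝ) {ψ : α → ℝ} (hψ : Integrable ψ μ)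
    (h : ∀ (s : SimpleFunc α ℝ) (hs : MemLp s p μ), Λ hs.toLp = ∫ x, s x * ψ x ∂μ)
    {f : α → ℝ} (hf : MemLp f p μ) {C : ℝ} (hC : ∀ᵐ x ∂μ, ‖f x‖ ≤ C) :
    Λ hf.toLp = ∫ x, f x * ψ x ∂μ := by
  obtain ⟨s, hsm, hsl, hsb, hst⟩ := exists_simpleFunc_approx hp hf
  have h1 : Tendsto (fun n => Λ (hsm n).toLp) atTop (𝓝 (Λ hf.toLp)) := by
    refine (Λ.continuous.tendsto _).comp ?_
    rw [Lp.tendsto_Lp_iff_tendsto_eLpNorm'']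
    exact hsl
  refine tendsto_nhds_unique h1 ?_
  simp only [h]
  refine tendsto_integral_of_dominated_convergence (fun x => 2 * C * ‖ψ x‖)
    (fun n => (s n).aestronglyMeasurable.mul hψ.1) (hψ.norm.const_mul _) (fun n => ?_) ?_
  · filter_upwards [hsb, hC] with x hx hxC
    rw [norm_mul]
    gcongr
    linarith [hx n]
  · filter_upwards [hst] with x hx
    exact hx.mul_const _

/-- The density of a functional on `L^p` belongs to the dual space. -/
theorem memLp_density [IsFiniteMeasure μ] {p q : ℝ} (hpq : p.HolderConjugate q)
    [Fact (1 ≤ ENNReal.ofReal p)] (Λ : Lp ℝ (ENNReal.ofReal p) μ →L[ℝ] ℝ)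
    {ψ : α → ℝ} (hψ : Integrable ψ μ)
    (h : ∀ (f : α → ℝ) (hf : MemLp f (ENNReal.ofReal p) μ) (C : ℝ), (∀ᵐ x ∂μ, ‖f x‖ ≤ C) →
      Λ hf.toLp = ∫ x, f x * ψ x ∂μ) : MemLp ψ (ENNReal.ofReal q) μ := by
  have hp0 := hpq.pos
  have hq0 := hpq.symm.pos
  have hpE : ENNReal.ofReal p ≠ 0 := by simpa using hp0
  have hqE : ENNReal.ofReal q ≠ 0 := by simpa using hq0
  set φ := hψ.1.mk ψ with hφ
  have hφm : Measurable φ := hψ.1.stronglyMeasurable_mk.measurable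
  have hψφ : ψ =ᵐ[μ] φ := hψ.1.ae_eq_mk
  let B : ℕ → Set α := fun n => {x | ‖φ x‖ ≤ n}
  have hB : ∀ n, MeasurableSet (B n) := fun n => measurableSet_le hφm.norm measurable_const
  -- Truncations of the extremal function `sign(φ) |φ|^{q-1}`. They satisfy `|f|^p = |φ|^q = f φ` on
  -- `B n`, so testing `Λ` with them bounds `∫_{B n} |φ|^q` by `‖Λ‖` times its own `1/p`-th power.
  let f : ℕ → α → ℝ := fun n => (B n).indicator fun x =>
    (if 0 ≤ φ x then 1 else -1) * ‖φ x‖ ^ (q - 1)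
  have hq1 : 0 < q - 1 := by linarith [hpq.symm.lt]
  have hfm : ∀ n, Measurable (f n) := fun n => by
    refine Measurable.indicator ?_ (hB n)
    refine Measurable.mul ?_ (hφm.norm.pow_const _)
    exact Measurable.ite (measurableSet_le measurable_const hφm) measurable_const measurable_const
  have hfn : ∀ n x, ‖f n x‖ = (B n).indicator (fun x => ‖φ x‖ ^ (q - 1)) x := fun n x => by
    by_cases hx : x ∈ B n
    · rcases le_or_gt 0 (φ x) with h0 | h0
      · simp [f, hx, h0, abs_of_nonneg (Real.rpow_nonneg (abs_nonneg _) _)]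
      · simp [f, hx, h0.not_ge, abs_of_nonneg (Real.rpow_nonneg (abs_nonneg _) _)]
    · simp [f, hx]
  have hfb : ∀ n x, ‖f n x‖ ≤ (n : ℝ) ^ (q - 1) := fun n x => by
    rw [hfn]
    by_cases hx : x ∈ B n
    · rw [Set.indicator_of_mem hx]
      exact Real.rpow_le_rpow (norm_nonneg _) hx hq1.le
    · rw [Set.indicator_of_notMem hx]
      positivity
  have hfL : ∀ n, MemLp (f n) (ENNReal.ofReal p) μ := fun n =>
    MemLp.of_bound (hfm n).aestronglyMeasurable _ (ae_of_all _ (hfb n))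
  have hfψ : ∀ n x, f n x * φ x = (B n).indicator (fun x => ‖φ x‖ ^ q) x := fun n x => by
    by_cases hx : x ∈ B n
    · have e : ‖φ x‖ ^ q = ‖φ x‖ ^ (q - 1) * ‖φ x‖ := by
        rcases eq_or_ne (φ x) 0 with h0 | h0
        · simp [h0, Real.zero_rpow hq0.ne']
        · rw [Real.rpow_sub_one (norm_ne_zero_iff.2 h0)]
          field_simp
      rw [Set.indicator_of_mem hx, e]
      rcases le_or_gt 0 (φ x) with h0 | h0
      · simp [f, hx, h0, abs_of_nonneg h0]
      · simp [f, hx, h0.not_ge, abs_of_neg h0]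
    · simp [f, hx]
  let a : ℕ → ℝ := fun n => ∫ x, (B n).indicator (fun x => ‖φ x‖ ^ q) x ∂μ
  have hint : ∀ n, Integrable ((B n).indicator fun x => ‖φ x‖ ^ q) μ := fun n => by
    refine Integrable.of_bound (((hφm.norm.pow_const _).indicator (hB n)).aestronglyMeasurable)
      ((n : ℝ) ^ q) (ae_of_all _ fun x => ?_)
    by_cases hx : x ∈ B n
    · rw [Set.indicator_of_mem hx, Real.norm_of_nonneg (by positivity)]
      exact Real.rpow_le_rpow (norm_nonneg _) hx hq0.le
    · rw [Set.indicator_of_notMem hx]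
      simp only [norm_zero]
      positivity
  have ha0 : ∀ n, 0 ≤ a n := fun n => integral_nonneg fun x =>
    Set.indicator_nonneg (fun _ _ => by positivity) x
  have hkey : ∀ n, a n ≤ ‖Λ‖ * (a n) ^ (1 / p) := fun n => by
    have h1 : Λ (hfL n).toLp = a n := by
      rw [h (f n) (hfL n) _ (ae_of_all _ (hfb n))]
      refine integral_congr_ae ?_
      filter_upwards [hψφ] with x hx
      rw [hx, hfψ]
    have h2 : ‖(hfL n).toLp‖ = a n ^ (1 / p) := by
      rw [Lp.norm_toLp, (hfL n).eLpNorm_eq_integral_rpow_norm hpE ENNReal.ofReal_ne_top,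
        ENNReal.toReal_ofReal hp0.le, ENNReal.toReal_ofReal (by positivity), one_div]
      congr 2
      ext x
      rw [hfn]
      by_cases hx : x ∈ B n
      · rw [Set.indicator_of_mem hx, Set.indicator_of_mem hx, ← Real.rpow_mul (norm_nonneg _),
          hpq.symm.sub_one_mul_conj]
      · rw [Set.indicator_of_notMem hx, Set.indicator_of_notMem hx, Real.zero_rpow hp0.ne']
    rw [← h2, ← h1]
    exact (le_abs_self _).trans (Λ.le_opNorm _)
  have hbound : ∀ n, a n ≤ ‖Λ‖ ^ q := fun n => by
    rcases (ha0 n).eq_or_lt with h0 | h0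
    · rw [← h0]
      positivity
    · have h3 : a n ^ (1 / q) ≤ ‖Λ‖ := by
        have e : a n = a n ^ (1 / q) * a n ^ (1 / p) := by
          rw [← Real.rpow_add h0, add_comm, one_div, one_div, hpq.inv_add_inv_eq_one, Real.rpow_one]
        have h4 := hkey n
        nth_rewrite 1 [e] at h4
        exact le_of_mul_le_mul_right h4 (by positivity)
      calc a n = (a n ^ (1 / q)) ^ q := by
            rw [← Real.rpow_mul h0.le, one_div_mul_cancel hq0.ne', Real.rpow_one]
        _ ≤ ‖Λ‖ ^ q := Real.rpow_le_rpow (by positivity) h3 hq0.le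
  refine MemLp.ae_eq hψφ.symm ⟨hφm.aestronglyMeasurable, ?_⟩
  rw [eLpNorm_lt_top_iff_lintegral_rpow_enorm_lt_top hqE ENNReal.ofReal_ne_top,
    ENNReal.toReal_ofReal hq0.le]
  -- Fatou's lemma removes the truncation, since every point eventually lies in `B n`.
  refine lt_of_le_of_lt ((lintegral_liminf_le' (u := atTop) (μ := μ) (f := fun (n : ℕ) x =>
    ENNReal.ofReal ((B n).indicator (fun x => ‖φ x‖ ^ q) x)) fun n => ?_).trans' ?_)
    (lt_of_le_of_lt (b := ENNReal.ofReal (‖Λ‖ ^ q)) ?_ ENNReal.ofReal_lt_top)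
  · exact ((hφm.norm.pow_const _).indicator (hB n)).ennreal_ofReal.aemeasurable
  · refine lintegral_mono fun x => ?_
    refine le_liminf_of_le (by isBoundedDefault) ?_
    obtain ⟨N, hN⟩ := exists_nat_ge ‖φ x‖
    filter_upwards [eventually_ge_atTop N] with n hn
    have hx : x ∈ B n := hN.trans (by exact_mod_cast hn)
    rw [Set.indicator_of_mem hx, ← ENNReal.ofReal_rpow_of_nonneg (norm_nonneg _) hq0.le,
      ofReal_norm]
  · refine liminf_le_of_le (by isBoundedDefault) fun b hb => ?_
    obtain ⟨n, hn⟩ := hb.exists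
    refine hn.trans ?_
    rw [← ofReal_integral_eq_lintegral_ofReal (hint n)
      (ae_of_all _ fun x => Set.indicator_nonneg (fun _ _ => by positivity) x)]
    exact ENNReal.ofReal_le_ofReal (hbound n)

/-- Riesz representation for real-valued `L^p` over a finite measure. -/
theorem exists_riesz_real [IsFiniteMeasure μ] {p q : ℝ} (hpq : p.HolderConjugate q)
    [Fact (1 ≤ ENNReal.ofReal p)] (Λ : Lp ℝ (ENNReal.ofReal p) μ →L[ℝ] ℝ) :
    ∃ ψ : α → ℝ, MemLp ψ (ENNReal.ofReal q) μ ∧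
      ∀ (f : α → ℝ) (hf : MemLp f (ENNReal.ofReal p) μ), Λ hf.toLp = ∫ x, f x * ψ x ∂μ := by
  have : ENNReal.HolderConjugate (ENNReal.ofReal p) (ENNReal.ofReal q) :=
    hpq.ennrealOfReal
  obtain ⟨ψ, hψ, hA⟩ := exists_density ENNReal.ofReal_ne_top Λ
  have hS := functional_eq_of_simpleFunc Λ hψ hA
  have hm : MemLp ψ (ENNReal.ofReal q) μ := memLp_density hpq Λ hψ fun f hf C hC =>
    functional_eq_of_bounded ENNReal.ofReal_ne_top Λ hψ hS hf hC
  refine ⟨ψ, hm, fun f hf => ?_⟩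
  obtain ⟨s, hsm, hsl, -, -⟩ := exists_simpleFunc_approx ENNReal.ofReal_ne_top hf
  have h1 : Tendsto (fun n => Λ (hsm n).toLp) atTop (𝓝 (Λ hf.toLp)) := by
    refine (Λ.continuous.tendsto _).comp ?_
    rw [Lp.tendsto_Lp_iff_tendsto_eLpNorm'']
    exact hsl
  refine tendsto_nhds_unique h1 ?_
  simp only [hS]
  have := tendsto_integral_inner hsm hf hm hsl
  simpa [mul_comm] using this

/-- Riesz representation for `L^p` with values in a finite-dimensional inner product space. -/
theorem exists_riesz {F : Type*} [NormedAddCommGroup F] [InnerProductSpace ℝ F]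
    [FiniteDimensional ℝ F] [IsFiniteMeasure μ] {p q : ℝ} (hpq : p.HolderConjugate q)
    [Fact (1 ≤ ENNReal.ofReal p)] (Λ : Lp F (ENNReal.ofReal p) μ →L[ℝ] ℝ) :
    ∃ ψ : α → F, MemLp ψ (ENNReal.ofReal q) μ ∧
      ∀ (f : α → F) (hf : MemLp f (ENNReal.ofReal p) μ),
        Λ hf.toLp = ∫ x, (inner ℝ (f x) (ψ x) : ℝ) ∂μ := by
  have : ENNReal.HolderConjugate (ENNReal.ofReal p) (ENNReal.ofReal q) :=
    hpq.ennrealOfReal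
  let b := stdOrthonormalBasis ℝ F
  let L : ∀ i, Lp ℝ (ENNReal.ofReal p) μ →L[ℝ] ℝ := fun i =>
    Λ.comp ((ContinuousLinearMap.toSpanSingleton ℝ (b i)).compLpL (ENNReal.ofReal p) μ)
  choose ψ hψ hL using fun i => exists_riesz_real hpq (L i)
  have hψb : ∀ i, MemLp (fun x => ψ i x • b i) (ENNReal.ofReal q) μ := fun i =>
    (ContinuousLinearMap.toSpanSingleton ℝ (b i)).comp_memLp' (hψ i)
  refine ⟨fun x => ∑ i, ψ i x • b i, memLp_finsetSum _ fun i _ => hψb i, fun f hf => ?_⟩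
  have hfi : ∀ i, MemLp (fun x => (inner ℝ (b i) (f x) : ℝ)) (ENNReal.ofReal p) μ := fun i =>
    (innerSL ℝ (b i)).comp_memLp' hf
  have h1 : hf.toLp = ∑ i, (ContinuousLinearMap.toSpanSingleton ℝ (b i)).compLpL
      (ENNReal.ofReal p) μ (hfi i).toLp := by
    refine Lp.ext ?_
    have e : ∀ᵐ x ∂μ, ∀ i, (ContinuousLinearMap.toSpanSingleton ℝ (b i)).compLpL
        (ENNReal.ofReal p) μ (hfi i).toLp x = (inner ℝ (b i) (f x) : ℝ) • b i := by
      rw [ae_all_iff]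
      intro i
      filter_upwards [ContinuousLinearMap.coeFn_compLpL
        (ContinuousLinearMap.toSpanSingleton ℝ (b i)) (hfi i).toLp, (hfi i).coeFn_toLp]
        with x h1 h2
      rw [h1, h2, ContinuousLinearMap.toSpanSingleton_apply]
    filter_upwards [hf.coeFn_toLp, e, Lp.coeFn_finsetSum Finset.univ fun i =>
      (ContinuousLinearMap.toSpanSingleton ℝ (b i)).compLpL (ENNReal.ofReal p) μ (hfi i).toLp]
      with x h1 h2 h3
    rw [h1, h3, Finset.sum_apply]
    simp only [h2]
    exact (b.sum_repr' (f x)).symm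
  rw [h1, map_sum]
  have h2 : ∀ i, Λ ((ContinuousLinearMap.toSpanSingleton ℝ (b i)).compLpL
      (ENNReal.ofReal p) μ (hfi i).toLp) = ∫ x, (inner ℝ (b i) (f x) : ℝ) * ψ i x ∂μ := fun i =>
    hL i _ (hfi i)
  simp only [h2]
  rw [← integral_finsetSum]
  · refine integral_congr_ae (ae_of_all _ fun x => ?_)
    simp only [inner_sum, inner_smul_right]
    refine Finset.sum_congr rfl fun i _ => ?_
    rw [real_inner_comm, mul_comm]
  · intro i _
    exact (hfi i).integrable_mul (hψ i)

end Duality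

/-! ### Hahn–Banach closures and weak compactness in `L^p` -/

section Duality

variable {α β : Type*} [MeasurableSpace α] [MeasurableSpace β] {μ : Measure α} {ν : Measure β}
  {F H : Type*} [NormedAddCommGroup F] [InnerProductSpace ℝ F] [FiniteDimensional ℝ F]
  [NormedAddCommGroup H] [InnerProductSpace ℝ H] [FiniteDimensional ℝ H]

/-- A pair of functions that cannot be separated from a convex set by dual pairings belongs to
its closure in `L^p × L^p`. -/
theorem exists_approx_pair_of_dual [IsFiniteMeasure μ] [IsFiniteMeasure ν] {p q : ℝ}
    (hpq : p.HolderConjugate q) {S : Set ((α → F) × (β → H))} (hS : Convex ℝ S)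
    (hSm : ∀ s ∈ S, MemLp s.1 (ENNReal.ofReal p) μ ∧ MemLp s.2 (ENNReal.ofReal p) ν)
    {f : α → F} {g : β → H} (hf : MemLp f (ENNReal.ofReal p) μ) (hg : MemLp g (ENNReal.ofReal p) ν)
    (h : ∀ (ψ : α → F) (φ : β → H), MemLp ψ (ENNReal.ofReal q) μ → MemLp φ (ENNReal.ofReal q) ν →
      ∀ c : ℝ, (∀ s ∈ S, (∫ x, (inner ℝ (s.1 x) (ψ x) : ℝ) ∂μ) +
        ∫ y, (inner ℝ (s.2 y) (φ y) : ℝ) ∂ν ≤ c) →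
        (∫ x, (inner ℝ (f x) (ψ x) : ℝ) ∂μ) + ∫ y, (inner ℝ (g y) (φ y) : ℝ) ∂ν ≤ c)
    {r : ℝ≥0∞} (hr : 0 < r) : ∃ s ∈ S,
      eLpNorm (fun x => f x - s.1 x) (ENNReal.ofReal p) μ < r ∧
      eLpNorm (fun y => g y - s.2 y) (ENNReal.ofReal p) ν < r := by
  have : Fact (1 ≤ ENNReal.ofReal p) := ⟨by simpa using hpq.lt.le⟩
  let X := Lp F (ENNReal.ofReal p) μ × Lp H (ENNReal.ofReal p) ν
  let T : Set X := {z | ∃ s, ∃ hs : s ∈ S, z = ((hSm s hs).1.toLp, (hSm s hs).2.toLp)}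
  have hT : Convex ℝ T := by
    rintro _ ⟨s, hs, rfl⟩ _ ⟨t, ht, rfl⟩ a b ha hb hab
    refine ⟨a • s + b • t, hS hs ht ha hb hab, ?_⟩
    rfl
  -- Otherwise Hahn–Banach separates the pair strictly from `T`, and the Riesz representatives of
  -- the two components of the separating functional contradict `h`.
  have hmem : ((hf.toLp, hg.toLp) : X) ∈ closure T := by
    by_contra hcon
    obtain ⟨Λ, u, hu, hlt⟩ := geometric_hahn_banach_closed_point hT.closure isClosed_closure hcon
    obtain ⟨ψ, hψ, hψ'⟩ := exists_riesz hpq (Λ.comp (ContinuousLinearMap.inl ℝ _ _))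
    obtain ⟨φ, hφ, hφ'⟩ := exists_riesz hpq (Λ.comp (ContinuousLinearMap.inr ℝ _ _))
    have hΛ : ∀ (a : α → F) (b : β → H) (ha : MemLp a (ENNReal.ofReal p) μ)
        (hb : MemLp b (ENNReal.ofReal p) ν), Λ (ha.toLp, hb.toLp) =
        (∫ x, (inner ℝ (a x) (ψ x) : ℝ) ∂μ) + ∫ y, (inner ℝ (b y) (φ y) : ℝ) ∂ν := by
      intro a b ha hb
      rw [← hψ' a ha, ← hφ' b hb]
      refine Eq.trans (congrArg Λ ?_) (Λ.map_add (ha.toLp, 0) (0, hb.toLp))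
      exact Prod.ext (add_zero _).symm (zero_add _).symm
    refine (h ψ φ hψ hφ u fun s hs => ?_).not_gt ((hΛ f g hf hg) ▸ hlt)
    rw [← hΛ _ _ (hSm s hs).1 (hSm s hs).2]
    exact (hu _ (subset_closure ⟨s, hs, rfl⟩)).le
  rw [EMetric.mem_closure_iff] at hmem
  obtain ⟨_, ⟨s, hs, rfl⟩, hd⟩ := hmem r hr
  rw [Prod.edist_eq, max_lt_iff, Lp.edist_toLp_toLp, Lp.edist_toLp_toLp] at hd
  exact ⟨s, hs, hd⟩

/-- A function that cannot be separated from a convex set by dual pairings belongs to its closure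
in `L^p`. -/
theorem exists_approx_of_dual [IsFiniteMeasure μ] {p q : ℝ}
    (hpq : p.HolderConjugate q) {S : Set (α → F)} (hS : Convex ℝ S)
    (hSm : ∀ s ∈ S, MemLp s (ENNReal.ofReal p) μ)
    {f : α → F} (hf : MemLp f (ENNReal.ofReal p) μ)
    (h : ∀ ψ : α → F, MemLp ψ (ENNReal.ofReal q) μ →
      ∀ c : ℝ, (∀ s ∈ S, ∫ x, (inner ℝ (s x) (ψ x) : ℝ) ∂μ ≤ c) →
        ∫ x, (inner ℝ (f x) (ψ x) : ℝ) ∂μ ≤ c)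
    {r : ℝ≥0∞} (hr : 0 < r) : ∃ s ∈ S,
      eLpNorm (fun x => f x - s x) (ENNReal.ofReal p) μ < r := by
  have hSc : Convex ℝ (S ×ˢ {(fun _ => 0 : α → ℝ)}) := hS.prod (convex_singleton _)
  obtain ⟨s, hs, h1, -⟩ := exists_approx_pair_of_dual (ν := μ) hpq hSc
    (fun s hs => ⟨hSm _ hs.1, by rw [hs.2]; exact MemLp.zero⟩) hf
    (g := fun _ => 0) MemLp.zero (fun ψ φ hψ _ c hc => by
      simp only [inner_zero_left, integral_zero, add_zero]
      refine h ψ hψ c fun s hs => ?_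
      simpa using hc (s, fun _ => 0) ⟨hs, rfl⟩) hr
  exact ⟨s.1, hs.1, h1⟩

/-- Bounded sequences in `L^p`, `1 < p < ∞`, have weakly convergent subsequences. -/
theorem exists_subseq_weakLpTendsto [IsFiniteMeasure μ] {p q : ℝ} (hpq : p.HolderConjugate q)
    [Fact (1 ≤ ENNReal.ofReal q)] [TopologicalSpace.SeparableSpace (Lp F (ENNReal.ofReal q) μ)]
    {u : ℕ → α → F} (hu : ∀ n, MemLp (u n) (ENNReal.ofReal p) μ) {M : ℝ≥0∞} (hM : M ≠ ∞)
    (hb : ∀ n, eLpNorm (u n) (ENNReal.ofReal p) μ ≤ M) :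
    ∃ (u₀ : α → F) (k : ℕ → ℕ), StrictMono k ∧
      WeakLpTendsto (ENNReal.ofReal p) μ (fun n => u (k n)) u₀ := by
  have hc : ENNReal.HolderConjugate (ENNReal.ofReal p) (ENNReal.ofReal q) := hpq.ennrealOfReal
  have hc' : ENNReal.HolderConjugate (ENNReal.ofReal q) (ENNReal.ofReal p) :=
    hpq.symm.ennrealOfReal
  have hbd : ∀ n (f : Lp F (ENNReal.ofReal q) μ),
      ‖∫ x, (inner ℝ (f x) (u n x) : ℝ) ∂μ‖ ≤ M.toReal * ‖f‖ := fun n f => by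
    have h1 := abs_integral_inner_le (Lp.memLp f) (hu n)
    rw [Real.norm_eq_abs, Lp.norm_def, ← ENNReal.toReal_mul, ← ENNReal.ofReal_le_iff_le_toReal
      (ENNReal.mul_ne_top hM (Lp.memLp f).2.ne), mul_comm]
    exact h1.trans (by gcongr; exact hb n)
  -- The `u n` act as functionals on the separable space `L^q`, whose dual balls are weak-star
  -- sequentially compact. Riesz representation turns the limit functional back into a function.
  let Λ : ℕ → Lp F (ENNReal.ofReal q) μ →L[ℝ] ℝ := fun n =>
    LinearMap.mkContinuous
      { toFun := fun f => ∫ x, (inner ℝ (f x) (u n x) : ℝ) ∂μ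
        map_add' := fun f g => by
          rw [← integral_add (memLp_inner (Lp.memLp f) (hu n)) (memLp_inner (Lp.memLp g) (hu n))]
          refine integral_congr_ae ?_
          filter_upwards [Lp.coeFn_add f g] with x hx
          rw [hx, Pi.add_apply, inner_add_left]
        map_smul' := fun c f => by
          rw [RingHom.id_apply, smul_eq_mul, ← integral_const_mul]
          refine integral_congr_ae ?_
          filter_upwards [Lp.coeFn_smul c f] with x hx
          rw [hx, Pi.smul_apply, real_inner_smul_left] } M.toReal (hbd n)
  have hΛ : ∀ n f, Λ n f = ∫ x, (inner ℝ (f x) (u n x) : ℝ) ∂μ := fun n f => rfl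
  have hΛn : ∀ n, StrongDual.toWeakDual (Λ n) ∈
      WeakDual.toStrongDual ⁻¹' Metric.closedBall (0 : StrongDual ℝ (Lp F (ENNReal.ofReal q) μ))
        M.toReal := fun n => by
    have h1 : ‖Λ n‖ ≤ M.toReal := LinearMap.mkContinuous_norm_le _ ENNReal.toReal_nonneg _
    exact (dist_zero_right (Λ n)).le.trans h1
  obtain ⟨Λ₀, -, k, hk, hlim⟩ := WeakDual.isSeqCompact_closedBall ℝ (Lp F (ENNReal.ofReal q) μ)
    0 M.toReal hΛn
  obtain ⟨u₀, hu₀, hrep⟩ := exists_riesz hpq.symm (WeakDual.toStrongDual Λ₀)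
  refine ⟨u₀, k, hk, fun n => hu _, hu₀, fun q' hq' ψ hψ => ?_⟩
  have hqq : q' = ENNReal.ofReal q := ENNReal.HolderConjugate.unique (ENNReal.ofReal p) _ _
  subst hqq
  have h1 : Tendsto (fun n => Λ (k n) hψ.toLp) atTop (𝓝 (Λ₀ hψ.toLp)) :=
    ((WeakDual.eval_continuous _).tendsto _).comp hlim
  have h2 : Λ₀ hψ.toLp = ∫ x, (inner ℝ (u₀ x) (ψ x) : ℝ) ∂μ := by
    refine (hrep ψ hψ).trans ?_
    simp only [real_inner_comm]
  rw [← h2]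
  refine h1.congr fun n => ?_
  rw [hΛ]
  refine integral_congr_ae ?_
  filter_upwards [hψ.coeFn_toLp] with x hx
  rw [hx, real_inner_comm]

end Duality

/-! ### `L^p` on product spaces: sections, tensors, Minkowski inequalities -/

section ProductLp

variable {α β : Type*} [MeasurableSpace α] [MeasurableSpace β] {μ : Measure α} {ν : Measure β}
  {F : Type*} [NormedAddCommGroup F]

theorem eLpNorm_rpow_eq {p : ℝ} (hp : 0 < p) (f : α → F) :
    eLpNorm f (ENNReal.ofReal p) μ ^ p = ∫⁻ a, ‖f a‖ₑ ^ p ∂μ := by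
  rw [eLpNorm_eq_lintegral_rpow_enorm_toReal (by simpa using hp) ENNReal.ofReal_ne_top,
    ENNReal.toReal_ofReal hp.le, ← ENNReal.rpow_mul, one_div_mul_cancel hp.ne', ENNReal.rpow_one]

theorem memLp_iff_lintegral {p : ℝ} (hp : 0 < p) (f : α → F) :
    MemLp f (ENNReal.ofReal p) μ ↔ AEStronglyMeasurable f μ ∧ ∫⁻ a, ‖f a‖ₑ ^ p ∂μ < ∞ := by
  rw [MemLp, ← eLpNorm_rpow_eq hp, ENNReal.rpow_lt_top_iff_of_pos hp]

theorem eLpNorm_le_iff {p : ℝ} (hp : 0 < p) (f : α → F) {c : ℝ≥0∞} :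
    eLpNorm f (ENNReal.ofReal p) μ ≤ c ↔ ∫⁻ a, ‖f a‖ₑ ^ p ∂μ ≤ c ^ p := by
  rw [← eLpNorm_rpow_eq hp, ENNReal.rpow_le_rpow_iff hp]

theorem eLpNorm_lt_iff {p : ℝ} (hp : 0 < p) (f : α → F) {c : ℝ≥0∞} :
    eLpNorm f (ENNReal.ofReal p) μ < c ↔ ∫⁻ a, ‖f a‖ₑ ^ p ∂μ < c ^ p := by
  rw [← eLpNorm_rpow_eq hp, ENNReal.rpow_lt_rpow_iff hp]

theorem tendsto_eLpNorm_iff {p : ℝ} (hp : 0 < p) {ι : Type*} {l : Filter ι} (f : ι → α → F) :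
    Tendsto (fun i => eLpNorm (f i) (ENNReal.ofReal p) μ) l (𝓝 0) ↔
      Tendsto (fun i => ∫⁻ a, ‖f i a‖ₑ ^ p ∂μ) l (𝓝 0) := by
  simp only [← eLpNorm_rpow_eq hp]
  constructor
  · intro h
    have := (ENNReal.continuous_rpow_const (y := p)).tendsto 0 |>.comp h
    rwa [ENNReal.zero_rpow_of_pos hp] at this
  · intro h
    have := (ENNReal.continuous_rpow_const (y := 1 / p)).tendsto 0 |>.comp h
    rw [ENNReal.zero_rpow_of_pos (by positivity)] at this
    refine this.congr fun i => ?_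
    simp only [Function.comp_apply]
    rw [← ENNReal.rpow_mul, mul_one_div_cancel hp.ne', ENNReal.rpow_one]

theorem lintegral_enorm_rpow_prod [SFinite ν] {p : ℝ} (hp : 0 < p) {f : α × β → F}
    (hf : AEStronglyMeasurable f (μ.prod ν)) :
    ∫⁻ z, ‖f z‖ₑ ^ p ∂(μ.prod ν) =
      ∫⁻ a, eLpNorm (fun b => f (a, b)) (ENNReal.ofReal p) ν ^ p ∂μ := by
  rw [lintegral_prod _ (hf.enorm.pow_const p)]
  simp only [eLpNorm_rpow_eq hp]

theorem aemeasurable_eLpNorm_section [SFinite ν] {p : ℝ} (hp : 0 < p) {f : α × β → F}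
    (hf : AEStronglyMeasurable f (μ.prod ν)) :
    AEMeasurable (fun a => eLpNorm (fun b => f (a, b)) (ENNReal.ofReal p) ν) μ := by
  have h : ∀ a, eLpNorm (fun b => f (a, b)) (ENNReal.ofReal p) ν =
      (∫⁻ b, ‖f (a, b)‖ₑ ^ p ∂ν) ^ (1 / p) := fun a => by
    rw [← eLpNorm_rpow_eq hp, ← ENNReal.rpow_mul, mul_one_div_cancel hp.ne', ENNReal.rpow_one]
  simp only [h]
  exact (hf.enorm.pow_const p).lintegral_prod_right'.pow_const _

/-- Sections of an `L^p` function on a product are in `L^p`. -/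
theorem MemLp_section [SFinite ν] {p : ℝ} (hp : 0 < p) {f : α × β → F}
    (hf : MemLp f (ENNReal.ofReal p) (μ.prod ν)) :
    ∀ᵐ a ∂μ, MemLp (fun b => f (a, b)) (ENNReal.ofReal p) ν := by
  have h1 := ((memLp_iff_lintegral hp f).1 hf).2
  rw [lintegral_enorm_rpow_prod hp hf.1] at h1
  filter_upwards [hf.1.prodMk_left, ae_lt_top' ((aemeasurable_eLpNorm_section hp hf.1).pow_const p)
    h1.ne] with a ha hb
  exact ⟨ha, (ENNReal.rpow_lt_top_iff_of_pos hp).1 hb⟩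

theorem memLp_swap [SFinite μ] [SFinite ν] {p : ℝ≥0∞} {f : α × β → F}
    (hf : MemLp f p (μ.prod ν)) : MemLp (fun z : β × α => f z.swap) p (ν.prod μ) :=
  hf.comp_measurePreserving Measure.measurePreserving_swap

theorem eLpNorm_swap [SFinite μ] [SFinite ν] {p : ℝ≥0∞} {f : α × β → F}
    (hf : AEStronglyMeasurable f (μ.prod ν)) :
    eLpNorm (fun z : β × α => f z.swap) p (ν.prod μ) = eLpNorm f p (μ.prod ν) :=
  eLpNorm_comp_measurePreserving hf Measure.measurePreserving_swap

theorem MemLp_section' [SFinite μ] [SFinite ν] {p : ℝ} (hp : 0 < p) {f : α × β → F}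
    (hf : MemLp f (ENNReal.ofReal p) (μ.prod ν)) :
    ∀ᵐ b ∂ν, MemLp (fun a => f (a, b)) (ENNReal.ofReal p) μ :=
  MemLp_section hp (memLp_swap hf)

theorem aestronglyMeasurable_tensor [SFinite ν] [NormedSpace ℝ F] {φ : α → ℝ} {g : β → F}
    (hφ : AEStronglyMeasurable φ μ) (hg : AEStronglyMeasurable g ν) :
    AEStronglyMeasurable (fun z : α × β => φ z.1 • g z.2) (μ.prod ν) :=
  hφ.comp_fst.smul hg.comp_snd

theorem eLpNorm_tensor [SFinite ν] [NormedSpace ℝ F] {p : ℝ} (hp : 0 < p) {φ : α → ℝ} {g : β → F}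
    (hφ : AEStronglyMeasurable φ μ) (hg : AEStronglyMeasurable g ν) :
    eLpNorm (fun z : α × β => φ z.1 • g z.2) (ENNReal.ofReal p) (μ.prod ν) =
      eLpNorm φ (ENNReal.ofReal p) μ * eLpNorm g (ENNReal.ofReal p) ν := by
  refine ENNReal.rpow_left_injective hp.ne' ?_
  simp only [ENNReal.mul_rpow_of_nonneg _ _ hp.le]
  rw [eLpNorm_rpow_eq hp, eLpNorm_rpow_eq hp,
    lintegral_enorm_rpow_prod hp (aestronglyMeasurable_tensor hφ hg)]
  rw [← lintegral_mul_const'' _ (hφ.enorm.pow_const p)]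
  refine lintegral_congr fun a => ?_
  rw [← ENNReal.mul_rpow_of_nonneg _ _ hp.le]
  congr 1
  exact eLpNorm_const_smul (φ a) g _ ν

theorem memLp_tensor [SFinite ν] [NormedSpace ℝ F] {p : ℝ} (hp : 0 < p) {φ : α → ℝ} {g : β → F}
    (hφ : MemLp φ (ENNReal.ofReal p) μ) (hg : MemLp g (ENNReal.ofReal p) ν) :
    MemLp (fun z : α × β => φ z.1 • g z.2) (ENNReal.ofReal p) (μ.prod ν) :=
  ⟨aestronglyMeasurable_tensor hφ.1 hg.1, by
    rw [eLpNorm_tensor hp hφ.1 hg.1]; exact ENNReal.mul_lt_top hφ.2 hg.2⟩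

/-- Every set of `L^p` functions contains a sequence that is dense in it. -/
theorem exists_dense_seq {p : ℝ≥0∞} [Fact (1 ≤ p)] [SecondCountableTopology (Lp F p ν)]
    {S : Set (β → F)} (hne : S.Nonempty) (hS : ∀ s ∈ S, MemLp s p ν) :
    ∃ s : ℕ → β → F, (∀ j, s j ∈ S) ∧
      ∀ f ∈ S, ∀ r : ℝ≥0∞, 0 < r → ∃ j, eLpNorm (fun b => f b - s j b) p ν < r := by
  let T : Set (Lp F p ν) := {z | ∃ s, ∃ hs : s ∈ S, (hS s hs).toLp = z}
  have : Nonempty T := by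
    obtain ⟨s, hs⟩ := hne
    exact ⟨⟨_, s, hs, rfl⟩⟩
  choose s hs hst using fun j => (TopologicalSpace.denseSeq T j).2
  refine ⟨s, hs, fun f hf r hr => ?_⟩
  have hd := TopologicalSpace.denseRange_denseSeq T ⟨_, f, hf, rfl⟩
  rw [EMetric.mem_closure_iff] at hd
  obtain ⟨_, ⟨j, rfl⟩, hj⟩ := hd r hr
  refine ⟨j, ?_⟩
  rw [Subtype.edist_eq, ← hst j, Lp.edist_toLp_toLp] at hj
  exact hj

/-- An `L^p` function on a product whose sections lie in the closure of a set `S` is approximated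
by finite sums `∑ 1_{A_i} ⊗ s_i` with `s_i ∈ S`. -/
theorem exists_tensor_approx [IsFiniteMeasure μ] [SFinite ν] [NormedSpace ℝ F] {p : ℝ} (hp : 1 ≤ p)
    [Fact (1 ≤ ENNReal.ofReal p)]
    [SecondCountableTopology (Lp F (ENNReal.ofReal p) ν)] {S : Set (β → F)} (hne : S.Nonempty)
    (hS : ∀ s ∈ S, MemLp s (ENNReal.ofReal p) ν) {f : α × β → F}
    (hf : MemLp f (ENNReal.ofReal p) (μ.prod ν))
    (hfS : ∀ᵐ a ∂μ, ∀ r : ℝ≥0∞, 0 < r → ∃ s ∈ S,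
      eLpNorm (fun b => f (a, b) - s b) (ENNReal.ofReal p) ν < r)
    {r : ℝ≥0∞} (hr : 0 < r) :
    ∃ (n : ℕ) (A : Fin n → Set α) (s : Fin n → β → F), (∀ i, MeasurableSet (A i)) ∧
      (∀ i, s i ∈ S) ∧ eLpNorm (fun z => f z - ∑ i, (A i).indicator (fun _ => (1 : ℝ)) z.1 • s i z.2)
        (ENNReal.ofReal p) (μ.prod ν) < r := by
  have hp0 : 0 < p := by linarith
  obtain ⟨s, hsS, hsd⟩ := exists_dense_seq hne hS
  wlog hrt : r ≠ ∞ generalizing r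
  · obtain ⟨n, A, t, h1, h2, h3⟩ := this one_pos ENNReal.one_ne_top
    exact ⟨n, A, t, h1, h2, h3.trans_le (by simp at hrt; simp [hrt])⟩
  set c : ℝ≥0∞ := r ^ p / 2 with hc
  have hrp0 : r ^ p ≠ 0 := (ENNReal.rpow_pos hr hrt).ne'
  have hrpt : r ^ p ≠ ∞ := ENNReal.rpow_ne_top_of_nonneg hp0.le hrt
  have hc0 : c ≠ 0 := (ENNReal.half_pos hrp0).ne'
  have hct : c ≠ ∞ := (ENNReal.half_lt_self hrp0 hrpt).ne_top
  -- Half of the error budget `r ^ p` is spent on sections approximated within `η`, half on the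
  -- sections not yet reached. Adding `1` keeps the denominator nonzero when `μ = 0`.
  set η : ℝ≥0∞ := (c / (μ Set.univ + 1)) ^ (1 / p) with hη
  have hM : μ Set.univ + 1 ≠ ∞ := ENNReal.add_ne_top.2 ⟨measure_ne_top _ _, ENNReal.one_ne_top⟩
  have hη0 : 0 < η := ENNReal.rpow_pos (ENNReal.div_pos hc0 hM)
    (ENNReal.div_ne_top hct (by simp))
  have hηp : η ^ p = c / (μ Set.univ + 1) := by
    rw [hη, ← ENNReal.rpow_mul, one_div_mul_cancel hp0.ne', ENNReal.rpow_one]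
  have hηle : η ^ p * μ Set.univ ≤ c := by
    rw [hηp]
    calc c / (μ Set.univ + 1) * μ Set.univ ≤ c / (μ Set.univ + 1) * (μ Set.univ + 1) := by
          gcongr; exact le_self_add
      _ = c := ENNReal.div_mul_cancel (by simp) hM
  have hdiff : ∀ j, AEStronglyMeasurable (fun z : α × β => f z - s j z.2) (μ.prod ν) := fun j =>
    hf.1.sub (hS _ (hsS j)).1.comp_snd
  have hNm := fun j => aemeasurable_eLpNorm_section hp0 (hdiff j)
  -- The `j`-th set collects the points whose section is within `η` of `s j`; disjointing assigns to
  -- each point its first such `j`. On `E n`, where none of the first `n` members is close enough,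
  -- the approximant is zero, so the error there is the mass of `f`, which vanishes as `E n` shrinks
  -- to a null set.
  let B : ℕ → Set α := fun j => {a | (hNm j).mk _ a < η}
  have hB : ∀ j, MeasurableSet (B j) := fun j =>
    measurableSet_lt (hNm j).measurable_mk measurable_const
  let A : ℕ → Set α := disjointed B
  have hA : ∀ j, MeasurableSet (A j) := fun j => MeasurableSet.disjointed hB j
  let g : ℕ → α × β → F := fun n z =>
    ∑ i : Fin n, (A i).indicator (fun _ => (1 : ℝ)) z.1 • s i z.2
  have hgm : ∀ n, AEStronglyMeasurable (g n) (μ.prod ν) := fun n =>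
    Finset.aestronglyMeasurable_fun_sum _ fun i _ =>
      aestronglyMeasurable_tensor (aestronglyMeasurable_const.indicator (hA i)) (hS _ (hsS i)).1
  let E : ℕ → Set α := fun n => (⋃ j < n, B j)ᶜ
  have hE : ∀ n, MeasurableSet (E n) := fun n =>
    (MeasurableSet.biUnion (Set.to_countable _) fun j _ => hB j).compl
  let Nf : α → ℝ≥0∞ := fun a => eLpNorm (fun b => f (a, b)) (ENNReal.ofReal p) ν ^ p
  have hNf : ∫⁻ a, Nf a ∂μ ≠ ∞ := by
    have := ((memLp_iff_lintegral hp0 f).1 hf).2.ne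
    rwa [lintegral_enorm_rpow_prod hp0 hf.1] at this
  have hae : ∀ᵐ a ∂μ, ∀ j, eLpNorm (fun b => f (a, b) - s j b) (ENNReal.ofReal p) ν =
      (hNm j).mk _ a := ae_all_iff.2 fun j => (hNm j).ae_eq_mk
  have hbound : ∀ n, ∫⁻ z, ‖f z - g n z‖ₑ ^ p ∂(μ.prod ν) ≤ c + ∫⁻ a in E n, Nf a ∂μ := fun n => by
    rw [lintegral_enorm_rpow_prod hp0 (f := fun z => f z - g n z) (hf.1.sub (hgm n)),
      ← lintegral_indicator (hE n)]
    calc ∫⁻ a, eLpNorm (fun b => f (a, b) - g n (a, b)) (ENNReal.ofReal p) ν ^ p ∂μ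
        ≤ ∫⁻ a, (η ^ p + (E n).indicator Nf a) ∂μ := by
          refine lintegral_mono_ae ?_
          filter_upwards [hae] with a ha
          by_cases hx : a ∈ E n
          · have hz : ∀ b, g n (a, b) = 0 := fun b => by
              refine Finset.sum_eq_zero fun i _ => ?_
              have : a ∉ A i := fun h => hx (Set.mem_biUnion i.2 (disjointed_subset B i h))
              simp [this]
            simp only [hz, sub_zero, Set.indicator_of_mem hx]
            exact le_add_self
          · have hx' : a ∈ ⋃ j < n, B j := by simpa [E] using hx
            obtain ⟨j₀, hj₀, hj₀B⟩ := Set.mem_iUnion₂.1 hx'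
            have h1 : a ∈ ⋃ j, A j := by
              rw [iUnion_disjointed]
              exact Set.mem_iUnion.2 ⟨j₀, hj₀B⟩
            obtain ⟨j, hj⟩ := Set.mem_iUnion.1 h1
            have hjn : j < n := by
              by_contra hcon
              have : j₀ < j := by omega
              rw [show A j = disjointed B j from rfl, disjointed_eq_inter_compl] at hj
              exact (Set.mem_iInter₂.1 hj.2 j₀ this) hj₀B
            have hg1 : ∀ b, g n (a, b) = s j b := fun b => by
              have : ∀ i : Fin n, i ≠ ⟨j, hjn⟩ →
                  (A i).indicator (fun _ => (1 : ℝ)) a • s i b = 0 := fun i hi => by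
                have : a ∉ A i := fun h =>
                  (disjoint_disjointed B (fun h' => hi (Fin.ext h') : (i : ℕ) ≠ j)).le_bot ⟨h, hj⟩
                simp [this]
              simp only [g]
              rw [Finset.sum_eq_single ⟨j, hjn⟩ (fun i _ hi => this i hi) (by simp)]
              simp [hj]
            simp only [hg1]
            refine le_trans ?_ le_self_add
            refine ENNReal.rpow_le_rpow ?_ hp0.le
            rw [ha j]
            exact (disjointed_subset B j hj : (hNm j).mk _ a < η).le
      _ = η ^ p * μ Set.univ + ∫⁻ a, (E n).indicator Nf a ∂μ := by
          rw [lintegral_add_left measurable_const, lintegral_const]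
      _ ≤ _ := by gcongr
  have hE0 : Tendsto (fun n => μ (E n)) atTop (𝓝 0) := by
    have hanti : Antitone E := fun m n hmn => Set.compl_subset_compl.2
      (Set.biUnion_subset_biUnion_left fun j hj => lt_of_lt_of_le hj hmn)
    have h1 := tendsto_measure_iInter_atTop (μ := μ) (fun n => (hE n).nullMeasurableSet) hanti
      ⟨0, measure_ne_top _ _⟩
    have h2 : μ (⋂ n, E n) = 0 := by
      refine measure_mono_null (t := {a | ¬ ∃ j, a ∈ B j}) (fun a ha => ?_) ?_
      · rintro ⟨j, hj⟩
        exact (Set.mem_iInter.1 ha (j + 1)) (Set.mem_biUnion (Nat.lt_succ_self j) hj)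
      · have : ∀ᵐ a ∂μ, ∃ j, a ∈ B j := by
          filter_upwards [hfS, hae, MemLp_section hp0 hf] with a ha hb hm
          obtain ⟨t, ht, hlt⟩ := ha (η / 2) (ENNReal.half_pos hη0.ne')
          obtain ⟨j, hj⟩ := hsd t ht (η / 2) (ENNReal.half_pos hη0.ne')
          refine ⟨j, ?_⟩
          change (hNm j).mk _ a < η
          rw [← hb j]
          have h3 := eLpNorm_add_le (p := ENNReal.ofReal p) (hm.1.sub (hS t ht).1)
            ((hS t ht).1.sub (hS _ (hsS j)).1) Fact.out
          refine lt_of_le_of_lt (le_trans (le_of_eq ?_) h3) ((ENNReal.add_lt_add hlt hj).trans_eq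
            (ENNReal.add_halves η))
          congr 1
          ext b
          simp
        exact this
    rwa [h2] at h1
  have hlim := tendsto_setLIntegral_zero (f := Nf) hNf hE0
  obtain ⟨n, hn⟩ := ((tendsto_order.1 hlim).2 c (pos_iff_ne_zero.2 hc0)).exists
  refine ⟨n, fun i => A i, fun i => s i, fun i => hA i, fun i => hsS i, ?_⟩
  rw [eLpNorm_lt_iff hp0]
  calc _ ≤ c + ∫⁻ a in E n, Nf a ∂μ := hbound n
    _ < c + c := ENNReal.add_lt_add_left hct hn
    _ = r ^ p := ENNReal.add_halves _

/-- Finite sums of elementary tensors are dense, hence `L^p` of a product is separable. -/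
theorem separableSpace_Lp_prod [IsFiniteMeasure μ] [SFinite ν] [NormedSpace ℝ F] {p : ℝ}
    (hp : 1 ≤ p) [Fact (1 ≤ ENNReal.ofReal p)]
    [SecondCountableTopology (Lp ℝ (ENNReal.ofReal p) μ)]
    [SecondCountableTopology (Lp F (ENNReal.ofReal p) ν)] :
    TopologicalSpace.SeparableSpace (Lp F (ENNReal.ofReal p) (μ.prod ν)) := by
  have hp0 : 0 < p := by linarith
  let T : Lp ℝ (ENNReal.ofReal p) μ × Lp F (ENNReal.ofReal p) ν →
      Lp F (ENNReal.ofReal p) (μ.prod ν) := fun w =>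
    (memLp_tensor hp0 (Lp.memLp w.1) (Lp.memLp w.2)).toLp
  have hTn : ∀ w, ‖T w‖ = ‖w.1‖ * ‖w.2‖ := fun w => by
    rw [Lp.norm_toLp, eLpNorm_tensor hp0 (Lp.memLp w.1).1 (Lp.memLp w.2).1, ENNReal.toReal_mul,
      Lp.norm_def, Lp.norm_def]
  have hsub₁ : ∀ φ φ' g, T (φ, g) - T (φ', g) = T (φ - φ', g) := fun φ φ' g => by
    refine Eq.trans (MemLp.toLp_sub _ _).symm ((MemLp.toLp_eq_toLp_iff _ _).2 ?_)
    filter_upwards [Measure.quasiMeasurePreserving_fst.ae (Lp.coeFn_sub φ φ')] with z hz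
    simp only [Pi.sub_apply] at hz ⊢
    rw [hz, sub_smul]
  have hsub₂ : ∀ φ g g', T (φ, g) - T (φ, g') = T (φ, g - g') := fun φ g g' => by
    refine Eq.trans (MemLp.toLp_sub _ _).symm ((MemLp.toLp_eq_toLp_iff _ _).2 ?_)
    filter_upwards [Measure.quasiMeasurePreserving_snd.ae (Lp.coeFn_sub g g')] with z hz
    simp only [Pi.sub_apply] at hz ⊢
    rw [hz, smul_sub]
  have hT : Continuous T := by
    rw [continuous_iff_continuousAt]
    intro w₀
    rw [ContinuousAt, tendsto_iff_norm_sub_tendsto_zero]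
    have hb : ∀ w, ‖T w - T w₀‖ ≤ ‖w.1‖ * ‖w.2 - w₀.2‖ + ‖w.1 - w₀.1‖ * ‖w₀.2‖ := fun w => by
      have : T w - T w₀ = (T (w.1, w.2) - T (w.1, w₀.2)) + (T (w.1, w₀.2) - T (w₀.1, w₀.2)) := by
        simp
      rw [this, hsub₁, hsub₂, ← hTn (w.1, w.2 - w₀.2), ← hTn (w.1 - w₀.1, w₀.2)]
      exact norm_add_le _ _
    refine squeeze_zero (fun _ => norm_nonneg _) hb ?_
    have hc : Continuous fun w : Lp ℝ (ENNReal.ofReal p) μ × Lp F (ENNReal.ofReal p) ν =>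
        ‖w.1‖ * ‖w.2 - w₀.2‖ + ‖w.1 - w₀.1‖ * ‖w₀.2‖ := by fun_prop
    have := hc.tendsto w₀
    simpa using this
  -- The tensor map is continuous on a product of separable spaces, so the closed span of its range
  -- is separable; `exists_tensor_approx` shows that this span is everything.
  have hsep : TopologicalSpace.IsSeparable
      (closure (Submodule.span ℝ (Set.range T) : Set (Lp F (ENNReal.ofReal p) (μ.prod ν)))) :=
    (TopologicalSpace.isSeparable_range hT).span.closure
  rw [← TopologicalSpace.isSeparable_univ_iff]
  refine hsep.mono fun f _ => ?_
  rw [EMetric.mem_closure_iff]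
  intro r hr
  obtain ⟨n, A, s, hA, hs, hlt⟩ := exists_tensor_approx hp
    (S := {s : β → F | MemLp s (ENNReal.ofReal p) ν}) ⟨fun _ => 0, MemLp.zero⟩ (fun s hs => hs)
    (Lp.memLp f) (by
      filter_upwards [MemLp_section hp0 (Lp.memLp f)] with a ha r hr
      exact ⟨_, ha, by simpa using hr⟩) hr
  have hAm : ∀ i, MemLp ((A i).indicator fun _ => (1 : ℝ)) (ENNReal.ofReal p) μ := fun i =>
    (memLp_const 1).indicator (hA i)
  have ht : ∀ i, MemLp (fun z : α × β => (A i).indicator (fun _ => (1 : ℝ)) z.1 • s i z.2)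
      (ENNReal.ofReal p) (μ.prod ν) := fun i => memLp_tensor hp0 (hAm i) (hs i)
  refine ⟨∑ i, (ht i).toLp, Submodule.sum_mem _ fun i _ => Submodule.subset_span
    ⟨((hAm i).toLp, MemLp.toLp (s i) (hs i)), ?_⟩, ?_⟩
  · refine (MemLp.toLp_eq_toLp_iff _ _).2 ?_
    have h1 : ∀ᵐ z : α × β ∂(μ.prod ν), MemLp.toLp _ (hAm i) z.1 = (A i).indicator (fun _ => (1 : ℝ)) z.1 :=
      Measure.quasiMeasurePreserving_fst.ae (hAm i).coeFn_toLp
    have h2 : ∀ᵐ z : α × β ∂(μ.prod ν), MemLp.toLp (s i) (hs i) z.2 = s i z.2 :=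
      Measure.quasiMeasurePreserving_snd.ae (MemLp.coeFn_toLp (hs i))
    filter_upwards [h1, h2] with z h1 h2
    simp only [h1, h2]
  · rw [Lp.edist_def]
    refine lt_of_le_of_lt (le_of_eq (eLpNorm_congr_ae ?_)) hlt
    have hall : ∀ᵐ z ∂(μ.prod ν), ∀ i, MemLp.toLp _ (ht i) z =
        (A i).indicator (fun _ => (1 : ℝ)) z.1 • s i z.2 := ae_all_iff.2 fun i => (ht i).coeFn_toLp
    filter_upwards [hall, Lp.coeFn_finsetSum Finset.univ fun i => (ht i).toLp] with z h1 h2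
    rw [Pi.sub_apply, h2, Finset.sum_apply]
    simp only [h1]

/-- Minkowski's inequality for a weighted average of uniformly bounded sections. -/
theorem eLpNorm_integral_smul_le [SFinite μ] [SFinite ν] [NormedSpace ℝ F] {p : ℝ} (hp : 1 < p)
    {f : α × β → F} (hf : AEStronglyMeasurable f (μ.prod ν)) {w : β → ℝ}
    (hw : AEStronglyMeasurable w ν) {M : ℝ≥0∞}
    (hM : ∀ᵐ b ∂ν, eLpNorm (fun a => f (a, b)) (ENNReal.ofReal p) μ ≤ M) :
    eLpNorm (fun a => ∫ b, w b • f (a, b) ∂ν) (ENNReal.ofReal p) μ ≤ (∫⁻ b, ‖w b‖ₑ ∂ν) * M := by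
  have hp0 : 0 < p := by linarith
  obtain ⟨q, hpq⟩ : ∃ q, p.HolderConjugate q := ⟨_, Real.HolderConjugate.conjExponent hp⟩
  have hq0 := hpq.symm.pos
  rw [eLpNorm_le_iff hp0, ENNReal.mul_rpow_of_nonneg _ _ hp0.le]
  set W := ∫⁻ b, ‖w b‖ₑ ∂ν with hW
  have hpt : ∀ᵐ a ∂μ, ‖∫ b, w b • f (a, b) ∂ν‖ₑ ^ p ≤
      W ^ (p - 1) * ∫⁻ b, ‖w b‖ₑ * ‖f (a, b)‖ₑ ^ p ∂ν := by
    filter_upwards [hf.prodMk_left] with a ha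
    have h1 : ‖∫ b, w b • f (a, b) ∂ν‖ₑ ≤ ∫⁻ b, ‖w b‖ₑ * ‖f (a, b)‖ₑ ∂ν :=
      (enorm_integral_le_lintegral_enorm _).trans (le_of_eq (by simp only [enorm_smul]))
    -- Hölder after splitting `|w| |f| = |w|^{1/q} · |w|^{1/p} |f|`, so that only the total mass `W`
    -- of the weight enters.
    have h2 := ENNReal.lintegral_mul_le_Lp_mul_Lq ν hpq.symm (f := fun b => ‖w b‖ₑ ^ (1 / q))
      (g := fun b => ‖w b‖ₑ ^ (1 / p) * ‖f (a, b)‖ₑ) (hw.enorm.pow_const _)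
      ((hw.enorm.pow_const _).mul ha.enorm)
    have h3 : ∀ b, ((fun b => ‖w b‖ₑ ^ (1 / q)) * fun b => ‖w b‖ₑ ^ (1 / p) * ‖f (a, b)‖ₑ) b =
        ‖w b‖ₑ * ‖f (a, b)‖ₑ := fun b => by
      rw [Pi.mul_apply, ← mul_assoc, ← ENNReal.rpow_add_of_nonneg _ _ (by positivity)
        (by positivity), one_div, one_div, hpq.symm.inv_add_inv_eq_one, ENNReal.rpow_one]
    have h4 : ∀ b, (‖w b‖ₑ ^ (1 / q)) ^ q = ‖w b‖ₑ := fun b => by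
      rw [← ENNReal.rpow_mul, one_div_mul_cancel hq0.ne', ENNReal.rpow_one]
    have h5 : ∀ b, (‖w b‖ₑ ^ (1 / p) * ‖f (a, b)‖ₑ) ^ p = ‖w b‖ₑ * ‖f (a, b)‖ₑ ^ p := fun b => by
      rw [ENNReal.mul_rpow_of_nonneg _ _ hp0.le, ← ENNReal.rpow_mul, one_div_mul_cancel hp0.ne',
        ENNReal.rpow_one]
    simp only [h3, h4, h5] at h2
    calc _ ≤ (W ^ (1 / q) * (∫⁻ b, ‖w b‖ₑ * ‖f (a, b)‖ₑ ^ p ∂ν) ^ (1 / p)) ^ p :=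
          ENNReal.rpow_le_rpow (h1.trans h2) hp0.le
      _ = _ := by
          rw [ENNReal.mul_rpow_of_nonneg _ _ hp0.le, ← ENNReal.rpow_mul, ← ENNReal.rpow_mul,
            one_div_mul_cancel hp0.ne', ENNReal.rpow_one]
          congr 2
          rw [one_div, inv_mul_eq_div, hpq.div_conj_eq_sub_one]
  have hm : AEMeasurable (fun z : α × β => ‖w z.2‖ₑ * ‖f z‖ₑ ^ p) (μ.prod ν) :=
    hw.comp_snd.enorm.mul (hf.enorm.pow_const p)
  calc _ ≤ ∫⁻ a, W ^ (p - 1) * ∫⁻ b, ‖w b‖ₑ * ‖f (a, b)‖ₑ ^ p ∂ν ∂μ := lintegral_mono_ae hpt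
    _ = W ^ (p - 1) * ∫⁻ b, ∫⁻ a, ‖w b‖ₑ * ‖f (a, b)‖ₑ ^ p ∂μ ∂ν := by
        rw [lintegral_const_mul'' _ hm.lintegral_prod_right', lintegral_lintegral_swap hm]
    _ ≤ W ^ (p - 1) * ∫⁻ b, ‖w b‖ₑ * M ^ p ∂ν := by
        refine mul_le_mul_right (lintegral_mono_ae ?_) _
        filter_upwards [hM, (hf.prod_swap).prodMk_left] with b hb hb'
        refine (lintegral_const_mul'' ‖w b‖ₑ (hb'.enorm.pow_const p)).le.trans ?_
        gcongr
        exact (eLpNorm_le_iff hp0 _).1 hb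
    _ = W ^ (p - 1) * (W * M ^ p) := by rw [lintegral_mul_const'' _ hw.enorm]
    _ = W ^ p * M ^ p := by
        rw [← mul_assoc]
        congr 1
        nth_rewrite 2 [← ENNReal.rpow_one W]
        rw [← ENNReal.rpow_add_of_nonneg _ _ (by linarith) zero_le_one]
        simp

/-- Partial integrals against an element of the dual space are bounded in `L^p`. -/
theorem eLpNorm_integral_smul_le_mul [SFinite ν] [NormedSpace ℝ F] {p q : ℝ}
    (hpq : p.HolderConjugate q) {f : α × β → F} (hf : AEStronglyMeasurable f (μ.prod ν))
    {w : β → ℝ} (hw : AEStronglyMeasurable w ν) :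
    eLpNorm (fun a => ∫ b, w b • f (a, b) ∂ν) (ENNReal.ofReal p) μ ≤
      eLpNorm w (ENNReal.ofReal q) ν * eLpNorm f (ENNReal.ofReal p) (μ.prod ν) := by
  have hp0 := hpq.pos
  have : ENNReal.HolderConjugate (ENNReal.ofReal q) (ENNReal.ofReal p) := hpq.symm.ennrealOfReal
  rw [eLpNorm_le_iff hp0, ENNReal.mul_rpow_of_nonneg _ _ hp0.le, eLpNorm_rpow_eq hp0 f,
    lintegral_enorm_rpow_prod hp0 hf,
    ← lintegral_const_mul'' _ ((aemeasurable_eLpNorm_section hp0 hf).pow_const p)]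
  refine lintegral_mono_ae ?_
  filter_upwards [hf.prodMk_left] with a ha
  rw [← ENNReal.mul_rpow_of_nonneg _ _ hp0.le]
  refine ENNReal.rpow_le_rpow ?_ hp0.le
  refine (enorm_integral_le_lintegral_enorm _).trans ?_
  rw [← eLpNorm_one_eq_lintegral_enorm]
  have := eLpNorm_le_eLpNorm_mul_eLpNorm'_of_norm (p := ENNReal.ofReal q) (q := ENNReal.ofReal p)
    (r := 1) hw ha (fun (c : ℝ) (v : F) => c • v) 1 (ae_of_all _ fun b => by
      rw [norm_smul]; simp)
  simpa using this

theorem aestronglyMeasurable_integral_smul [SFinite ν] [NormedSpace ℝ F]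
    {f : α × β → F} (hf : AEStronglyMeasurable f (μ.prod ν)) {w : β → ℝ}
    (hw : AEStronglyMeasurable w ν) : AEStronglyMeasurable (fun a => ∫ b, w b • f (a, b) ∂ν) μ :=
  AEStronglyMeasurable.integral_prod_right' (f := fun z : α × β => w z.2 • f z)
    (hw.comp_snd.smul hf)

/-- An integrable function on a product all of whose partial integrals vanish is zero. -/
theorem ae_eq_zero_of_setIntegral_section [IsFiniteMeasure μ] [IsFiniteMeasure ν]
    [NormedSpace ℝ F] [CompleteSpace F] {f : α × β → F} (hf : Integrable f (μ.prod ν))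
    (h : ∀ A, MeasurableSet A → ∀ᵐ b ∂ν, ∫ a in A, f (a, b) ∂μ = 0) : f =ᵐ[μ.prod ν] 0 := by
  refine hf.ae_eq_zero_of_forall_setIntegral_eq_zero fun s hs _ => ?_
  have hrect : ∀ A B, MeasurableSet A → MeasurableSet B →
      ∫ z in A ×ˢ B, f z ∂(μ.prod ν) = 0 := fun A B hA hB => by
    rw [← Measure.prod_restrict, integral_prod_symm]
    · rw [integral_congr_ae (g := fun _ => 0), integral_zero]
      exact ae_restrict_of_ae (h A hA)
    · rw [Measure.prod_restrict]
      exact hf.integrableOn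
  induction s, hs using MeasurableSpace.induction_on_inter generateFrom_prod.symm
    isPiSystem_prod with
  | empty => simp
  | basic s hs =>
    obtain ⟨A, hA, B, hB, rfl⟩ := hs
    exact hrect A B hA hB
  | compl s hs ih =>
    have h1 := integral_add_compl hs hf
    have h2 : ∫ z, f z ∂(μ.prod ν) = 0 := by
      simpa using hrect Set.univ Set.univ MeasurableSet.univ MeasurableSet.univ
    rw [ih (measure_lt_top _ _), h2, zero_add] at h1
    exact h1
  | iUnion s hd hs ih =>
    rw [integral_iUnion hs hd hf.integrableOn]
    simp [ih _ (measure_lt_top _ _)]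

end ProductLp

/-! ### Maps preserving a measure up to null sets -/

/-- Preimages of measurable sets under `Φ` are null measurable and of the same measure. -/
def NullPreserving {α : Type*} [MeasurableSpace α] (Φ : α → α) (μ : Measure α) : Prop :=
  ∀ S, MeasurableSet S → NullMeasurableSet (Φ ⁻¹' S) μ ∧ μ (Φ ⁻¹' S) = μ S

namespace NullPreserving

variable {α : Type*} [MeasurableSpace α] {μ : Measure α} {Φ : α → α}

theorem ae (h : NullPreserving Φ μ) {p : α → Prop} (hp : ∀ᵐ z ∂μ, p z) : ∀ᵐ z ∂μ, p (Φ z) := by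
  obtain ⟨t, ht, htm, ht0⟩ := exists_measurable_superset_of_null hp
  refine measure_mono_null (t := Φ ⁻¹' t) (fun z hz => ht hz) ?_
  rw [(h t htm).2, ht0]

theorem aemeasurable (h : NullPreserving Φ μ) {β : Type*} [MeasurableSpace β]
    [MeasurableSpace.CountablyGenerated β] {f : α → β} (hf : AEMeasurable f μ) :
    AEMeasurable (fun z => f (Φ z)) μ := by
  have h1 : NullMeasurable (fun z => hf.mk f (Φ z)) μ := fun s hs =>
    (h _ (hf.measurable_mk hs)).1
  refine h1.aemeasurable.congr ?_
  filter_upwards [h.ae hf.ae_eq_mk] with z hz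
  exact hz.symm

theorem aestronglyMeasurable (h : NullPreserving Φ μ) {F : Type*} [TopologicalSpace F]
    [TopologicalSpace.PseudoMetrizableSpace F] [SecondCountableTopology F] {f : α → F}
    (hf : AEStronglyMeasurable f μ) : AEStronglyMeasurable (fun z => f (Φ z)) μ := by
  borelize F
  exact (h.aemeasurable hf.aemeasurable).aestronglyMeasurable

theorem lintegral_comp (h : NullPreserving Φ μ) {f : α → ℝ≥0∞} (hf : AEMeasurable f μ) :
    ∫⁻ z, f (Φ z) ∂μ = ∫⁻ z, f z ∂μ := by
  have key : ∀ f : α → ℝ≥0∞, Measurable f → ∫⁻ z, f (Φ z) ∂μ = ∫⁻ z, f z ∂μ := fun f hf => by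
    refine Measurable.ennreal_induction (motive := fun f => ∫⁻ z, f (Φ z) ∂μ = ∫⁻ z, f z ∂μ)
      (fun c s hs => ?_) (fun f g _ hf hg h1 h2 => ?_) (fun f hf hm h1 => ?_) hf
    · have e : (fun z => s.indicator (fun _ => c) (Φ z)) = (Φ ⁻¹' s).indicator fun _ => c := rfl
      rw [e, lintegral_indicator₀ (h s hs).1, lintegral_indicator hs, setLIntegral_const,
        setLIntegral_const, (h s hs).2]
    · simp only [Pi.add_apply]
      rw [lintegral_add_left' (h.aemeasurable hf.aemeasurable), lintegral_add_left hf, h1, h2]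
    · rw [lintegral_iSup' (fun n => h.aemeasurable (hf n).aemeasurable)
        (ae_of_all _ fun z i j hij => hm hij (Φ z)), lintegral_iSup hf hm]
      simp only [h1]
  rw [lintegral_congr_ae hf.ae_eq_mk, ← key _ hf.measurable_mk]
  exact lintegral_congr_ae (h.ae hf.ae_eq_mk)

theorem eLpNorm_comp (h : NullPreserving Φ μ) {F : Type*} [NormedAddCommGroup F] {p : ℝ}
    (hp : 0 < p) {f : α → F} (hf : AEStronglyMeasurable f μ) :
    eLpNorm (fun z => f (Φ z)) (ENNReal.ofReal p) μ = eLpNorm f (ENNReal.ofReal p) μ := by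
  refine ENNReal.rpow_left_injective hp.ne' ?_
  simp only [eLpNorm_rpow_eq hp]
  exact h.lintegral_comp (hf.enorm.pow_const p)

theorem memLp_comp (h : NullPreserving Φ μ) {F : Type*} [NormedAddCommGroup F]
    [SecondCountableTopology F] {p : ℝ} (hp : 0 < p) {f : α → F}
    (hf : MemLp f (ENNReal.ofReal p) μ) : MemLp (fun z => f (Φ z)) (ENNReal.ofReal p) μ :=
  ⟨h.aestronglyMeasurable hf.1, by rw [h.eLpNorm_comp hp hf.1]; exact hf.2⟩

end NullPreserving

/-- Tonelli's theorem for sets that are only null measurable, as are the ones produced by the joint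
measurability of the action. -/
theorem measure_prod_eq_zero_of_sections {α β : Type*} [MeasurableSpace α] [MeasurableSpace β]
    {μ : Measure α} {ν : Measure β} [SFinite μ] [SFinite ν] {S : Set (α × β)}
    (hS : NullMeasurableSet S (μ.prod ν)) (h : ∀ᵐ b ∂ν, ∀ᵐ a ∂μ, (a, b) ∉ S) :
    (μ.prod ν) S = 0 := by
  have hm : AEMeasurable (S.indicator fun _ => (1 : ℝ≥0∞)) (μ.prod ν) :=
    (aemeasurable_indicator_const_iff 1).2 hS
  rw [← lintegral_indicator_one₀ hS]
  refine (lintegral_prod_symm _ hm).trans ?_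
  rw [lintegral_congr_ae (g := fun _ => 0), lintegral_zero]
  filter_upwards [h] with b hb
  rw [lintegral_congr_ae (g := fun _ => 0), lintegral_zero]
  filter_upwards [hb] with a ha
  simp [ha]

/-! ### Stationary actions -/

section Stationary

variable {Ω : Type*} [MeasurableSpace Ω] {d : ℕ} {P : Measure Ω} {τ : Sp d → Ω → Ω}

/-- The skew shift `(ω, x) ↦ (τ_{c x} ω, x)`. -/
def skew (τ : Sp d → Ω → Ω) (c : ℝ) (z : Ω × Sp d) : Ω × Sp d := (τ (c • z.2) z.1, z.2)

omit [MeasurableSpace Ω] in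
theorem unf_eq_skew {F : Type*} (ε : ℝ) (u : Ω × Sp d → F) :
    unf τ ε u = fun z => u (skew τ (-ε⁻¹) z) := by
  funext z
  simp [unf, skew]

theorem skew_skew (hτ : IsStationary P τ) (c : ℝ) (z : Ω × Sp d) :
    skew τ (-c) (skew τ c z) = z := by
  simp [skew, ← hτ.map_add, hτ.map_zero]

/-- For fixed `x` the map `τ_{c x}` preserves `P`, so integrating over `ω` first gives preimages of
rectangles their product measure. The action is jointly measurable only for the completion; the
pushforward is therefore taken from the completed σ-algebra and identified by uniqueness of product
measures. This is the invariance behind unfolding. -/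
theorem skew_nullPreserving (hτ : IsStationary P τ) {c : ℝ} (hc : c ≠ 0) {ν : Measure (Sp d)}
    [SigmaFinite ν] (hν : ν ≪ volume) : NullPreserving (skew τ c) (P.prod ν) := by
  have := hτ.prob
  have hq : Measure.QuasiMeasurePreserving (fun x : Sp d => c • x) volume volume := by
    refine ⟨measurable_const_smul c, Measure.AbsolutelyContinuous.mk fun s hs h0 => ?_⟩
    rw [Measure.map_apply (measurable_const_smul c) hs]
    exact (Measure.addHaar_preimage_smul volume hc s).trans (by rw [h0, mul_zero])
  -- Joint measurability is available for `τ_x`. Dilation by `c ≠ 0` maps null sets to null sets in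
  -- both directions, which transfers it to `τ_{c x}`.
  have hqp : Measure.QuasiMeasurePreserving (fun z : Ω × Sp d => (z.1, c • z.2))
      (P.prod volume) (P.prod volume) := by
    refine ⟨by fun_prop, ?_⟩
    have h1 := Measure.map_prod_map P (volume : Measure (Sp d)) measurable_id hq.measurable
    rw [Measure.map_id] at h1
    change Measure.map (Prod.map id fun x : Sp d => c • x) _ ≪ _
    rw [← h1]
    exact Measure.AbsolutelyContinuous.rfl.prod hq.absolutelyContinuous
  have hrect : ∀ A B, MeasurableSet A → MeasurableSet B →
      NullMeasurableSet (skew τ c ⁻¹' A ×ˢ B) (P.prod ν) ∧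
      (P.prod ν) (skew τ c ⁻¹' A ×ˢ B) = P A * ν B := fun A B hA hB => by
    have hn : NullMeasurableSet (skew τ c ⁻¹' A ×ˢ B) (P.prod ν) := by
      have h1 : NullMeasurableSet ((fun z : Ω × Sp d => (z.1, c • z.2)) ⁻¹'
          {z | τ z.2 z.1 ∈ A}) (P.prod volume) :=
        (hτ.jointly A hA).preimage hqp
      have h2 : NullMeasurableSet (Prod.snd ⁻¹' B : Set (Ω × Sp d)) (P.prod ν) :=
        (measurable_snd hB).nullMeasurableSet
      exact (h1.mono_ac (Measure.AbsolutelyContinuous.rfl.prod hν)).inter h2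
    refine ⟨hn, ?_⟩
    rw [← lintegral_indicator_one₀ hn]
    refine (lintegral_prod_symm _ ((aemeasurable_indicator_const_iff 1).2 hn)).trans ?_
    have h3 : ∀ x : Sp d, ∫⁻ ω, (skew τ c ⁻¹' A ×ˢ B).indicator (fun _ => (1 : ℝ≥0∞)) (ω, x) ∂P =
        B.indicator (fun _ => P A) x := fun x => by
      by_cases hx : x ∈ B
      · rw [Set.indicator_of_mem hx, ← (hτ.preserving (c • x)).measure_preimage
          hA.nullMeasurableSet, ← lintegral_indicator_one ((hτ.preserving (c • x)).measurable hA)]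
        refine lintegral_congr fun ω => ?_
        by_cases hω : τ (c • x) ω ∈ A <;> simp [skew, hx, hω, Set.indicator]
      · rw [Set.indicator_of_notMem hx]
        simp [skew, hx, Set.indicator]
    rw [lintegral_congr h3, lintegral_indicator hB, setLIntegral_const]
  have hmeas : @Measurable (NullMeasurableSpace (Ω × Sp d) (P.prod ν)) (Ω × Sp d) _ _
      (skew τ c) := by
    intro S hS
    change NullMeasurableSet (skew τ c ⁻¹' S) (P.prod ν)
    induction S, hS using MeasurableSpace.induction_on_inter generateFrom_prod.symm
      isPiSystem_prod with
    | empty => exact nullMeasurableSet_empty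
    | basic S hS =>
      obtain ⟨A, hA, B, hB, rfl⟩ := hS
      exact (hrect A B hA hB).1
    | compl S _ ih => exact ih.compl
    | iUnion S _ _ ih =>
      rw [Set.preimage_iUnion]
      exact NullMeasurableSet.iUnion ih
  have hmap : P.prod ν = @Measure.map (NullMeasurableSpace (Ω × Sp d) (P.prod ν)) (Ω × Sp d) _ _
      (skew τ c) (P.prod ν).completion :=
    Measure.prod_eq fun A B hA hB =>
      (Measure.map_apply hmeas (hA.prod hB)).trans (hrect A B hA hB).2
  intro S hS
  refine ⟨hmeas hS, Eq.symm ?_⟩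
  have h1 := congrArg (fun κ : Measure (Ω × Sp d) => κ S) hmap
  exact h1.trans (Measure.map_apply hmeas hS)

theorem eLpNorm_shift (hτ : IsStationary P τ) {F : Type*} [NormedAddCommGroup F] {p : ℝ≥0∞}
    {φ : Ω → F} (hφ : AEStronglyMeasurable φ P) (x : Sp d) :
    eLpNorm (fun ω => φ (τ x ω)) p P = eLpNorm φ p P :=
  eLpNorm_comp_measurePreserving hφ (hτ.preserving x)

theorem memLp_shift (hτ : IsStationary P τ) {F : Type*} [NormedAddCommGroup F] {p : ℝ≥0∞}
    {φ : Ω → F} (hφ : MemLp φ p P) (x : Sp d) : MemLp (fun ω => φ (τ x ω)) p P :=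
  hφ.comp_measurePreserving (hτ.preserving x)

theorem integral_shift (hτ : IsStationary P τ) {F : Type*} [NormedAddCommGroup F]
    [NormedSpace ℝ F] {φ : Ω → F} (hφ : AEStronglyMeasurable φ P) (x : Sp d) :
    ∫ ω, φ (τ x ω) ∂P = ∫ ω, φ ω ∂P := by
  have h := integral_map (hτ.preserving x).measurable.aemeasurable
    (f := φ) (by rwa [(hτ.preserving x).map_eq])
  rw [(hτ.preserving x).map_eq] at h
  exact h.symm

namespace IsStochGrad

variable {p : ℝ} {φ φ' : Ω → ℝ} {ψ ψ' : Ω → Sp d}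

theorem add (hp : 1 ≤ p) (h : IsStochGrad p P τ φ ψ) (hτ : IsStationary P τ)
    (h' : IsStochGrad p P τ φ' ψ') :
    IsStochGrad p P τ (fun ω => φ ω + φ' ω) (fun ω => ψ ω + ψ' ω) where
  memLp := h.memLp.add h'.memLp
  memLp_grad := h.memLp_grad.add h'.memLp_grad
  tendsto i := by
    have h0 := (h.tendsto i).add (h'.tendsto i)
    rw [add_zero] at h0
    have hm : ∀ {φ : Ω → ℝ} {ψ : Ω → Sp d} (_ : IsStochGrad p P τ φ ψ) (t : ℝ),
        AEStronglyMeasurable (fun ω => (φ (τ (t • EuclideanSpace.single i (1 : ℝ)) ω) - φ ω) / t -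
          ψ ω i) P := fun {φ ψ} h t =>
      ((((memLp_shift hτ h.memLp _).1.sub h.memLp.1).mul_const t⁻¹)).sub
        ((EuclideanSpace.proj (𝕜 := ℝ) i).continuous.comp_aestronglyMeasurable h.memLp_grad.1)
    refine tendsto_of_tendsto_of_tendsto_of_le_of_le tendsto_const_nhds h0 (fun _ => zero_le)
      fun t => ?_
    refine le_trans (le_of_eq ?_) (eLpNorm_add_le (hm h t) (hm h' t) (by simpa using hp))
    congr 1
    funext ω
    simp only [Pi.add_apply, PiLp.add_apply]
    ring

theorem smul (h : IsStochGrad p P τ φ ψ) (c : ℝ) :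
    IsStochGrad p P τ (fun ω => c * φ ω) (fun ω => c • ψ ω) where
  memLp := h.memLp.const_mul c
  memLp_grad := h.memLp_grad.const_smul c
  tendsto i := by
    have h0 := ENNReal.Tendsto.const_mul (a := ‖c‖ₑ) (h.tendsto i) (Or.inr (by simp))
    rw [mul_zero] at h0
    refine h0.congr fun t => ?_
    rw [← eLpNorm_const_smul]
    congr 1
    funext ω
    simp only [Pi.smul_apply, PiLp.smul_apply, smul_eq_mul]
    ring

theorem zero : IsStochGrad p P τ (fun _ => 0) (fun _ => 0) where
  memLp := MemLp.zero
  memLp_grad := MemLp.zero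
  tendsto i := by simp

theorem sub (hp : 1 ≤ p) (h : IsStochGrad p P τ φ ψ) (hτ : IsStationary P τ)
    (h' : IsStochGrad p P τ φ' ψ') :
    IsStochGrad p P τ (fun ω => φ ω - φ' ω) (fun ω => ψ ω - ψ' ω) := by
  have := h.add hp hτ (h'.smul (-1))
  simpa [sub_eq_add_neg] using this

theorem shift (hτ : IsStationary P τ) (h : IsStochGrad p P τ φ ψ) (x : Sp d) :
    IsStochGrad p P τ (fun ω => φ (τ x ω)) (fun ω => ψ (τ x ω)) where
  memLp := memLp_shift hτ h.memLp x
  memLp_grad := memLp_shift hτ h.memLp_grad x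
  tendsto i := by
    refine (h.tendsto i).congr fun t => ?_
    rw [← eLpNorm_shift hτ (x := x)]
    · simp only [← hτ.map_add, add_comm x]
    · exact ((((memLp_shift hτ h.memLp _).1.sub h.memLp.1).mul_const t⁻¹)).sub
        ((EuclideanSpace.proj (𝕜 := ℝ) i).continuous.comp_aestronglyMeasurable h.memLp_grad.1)

/-- Divide the displacement into `n + 1` equal steps. By stationarity all steps have increments of
the same norm, so the total is at most `|t|` times the norm of a difference quotient of step `t / (n
+ 1)`; let `n → ∞`. -/
theorem eLpNorm_sub_single_le (hp : 1 ≤ p) (hτ : IsStationary P τ) (h : IsStochGrad p P τ φ ψ)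
    (i : Fin d) (t : ℝ) :
    eLpNorm (fun ω => φ (τ (t • EuclideanSpace.single i (1 : ℝ)) ω) - φ ω) (ENNReal.ofReal p) P ≤
      ‖t‖ₑ * eLpNorm (fun ω => ψ ω i) (ENNReal.ofReal p) P := by
  have hp1 : 1 ≤ ENNReal.ofReal p := by simpa using hp
  rcases eq_or_ne t 0 with rfl | ht
  · simp [hτ.map_zero]
  set e : Sp d := EuclideanSpace.single i (1 : ℝ)
  have hψm : AEStronglyMeasurable (fun ω => ψ ω i) P :=
    (EuclideanSpace.proj (𝕜 := ℝ) i).continuous.comp_aestronglyMeasurable h.memLp_grad.1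
  have hm : ∀ x, AEStronglyMeasurable (fun ω => φ (τ x ω) - φ ω) P := fun x =>
    (memLp_shift hτ h.memLp _).1.sub h.memLp.1
  have hsub : ∀ (s : ℝ) (n : ℕ), eLpNorm (fun ω => φ (τ ((n * s) • e) ω) - φ ω)
      (ENNReal.ofReal p) P ≤ n * eLpNorm (fun ω => φ (τ (s • e) ω) - φ ω) (ENNReal.ofReal p) P := by
    intro s n
    induction n with
    | zero => simp [hτ.map_zero]
    | succ n ih =>
      have e1 : (fun ω => φ (τ (((n + 1 : ℕ) * s) • e) ω) - φ ω) =
          (fun ω => φ (τ (s • e) (τ ((n * s) • e) ω)) - φ (τ ((n * s) • e) ω)) +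
            fun ω => φ (τ ((n * s) • e) ω) - φ ω := by
        funext ω
        simp only [Pi.add_apply, ← hτ.map_add, ← add_smul]
        push_cast
        rw [show (n + 1 : ℝ) * s = s + n * s by ring]
        ring
      rw [e1]
      have hms : AEStronglyMeasurable (fun ω => φ (τ (s • e) (τ ((n * s) • e) ω)) -
          φ (τ ((n * s) • e) ω)) P :=
        (hm (s • e)).comp_measurePreserving (hτ.preserving _)
      refine (eLpNorm_add_le hms (hm _) hp1).trans ?_
      have e2 := eLpNorm_shift hτ (p := ENNReal.ofReal p) (hm (s • e)) ((n * s) • e)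
      rw [e2]
      push_cast
      rw [add_mul, one_mul, add_comm]
      gcongr
  have hkey : ∀ n : ℕ, eLpNorm (fun ω => φ (τ (t • e) ω) - φ ω) (ENNReal.ofReal p) P ≤
      ‖t‖ₑ * (eLpNorm (fun ω => (φ (τ ((t / (n + 1)) • e) ω) - φ ω) / (t / (n + 1)) - ψ ω i)
        (ENNReal.ofReal p) P + eLpNorm (fun ω => ψ ω i) (ENNReal.ofReal p) P) := fun n => by
    have hs : t / ((n : ℝ) + 1) ≠ 0 := div_ne_zero ht (by positivity)
    set s := t / ((n : ℝ) + 1)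
    have hts : ((n + 1 : ℕ) : ℝ) * s = t := by
      simp only [s]
      push_cast
      field_simp
    have h1 := hsub s (n + 1)
    rw [hts] at h1
    refine h1.trans ?_
    have e3 : (fun ω => φ (τ (s • e) ω) - φ ω) =
        s • ((fun ω => (φ (τ (s • e) ω) - φ ω) / s - ψ ω i) + fun ω => ψ ω i) := by
      funext ω
      simp only [Pi.smul_apply, Pi.add_apply, smul_eq_mul]
      field_simp
      ring
    rw [e3, eLpNorm_const_smul, ← mul_assoc]
    have e4 : ((n + 1 : ℕ) : ℝ≥0∞) * ‖s‖ₑ = ‖t‖ₑ := by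
      rw [← hts, enorm_mul]
      congr 1
      rw [Real.enorm_natCast]
    rw [e4]
    gcongr
    exact eLpNorm_add_le (((hm _).mul_const s⁻¹).sub hψm) hψm hp1
  have hlim : Tendsto (fun n : ℕ => t / ((n : ℝ) + 1)) atTop (𝓝[≠] 0) := by
    refine tendsto_nhdsWithin_of_tendsto_nhds_of_eventually_within _ ?_
      (Eventually.of_forall fun n => div_ne_zero ht (by positivity))
    exact tendsto_const_nhds.div_atTop
      (tendsto_atTop_add_const_right _ _ tendsto_natCast_atTop_atTop)
  have h2 := (((h.tendsto i).comp hlim).add_const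
    (eLpNorm (fun ω => ψ ω i) (ENNReal.ofReal p) P))
  have h3 := ENNReal.Tendsto.const_mul (a := ‖t‖ₑ) h2 (Or.inr (by simp))
  rw [zero_add] at h3
  exact ge_of_tendsto' h3 hkey

/-- A stationary field with stochastic gradient is Lipschitz along the shifts. -/
theorem eLpNorm_sub_le (hp : 1 ≤ p) (hτ : IsStationary P τ) (h : IsStochGrad p P τ φ ψ)
    (x : Sp d) :
    eLpNorm (fun ω => φ (τ x ω) - φ ω) (ENNReal.ofReal p) P ≤
      (d * ‖x‖ₑ) * eLpNorm ψ (ENNReal.ofReal p) P := by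
  have hp1 : 1 ≤ ENNReal.ofReal p := by simpa using hp
  have hm : ∀ x, AEStronglyMeasurable (fun ω => φ (τ x ω) - φ ω) P := fun x =>
    (memLp_shift hτ h.memLp _).1.sub h.memLp.1
  -- The displacement is made along one coordinate at a time; the factor `d` counts the directions,
  -- each contributing at most `|x|` times the norm of `ψ`.
  have hs : ∀ s : Finset (Fin d), eLpNorm (fun ω => φ (τ (∑ i ∈ s, x i •
      EuclideanSpace.single i (1 : ℝ)) ω) - φ ω) (ENNReal.ofReal p) P ≤
      ∑ i ∈ s, ‖x‖ₑ * eLpNorm ψ (ENNReal.ofReal p) P := fun s => by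
    induction s using Finset.induction_on with
    | empty => simp [hτ.map_zero]
    | insert a s ha ih =>
      rw [Finset.sum_insert ha, Finset.sum_insert ha]
      set y := ∑ i ∈ s, x i • EuclideanSpace.single i (1 : ℝ)
      set b := x a • EuclideanSpace.single a (1 : ℝ)
      have e1 : (fun ω => φ (τ (b + y) ω) - φ ω) =
          (fun ω => φ (τ b (τ y ω)) - φ (τ y ω)) + fun ω => φ (τ y ω) - φ ω := by
        funext ω
        simp [hτ.map_add]
      rw [e1]
      refine (eLpNorm_add_le ((hm b).comp_measurePreserving (hτ.preserving y)) (hm _) hp1).trans ?_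
      have e2 := eLpNorm_shift hτ (p := ENNReal.ofReal p) (hm b) y
      refine add_le_add (e2.le.trans ((h.eLpNorm_sub_single_le hp hτ a (x a)).trans ?_)) ih
      refine mul_le_mul' ?_ (eLpNorm_mono fun ω => PiLp.norm_apply_le _ _)
      exact enorm_le_iff_norm_le.2 (PiLp.norm_apply_le _ _)
  have h1 := hs Finset.univ
  have h2 : ∑ i, x i • EuclideanSpace.single i (1 : ℝ) = x := by
    ext j
    simp [Finset.sum_apply, Pi.single_apply]
  rw [h2] at h1
  simpa [mul_assoc] using h1

/-- Difference quotients have mean zero because shifts preserve `P`, and `L^p` convergence implies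
convergence of means. -/
theorem integral_eq_zero (hp : 1 ≤ p) (hτ : IsStationary P τ) (h : IsStochGrad p P τ φ ψ) :
    ∫ ω, ψ ω ∂P = 0 := by
  have := hτ.prob
  have hp1 : 1 ≤ ENNReal.ofReal p := by simpa using hp
  have hψi : Integrable ψ P := h.memLp_grad.integrable hp1
  ext i
  have hψm : Integrable (fun ω => ψ ω i) P := (EuclideanSpace.proj (𝕜 := ℝ) i).integrable_comp hψi
  have e1 : (∫ ω, ψ ω ∂P) i = ∫ ω, ψ ω i ∂P :=
    ((EuclideanSpace.proj (𝕜 := ℝ) i).integral_comp_comm hψi).symm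
  rw [e1]
  set e : Sp d := EuclideanSpace.single i (1 : ℝ)
  have hφi := h.memLp.integrable hp1
  have hsi : ∀ x, Integrable (fun ω => φ (τ x ω)) P := fun x =>
    (memLp_shift hτ h.memLp x).integrable hp1
  have hq : ∀ t : ℝ, ∫ ω, (φ (τ (t • e) ω) - φ ω) / t ∂P = 0 := fun t => by
    rw [integral_div, integral_sub (hsi _) hφi, integral_shift hτ hφi.1, sub_self, zero_div]
  have hle : ∀ t : ℝ, ‖∫ ω, ψ ω i ∂P‖ₑ ≤ eLpNorm (fun ω => (φ (τ (t • e) ω) - φ ω) / t - ψ ω i)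
      (ENNReal.ofReal p) P := fun t => by
    have hqi : Integrable (fun ω => (φ (τ (t • e) ω) - φ ω) / t) P := ((hsi _).sub hφi).div_const t
    have e2 : ‖∫ ω, ψ ω i ∂P‖ₑ = ‖∫ ω, ((φ (τ (t • e) ω) - φ ω) / t - ψ ω i) ∂P‖ₑ := by
      rw [integral_sub hqi hψm, hq, zero_sub, enorm_neg]
    rw [e2]
    refine (enorm_integral_le_lintegral_enorm _).trans ?_
    rw [← eLpNorm_one_eq_lintegral_enorm]
    exact eLpNorm_le_eLpNorm_of_exponent_le hp1 (hqi.1.sub hψm.1)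
  have h0 := ge_of_tendsto' (h.tendsto i) hle
  simpa using h0

end IsStochGrad

theorem IsPot.integral_eq_zero {p : ℝ} (hp : 1 ≤ p) (hτ : IsStationary P τ) {χ : Ω → Sp d}
    (h : IsPot p P τ χ) : ∫ ω, χ ω ∂P = 0 := by
  have := hτ.prob
  have hp1 : 1 ≤ ENNReal.ofReal p := by simpa using hp
  have hle : ∀ r : ℝ≥0∞, 0 < r → ‖∫ ω, χ ω ∂P‖ₑ ≤ r := fun r hr => by
    obtain ⟨φ, ψ, hφ, hlt⟩ := h.approx r hr
    have e2 : ∫ ω, χ ω ∂P = ∫ ω, (χ ω - ψ ω) ∂P := by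
      rw [integral_sub (h.memLp.integrable hp1) (hφ.memLp_grad.integrable hp1),
        hφ.integral_eq_zero hp hτ, sub_zero]
    rw [e2]
    refine (enorm_integral_le_lintegral_enorm _).trans (le_trans ?_ hlt.le)
    rw [← eLpNorm_one_eq_lintegral_enorm]
    exact eLpNorm_le_eLpNorm_of_exponent_le hp1 (h.memLp.1.sub hφ.memLp_grad.1)
  have h0 : ‖∫ ω, χ ω ∂P‖ₑ ≤ 0 := le_of_forall_gt_imp_ge_of_dense fun r hr => hle r hr
  simpa using h0

/-- Functions invariant up to null sets under every shift are constant. -/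
theorem exists_const_of_invariant (hτ : IsStationary P τ) (herg : IsErgodic P τ) {f : Ω → ℝ}
    (hf : AEMeasurable f P) (hinv : ∀ x, ∀ᵐ ω ∂P, f (τ x ω) = f ω) : ∃ c, f =ᵐ[P] fun _ => c := by
  have := hτ.prob
  have := hτ.complete
  have h01 : ∀ A, MeasurableSet A → (∀ x, ∀ᵐ ω ∂P, τ x ω ∈ A ↔ ω ∈ A) → P A = 0 ∨ P A = 1 := by
    intro A hA hAi
    -- Ergodicity speaks of strictly invariant sets only. This set is strictly invariant by
    -- translation invariance of Lebesgue measure, agrees with `A` almost surely by Fubini, and is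
    -- measurable because `P` is complete.
    let A' : Set Ω := {ω | ∀ᵐ x : Sp d, τ x ω ∈ A}
    have hn : NullMeasurableSet {z : Ω × Sp d | ¬ (τ z.2 z.1 ∈ A ↔ z.1 ∈ A)} (P.prod volume) := by
      have h1 := hτ.jointly A hA
      have h2 : NullMeasurableSet {z : Ω × Sp d | z.1 ∈ A} (P.prod volume) :=
        (measurable_fst hA).nullMeasurableSet
      convert (h1.symmDiff h2) using 1
      ext z
      simp only [Set.mem_ofPred_eq, Set.mem_symmDiff]
      tauto
    have h0 := measure_prod_eq_zero_of_sections hn (ae_of_all _ fun x => by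
      simpa using hAi x)
    have h3 : ∀ᵐ ω ∂P, ∀ᵐ x : Sp d, τ x ω ∈ A ↔ ω ∈ A := by
      have h4 : ∀ᵐ z : Ω × Sp d ∂(P.prod volume), τ z.2 z.1 ∈ A ↔ z.1 ∈ A := h0
      exact Measure.ae_ae_of_ae_prod h4
    have hAA : A' =ᵐ[P] A := by
      filter_upwards [h3] with ω hω
      refine propext ⟨fun h => ?_, fun h => ?_⟩
      · obtain ⟨x, hx1, hx2⟩ := (hω.and h).exists
        exact hx1.1 hx2
      · filter_upwards [hω] with x hx
        exact hx.2 h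
    have hA' : MeasurableSet A' := (hA.nullMeasurableSet.congr hAA.symm).measurable_of_complete
    have hmem : ∀ y ω, ω ∈ A' → τ y ω ∈ A' := fun y ω hω => by
      have h5 : ∀ᵐ x : Sp d, τ (x + y) ω ∈ A :=
        (measurePreserving_add_right volume y).quasiMeasurePreserving.ae hω
      filter_upwards [h5] with x hx
      rwa [← hτ.map_add]
    rw [← measure_congr hAA]
    refine herg A' hA' fun x => ?_
    ext ω
    constructor
    · rintro ⟨ω', h', rfl⟩
      exact hmem x ω' h'
    · intro h
      exact ⟨τ (-x) ω, hmem _ _ h, by rw [← hτ.map_add]; simp [hτ.map_zero]⟩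
  set g := hf.mk f
  have hg : Measurable g := hf.measurable_mk
  have hfg : f =ᵐ[P] g := hf.ae_eq_mk
  obtain ⟨c, hc⟩ := exists_eventuallyEq_const_of_forall_separating (l := ae P) (f := g)
    MeasurableSet (fun U hU => by
    have h1 := h01 (g ⁻¹' U) (hg hU) fun x => by
      filter_upwards [hinv x, hfg, (hτ.preserving x).quasiMeasurePreserving.ae hfg] with ω h1 h2 h3
      simp only [Set.mem_preimage]
      rw [← h3, h1, h2]
    rcases h1 with h1 | h1
    · right
      exact measure_eq_zero_iff_ae_notMem.1 h1
    · left
      have := (prob_compl_eq_zero_iff (hg hU)).2 h1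
      exact this)
  exact ⟨c, hfg.trans hc⟩

end Stationary

/-! ### Test functions -/

/-- Smooth compactly supported functions on `ℝ^d`. -/
def IsTest {d : ℕ} (ζ : Sp d → ℝ) : Prop :=
  ContDiff ℝ ((⊤ : ℕ∞) : WithTop ℕ∞) ζ ∧ HasCompactSupport ζ

theorem gradient_apply {d : ℕ} (ζ : Sp d → ℝ) (x : Sp d) (i : Fin d) :
    gradient ζ x i = fderiv ℝ ζ x (EuclideanSpace.single i 1) := by
  rw [← inner_gradient_left, EuclideanSpace.inner_single_right]
  simp

namespace IsTest

variable {d : ℕ} {ζ : Sp d → ℝ}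

theorem continuous (h : IsTest ζ) : Continuous ζ := h.1.continuous

theorem differentiable (h : IsTest ζ) : Differentiable ℝ ζ := h.1.differentiable (by simp)

theorem continuous_gradient (h : IsTest ζ) : Continuous (gradient ζ) :=
  (InnerProductSpace.toDual ℝ (Sp d)).symm.continuous.comp (h.1.continuous_fderiv (by simp))

theorem hasCompactSupport_gradient (h : IsTest ζ) : HasCompactSupport (gradient ζ) :=
  (h.2.fderiv (𝕜 := ℝ)).comp_left (g := (InnerProductSpace.toDual ℝ (Sp d)).symm) (map_zero _)

theorem continuous_gradient_apply (h : IsTest ζ) (i : Fin d) :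
    Continuous fun x => gradient ζ x i :=
  (EuclideanSpace.proj (𝕜 := ℝ) i).continuous.comp h.continuous_gradient

theorem hasCompactSupport_gradient_apply (h : IsTest ζ) (i : Fin d) :
    HasCompactSupport fun x => gradient ζ x i :=
  h.hasCompactSupport_gradient.comp_left (g := fun v : Sp d => v i) rfl

theorem exists_lipschitz (h : IsTest ζ) : ∃ L : NNReal, LipschitzWith L ζ :=
  ContDiff.lipschitzWith_of_hasCompactSupport h.2 h.1 (by simp)

theorem lintegral_enorm_lt_top {g : Sp d → ℝ} (hc : Continuous g) (hs : HasCompactSupport g) :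
    ∫⁻ x, ‖g x‖ₑ < ∞ :=
  (hc.integrable_of_hasCompactSupport hs).2

/-- Difference quotients of test functions converge in `L^1`. -/
theorem tendsto_diffQuot (h : IsTest ζ) (a : ℝ) (i : Fin d) :
    Tendsto (fun t : ℝ => ∫⁻ x, ‖(ζ (x + (a * t) • EuclideanSpace.single i (1 : ℝ)) - ζ x) / t -
      a * gradient ζ x i‖ₑ) (𝓝[≠] 0) (𝓝 0) := by
  set e : Sp d := EuclideanSpace.single i (1 : ℝ)
  have he : ‖e‖ = 1 := by simp [e]
  obtain ⟨L, hL⟩ := h.exists_lipschitz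
  obtain ⟨R, hR⟩ := h.2.isCompact.isBounded.subset_closedBall 0
  -- For `|t| < 1` the translation has length at most `|a|`, so all difference quotients are
  -- supported in this ball and bounded through the Lipschitz constant.
  let K : Set (Sp d) := Metric.closedBall 0 (R + |a|)
  have hsupp : ∀ x, x ∉ Metric.closedBall (0 : Sp d) R → ζ x = 0 := fun x hx =>
    image_eq_zero_of_notMem_tsupport fun h' => hx (hR h')
  have hgrad : ∀ x, |gradient ζ x i| ≤ L := fun x => by
    rw [gradient_apply, ← Real.norm_eq_abs]
    refine (ContinuousLinearMap.le_opNorm _ _).trans ?_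
    rw [he, mul_one]
    exact norm_fderiv_le_of_lipschitz ℝ hL
  have hgsupp : ∀ x, x ∉ Metric.closedBall (0 : Sp d) R → gradient ζ x i = 0 := fun x hx => by
    rw [gradient_apply]
    have : fderiv ℝ ζ x = 0 := by
      by_contra hne
      exact hx (hR (support_fderiv_subset ℝ hne))
    rw [this]
    rfl
  have key := tendsto_lintegral_filter_of_dominated_convergence (μ := (volume : Measure (Sp d)))
    (l := 𝓝[≠] (0 : ℝ))
    (F := fun (t : ℝ) x => ‖(ζ (x + (a * t) • e) - ζ x) / t - a * gradient ζ x i‖ₑ)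
    (f := fun _ => 0) (K.indicator fun _ => ENNReal.ofReal (2 * (|a| * L))) ?_ ?_ ?_ ?_
  · simpa using key
  · refine Eventually.of_forall fun t => ?_
    have h1 := h.continuous
    have h2 := h.continuous_gradient_apply i
    have hs : Continuous fun x : Sp d => x + (a * t) • e := continuous_id.add continuous_const
    exact (((((h1.comp hs).sub h1).div_const t).sub (continuous_const.mul h2)).enorm).measurable
  · have h1 : ∀ᶠ t : ℝ in 𝓝[≠] 0, |t| < 1 ∧ t ≠ 0 := by
      refine (eventually_nhdsWithin_of_eventually_nhds ?_).and self_mem_nhdsWithin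
      have := (continuous_abs (G := ℝ)).tendsto 0
      rw [abs_zero] at this
      exact this.eventually_lt_const one_pos
    filter_upwards [h1] with t ht
    refine ae_of_all _ fun x => ?_
    by_cases hx : x ∈ K
    · rw [Set.indicator_of_mem hx, ← ofReal_norm]
      refine ENNReal.ofReal_le_ofReal ?_
      refine (norm_sub_le _ _).trans ?_
      have h2 : ‖(ζ (x + (a * t) • e) - ζ x) / t‖ ≤ |a| * L := by
        rw [norm_div, div_le_iff₀ (norm_pos_iff.2 ht.2)]
        have := hL.norm_sub_le (x + (a * t) • e) x
        rw [add_sub_cancel_left, norm_smul, he, mul_one, norm_mul] at this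
        simp only [Real.norm_eq_abs] at this ⊢
        linarith
      have h3 : ‖a * gradient ζ x i‖ ≤ |a| * L := by
        rw [norm_mul]
        exact mul_le_mul_of_nonneg_left (hgrad x) (abs_nonneg _)
      linarith
    · have h4 : R + |a| < ‖x‖ := by simpa [K] using hx
      have h5 : x ∉ Metric.closedBall (0 : Sp d) R := by
        simp only [mem_closedBall_zero_iff, not_le]
        linarith [abs_nonneg a]
      have h6 : x + (a * t) • e ∉ Metric.closedBall (0 : Sp d) R := by
        simp only [mem_closedBall_zero_iff, not_le]
        have h7 : ‖(a * t) • e‖ ≤ |a| := by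
          rw [norm_smul, he, mul_one, norm_mul]
          exact mul_le_of_le_one_right (abs_nonneg _) ht.1.le
        have h8 := norm_sub_le (x + (a * t) • e) ((a * t) • e)
        rw [add_sub_cancel_right] at h8
        linarith
      rw [hsupp _ h5, hsupp _ h6, hgsupp _ h5]
      simp
  · rw [lintegral_indicator Metric.isClosed_closedBall.measurableSet, setLIntegral_const]
    exact ENNReal.mul_ne_top ENNReal.ofReal_ne_top
      (isCompact_closedBall _ _).measure_lt_top.ne
  · refine ae_of_all _ fun x => ?_
    have h1 : HasLineDerivAt ℝ ζ (fderiv ℝ ζ x (a • e)) x (a • e) :=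
      (h.differentiable x).hasFDerivAt.hasLineDerivAt _
    have h2 := h1.tendsto_slope_zero.sub_const (fderiv ℝ ζ x (a • e))
    rw [sub_self] at h2
    have h3 := h2.enorm
    simp only [enorm_zero] at h3
    refine h3.congr fun t => ?_
    congr 1
    rw [map_smul, gradient_apply, smul_eq_mul, smul_eq_mul, smul_smul, mul_comm t a]
    ring

end IsTest

/-! ### Mollification along the orbits -/

section Mollification

variable {Ω : Type*} [MeasurableSpace Ω] {d : ℕ} {P : Measure Ω} {τ : Sp d → Ω → Ω}
  {F : Type*} [NormedAddCommGroup F] [NormedSpace ℝ F]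

/-- The average of `φ` along orbits with weight `ζ`. -/
noncomputable def moll (τ : Sp d → Ω → Ω) (c : ℝ) (ζ : Sp d → ℝ) (φ : Ω → F) (ω : Ω) : F :=
  ∫ x, ζ x • φ (τ (-(c • x)) ω)

omit [NormedSpace ℝ F] in
theorem aestronglyMeasurable_orbit [SecondCountableTopology F] (hτ : IsStationary P τ) {c : ℝ}
    (hc : c ≠ 0) {φ : Ω → F} (hφ : AEStronglyMeasurable φ P) {ν : Measure (Sp d)} [SigmaFinite ν]
    (hν : ν ≪ volume) :
    AEStronglyMeasurable (fun z : Ω × Sp d => φ (τ (c • z.2) z.1)) (P.prod ν) := by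
  have := hτ.prob
  exact (skew_nullPreserving hτ hc hν).aestronglyMeasurable hφ.comp_fst

omit [NormedSpace ℝ F] in
theorem aestronglyMeasurable_orbit_neg [SecondCountableTopology F] (hτ : IsStationary P τ) {c : ℝ}
    (hc : c ≠ 0) {φ : Ω → F} (hφ : AEStronglyMeasurable φ P) {ν : Measure (Sp d)} [SigmaFinite ν]
    (hν : ν ≪ volume) :
    AEStronglyMeasurable (fun z : Ω × Sp d => φ (τ (-(c • z.2)) z.1)) (P.prod ν) := by
  have := aestronglyMeasurable_orbit hτ (neg_ne_zero.2 hc) hφ hν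
  simpa only [neg_smul] using this

/-- Minkowski's inequality, all shifts of `φ` having the same norm. The bound by the `L^1` norm of
the weight turns `L^1` convergence of weights into `L^p` convergence of averages. -/
theorem eLpNorm_moll_le [SecondCountableTopology F] (hτ : IsStationary P τ) {c : ℝ} (hc : c ≠ 0)
    {p : ℝ} (hp : 1 < p) {ζ : Sp d → ℝ} (hζ : Continuous ζ) {φ : Ω → F}
    (hφ : AEStronglyMeasurable φ P) :
    eLpNorm (moll τ c ζ φ) (ENNReal.ofReal p) P ≤
      (∫⁻ x, ‖ζ x‖ₑ) * eLpNorm φ (ENNReal.ofReal p) P := by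
  have := hτ.prob
  have hm := aestronglyMeasurable_orbit_neg hτ hc hφ
    (Measure.AbsolutelyContinuous.rfl (μ := (volume : Measure (Sp d))))
  have hM : ∀ᵐ x : Sp d, eLpNorm (fun ω => φ (τ (-(c • x)) ω)) (ENNReal.ofReal p) P ≤
      eLpNorm φ (ENNReal.ofReal p) P := ae_of_all _ fun x => (eLpNorm_shift hτ hφ (-(c • x))).le
  exact eLpNorm_integral_smul_le (f := fun z : Ω × Sp d => φ (τ (-(c • z.2)) z.1)) hp hm
    hζ.aestronglyMeasurable hM

theorem aestronglyMeasurable_moll [SecondCountableTopology F] (hτ : IsStationary P τ) {c : ℝ}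
    (hc : c ≠ 0) {ζ : Sp d → ℝ} (hζ : Continuous ζ) {φ : Ω → F}
    (hφ : AEStronglyMeasurable φ P) : AEStronglyMeasurable (moll τ c ζ φ) P := by
  have := hτ.prob
  exact aestronglyMeasurable_integral_smul
    (aestronglyMeasurable_orbit_neg hτ hc hφ Measure.AbsolutelyContinuous.rfl)
    hζ.aestronglyMeasurable

theorem memLp_moll [SecondCountableTopology F] (hτ : IsStationary P τ) {c : ℝ} (hc : c ≠ 0)
    {p : ℝ} (hp : 1 < p) {ζ : Sp d → ℝ} (hζ : Continuous ζ) (hζs : HasCompactSupport ζ) {φ : Ω → F}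
    (hφ : MemLp φ (ENNReal.ofReal p) P) : MemLp (moll τ c ζ φ) (ENNReal.ofReal p) P :=
  ⟨aestronglyMeasurable_moll hτ hc hζ hφ.1, (eLpNorm_moll_le hτ hc hp hζ hφ.1).trans_lt
    (ENNReal.mul_lt_top (IsTest.lintegral_enorm_lt_top hζ hζs) hφ.2)⟩

theorem integrable_moll [SecondCountableTopology F] (hτ : IsStationary P τ) {c : ℝ} (hc : c ≠ 0)
    {ζ : Sp d → ℝ} (hζ : Continuous ζ) (hζs : HasCompactSupport ζ) {φ : Ω → F}
    (hφ : Integrable φ P) : ∀ᵐ ω ∂P, Integrable fun x => ζ x • φ (τ (-(c • x)) ω) := by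
  have := hτ.prob
  have hm := aestronglyMeasurable_orbit_neg hτ hc hφ.1
    (Measure.AbsolutelyContinuous.rfl (μ := (volume : Measure (Sp d))))
  have hm2 : AEStronglyMeasurable (fun z : Ω × Sp d => ζ z.2 • φ (τ (-(c • z.2)) z.1))
      (P.prod volume) := hζ.aestronglyMeasurable.comp_snd.smul hm
  have h1 : Integrable (fun z : Ω × Sp d => ζ z.2 • φ (τ (-(c • z.2)) z.1)) (P.prod volume) := by
    refine ⟨hm2, ?_⟩
    rw [HasFiniteIntegral, lintegral_prod_symm _ hm2.enorm]
    have h2 : ∀ x : Sp d, ∫⁻ ω, ‖ζ x • φ (τ (-(c • x)) ω)‖ₑ ∂P = ‖ζ x‖ₑ * eLpNorm φ 1 P :=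
      fun x => by
        rw [← eLpNorm_shift hτ hφ.1 (-(c • x)), ← eLpNorm_const_smul,
          eLpNorm_one_eq_lintegral_enorm]
        rfl
    simp only [h2]
    rw [lintegral_mul_const'' _ hζ.enorm.aemeasurable]
    exact ENNReal.mul_lt_top (IsTest.lintegral_enorm_lt_top hζ hζs)
      (memLp_one_iff_integrable.2 hφ).2
  exact h1.prod_right_ae

/-- A translation of the integration variable moves the shift from the function to the smooth
weight. -/
theorem moll_shift (hτ : IsStationary P τ) {c : ℝ} (hc : c ≠ 0) (ζ : Sp d → ℝ) (φ : Ω → F)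
    (h : Sp d) (ω : Ω) :
    moll τ c ζ φ (τ h ω) = moll τ c (fun x => ζ (x + c⁻¹ • h)) φ ω := by
  have h1 := integral_add_right_eq_self (μ := (volume : Measure (Sp d)))
    (fun x => ζ x • φ (τ (-(c • x) + h) ω)) (c⁻¹ • h)
  simp only [moll, ← hτ.map_add]
  rw [← h1]
  refine integral_congr_ae (ae_of_all _ fun x => ?_)
  simp only [smul_add, smul_smul, mul_inv_cancel₀ hc, one_smul, neg_add_rev]
  congr 3
  abel

/-- The stochastic gradient of a mollification. -/
noncomputable def mollGrad (τ : Sp d → Ω → Ω) (c : ℝ) (ζ : Sp d → ℝ) (φ : Ω → ℝ) (ω : Ω) : Sp d :=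
  WithLp.toLp 2 fun i => c⁻¹ * moll τ c (fun x => gradient ζ x i) φ ω

/-- By `moll_shift` the difference quotient of the average is the average with the difference
quotient of `ζ` as weight, which converges in `L^1` with step rescaled by `c⁻¹`. -/
theorem isStochGrad_moll (hτ : IsStationary P τ) {c : ℝ} (hc : c ≠ 0) {p : ℝ} (hp : 1 < p)
    {ζ : Sp d → ℝ} (hζ : IsTest ζ) {φ : Ω → ℝ} (hφ : MemLp φ (ENNReal.ofReal p) P) :
    IsStochGrad p P τ (moll τ c ζ φ) (mollGrad τ c ζ φ) where
  memLp := memLp_moll hτ hc hp hζ.continuous hζ.2 hφ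
  memLp_grad := MemLp.of_eval_piLp fun i => by
    refine (memLp_moll hτ hc hp (hζ.continuous_gradient_apply i)
      (hζ.hasCompactSupport_gradient_apply i) hφ).const_mul c⁻¹
  tendsto i := by
    have := hτ.prob
    have hφi : Integrable φ P := hφ.integrable (by simpa using hp.le)
    have h0 := ENNReal.Tendsto.mul_const (b := eLpNorm φ (ENNReal.ofReal p) P)
      (hζ.tendsto_diffQuot c⁻¹ i) (Or.inr hφ.2.ne)
    rw [zero_mul] at h0
    refine tendsto_of_tendsto_of_tendsto_of_le_of_le tendsto_const_nhds h0 (fun _ => zero_le)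
      fun t => ?_
    set e : Sp d := EuclideanSpace.single i (1 : ℝ)
    have hs : Continuous fun x : Sp d => x + (c⁻¹ * t) • e := by fun_prop
    have hζ1 : Continuous fun x => ζ (x + (c⁻¹ * t) • e) := hζ.continuous.comp hs
    have hζ1s : HasCompactSupport fun x => ζ (x + (c⁻¹ * t) • e) :=
      hζ.2.comp_homeomorph (Homeomorph.addRight ((c⁻¹ * t) • e))
    have hw : Continuous fun x => (ζ (x + (c⁻¹ * t) • e) - ζ x) / t - c⁻¹ * gradient ζ x i := by
      exact ((hζ1.sub hζ.continuous).div_const t).sub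
        (continuous_const.mul (hζ.continuous_gradient_apply i))
    refine le_trans (le_of_eq ?_) (eLpNorm_moll_le hτ hc hp hw hφ.1)
    refine eLpNorm_congr_ae ?_
    filter_upwards [integrable_moll hτ hc hζ1 hζ1s hφi,
      integrable_moll hτ hc hζ.continuous hζ.2 hφi,
      integrable_moll hτ hc (hζ.continuous_gradient_apply i)
        (hζ.hasCompactSupport_gradient_apply i) hφi] with ω h1 h2 h3
    rw [moll_shift hτ hc, smul_smul]
    simp only [moll, mollGrad]
    have e3 := integral_sub ((h1.sub h2).div_const t) (h3.const_mul c⁻¹)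
    simp only [Pi.sub_apply] at e3
    rw [← integral_sub h1 h2, ← integral_div, ← integral_const_mul]
    simp only [smul_eq_mul] at e3 ⊢
    rw [← e3]
    refine integral_congr_ae (ae_of_all _ fun x => ?_)
    ring

/-- Averaging commutes with shifts, hence with difference quotients. With `D t` and `D' t` the
errors of the quotients of `φ` and of its average, the average of `D t` minus `D' t` does not depend
on `t` and equals the difference of the two sides; both errors tend to zero. -/
theorem mollGrad_ae_eq (hτ : IsStationary P τ) {c : ℝ} (hc : c ≠ 0) {p : ℝ} (hp : 1 < p)
    {ζ : Sp d → ℝ} (hζ : IsTest ζ) {φ : Ω → ℝ} {ψ : Ω → Sp d} (h : IsStochGrad p P τ φ ψ) :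
    mollGrad τ c ζ φ =ᵐ[P] moll τ c ζ ψ := by
  have := hτ.prob
  have hp1 : 1 ≤ ENNReal.ofReal p := by simpa using hp.le
  have hφi : Integrable φ P := h.memLp.integrable hp1
  have hψi : Integrable ψ P := h.memLp_grad.integrable hp1
  have hG := isStochGrad_moll hτ hc hp hζ h.memLp
  have hi : ∀ i, ∀ᵐ ω ∂P, mollGrad τ c ζ φ ω i = moll τ c ζ (fun ω => ψ ω i) ω := fun i => by
    have hψm : MemLp (fun ω => ψ ω i) (ENNReal.ofReal p) P := memLp_piLp_iff.1 h.memLp_grad i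
    have hψii : Integrable (fun ω => ψ ω i) P := hψm.integrable hp1
    set e : Sp d := EuclideanSpace.single i (1 : ℝ)
    set D : ℝ → Ω → ℝ := fun t ω => (φ (τ (t • e) ω) - φ ω) / t - ψ ω i
    set D' : ℝ → Ω → ℝ := fun t ω =>
      (moll τ c ζ φ (τ (t • e) ω) - moll τ c ζ φ ω) / t - mollGrad τ c ζ φ ω i
    have hsm : ∀ x, MemLp (fun ω => φ (τ x ω)) (ENNReal.ofReal p) P := memLp_shift hτ h.memLp
    have hDm : ∀ t, MemLp (D t) (ENNReal.ofReal p) P := fun t =>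
      (((hsm _).sub h.memLp).mul_const t⁻¹).sub hψm
    have hMm := hG.memLp
    have hD'm : ∀ t, MemLp (D' t) (ENNReal.ofReal p) P := fun t =>
      (((memLp_shift hτ hMm _).sub hMm).mul_const t⁻¹).sub (memLp_piLp_iff.1 hG.memLp_grad i)
    have hdec : ∀ t, ∀ᵐ ω ∂P, moll τ c ζ (D t) ω - D' t ω =
        mollGrad τ c ζ φ ω i - moll τ c ζ (fun ω => ψ ω i) ω := fun t => by
      filter_upwards [integrable_moll hτ hc hζ.continuous hζ.2 hφi,
        integrable_moll hτ hc hζ.continuous hζ.2 ((hsm (t • e)).integrable hp1),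
        integrable_moll hτ hc hζ.continuous hζ.2 hψii] with ω h1 h2 h3
      have e1 : moll τ c ζ φ (τ (t • e) ω) = moll τ c ζ (fun ω => φ (τ (t • e) ω)) ω := by
        simp only [moll, ← hτ.map_add, add_comm]
      simp only [D', e1]
      simp only [moll, D]
      have e2 : ∀ x : Sp d, ζ x • ((φ (τ (t • e) (τ (-(c • x)) ω)) - φ (τ (-(c • x)) ω)) / t -
          ψ (τ (-(c • x)) ω) i) = (ζ x • φ (τ (t • e) (τ (-(c • x)) ω)) -
            ζ x • φ (τ (-(c • x)) ω)) / t - ζ x • ψ (τ (-(c • x)) ω) i := fun x => by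
        simp only [smul_eq_mul]
        ring
      simp only [e2]
      have e3 := integral_sub ((h2.sub h1).div_const t) h3
      simp only [Pi.sub_apply] at e3
      rw [e3, integral_div, integral_sub h2 h1]
      ring
    have hle : ∀ t, eLpNorm (fun ω => mollGrad τ c ζ φ ω i - moll τ c ζ (fun ω => ψ ω i) ω)
        (ENNReal.ofReal p) P ≤ (∫⁻ x, ‖ζ x‖ₑ) * eLpNorm (D t) (ENNReal.ofReal p) P +
          eLpNorm (D' t) (ENNReal.ofReal p) P := fun t => by
      rw [← eLpNorm_congr_ae (hdec t)]
      refine (eLpNorm_sub_le (aestronglyMeasurable_moll hτ hc hζ.continuous (hDm t).1)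
        (hD'm t).1 hp1).trans ?_
      gcongr
      exact eLpNorm_moll_le hτ hc hp hζ.continuous (hDm t).1
    have hlim := (ENNReal.Tendsto.const_mul (a := ∫⁻ x, ‖ζ x‖ₑ) (h.tendsto i)
      (Or.inr (IsTest.lintegral_enorm_lt_top hζ.continuous hζ.2).ne)).add (hG.tendsto i)
    rw [mul_zero, add_zero] at hlim
    have h0 := ge_of_tendsto' hlim hle
    have hm0 : AEStronglyMeasurable (fun ω => mollGrad τ c ζ φ ω i -
        moll τ c ζ (fun ω => ψ ω i) ω) P :=
      (memLp_piLp_iff.1 hG.memLp_grad i).1.sub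
        (aestronglyMeasurable_moll hτ hc hζ.continuous hψm.1)
    rw [nonpos_iff_eq_zero, eLpNorm_eq_zero_iff hm0 (by simpa using (by linarith : 0 < p))] at h0
    filter_upwards [h0] with ω hω
    simpa [sub_eq_zero] using hω
  filter_upwards [ae_all_iff.2 hi, integrable_moll hτ hc hζ.continuous hζ.2 hψi] with ω h1 h2
  ext i
  rw [h1 i]
  exact ((EuclideanSpace.proj (𝕜 := ℝ) i).integral_comp_comm h2)

end Mollification

/-! ### Closures in `L^p` -/

section Closure

variable {α : Type*} [MeasurableSpace α] {μ : Measure α} {F : Type*} [NormedAddCommGroup F]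
  {p : ℝ}

/-- The functions in `L^p` that are limits in `L^p` of members of `S`. -/
def LpClosure (p : ℝ) (μ : Measure α) (S : Set (α → F)) : Set (α → F) :=
  {f | MemLp f (ENNReal.ofReal p) μ ∧ ∀ r : ℝ≥0∞, 0 < r → ∃ s ∈ S,
    eLpNorm (fun x => f x - s x) (ENNReal.ofReal p) μ < r}

theorem subset_lpClosure {S : Set (α → F)} (hS : ∀ s ∈ S, MemLp s (ENNReal.ofReal p) μ) :
    S ⊆ LpClosure p μ S := fun s hs => ⟨hS s hs, fun r hr => ⟨s, hs, by simpa using hr⟩⟩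

theorem lpClosure_congr {S : Set (α → F)} {f g : α → F} (hf : f ∈ LpClosure p μ S)
    (h : f =ᵐ[μ] g) : g ∈ LpClosure p μ S := by
  refine ⟨hf.1.ae_eq h, fun r hr => ?_⟩
  obtain ⟨s, hs, hr⟩ := hf.2 r hr
  refine ⟨s, hs, lt_of_le_of_lt (le_of_eq (eLpNorm_congr_ae ?_)) hr⟩
  filter_upwards [h] with x hx
  rw [hx]

theorem eLpNorm_triangle (hp : 1 ≤ p) {f g h : α → F} (hf : AEStronglyMeasurable f μ)
    (hg : AEStronglyMeasurable g μ) (hh : AEStronglyMeasurable h μ) :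
    eLpNorm (fun x => f x - h x) (ENNReal.ofReal p) μ ≤
      eLpNorm (fun x => f x - g x) (ENNReal.ofReal p) μ +
        eLpNorm (fun x => g x - h x) (ENNReal.ofReal p) μ := by
  refine le_trans (le_of_eq ?_) (eLpNorm_add_le (hf.sub hg) (hg.sub hh) (by simpa using hp))
  congr 1
  ext x
  simp

theorem lpClosure_trans (hp : 1 ≤ p) {S T : Set (α → F)}
    (hS : ∀ s ∈ S, MemLp s (ENNReal.ofReal p) μ) (hT : T ⊆ LpClosure p μ S) :
    LpClosure p μ T ⊆ LpClosure p μ S := fun f hf => by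
  refine ⟨hf.1, fun r hr => ?_⟩
  obtain ⟨t, ht, h1⟩ := hf.2 (r / 2) (ENNReal.half_pos hr.ne')
  obtain ⟨s, hs, h2⟩ := (hT ht).2 (r / 2) (ENNReal.half_pos hr.ne')
  refine ⟨s, hs, (eLpNorm_triangle hp hf.1.1 (hT ht).1.1 (hS s hs).1).trans_lt ?_⟩
  calc _ < r / 2 + r / 2 := ENNReal.add_lt_add h1 h2
    _ = r := ENNReal.add_halves r

theorem add_mem_lpClosure [NormedSpace ℝ F] (hp : 1 ≤ p) {S : Submodule ℝ (α → F)}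
    (hS : ∀ s ∈ S, MemLp s (ENNReal.ofReal p) μ) {f g : α → F}
    (hf : f ∈ LpClosure p μ (S : Set (α → F))) (hg : g ∈ LpClosure p μ (S : Set (α → F))) :
    f + g ∈ LpClosure p μ (S : Set (α → F)) := by
  refine ⟨hf.1.add hg.1, fun r hr => ?_⟩
  obtain ⟨s, hs, h1⟩ := hf.2 (r / 2) (ENNReal.half_pos hr.ne')
  obtain ⟨t, ht, h2⟩ := hg.2 (r / 2) (ENNReal.half_pos hr.ne')
  refine ⟨s + t, S.add_mem hs ht, ?_⟩
  have h3 : (fun x => (f + g) x - (s + t) x) = (fun x => f x - s x) + fun x => g x - t x := by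
    ext x
    simp only [Pi.add_apply]
    abel
  rw [h3]
  refine (eLpNorm_add_le (hf.1.1.sub (hS s hs).1) (hg.1.1.sub (hS t ht).1)
    (by simpa using hp)).trans_lt ?_
  calc _ < r / 2 + r / 2 := ENNReal.add_lt_add h1 h2
    _ = r := ENNReal.add_halves r

theorem smul_mem_lpClosure [NormedSpace ℝ F] {S : Submodule ℝ (α → F)} (c : ℝ) {f : α → F}
    (hf : f ∈ LpClosure p μ (S : Set (α → F))) : c • f ∈ LpClosure p μ (S : Set (α → F)) := by
  refine ⟨hf.1.const_smul c, fun r hr => ?_⟩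
  obtain ⟨r', hr', h'⟩ : ∃ r' : ℝ≥0∞, 0 < r' ∧ ‖c‖ₑ * r' ≤ r :=
    ⟨r / (‖c‖ₑ + 1), ENNReal.div_pos hr.ne' (by simp), by
      rw [← mul_div_assoc, mul_comm]
      refine ENNReal.div_le_of_le_mul ?_
      gcongr
      exact le_self_add⟩
  obtain ⟨s, hs, h1⟩ := hf.2 r' hr'
  by_cases hc : c = 0
  · exact ⟨0, S.zero_mem, by simpa [hc] using hr⟩
  refine ⟨c • s, S.smul_mem c hs, ?_⟩
  have h3 : (fun x => (c • f) x - (c • s) x) = c • fun x => f x - s x := by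
    ext x
    simp [smul_sub]
  rw [h3, eLpNorm_const_smul]
  refine lt_of_lt_of_le ?_ h'
  exact (ENNReal.mul_lt_mul_iff_right (by simpa using hc) (by simp)).2 h1

theorem sum_mem_lpClosure [NormedSpace ℝ F] (hp : 1 ≤ p) {S : Submodule ℝ (α → F)}
    (hS : ∀ s ∈ S, MemLp s (ENNReal.ofReal p) μ) {ι : Type*} (t : Finset ι) {f : ι → α → F}
    (hf : ∀ i ∈ t, f i ∈ LpClosure p μ (S : Set (α → F))) :
    ∑ i ∈ t, f i ∈ LpClosure p μ (S : Set (α → F)) := by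
  classical
  induction t using Finset.induction_on with
  | empty => simpa using subset_lpClosure hS S.zero_mem
  | insert i t hi ih =>
    rw [Finset.sum_insert hi]
    exact add_mem_lpClosure hp hS (hf i (Finset.mem_insert_self i t))
      (ih fun j hj => hf j (Finset.mem_insert_of_mem hj))

theorem mem_lpClosure_iff_seq {S : Set (α → F)} {f : α → F} :
    f ∈ LpClosure p μ S ↔ MemLp f (ENNReal.ofReal p) μ ∧ ∃ s : ℕ → α → F, (∀ n, s n ∈ S) ∧
      Tendsto (fun n => eLpNorm (fun x => s n x - f x) (ENNReal.ofReal p) μ) atTop (𝓝 0) := by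
  constructor
  · intro h
    refine ⟨h.1, ?_⟩
    have h1 : ∀ n : ℕ, ∃ s ∈ S, eLpNorm (fun x => f x - s x) (ENNReal.ofReal p) μ <
        (n : ℝ≥0∞)⁻¹ := fun n => h.2 _ (by simp)
    choose s hs hsn using h1
    refine ⟨s, hs, ?_⟩
    refine tendsto_of_tendsto_of_tendsto_of_le_of_le tendsto_const_nhds
      ENNReal.tendsto_inv_nat_nhds_zero (fun _ => zero_le) fun n => ?_
    have h2 := eLpNorm_sub_comm f (s n) (ENNReal.ofReal p) μ
    simp only [Pi.sub_def] at h2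
    exact h2 ▸ (hsn n).le
  · rintro ⟨h, s, hs, hlim⟩
    refine ⟨h, fun r hr => ?_⟩
    obtain ⟨n, hn⟩ := (hlim.eventually_lt_const hr).exists
    have h2 := eLpNorm_sub_comm f (s n) (ENNReal.ofReal p) μ
    simp only [Pi.sub_def] at h2
    exact ⟨s n, hs n, h2 ▸ hn⟩

theorem integral_inner_eq_zero_of_mem_lpClosure {F : Type*} [NormedAddCommGroup F]
    [InnerProductSpace ℝ F] {q : ℝ} (hpq : p.HolderConjugate q) {S : Set (α → F)}
    (hS : ∀ s ∈ S, MemLp s (ENNReal.ofReal p) μ) {ψ : α → F}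
    (hψ : MemLp ψ (ENNReal.ofReal q) μ) (h0 : ∀ s ∈ S, ∫ x, (inner ℝ (s x) (ψ x) : ℝ) ∂μ = 0)
    {f : α → F} (hf : f ∈ LpClosure p μ S) : ∫ x, (inner ℝ (f x) (ψ x) : ℝ) ∂μ = 0 := by
  have := hpq.ennrealOfReal
  obtain ⟨hm, s, hs, hlim⟩ := mem_lpClosure_iff_seq.1 hf
  have h1 := tendsto_integral_inner (fun n => hS _ (hs n)) hm hψ hlim
  simp only [fun n => h0 _ (hs n)] at h1
  exact (tendsto_nhds_unique h1 tendsto_const_nhds)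

/-- The closure of a subspace of `L^p` is cut out by countably many elements of `L^q`. -/
theorem exists_annihilating_seq {F : Type*} [NormedAddCommGroup F] [InnerProductSpace ℝ F]
    [FiniteDimensional ℝ F] [IsFiniteMeasure μ] {q : ℝ} (hpq : p.HolderConjugate q)
    [Fact (1 ≤ ENNReal.ofReal q)] [SecondCountableTopology (Lp F (ENNReal.ofReal q) μ)]
    (S : Submodule ℝ (α → F)) (hS : ∀ s ∈ S, MemLp s (ENNReal.ofReal p) μ) :
    ∃ g : ℕ → α → F, (∀ j, MemLp (g j) (ENNReal.ofReal q) μ) ∧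
      (∀ j, ∀ s ∈ S, ∫ x, (inner ℝ (s x) (g j x) : ℝ) ∂μ = 0) ∧
      ∀ f, MemLp f (ENNReal.ofReal p) μ → (∀ j, ∫ x, (inner ℝ (f x) (g j x) : ℝ) ∂μ = 0) →
        f ∈ LpClosure p μ (S : Set (α → F)) := by
  have := hpq.ennrealOfReal
  -- The annihilator of `S` in `L^q`; by separability it has a dense sequence, and vanishing against
  -- that sequence is vanishing against all of it.
  let N : Set (α → F) := {ψ | MemLp ψ (ENNReal.ofReal q) μ ∧
    ∀ s ∈ S, ∫ x, (inner ℝ (s x) (ψ x) : ℝ) ∂μ = 0}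
  obtain ⟨g, hgN, hg⟩ := exists_dense_seq (ν := μ) (p := ENNReal.ofReal q) (S := N)
    ⟨0, MemLp.zero, fun s _ => by simp⟩ (fun s hs => hs.1)
  refine ⟨g, fun j => (hgN j).1, fun j => (hgN j).2, fun f hf h0 => ⟨hf, fun r hr => ?_⟩⟩
  refine exists_approx_of_dual hpq S.convex hS hf (fun ψ hψ c hc => ?_) hr
  -- A linear functional bounded above on a subspace vanishes there: otherwise a multiple of `s`
  -- takes the value `c + 1`.
  have hψN : ψ ∈ N := by
    refine ⟨hψ, fun s hs => ?_⟩
    by_contra hne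
    set a := ∫ x, (inner ℝ (s x) (ψ x) : ℝ) ∂μ with ha
    have h1 := hc (((c + 1) / a) • s) (S.smul_mem _ hs)
    simp only [Pi.smul_apply, inner_smul_left, conj_trivial, integral_const_mul] at h1
    rw [← ha, div_mul_cancel₀ _ hne] at h1
    linarith
  have hc0 : 0 ≤ c := by simpa using hc 0 S.zero_mem
  refine le_trans (le_of_eq ?_) hc0
  have h1 : ψ ∈ LpClosure q μ (Set.range g) := by
    refine ⟨hψ, fun r hr => ?_⟩
    obtain ⟨j, hj⟩ := hg ψ hψN r hr
    exact ⟨g j, ⟨j, rfl⟩, hj⟩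
  have h2 := integral_inner_eq_zero_of_mem_lpClosure hpq.symm (S := Set.range g)
    (by rintro _ ⟨j, rfl⟩; exact (hgN j).1) hf
    (by rintro _ ⟨j, rfl⟩; simpa only [real_inner_comm] using h0 j) h1
  simpa only [real_inner_comm] using h2

end Closure

/-! ### Gradients of sums and products -/

section Gradient

variable {d : ℕ} {f g : Sp d → ℝ}

theorem gradient_add (hf : Differentiable ℝ f) (hg : Differentiable ℝ g) (x : Sp d) :
    gradient (fun y => f y + g y) x = gradient f x + gradient g x := by
  ext i
  simp only [PiLp.add_apply, gradient_apply]
  rw [fderiv_fun_add (hf x) (hg x)]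
  rfl

theorem gradient_const_mul (hf : Differentiable ℝ f) (c : ℝ) (x : Sp d) :
    gradient (fun y => c * f y) x = c • gradient f x := by
  ext i
  simp only [PiLp.smul_apply, gradient_apply]
  rw [fderiv_const_mul (hf x)]
  rfl

theorem gradient_mul (hf : Differentiable ℝ f) (hg : Differentiable ℝ g) (x : Sp d) :
    gradient (fun y => f y * g y) x = f x • gradient g x + g x • gradient f x := by
  ext i
  simp only [PiLp.add_apply, PiLp.smul_apply, gradient_apply]
  rw [fderiv_fun_mul (hf x) (hg x)]
  rfl

theorem gradient_comp_deriv {s : ℝ → ℝ} (hs : Differentiable ℝ s) (hf : Differentiable ℝ f)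
    (x : Sp d) : gradient (fun y => s (f y)) x = deriv s (f x) • gradient f x := by
  ext i
  simp only [PiLp.smul_apply, gradient_apply]
  have := ((hs (f x)).hasDerivAt.comp_hasFDerivAt x (hf x).hasFDerivAt).fderiv
  simp only [Function.comp_def] at this
  rw [this]
  rfl

theorem gradient_comp_smul (hf : Differentiable ℝ f) (c : ℝ) (x : Sp d) :
    gradient (fun y => f (c • y)) x = c • gradient f (c • x) := by
  ext i
  simp only [PiLp.smul_apply, gradient_apply]
  have h1 : HasFDerivAt (fun y : Sp d => c • y) (c • ContinuousLinearMap.id ℝ (Sp d)) x :=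
    (hasFDerivAt_id x).const_smul c
  have h2 := ((hf (c • x)).hasFDerivAt.comp x h1).fderiv
  simp only [Function.comp_def] at h2
  rw [h2]
  simp

end Gradient

/-! ### Partial integrals -/

section Partial

variable {α β : Type*} [MeasurableSpace α] [MeasurableSpace β] {μ : Measure α} {ν : Measure β}
  {F : Type*} [NormedAddCommGroup F]

theorem memLp_bdd_smul [NormedSpace ℝ F] {p : ℝ≥0∞} {w : α → ℝ} (hw : AEStronglyMeasurable w μ)
    {C : ℝ} (hC : ∀ x, |w x| ≤ C) {f : α → F} (hf : MemLp f p μ) :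
    MemLp (fun x => w x • f x) p μ :=
  hf.of_le_mul (c := C) (hw.smul hf.1) (ae_of_all _ fun x => by
    rw [norm_smul]
    exact mul_le_mul_of_nonneg_right (hC x) (norm_nonneg _))

theorem integral_inner_integral [InnerProductSpace ℝ F] [CompleteSpace F] [SFinite μ]
    [IsFiniteMeasure ν] {p q : ℝ} (hpq : p.HolderConjugate q) {f : α × β → F}
    (hf : MemLp f (ENNReal.ofReal p) (μ.prod ν)) {ψ : α → F} (hψ : MemLp ψ (ENNReal.ofReal q) μ) :
    ∫ a, (inner ℝ (∫ b, f (a, b) ∂ν) (ψ a) : ℝ) ∂μ =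
      ∫ z, (inner ℝ (f z) (ψ z.1) : ℝ) ∂(μ.prod ν) := by
  have := hpq.ennrealOfReal
  have h1 : Integrable (fun z : α × β => (inner ℝ (f z) (ψ z.1) : ℝ)) (μ.prod ν) :=
    memLp_inner hf (hψ.comp_fst ν)
  rw [integral_prod _ h1]
  refine integral_congr_ae ?_
  filter_upwards [MemLp_section hpq.pos hf] with a ha
  have h2 := integral_inner (𝕜 := ℝ) (ha.integrable (by simpa using hpq.lt.le)) (ψ a)
  simp only [real_inner_comm]
  exact h2.symm

end Partial

/-! ### Stationary functions with smooth realizations -/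

section Smooth

variable {Ω : Type*} [MeasurableSpace Ω] {d : ℕ} {P : Measure Ω} {τ : Sp d → Ω → Ω} {p : ℝ}

theorem fact_one_le_ofReal (hp : 1 ≤ p) : Fact (1 ≤ ENNReal.ofReal p) := ⟨by simpa using hp⟩

/-- On each ball this is Fubini for the skew shift; countably many balls exhaust the space, so one
null set suffices. -/
theorem ae_locallyIntegrable_orbit (hτ : IsStationary P τ) {φ : Ω → ℝ} (hφ : Integrable φ P) :
    ∀ᵐ ω ∂P, LocallyIntegrable fun x => φ (τ x ω) := by
  have := hτ.prob
  have h1 : ∀ n : ℕ, ∀ᵐ ω ∂P, IntegrableOn (fun x => φ (τ x ω)) (Metric.ball (0 : Sp d) n) :=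
      fun n => by
    have : IsFiniteMeasure (volume.restrict (Metric.ball (0 : Sp d) n)) :=
      ⟨by simpa using measure_ball_lt_top⟩
    have h2 := (skew_nullPreserving hτ one_ne_zero
      (Measure.restrict_le_self (μ := volume) (s := Metric.ball (0 : Sp d) n)).absolutelyContinuous)
    have h3 : MemLp φ (ENNReal.ofReal 1) P := by simpa using memLp_one_iff_integrable.2 hφ
    have h4 := MemLp_section one_pos (h2.memLp_comp one_pos (h3.comp_fst _))
    filter_upwards [h4] with ω hω
    simpa [skew, memLp_one_iff_integrable, IntegrableOn] using hω
  filter_upwards [ae_all_iff.2 h1] with ω hω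
  rw [locallyIntegrable_iff]
  intro K hK
  obtain ⟨R, hR⟩ := hK.isBounded.subset_ball 0
  obtain ⟨n, hn⟩ := exists_nat_gt R
  exact (hω n).mono_set (hR.trans (Metric.ball_subset_ball hn.le))

/-- A stochastic gradient whose realizations are gradients of smooth functions. -/
structure IsSmoothGrad (p : ℝ) (P : Measure Ω) (τ : Sp d → Ω → Ω) (φ : Ω → ℝ) (ψ : Ω → Sp d) :
    Prop where
  grad : IsStochGrad p P τ φ ψ
  smooth : ∀ᵐ ω ∂P, ContDiff ℝ ((⊤ : ℕ∞) : WithTop ℕ∞) (fun x => φ (τ x ω)) ∧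
    ∀ x, gradient (fun x => φ (τ x ω)) x = ψ (τ x ω)

/-- Along an orbit, the average is the convolution of the locally integrable realization of `φ` with
`ζ`, so smoothness and the gradient formula are those of convolutions. -/
theorem isSmoothGrad_moll (hτ : IsStationary P τ) (hp : 1 < p) {ζ : Sp d → ℝ} (hζ : IsTest ζ)
    {φ : Ω → ℝ} (hφ : MemLp φ (ENNReal.ofReal p) P) :
    IsSmoothGrad p P τ (moll τ 1 ζ φ) (mollGrad τ 1 ζ φ) where
  grad := isStochGrad_moll hτ one_ne_zero hp hζ hφ
  smooth := by
    have := hτ.prob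
    filter_upwards [ae_locallyIntegrable_orbit hτ (hφ.integrable (by simpa using hp.le))] with ω hω
    set f : Sp d → ℝ := fun x => φ (τ x ω) with hf
    let L := ContinuousLinearMap.mul ℝ ℝ
    have hconv : ∀ (ξ : Sp d → ℝ) (x : Sp d), moll τ 1 ξ φ (τ x ω) = convolution f ξ L volume x := by
      intro ξ x
      rw [convolution_def, ← integral_sub_left_eq_self _ volume x]
      simp only [moll, ← hτ.map_add, L, ContinuousLinearMap.mul_apply', one_smul, smul_eq_mul,
        sub_sub_cancel, hf]
      refine integral_congr_ae (ae_of_all _ fun t => ?_)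
      simp only
      rw [mul_comm, neg_add_eq_sub]
    have h1 := hζ.2.contDiff_convolution_right L hω hζ.1
    have h2 : (fun x => moll τ 1 ζ φ (τ x ω)) = convolution f ζ L volume := by
      ext x
      exact hconv ζ x
    rw [h2]
    refine ⟨h1, fun x => ?_⟩
    ext i
    rw [gradient_apply, (hζ.2.hasFDerivAt_convolution_right L hω (hζ.1.of_le (by simp)) x).fderiv,
      convolution_precompR_apply L hω (hζ.2.fderiv (𝕜 := ℝ)) (hζ.1.continuous_fderiv (by simp))]
    simp only [mollGrad, inv_one, one_mul]
    rw [hconv]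
    simp only [gradient_apply]

theorem IsSmoothGrad.add (hp : 1 ≤ p) (hτ : IsStationary P τ) {φ φ' : Ω → ℝ} {ψ ψ' : Ω → Sp d}
    (h : IsSmoothGrad p P τ φ ψ) (h' : IsSmoothGrad p P τ φ' ψ') :
    IsSmoothGrad p P τ (fun ω => φ ω + φ' ω) (fun ω => ψ ω + ψ' ω) where
  grad := h.grad.add hp hτ h'.grad
  smooth := by
    filter_upwards [h.smooth, h'.smooth] with ω h1 h2
    refine ⟨h1.1.add h2.1, fun x => ?_⟩
    rw [gradient_add (h1.1.differentiable (by simp)) (h2.1.differentiable (by simp)), h1.2, h2.2]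

theorem IsSmoothGrad.smul {φ : Ω → ℝ} {ψ : Ω → Sp d} (h : IsSmoothGrad p P τ φ ψ) (c : ℝ) :
    IsSmoothGrad p P τ (fun ω => c * φ ω) (fun ω => c • ψ ω) where
  grad := h.grad.smul c
  smooth := by
    filter_upwards [h.smooth] with ω h1
    refine ⟨contDiff_const.mul h1.1, fun x => ?_⟩
    rw [gradient_const_mul (h1.1.differentiable (by simp)), h1.2]

theorem IsSmoothGrad.shift (hτ : IsStationary P τ) {φ : Ω → ℝ} {ψ : Ω → Sp d}
    (h : IsSmoothGrad p P τ φ ψ) (y : Sp d) :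
    IsSmoothGrad p P τ (fun ω => φ (τ y ω)) (fun ω => ψ (τ y ω)) where
  grad := h.grad.shift hτ y
  smooth := by
    filter_upwards [(hτ.preserving y).quasiMeasurePreserving.ae h.smooth] with ω h1
    simpa only [← hτ.map_add, add_comm] using h1

/-- The gradients of stationary functions with smooth realizations. -/
def smoothGrads (hp : 1 ≤ p) (hτ : IsStationary P τ) : Submodule ℝ (Ω → Sp d) where
  carrier := {ψ | ∃ φ, IsSmoothGrad p P τ φ ψ}
  add_mem' := by
    rintro ψ ψ' ⟨φ, h⟩ ⟨φ', h'⟩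
    exact ⟨_, h.add hp hτ h'⟩
  zero_mem' := ⟨fun _ => 0, IsStochGrad.zero, ae_of_all _ fun ω =>
    ⟨contDiff_const, fun x => by simp [gradient_fun_const]⟩⟩
  smul_mem' := by
    rintro c ψ ⟨φ, h⟩
    exact ⟨_, h.smul c⟩

/-- No approximate identity is needed. A functional `g j` annihilating smooth gradients annihilates
the averages of `ψ` with every weight `ζ`, so `⟨ψ ∘ τ_{-y}, g j⟩ = 0` for almost every `y`. For one
`y` this holds for all `j`, which places `ψ ∘ τ_{-y}` in the closure; smooth gradients are stable
under shifts, so shifting back by `y` finishes. -/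
theorem IsStochGrad.mem_lpClosure_smoothGrads (hτ : IsStationary P τ) (hp : 1 < p) {φ : Ω → ℝ}
    {ψ : Ω → Sp d} (h : IsStochGrad p P τ φ ψ) :
    ψ ∈ LpClosure p P (smoothGrads hp.le hτ : Set (Ω → Sp d)) := by
  have := hτ.prob
  have := hτ.separable
  obtain ⟨q, hpq⟩ : ∃ q, p.HolderConjugate q := ⟨_, Real.HolderConjugate.conjExponent hp⟩
  have := hpq.ennrealOfReal
  have hp0 : 0 < p := hpq.pos
  have := fact_one_le_ofReal hpq.symm.lt.le
  have : Fact (ENNReal.ofReal q ≠ ∞) := ⟨ENNReal.ofReal_ne_top⟩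
  have hSm : ∀ s ∈ smoothGrads hp.le hτ, MemLp s (ENNReal.ofReal p) P :=
    fun s ⟨_, hs⟩ => hs.grad.memLp_grad
  obtain ⟨g, hgm, hg0, hg⟩ := exists_annihilating_seq hpq (smoothGrads hp.le hτ) hSm
  set U : Set (Sp d) := Metric.ball 0 1
  have hUfin : IsFiniteMeasure (volume.restrict U) := ⟨by simpa [U] using measure_ball_lt_top⟩
  have hf : MemLp (fun z : Ω × Sp d => ψ (τ (-z.2) z.1)) (ENNReal.ofReal p)
      (P.prod (volume.restrict U)) := by
    have h2 := (skew_nullPreserving hτ (neg_ne_zero.2 one_ne_zero)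
      (Measure.restrict_le_self (μ := volume) (s := U)).absolutelyContinuous)
    simpa [skew] using h2.memLp_comp hp0 (h.memLp_grad.comp_fst _)
  have hH : ∀ j, ∀ᵐ y : Sp d, y ∈ U → ∫ ω, (inner ℝ (ψ (τ (-y) ω)) (g j ω) : ℝ) ∂P = 0 := by
    intro j
    have hint : Integrable (fun z : Ω × Sp d => (inner ℝ (ψ (τ (-z.2) z.1)) (g j z.1) : ℝ))
        (P.prod (volume.restrict U)) := memLp_inner hf ((hgm j).comp_fst _)
    refine Metric.isOpen_ball.ae_eq_zero_of_integral_contDiff_smul_eq_zero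
      (IntegrableOn.locallyIntegrableOn hint.integral_prod_right) fun ζ hζ1 hζ2 hζU => ?_
    have hζ : IsTest ζ := ⟨hζ1, hζ2⟩
    obtain ⟨C, hC⟩ := hζ.continuous.bounded_above_of_compact_support hζ2
    have hmf := memLp_bdd_smul (w := fun z : Ω × Sp d => ζ z.2)
      (hζ.continuous.aestronglyMeasurable.comp_snd (μ := P) (ν := volume.restrict U))
      (C := C) (fun z => hC z.2) hf
    have h1 := hg0 j _ ⟨_, isSmoothGrad_moll hτ hp hζ h.memLp⟩
    have h2 := integral_inner_integral hpq hmf (hgm j)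
    have hsupp : ∀ y, y ∉ U → ζ y = 0 := fun y hy =>
      image_eq_zero_of_notMem_tsupport fun h' => hy (hζU h')
    have h3 : ∫ ω, (inner ℝ (∫ y, ζ y • ψ (τ (-y) ω) ∂volume.restrict U) (g j ω) : ℝ) ∂P = 0 := by
      rw [← h1]
      refine integral_congr_ae ?_
      filter_upwards [mollGrad_ae_eq hτ one_ne_zero hp hζ h] with ω hω
      rw [hω, moll, setIntegral_eq_integral_of_forall_compl_eq_zero fun y hy => by
        rw [hsupp y hy, zero_smul]]
      simp only [one_smul]
    have hint2 := memLp_inner hmf ((hgm j).comp_fst (volume.restrict U))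
    rw [← setIntegral_eq_integral_of_forall_compl_eq_zero (s := U) fun y hy => by
        rw [hsupp y hy, zero_smul], ← h3, h2, integral_prod_symm _ hint2]
    simp only [inner_smul_left, conj_trivial, integral_const_mul, smul_eq_mul]
  have hpos : volume U ≠ 0 := (Metric.measure_ball_pos volume (0 : Sp d) one_pos).ne'
  obtain ⟨y, -, hy⟩ : ∃ y ∈ U, ∀ j, ∫ ω, (inner ℝ (ψ (τ (-y) ω)) (g j ω) : ℝ) ∂P = 0 := by
    by_contra! hcon
    refine hpos (measure_mono_null (fun y hy => ?_) (ae_all_iff.2 hH))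
    simp only [Set.mem_compl_iff, Set.mem_ofPred_eq, not_forall]
    obtain ⟨j, hj⟩ := hcon y hy
    exact ⟨j, hy, hj⟩
  have hcl := hg _ (memLp_shift hτ h.memLp_grad (-y)) hy
  refine ⟨h.memLp_grad, fun r hr => ?_⟩
  obtain ⟨s, ⟨φ', hs⟩, hsr⟩ := hcl.2 r hr
  refine ⟨fun ω => s (τ y ω), ⟨_, hs.shift hτ y⟩, ?_⟩
  have hm : AEStronglyMeasurable (fun ω => ψ (τ (-y) ω) - s ω) P :=
    (memLp_shift hτ h.memLp_grad (-y)).1.sub hs.grad.memLp_grad.1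
  rw [← eLpNorm_shift hτ hm y] at hsr
  simpa only [← hτ.map_add, neg_add_cancel, hτ.map_zero] using hsr

theorem isPot_iff_mem_lpClosure {χ : Ω → Sp d} : IsPot p P τ χ ↔
    χ ∈ LpClosure p P {ψ | ∃ φ, IsStochGrad p P τ φ ψ} :=
  ⟨fun h => ⟨h.memLp, fun r hr => by
    obtain ⟨φ, ψ, h1, h2⟩ := h.approx r hr
    exact ⟨ψ, ⟨φ, h1⟩, h2⟩⟩, fun h => ⟨h.1, fun r hr => by
    obtain ⟨ψ, ⟨φ, h1⟩, h2⟩ := h.2 r hr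
    exact ⟨φ, ψ, h1, h2⟩⟩⟩

theorem IsPot.mem_lpClosure_smoothGrads (hτ : IsStationary P τ) (hp : 1 < p) {χ : Ω → Sp d}
    (h : IsPot p P τ χ) : χ ∈ LpClosure p P (smoothGrads hp.le hτ : Set (Ω → Sp d)) :=
  lpClosure_trans (S := (smoothGrads hp.le hτ : Set (Ω → Sp d))) (T := {ψ | ∃ φ, IsStochGrad p P τ φ ψ}) hp.le
    (fun _ ⟨_, hs⟩ => hs.grad.memLp_grad)
    (by rintro _ ⟨_, h⟩; exact h.mem_lpClosure_smoothGrads hτ hp) (isPot_iff_mem_lpClosure.1 h)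

/-- The stochastic gradients form a subspace. -/
def stochGrads (hp : 1 ≤ p) (hτ : IsStationary P τ) : Submodule ℝ (Ω → Sp d) where
  carrier := {ψ | ∃ φ, IsStochGrad p P τ φ ψ}
  add_mem' := by
    rintro ψ ψ' ⟨φ, h⟩ ⟨φ', h'⟩
    exact ⟨_, h.add hp hτ h'⟩
  zero_mem' := ⟨fun _ => 0, IsStochGrad.zero⟩
  smul_mem' := by
    rintro c ψ ⟨φ, h⟩
    exact ⟨_, h.smul c⟩

end Smooth

/-! ### Bounded maps and pairs in `L^p` -/

section Pairs

variable {α : Type*} [MeasurableSpace α] {μ : Measure α} {F G : Type*} [NormedAddCommGroup F]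
  [NormedAddCommGroup G] {p : ℝ}

theorem map_mem_lpClosure {β : Type*} [MeasurableSpace β] {ν : Measure β} {S : Set (α → F)}
    {S' : Set (β → G)} (T : (α → F) → β → G) {C : ℝ≥0∞} (hC : C ≠ ∞)
    (hS : ∀ s ∈ S, MemLp s (ENNReal.ofReal p) μ)
    (hT : ∀ f s, MemLp f (ENNReal.ofReal p) μ → MemLp s (ENNReal.ofReal p) μ →
      eLpNorm (fun x => T f x - T s x) (ENNReal.ofReal p) ν ≤
        C * eLpNorm (fun x => f x - s x) (ENNReal.ofReal p) μ)
    (hTS : ∀ s ∈ S, T s ∈ S') {f : α → F} (hf : f ∈ LpClosure p μ S)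
    (hTf : MemLp (T f) (ENNReal.ofReal p) ν) : T f ∈ LpClosure p ν S' := by
  obtain ⟨hm, s, hs, hlim⟩ := mem_lpClosure_iff_seq.1 hf
  refine mem_lpClosure_iff_seq.2 ⟨hTf, fun n => T (s n), fun n => hTS _ (hs n), ?_⟩
  have h1 := ENNReal.Tendsto.const_mul (a := C) hlim (Or.inr hC)
  rw [mul_zero] at h1
  exact tendsto_of_tendsto_of_tendsto_of_le_of_le tendsto_const_nhds h1 (fun _ => zero_le)
    fun n => hT _ _ (hS _ (hs n)) hm

theorem eLpNorm_fst_le (f : α → F × G) (r : ℝ≥0∞) :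
    eLpNorm (fun x => (f x).1) r μ ≤ eLpNorm f r μ :=
  eLpNorm_mono fun x => norm_fst_le (f x)

theorem eLpNorm_snd_le (f : α → F × G) (r : ℝ≥0∞) :
    eLpNorm (fun x => (f x).2) r μ ≤ eLpNorm f r μ :=
  eLpNorm_mono fun x => norm_snd_le (f x)

theorem memLp_fst {f : α → F × G} {r : ℝ≥0∞} (h : MemLp f r μ) : MemLp (fun x => (f x).1) r μ :=
  ⟨continuous_fst.comp_aestronglyMeasurable h.1, (eLpNorm_fst_le f r).trans_lt h.2⟩

theorem memLp_snd {f : α → F × G} {r : ℝ≥0∞} (h : MemLp f r μ) : MemLp (fun x => (f x).2) r μ :=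
  ⟨continuous_snd.comp_aestronglyMeasurable h.1, (eLpNorm_snd_le f r).trans_lt h.2⟩

theorem eLpNorm_pair_le (hp : 1 ≤ p) {f : α → F} {g : α → G} (hf : AEStronglyMeasurable f μ)
    (hg : AEStronglyMeasurable g μ) : eLpNorm (fun x => (f x, g x)) (ENNReal.ofReal p) μ ≤
      eLpNorm f (ENNReal.ofReal p) μ + eLpNorm g (ENNReal.ofReal p) μ := by
  have h1 : AEStronglyMeasurable (fun x => (f x, (0 : G))) μ := hf.prodMk aestronglyMeasurable_const
  have h2 : AEStronglyMeasurable (fun x => ((0 : F), g x)) μ := aestronglyMeasurable_const.prodMk hg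
  have h3 := eLpNorm_add_le h1 h2 (p := ENNReal.ofReal p) (by simpa using hp)
  have h4 : ((fun x => (f x, (0 : G))) + fun x => ((0 : F), g x)) = fun x => (f x, g x) := by
    ext x <;> simp
  rw [h4] at h3
  refine h3.trans (add_le_add (eLpNorm_mono fun x => ?_) (eLpNorm_mono fun x => ?_)) <;> simp

theorem memLp_pair (hp : 1 ≤ p) {f : α → F} {g : α → G} (hf : MemLp f (ENNReal.ofReal p) μ)
    (hg : MemLp g (ENNReal.ofReal p) μ) : MemLp (fun x => (f x, g x)) (ENNReal.ofReal p) μ :=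
  ⟨hf.1.prodMk hg.1, (eLpNorm_pair_le hp hf.1 hg.1).trans_lt (ENNReal.add_lt_top.2 ⟨hf.2, hg.2⟩)⟩

end Pairs

/-! ### Sobolev functions with zero boundary values and Poincaré's inequality -/

section W10

variable {d : ℕ} {p : ℝ} {Q : Set (Sp d)}

/-- The pairs `(η, ∇η)` of smooth functions with compact support in `Q` and their gradients. -/
def testPairs (Q : Set (Sp d)) : Submodule ℝ (Sp d → ℝ × Sp d) where
  carrier := {f | ∃ η, IsTest η ∧ tsupport η ⊆ Q ∧ f = fun x => (η x, gradient η x)}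
  add_mem' := by
    rintro _ _ ⟨η, h, hQ, rfl⟩ ⟨η', h', hQ', rfl⟩
    refine ⟨fun x => η x + η' x, ⟨h.1.add h'.1, h.2.add h'.2⟩,
      (tsupport_add _ _).trans (Set.union_subset hQ hQ'), ?_⟩
    ext1 x
    rw [gradient_add h.differentiable h'.differentiable]
    rfl
  zero_mem' := by
    refine ⟨fun _ => 0, ⟨contDiff_const, HasCompactSupport.zero⟩, ?_, ?_⟩
    · simp [tsupport]
    · ext1 x
      simp only [gradient_fun_const]
      rfl
  smul_mem' := by
    rintro c _ ⟨η, h, hQ, rfl⟩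
    refine ⟨fun x => c * η x, ⟨contDiff_const.mul h.1, h.2.mul_left⟩,
      (tsupport_mul_subset_right).trans hQ, ?_⟩
    ext1 x
    rw [gradient_const_mul h.differentiable]
    rfl

theorem IsTest.memLp {ζ : Sp d → ℝ} (h : IsTest ζ) {r : ℝ≥0∞} {ν : Measure (Sp d)}
    [IsFiniteMeasureOnCompacts ν] : MemLp ζ r ν :=
  h.continuous.memLp_of_hasCompactSupport h.2

theorem IsTest.memLp_gradient {ζ : Sp d → ℝ} (h : IsTest ζ) {r : ℝ≥0∞} {ν : Measure (Sp d)}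
    [IsFiniteMeasureOnCompacts ν] : MemLp (gradient ζ) r ν :=
  h.continuous_gradient.memLp_of_hasCompactSupport h.hasCompactSupport_gradient

theorem memLp_testPairs (hp : 1 ≤ p) {f : Sp d → ℝ × Sp d} (hf : f ∈ testPairs Q) :
    MemLp f (ENNReal.ofReal p) (volume.restrict Q) := by
  obtain ⟨η, h, -, rfl⟩ := hf
  exact memLp_pair hp h.memLp h.memLp_gradient

/-- Treating function and gradient as one vector-valued function makes the general facts on
`LpClosure` available. -/
theorem isW10_iff (hp : 1 ≤ p) {u : Sp d → ℝ} {g : Sp d → Sp d} : IsW10 p Q u g ↔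
    (fun x => (u x, g x)) ∈ LpClosure p (volume.restrict Q) (testPairs Q : Set _) := by
  constructor
  · intro h
    refine ⟨memLp_pair hp h.memLp h.memLp_grad, fun r hr => ?_⟩
    obtain ⟨η, h1, h2, h3, h4, h5⟩ := h.approx (r / 2) (ENNReal.half_pos hr.ne')
    have ht : IsTest η := ⟨h1, h2⟩
    refine ⟨_, ⟨η, ht, h3, rfl⟩, ?_⟩
    refine (eLpNorm_pair_le hp (h.memLp.1.sub ht.continuous.aestronglyMeasurable)
      (h.memLp_grad.1.sub ht.continuous_gradient.aestronglyMeasurable)).trans_lt ?_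
    calc _ < r / 2 + r / 2 := ENNReal.add_lt_add h4 h5
      _ = r := ENNReal.add_halves r
  · intro h
    refine ⟨memLp_fst h.1, memLp_snd h.1, fun r hr => ?_⟩
    obtain ⟨_, ⟨η, h1, h2, rfl⟩, h3⟩ := h.2 r hr
    have h4 : eLpNorm (fun x => (u x - η x, g x - gradient η x)) (ENNReal.ofReal p)
        (volume.restrict Q) < r := h3
    exact ⟨η, h1.1, h1.2, h2,
      (eLpNorm_fst_le (fun x => (u x - η x, g x - gradient η x)) _).trans_lt h4,
      (eLpNorm_snd_le (fun x => (u x - η x, g x - gradient η x)) _).trans_lt h4⟩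

/-- The Poincaré inequality for test functions on a bounded set. -/
theorem exists_poincare_test (hd : 0 < d) (hp : 1 < p) (hQm : MeasurableSet Q)
    (hQ : Bornology.IsBounded Q) :
    ∃ C : ℝ≥0∞, C ≠ ∞ ∧ ∀ η : Sp d → ℝ, IsTest η → tsupport η ⊆ Q →
      eLpNorm η (ENNReal.ofReal p) (volume.restrict Q) ≤
        C * eLpNorm (gradient η) (ENNReal.ofReal p) (volume.restrict Q) := by
  obtain ⟨R, hR0, hR⟩ := hQ.subset_ball_lt 0 0
  let e : Sp d := EuclideanSpace.single ⟨0, hd⟩ (1 : ℝ)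
  have he : ‖e‖ = 1 := by simp [e]
  -- The constant is `2 R`, written as the mass of the weight `1` in Minkowski's inequality.
  refine ⟨∫⁻ t : ℝ in Set.Ioc 0 (2 * R), ‖(1 : ℝ)‖ₑ,
    by simpa using ENNReal.mul_ne_top ENNReal.ofNat_ne_top ENNReal.ofReal_ne_top, fun η hη hηQ => ?_⟩
  let f : Sp d × ℝ → ℝ := fun z => inner ℝ (gradient η (z.1 + z.2 • e)) e
  have hfc : Continuous f := by
    have h1 : Continuous fun z : Sp d × ℝ => z.1 + z.2 • e :=
      continuous_fst.add (continuous_snd.smul continuous_const)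
    exact (hη.continuous_gradient.comp h1).inner continuous_const
  have hgs : Function.support (gradient η) ⊆ Q := fun x hx => by
    refine hηQ (support_fderiv_subset ℝ (f := η) ?_)
    intro h0
    exact hx (by simp [gradient, h0])
  -- The point `x + 2 R e` is outside the ball of radius `R` containing `Q`, so `η` vanishes there,
  -- and the fundamental theorem of calculus along `e` recovers `η x`.
  have hkey : ∀ x ∈ Q, η x = -∫ t in Set.Ioc 0 (2 * R), (1 : ℝ) • f (x, t) := by
    intro x hx
    have h1 : ∀ t ∈ Set.uIcc 0 (2 * R), HasDerivAt (fun t : ℝ => η (x + t • e)) (f (x, t)) t := by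
      intro t _
      have h2 : HasDerivAt (fun t : ℝ => x + t • e) e t := by
        simpa using ((hasDerivAt_id t).smul_const e).const_add x
      have h3 := (hη.differentiable (x + t • e)).hasFDerivAt.comp_hasDerivAt t h2
      simp only [f, inner_gradient_left]
      exact h3
    have h4 := intervalIntegral.integral_eq_sub_of_hasDerivAt h1
      ((hfc.comp (Continuous.prodMk_right x)).intervalIntegrable _ _)
    have h5 : η (x + (2 * R) • e) = 0 := by
      refine image_eq_zero_of_notMem_tsupport fun h' => ?_
      have h6 := hR (hηQ h')
      have h7 := hR hx
      rw [mem_ball_zero_iff] at h6 h7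
      have h8 := norm_sub_le (x + (2 * R) • e) x
      rw [add_sub_cancel_left, norm_smul, he, mul_one, Real.norm_of_nonneg (by linarith)] at h8
      linarith
    rw [intervalIntegral.integral_of_le (by linarith), h5] at h4
    simp only [one_smul, h4]
    simp
  have h1 : eLpNorm η (ENNReal.ofReal p) (volume.restrict Q) ≤
      eLpNorm (fun x => ∫ t in Set.Ioc 0 (2 * R), (1 : ℝ) • f (x, t)) (ENNReal.ofReal p)
        volume := by
    refine le_trans (le_of_eq ?_) (eLpNorm_mono_measure _ (Measure.restrict_le_self (s := Q)))
    rw [← eLpNorm_neg (fun x => ∫ t in Set.Ioc 0 (2 * R), (1 : ℝ) • f (x, t))]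
    refine eLpNorm_congr_ae ?_
    filter_upwards [ae_restrict_mem hQm] with x hx
    exact hkey x hx
  refine h1.trans (eLpNorm_integral_smul_le hp hfc.aestronglyMeasurable
    aestronglyMeasurable_const (ae_of_all _ fun t => ?_))
  rw [eLpNorm_restrict_eq_of_support_subset hgs]
  have h2 := eLpNorm_comp_measurePreserving (p := ENNReal.ofReal p)
    (hη.continuous_gradient.aestronglyMeasurable (μ := volume))
    (measurePreserving_add_right (volume : Measure (Sp d)) (t • e))
  rw [← h2]
  refine eLpNorm_mono fun x => ?_
  refine (norm_inner_le_norm _ _).trans ?_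
  rw [he, mul_one]
  rfl

end W10

/-! ### Functions on `Ω × Q` determined by test functions in `x` -/

section TestIdentities

variable {Ω : Type*} [MeasurableSpace Ω] {d : ℕ} {P : Measure Ω} {Q : Set (Sp d)}
  {F : Type*} [NormedAddCommGroup F] [InnerProductSpace ℝ F] [FiniteDimensional ℝ F] {p q : ℝ}

theorem isFiniteMeasure_restrict (hQ : Bornology.IsBounded Q) :
    IsFiniteMeasure (volume.restrict Q) :=
  ⟨by simpa using hQ.measure_lt_top⟩

theorem IsTest.exists_bound {ζ : Sp d → ℝ} (h : IsTest ζ) : ∃ C, ∀ x, |ζ x| ≤ C :=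
  h.continuous.bounded_above_of_compact_support h.2

omit [FiniteDimensional ℝ F] in
theorem IsTest.memLp_smul {ζ : Sp d → ℝ} (h : IsTest ζ) {r : ℝ≥0∞} {f : Ω × Sp d → F}
    (hf : MemLp f r (prodMeas P Q)) [SFinite P] :
    MemLp (fun z => ζ z.2 • f z) r (prodMeas P Q) := by
  obtain ⟨C, hC⟩ := h.exists_bound
  exact memLp_bdd_smul (w := fun z : Ω × Sp d => ζ z.2)
    (h.continuous.aestronglyMeasurable.comp_snd (μ := P) (ν := volume.restrict Q))
    (C := C) (fun z => hC z.2) hf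

omit [FiniteDimensional ℝ F] in
theorem ae_integral_inner_eq_zero [IsFiniteMeasure P] (hpq : p.HolderConjugate q)
    (hQ : Bornology.IsBounded Q) {D : Ω × Sp d → F}
    (hD : MemLp D (ENNReal.ofReal p) (prodMeas P Q)) {ψ : Ω → F}
    (hψ : MemLp ψ (ENNReal.ofReal q) P)
    (h : ∀ θ, IsTest θ → ∫ z, (inner ℝ (θ z.2 • D z) (ψ z.1) : ℝ) ∂(prodMeas P Q) = 0) :
    ∀ᵐ x ∂(volume.restrict Q), ∫ ω, (inner ℝ (D (ω, x)) (ψ ω) : ℝ) ∂P = 0 := by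
  have := isFiniteMeasure_restrict hQ
  have := hpq.ennrealOfReal
  have hint : Integrable (fun z => (inner ℝ (D z) (ψ z.1) : ℝ)) (prodMeas P Q) :=
    memLp_inner hD (hψ.comp_fst _)
  refine ae_eq_zero_of_integral_contDiff_smul_eq_zero
    hint.integral_prod_right.locallyIntegrable fun θ h1 h2 => ?_
  have hθ : IsTest θ := ⟨h1, h2⟩
  have hint2 : Integrable (fun z => (inner ℝ (θ z.2 • D z) (ψ z.1) : ℝ)) (prodMeas P Q) :=
    memLp_inner (hθ.memLp_smul hD) (hψ.comp_fst _)
  rw [← h θ hθ, integral_prod_symm _ hint2]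
  simp only [inner_smul_left, conj_trivial, integral_const_mul, smul_eq_mul]

/-- The `ψ` are taken to be indicators times basis vectors; for each of them the pairing vanishes at
almost every `x`, so all partial integrals over `Ω` vanish. -/
theorem ae_eq_zero_of_integral_test [IsFiniteMeasure P] (hpq : p.HolderConjugate q)
    (hQ : Bornology.IsBounded Q) {D : Ω × Sp d → F}
    (hD : MemLp D (ENNReal.ofReal p) (prodMeas P Q))
    (h : ∀ θ, IsTest θ → ∀ ψ : Ω → F, MemLp ψ (ENNReal.ofReal q) P →
      ∫ z, (inner ℝ (θ z.2 • D z) (ψ z.1) : ℝ) ∂(prodMeas P Q) = 0) :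
    D =ᵐ[prodMeas P Q] 0 := by
  have := isFiniteMeasure_restrict hQ
  refine ae_eq_zero_of_setIntegral_section (hD.integrable (by simpa using hpq.lt.le))
    fun A hA => ?_
  have h1 : ∀ i, ∀ᵐ x ∂(volume.restrict Q), ∫ ω, (inner ℝ (D (ω, x))
      (A.indicator (fun _ => stdOrthonormalBasis ℝ F i) ω) : ℝ) ∂P = 0 := fun i => by
    have hm : MemLp (A.indicator fun _ => stdOrthonormalBasis ℝ F i) (ENNReal.ofReal q) P :=
      (memLp_const _).indicator hA
    exact ae_integral_inner_eq_zero hpq hQ hD hm fun θ hθ => h θ hθ _ hm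
  filter_upwards [ae_all_iff.2 h1, MemLp_section' hpq.pos hD] with x hx hDx
  refine (InnerProductSpace.ext_inner_left_basis (stdOrthonormalBasis ℝ F).toBasis) fun i => ?_
  rw [OrthonormalBasis.coe_toBasis, inner_zero_right, ← integral_inner (hDx.integrable (by simpa using hpq.lt.le)).integrableOn,
    ← hx i, ← integral_indicator hA]
  refine integral_congr_ae (ae_of_all _ fun ω => ?_)
  by_cases hω : ω ∈ A <;> simp [hω, real_inner_comm]

end TestIdentities

/-! ### The space `L^p(Ω) ⊗ W^{1,p}_0(Q)` -/

section LpW10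

variable {Ω : Type*} [MeasurableSpace Ω] {d : ℕ} {P : Measure Ω} {Q : Set (Sp d)} {p q : ℝ}

/-- The span of the products of `L^p(Ω)`-functions and pairs `(η, ∇η)` with `η ∈ C_c^∞(Q)`. -/
def elemTensors (p : ℝ) (P : Measure Ω) (Q : Set (Sp d)) : Submodule ℝ (Ω × Sp d → ℝ × Sp d) :=
  Submodule.span ℝ {f | ∃ (φ : Ω → ℝ) (s : Sp d → ℝ × Sp d), MemLp φ (ENNReal.ofReal p) P ∧
    s ∈ testPairs Q ∧ f = fun z => φ z.1 • s z.2}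

theorem tensor_mem_elemTensors {φ : Ω → ℝ} (hφ : MemLp φ (ENNReal.ofReal p) P)
    {s : Sp d → ℝ × Sp d} (hs : s ∈ testPairs Q) :
    (fun z : Ω × Sp d => φ z.1 • s z.2) ∈ elemTensors p P Q :=
  Submodule.subset_span ⟨φ, s, hφ, hs, rfl⟩

theorem memLp_elemTensors (hp : 1 ≤ p) {f : Ω × Sp d → ℝ × Sp d}
    (hf : f ∈ elemTensors p P Q) : MemLp f (ENNReal.ofReal p) (prodMeas P Q) := by
  induction hf using Submodule.span_induction with
  | mem f hf =>
    obtain ⟨φ, s, hφ, hs, rfl⟩ := hf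
    exact memLp_tensor (by linarith) hφ (memLp_testPairs hp hs)
  | zero => exact MemLp.zero
  | add f g _ _ hf hg => exact hf.add hg
  | smul c f _ hf => exact hf.const_smul c

theorem section_elemTensors {f : Ω × Sp d → ℝ × Sp d} (hf : f ∈ elemTensors p P Q) (ω : Ω) :
    (fun x => f (ω, x)) ∈ testPairs Q := by
  induction hf using Submodule.span_induction with
  | mem f hf =>
    obtain ⟨φ, s, hφ, hs, rfl⟩ := hf
    exact (testPairs Q).smul_mem (φ ω) hs
  | zero => exact (testPairs Q).zero_mem
  | add f g _ _ hf hg => exact (testPairs Q).add_mem hf hg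
  | smul c f _ hf => exact (testPairs Q).smul_mem c hf

theorem tensor_mem_lpClosure (hp : 1 ≤ p) {φ : Ω → ℝ} (hφ : MemLp φ (ENNReal.ofReal p) P)
    {s : Sp d → ℝ × Sp d} (hs : s ∈ LpClosure p (volume.restrict Q) (testPairs Q : Set _)) :
    (fun z : Ω × Sp d => φ z.1 • s z.2) ∈
      LpClosure p (prodMeas P Q) (elemTensors p P Q : Set _) := by
  refine map_mem_lpClosure (S := (testPairs Q : Set _)) (μ := volume.restrict Q)
    (fun s (z : Ω × Sp d) => φ z.1 • s z.2) hφ.2.ne (fun s hs => memLp_testPairs hp hs)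
    (fun f s hf hs => ?_) (S' := (elemTensors p P Q : Set _))
    (fun s hs => tensor_mem_elemTensors hφ hs) hs
    (memLp_tensor (by linarith) hφ hs.1)
  have := eLpNorm_tensor (p := p) (by linarith) hφ.1 (hf.1.sub hs.1)
  simp only [Pi.sub_apply, smul_sub] at this
  exact this.le

/-- A closure inside a closure: tensors with Sobolev factors are limits of tensors with
test-function factors. Later arguments can therefore be checked on the latter. -/
theorem isLpW10_iff (hp : 1 ≤ p) {u : Ω × Sp d → ℝ} {G : Ω × Sp d → Sp d} : IsLpW10 p P Q u G ↔
    (fun z => (u z, G z)) ∈ LpClosure p (prodMeas P Q) (elemTensors p P Q : Set _) := by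
  constructor
  · intro h
    refine lpClosure_trans (T := LpClosure p (prodMeas P Q) (elemTensors p P Q : Set _)) hp
      (fun s hs => memLp_elemTensors hp hs) le_rfl ?_
    refine ⟨memLp_pair hp h.memLp h.memLp_grad, fun r hr => ?_⟩
    obtain ⟨n, φ, η, g, h1, h2, h3, h4⟩ := h.approx (r / 2) (ENNReal.half_pos hr.ne')
    have h5 : ∀ i, (fun z : Ω × Sp d => φ i z.1 • (η i z.2, g i z.2)) ∈
        LpClosure p (prodMeas P Q) (elemTensors p P Q : Set _) := fun i =>
      tensor_mem_lpClosure hp (h1 i) ((isW10_iff hp).1 (h2 i))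
    have h6 := sum_mem_lpClosure hp (fun s hs => memLp_elemTensors hp hs) Finset.univ
      fun i _ => h5 i
    refine ⟨_, h6, ?_⟩
    have h7 : (fun z => (u z, G z) - (∑ i, fun z : Ω × Sp d =>
        φ i z.1 • (η i z.2, g i z.2)) z) = fun z => (u z - ∑ i, φ i z.1 * η i z.2,
          G z - ∑ i, φ i z.1 • g i z.2) := by
      ext1 z
      rw [Finset.sum_apply]
      simp [Prod.ext_iff, Prod.fst_sum, Prod.snd_sum]
    have h8 := memLp_fst h6.1
    have h9 := memLp_snd h6.1
    simp only [Finset.sum_apply, Prod.fst_sum, Prod.snd_sum, Prod.smul_mk, smul_eq_mul] at h8 h9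
    rw [h7]
    refine (eLpNorm_pair_le hp (h.memLp.1.sub h8.1) (h.memLp_grad.1.sub h9.1)).trans_lt ?_
    calc _ < r / 2 + r / 2 := ENNReal.add_lt_add h3 h4
      _ = r := ENNReal.add_halves r
  · intro h
    refine ⟨memLp_fst h.1, memLp_snd h.1, fun r hr => ?_⟩
    obtain ⟨s, hs, h1⟩ := h.2 r hr
    obtain ⟨n, c, t, rfl⟩ := (Submodule.mem_span_set').1 hs
    choose φ s' hφ hs' hts using fun i => (t i).2
    choose η hη hηQ hηs using hs'
    have h2 : (fun z => (u z, G z) - (∑ i, c i • (t i : Ω × Sp d → ℝ × Sp d)) z) =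
        fun z => (u z - ∑ i, (c i * φ i z.1) * η i z.2,
          G z - ∑ i, (c i * φ i z.1) • gradient (η i) z.2) := by
      ext1 z
      rw [Finset.sum_apply]
      simp [Prod.ext_iff, Prod.fst_sum, Prod.snd_sum, hts, hηs, mul_assoc, mul_smul]
    rw [h2] at h1
    refine ⟨n, fun i ω => c i * φ i ω, η, fun i => gradient (η i), fun i => (hφ i).const_mul _,
      fun i => (isW10_iff hp).2 (subset_lpClosure (fun s hs => memLp_testPairs hp hs)
        ⟨η i, hη i, hηQ i, rfl⟩), ?_, ?_⟩
    · exact (eLpNorm_fst_le (fun z => (u z - ∑ i, (c i * φ i z.1) * η i z.2,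
          G z - ∑ i, (c i * φ i z.1) • gradient (η i) z.2)) _).trans_lt h1
    · exact (eLpNorm_snd_le (fun z => (u z - ∑ i, (c i * φ i z.1) * η i z.2,
          G z - ∑ i, (c i * φ i z.1) • gradient (η i) z.2)) _).trans_lt h1

/-- Admits random fields which are not finite sums, provided almost every realization is a test
function: such a field is approximated by tensors of indicators and test functions. -/
theorem isLpW10_of_sections (hp : 1 ≤ p) [IsFiniteMeasure P] {u : Ω × Sp d → ℝ}
    {G : Ω × Sp d → Sp d} (hu : MemLp u (ENNReal.ofReal p) (prodMeas P Q))
    (hG : MemLp G (ENNReal.ofReal p) (prodMeas P Q))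
    (h : ∀ᵐ ω ∂P, (fun x => (u (ω, x), G (ω, x))) ∈ testPairs Q) : IsLpW10 p P Q u G := by
  have := fact_one_le_ofReal hp
  have : Fact (ENNReal.ofReal p ≠ ∞) := ⟨ENNReal.ofReal_ne_top⟩
  refine (isLpW10_iff hp).2 ⟨memLp_pair hp hu hG, fun r hr => ?_⟩
  obtain ⟨n, A, s, hA, hs, hr⟩ := exists_tensor_approx (S := (testPairs Q : Set _)) hp
    ⟨0, (testPairs Q).zero_mem⟩ (fun s hs => memLp_testPairs hp hs) (memLp_pair hp hu hG)
    (h.mono fun ω hω r hr => ⟨_, hω, by simpa using hr⟩) hr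
  refine ⟨_, Submodule.sum_mem _ (t := Finset.univ) fun i _ =>
    tensor_mem_elemTensors ((memLp_const (μ := P) (1 : ℝ)).indicator (hA i)) (hs i), ?_⟩
  simpa only [Finset.sum_apply] using hr

theorem isLpW10_of_isW10 (hp : 1 ≤ p) [IsFiniteMeasure P] {u : Sp d → ℝ} {g : Sp d → Sp d}
    (h : IsW10 p Q u g) : IsLpW10 p P Q (fun z => u z.2) (fun z => g z.2) := by
  have := tensor_mem_lpClosure hp (memLp_const (μ := P) (1 : ℝ)) ((isW10_iff hp).1 h)
  simp only [one_smul] at this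
  exact (isLpW10_iff hp).2 this

theorem IsLpW10.add (hp : 1 ≤ p) {u u' : Ω × Sp d → ℝ} {G G' : Ω × Sp d → Sp d}
    (h : IsLpW10 p P Q u G) (h' : IsLpW10 p P Q u' G') :
    IsLpW10 p P Q (fun z => u z + u' z) (fun z => G z + G' z) :=
  (isLpW10_iff hp).2 (add_mem_lpClosure hp (fun _ hs => memLp_elemTensors hp hs)
    ((isLpW10_iff hp).1 h) ((isLpW10_iff hp).1 h'))

theorem IsLpW10.smul (hp : 1 ≤ p) {u : Ω × Sp d → ℝ} {G : Ω × Sp d → Sp d}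
    (h : IsLpW10 p P Q u G) (c : ℝ) : IsLpW10 p P Q (fun z => c * u z) (fun z => c • G z) :=
  (isLpW10_iff hp).2 (smul_mem_lpClosure c ((isLpW10_iff hp).1 h))

theorem IsLpW10.sum (hp : 1 ≤ p) {ι : Type*} (t : Finset ι) {u : ι → Ω × Sp d → ℝ}
    {G : ι → Ω × Sp d → Sp d} (h : ∀ i ∈ t, IsLpW10 p P Q (u i) (G i)) :
    IsLpW10 p P Q (fun z => ∑ i ∈ t, u i z) (fun z => ∑ i ∈ t, G i z) := by
  have := sum_mem_lpClosure hp (fun _ hs => memLp_elemTensors hp hs) t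
    fun i hi => (isLpW10_iff hp).1 (h i hi)
  refine (isLpW10_iff hp).2 ?_
  convert this using 1
  ext1 z
  rw [Finset.sum_apply]
  simp [Prod.ext_iff, Prod.fst_sum, Prod.snd_sum]

/-- `L^p(Ω) ⊗ W^{1,p}_0(Q)` is closed. -/
theorem IsLpW10.of_tendsto (hp : 1 ≤ p) {u : ℕ → Ω × Sp d → ℝ} {G : ℕ → Ω × Sp d → Sp d}
    {u₀ : Ω × Sp d → ℝ} {G₀ : Ω × Sp d → Sp d} (h : ∀ n, IsLpW10 p P Q (u n) (G n))
    (hu₀ : MemLp u₀ (ENNReal.ofReal p) (prodMeas P Q))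
    (hG₀ : MemLp G₀ (ENNReal.ofReal p) (prodMeas P Q))
    (hu : Tendsto (fun n => eLpNorm (fun z => u n z - u₀ z) (ENNReal.ofReal p) (prodMeas P Q))
      atTop (𝓝 0))
    (hG : Tendsto (fun n => eLpNorm (fun z => G n z - G₀ z) (ENNReal.ofReal p) (prodMeas P Q))
      atTop (𝓝 0)) : IsLpW10 p P Q u₀ G₀ := by
  refine (isLpW10_iff hp).2 (lpClosure_trans
    (T := LpClosure p (prodMeas P Q) (elemTensors p P Q : Set _)) hp
    (fun s hs => memLp_elemTensors hp hs) le_rfl ?_)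
  refine mem_lpClosure_iff_seq.2 ⟨memLp_pair hp hu₀ hG₀, fun n z => (u n z, G n z),
    fun n => (isLpW10_iff hp).1 (h n), ?_⟩
  have h1 := hu.add hG
  rw [add_zero] at h1
  refine tendsto_of_tendsto_of_tendsto_of_le_of_le tendsto_const_nhds h1 (fun _ => zero_le)
    fun n => ?_
  exact eLpNorm_pair_le hp ((h n).memLp.1.sub hu₀.1) ((h n).memLp_grad.1.sub hG₀.1)

/-- Multiplication of a function and its gradient by a test function. -/
noncomputable def mulTest (θ : Sp d → ℝ) (f : Ω × Sp d → ℝ × Sp d) (z : Ω × Sp d) : ℝ × Sp d :=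
  (θ z.2 * (f z).1, θ z.2 • (f z).2 + (f z).1 • gradient θ z.2)

theorem mulTest_mem {θ : Sp d → ℝ} (hθ : IsTest θ) {f : Ω × Sp d → ℝ × Sp d}
    (hf : f ∈ elemTensors p P Q) : mulTest θ f ∈ elemTensors p P Q := by
  induction hf using Submodule.span_induction with
  | mem f hf =>
    obtain ⟨φ, s, hφ, ⟨η, hη, hηQ, rfl⟩, rfl⟩ := hf
    refine Submodule.subset_span ⟨φ, _, hφ, ⟨fun x => θ x * η x, ⟨hθ.1.mul hη.1, hη.2.mul_left⟩,
      (tsupport_mul_subset_right).trans hηQ, rfl⟩, ?_⟩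
    ext1 z
    simp only [mulTest, gradient_mul hθ.differentiable hη.differentiable, Prod.smul_mk,
      smul_eq_mul, Prod.mk.injEq]
    refine ⟨by ring, ?_⟩
    simp only [smul_add, smul_smul]
    congr 2
    ring
  | zero =>
    convert (elemTensors p P Q).zero_mem using 1
    ext1 z
    simp [mulTest]
  | add f g _ _ hf hg =>
    convert (elemTensors p P Q).add_mem hf hg using 1
    ext1 z
    simp only [mulTest, Pi.add_apply, Prod.fst_add, Prod.snd_add, Prod.mk_add_mk, Prod.mk.injEq]
    refine ⟨by ring, ?_⟩
    simp only [smul_add, add_smul]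
    abel
  | smul c f _ hf =>
    convert (elemTensors p P Q).smul_mem c hf using 1
    ext1 z
    simp only [mulTest, Pi.smul_apply, Prod.smul_fst, Prod.smul_snd, Prod.smul_mk, Prod.mk.injEq,
      smul_eq_mul]
    refine ⟨by ring, ?_⟩
    simp only [smul_add, smul_smul]
    congr 2
    ring

/-- The product rule defines a linear map bounded in `L^p` that keeps elementary tensors elementary,
so it maps the closure into itself. It serves to localize identities in `x`. -/
theorem IsLpW10.mul_test (hp : 1 ≤ p) [SFinite P] {θ : Sp d → ℝ} (hθ : IsTest θ)
    {u : Ω × Sp d → ℝ} {G : Ω × Sp d → Sp d} (h : IsLpW10 p P Q u G) :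
    IsLpW10 p P Q (fun z => θ z.2 * u z) (fun z => θ z.2 • G z + u z • gradient θ z.2) := by
  obtain ⟨C, hC⟩ := hθ.exists_bound
  obtain ⟨C', hC'⟩ := hθ.continuous_gradient.bounded_above_of_compact_support
    hθ.hasCompactSupport_gradient
  have hgm : AEStronglyMeasurable (fun z : Ω × Sp d => gradient θ z.2) (prodMeas P Q) :=
    hθ.continuous_gradient.aestronglyMeasurable.comp_snd
  have hbd : ∀ f : Ω × Sp d → ℝ × Sp d, ∀ z, ‖mulTest θ f z‖ ≤ (C + C') * ‖f z‖ := fun f z => by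
    have h1 := norm_fst_le (f z)
    have h2 := norm_snd_le (f z)
    have hC0 : 0 ≤ C := (abs_nonneg _).trans (hC 0)
    have hC0' : 0 ≤ C' := (norm_nonneg _).trans (hC' 0)
    have h3 : |θ z.2| * ‖(f z).1‖ ≤ C * ‖f z‖ :=
      mul_le_mul (hC _) h1 (norm_nonneg _) hC0
    have h4 : |θ z.2| * ‖(f z).2‖ ≤ C * ‖f z‖ :=
      mul_le_mul (hC _) h2 (norm_nonneg _) hC0
    have h5 : ‖(f z).1‖ * ‖gradient θ z.2‖ ≤ ‖f z‖ * C' :=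
      mul_le_mul h1 (hC' _) (norm_nonneg _) (norm_nonneg _)
    refine max_le ?_ ?_
    · simp only [mulTest]
      rw [norm_mul, Real.norm_eq_abs]
      nlinarith [mul_nonneg hC0' (norm_nonneg (f z))]
    · simp only [mulTest]
      refine (norm_add_le _ _).trans ?_
      rw [norm_smul, norm_smul, Real.norm_eq_abs]
      linarith
  have hm : MemLp (mulTest θ fun z => (u z, G z)) (ENNReal.ofReal p) (prodMeas P Q) := by
    refine memLp_pair hp (hθ.memLp_smul h.memLp) ((hθ.memLp_smul h.memLp_grad).add ?_)
    refine h.memLp.of_le_mul (c := C') (h.memLp.1.smul hgm) (ae_of_all _ fun z => ?_)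
    rw [norm_smul, mul_comm]
    exact mul_le_mul_of_nonneg_right (hC' _) (norm_nonneg _)
  refine (isLpW10_iff hp).2 (map_mem_lpClosure (mulTest θ)
    (C := ENNReal.ofReal (C + C')) ENNReal.ofReal_ne_top
    (fun s hs => memLp_elemTensors hp hs) (fun f s _ _ => ?_)
    (fun s hs => mulTest_mem hθ hs) ((isLpW10_iff hp).1 h) hm)
  refine eLpNorm_le_mul_eLpNorm_of_ae_le_mul (ae_of_all _ fun z => ?_) _
  have h1 : mulTest θ f z - mulTest θ s z = mulTest θ (fun z => f z - s z) z := by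
    simp only [mulTest, Prod.mk_sub_mk, Prod.fst_sub, Prod.snd_sub, Prod.mk.injEq]
    refine ⟨by ring, ?_⟩
    simp only [smul_sub, sub_smul]
    abel
  rw [h1]
  exact hbd _ z

theorem integral_gradient_test {η : Sp d → ℝ} (hη : IsTest η) : ∫ x, gradient η x = 0 := by
  ext i
  have h0 := hη.continuous_gradient.integrable_of_hasCompactSupport (μ := (volume : Measure (Sp d)))
    hη.hasCompactSupport_gradient
  have h1 : (∫ x, gradient η x) i = ∫ x, gradient η x i :=
    ((EuclideanSpace.proj (𝕜 := ℝ) i).integral_comp_comm h0).symm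
  rw [h1]
  have h2 : Integrable fun x => gradient η x i :=
    (hη.continuous_gradient_apply i).integrable_of_hasCompactSupport
      (hη.hasCompactSupport_gradient_apply i)
  simp only [gradient_apply] at h2 ⊢
  have h3 := integral_mul_fderiv_eq_neg_fderiv_mul_of_integrable (μ := (volume : Measure (Sp d)))
    (f := fun _ => (1 : ℝ)) (g := η) (v := EuclideanSpace.single i (1 : ℝ)) (by simp)
    (by simpa using h2) (by simpa using hη.continuous.integrable_of_hasCompactSupport hη.2)
    (fun x _ => differentiableAt_const _) (fun x _ => hη.differentiable x)
  simpa using h3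

/-- Gradients of compactly supported functions have mean zero, and `ψ` does not depend on `x`. -/
theorem IsLpW10.integral_inner_eq_zero (hpq : p.HolderConjugate q) [IsFiniteMeasure P]
    (hQ : Bornology.IsBounded Q) {u : Ω × Sp d → ℝ} {G : Ω × Sp d → Sp d}
    (h : IsLpW10 p P Q u G) {ψ : Ω → Sp d} (hψ : MemLp ψ (ENNReal.ofReal q) P) :
    ∫ z, (inner ℝ (G z) (ψ z.1) : ℝ) ∂(prodMeas P Q) = 0 := by
  have := isFiniteMeasure_restrict hQ
  have hp := hpq.lt.le
  let T : (Ω × Sp d → ℝ × Sp d) → Ω × Sp d → Sp d := fun f z => (f z).2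
  have hmem : T (fun z => (u z, G z)) ∈ LpClosure p (prodMeas P Q)
      (T '' (elemTensors p P Q : Set _)) :=
    map_mem_lpClosure T ENNReal.one_ne_top (fun s hs => memLp_elemTensors hp hs)
      (fun f s _ _ => by
        rw [one_mul]
        exact eLpNorm_snd_le (fun x => f x - s x) _) (fun s hs => Set.mem_image_of_mem T hs)
      ((isLpW10_iff hp).1 h) h.memLp_grad
  refine integral_inner_eq_zero_of_mem_lpClosure (f := T fun z => (u z, G z)) hpq ?_
    (hψ.comp_fst _) ?_ hmem
  · rintro _ ⟨s, hs, rfl⟩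
    exact memLp_snd (memLp_elemTensors hp hs)
  · rintro _ ⟨s, hs, rfl⟩
    have h0 := integral_inner_integral hpq (memLp_snd (memLp_elemTensors hp hs)) hψ
    refine h0.symm.trans ?_
    have : ∀ ω, ∫ x in Q, (s (ω, x)).2 = 0 := fun ω => by
      obtain ⟨η, hη, hηQ, h1⟩ := section_elemTensors hs ω
      have h2 : ∀ x, (s (ω, x)).2 = gradient η x := fun x => congrArg Prod.snd (congrFun h1 x)
      simp only [h2]
      rw [setIntegral_eq_integral_of_forall_compl_eq_zero fun x hx => ?_,
        integral_gradient_test hη]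
      by_contra hne
      refine hx (hηQ (support_fderiv_subset ℝ (f := η) fun h0 => hne ?_))
      simp [gradient, h0]
    simp [this]

/-- The difference `D` of the gradients belongs to a function vanishing almost everywhere, so `θ D`
is a gradient for every test function `θ` and has mean zero against all `ψ(ω)`. -/
theorem IsLpW10.gradient_unique (hpq : p.HolderConjugate q) [IsFiniteMeasure P]
    (hQ : Bornology.IsBounded Q) {u u' : Ω × Sp d → ℝ} {G G' : Ω × Sp d → Sp d}
    (h : IsLpW10 p P Q u G) (h' : IsLpW10 p P Q u' G') (hu : u =ᵐ[prodMeas P Q] u') :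
    G =ᵐ[prodMeas P Q] G' := by
  have hp := hpq.lt.le
  have h1 := h.add hp (h'.smul hp (-1))
  have h2 : (fun z => G z + (-1 : ℝ) • G' z) =ᵐ[prodMeas P Q] 0 := by
    refine ae_eq_zero_of_integral_test hpq hQ h1.memLp_grad fun θ hθ ψ hψ => ?_
    rw [← (h1.mul_test hp hθ).integral_inner_eq_zero hpq hQ hψ]
    refine integral_congr_ae ?_
    filter_upwards [hu] with z hz
    simp [hz]
  filter_upwards [h2] with z hz
  simpa [← sub_eq_add_neg, sub_eq_zero] using hz

/-- For elementary tensors every section is a test function; integrate the `p`-th power of the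
deterministic inequality over `Ω` and pass to the closure. -/
theorem exists_poincare (hd : 0 < d) (hp : 1 < p) [SFinite P] (hQm : MeasurableSet Q)
    (hQ : Bornology.IsBounded Q) :
    ∃ C : ℝ≥0∞, C ≠ ∞ ∧ ∀ (u : Ω × Sp d → ℝ) (G : Ω × Sp d → Sp d), IsLpW10 p P Q u G →
      eLpNorm u (ENNReal.ofReal p) (prodMeas P Q) ≤
        C * eLpNorm G (ENNReal.ofReal p) (prodMeas P Q) := by
  obtain ⟨C, hC, hCQ⟩ := exists_poincare_test hd hp hQm hQ
  have hp0 : 0 < p := by linarith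
  have hp1 : 1 ≤ ENNReal.ofReal p := by simpa using hp.le
  refine ⟨C, hC, fun u G h => ?_⟩
  have hs : ∀ s ∈ elemTensors p P Q, eLpNorm (fun z => (s z).1) (ENNReal.ofReal p) (prodMeas P Q) ≤
      C * eLpNorm (fun z => (s z).2) (ENNReal.ofReal p) (prodMeas P Q) := fun s hs => by
    have hm := memLp_elemTensors hp.le hs
    rw [eLpNorm_le_iff hp0, ENNReal.mul_rpow_of_nonneg _ _ hp0.le, eLpNorm_rpow_eq hp0,
      lintegral_enorm_rpow_prod hp0 (memLp_fst hm).1,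
      lintegral_enorm_rpow_prod hp0 (memLp_snd hm).1,
      ← lintegral_const_mul'' _ ((aemeasurable_eLpNorm_section hp0 (memLp_snd hm).1).pow_const p)]
    refine lintegral_mono fun ω => ?_
    rw [← ENNReal.mul_rpow_of_nonneg _ _ hp0.le]
    obtain ⟨η, hη, hηQ, h1⟩ := section_elemTensors hs ω
    have h2 : ∀ x, s (ω, x) = (η x, gradient η x) := fun x => congrFun h1 x
    simp only [h2]
    exact ENNReal.rpow_le_rpow (hCQ η hη hηQ) hp0.le
  obtain ⟨hm, s, hsm, hlim⟩ := mem_lpClosure_iff_seq.1 ((isLpW10_iff hp.le).1 h)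
  set a : ℕ → ℝ≥0∞ := fun n => eLpNorm (fun x => s n x - (u x, G x)) (ENNReal.ofReal p)
    (prodMeas P Q)
  have hle : ∀ n, eLpNorm u (ENNReal.ofReal p) (prodMeas P Q) ≤
      a n + C * (a n + eLpNorm G (ENNReal.ofReal p) (prodMeas P Q)) := fun n => by
    have hsn := memLp_elemTensors hp.le (hsm n)
    have h1 : eLpNorm (fun z => (s n z).1 - u z) (ENNReal.ofReal p) (prodMeas P Q) ≤ a n :=
      eLpNorm_fst_le (fun x => s n x - (u x, G x)) _
    have h2 : eLpNorm (fun z => (s n z).2 - G z) (ENNReal.ofReal p) (prodMeas P Q) ≤ a n :=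
      eLpNorm_snd_le (fun x => s n x - (u x, G x)) _
    have h3 : eLpNorm u (ENNReal.ofReal p) (prodMeas P Q) ≤
        eLpNorm (fun z => (s n z).1 - u z) (ENNReal.ofReal p) (prodMeas P Q) +
          eLpNorm (fun z => (s n z).1) (ENNReal.ofReal p) (prodMeas P Q) := by
      have := eLpNorm_sub_le (memLp_fst hsn).1 ((memLp_fst hsn).1.sub h.memLp.1) hp1
      rw [add_comm]
      simpa [Pi.sub_def] using this
    have h4 : eLpNorm (fun z => (s n z).2) (ENNReal.ofReal p) (prodMeas P Q) ≤
        eLpNorm (fun z => (s n z).2 - G z) (ENNReal.ofReal p) (prodMeas P Q) +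
          eLpNorm G (ENNReal.ofReal p) (prodMeas P Q) := by
      have := eLpNorm_add_le ((memLp_snd hsn).1.sub h.memLp_grad.1) h.memLp_grad.1 hp1
      simpa [Pi.sub_def, Pi.add_def] using this
    refine h3.trans (add_le_add h1 ((hs _ (hsm n)).trans ?_))
    gcongr
    exact h4.trans (add_le_add h2 le_rfl)
  have h5 := hlim.add (ENNReal.Tendsto.const_mul (a := C)
    (hlim.add_const (eLpNorm G (ENNReal.ofReal p) (prodMeas P Q))) (Or.inr hC))
  simpa using ge_of_tendsto' h5 hle

end LpW10

/-! ### Measurability of compositions -/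

section Caratheodory

variable {α : Type*} [MeasurableSpace α] {μ : Measure α} {F : Type*} [NormedAddCommGroup F]

omit [NormedAddCommGroup F] in
theorem aemeasurable_comp_simpleFunc {W : α → F → ℝ} (hW : ∀ v, AEMeasurable (fun z => W z v) μ)
    (s : SimpleFunc α F) : AEMeasurable (fun z => W z (s z)) μ := by
  have h : (fun z => W z (s z)) = fun z => ∑ v ∈ s.range,
      (s ⁻¹' {v}).indicator (fun z => W z v) z := by
    ext z
    rw [Finset.sum_eq_single (s z)]
    · simp
    · intro v _ hv
      exact Set.indicator_of_notMem (fun h => hv h.symm) _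
    · intro h
      exact absurd (s.mem_range_self z) h
  rw [h]
  exact Finset.aemeasurable_fun_sum _ fun v _ => (hW v).indicator (s.measurableSet_fiber v)

/-- Approximate `Γ` by simple functions and use continuity in the last variable, which for the
integrand follows from convexity. -/
theorem aemeasurable_caratheodory {W : α → F → ℝ} (hW : ∀ v, AEMeasurable (fun z => W z v) μ)
    (hc : ∀ᵐ z ∂μ, Continuous (W z)) {Γ : α → F} (hΓ : AEStronglyMeasurable Γ μ) :
    AEMeasurable (fun z => W z (Γ z)) μ := by
  obtain ⟨Γ', hΓ', heq⟩ := hΓ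
  have hlim : ∀ᵐ z ∂μ, Tendsto (fun n => W z (hΓ'.approx n z)) atTop (𝓝 (W z (Γ' z))) := by
    filter_upwards [hc] with z hz
    exact (hz.tendsto _).comp (hΓ'.tendsto_approx z)
  have h1 := aemeasurable_of_tendsto_metrizable_ae atTop
    (fun n => aemeasurable_comp_simpleFunc hW (hΓ'.approx n)) hlim
  refine h1.congr ?_
  filter_upwards [heq] with z hz
  rw [hz]

end Caratheodory

/-! ### Extended integrals -/

section Eint

variable {α : Type*} [MeasurableSpace α] {μ : Measure α}

theorem eint_mono {f g : α → EReal} (h : ∀ᵐ a ∂μ, f a ≤ g a) : eint μ f ≤ eint μ g := by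
  refine EReal.sub_le_sub ?_ ?_
  · refine EReal.coe_ennreal_le_coe_ennreal_iff.2 (lintegral_mono_ae ?_)
    filter_upwards [h] with a ha
    exact EReal.toENNReal_le_toENNReal ha
  · refine EReal.coe_ennreal_le_coe_ennreal_iff.2 (lintegral_mono_ae ?_)
    filter_upwards [h] with a ha
    exact EReal.toENNReal_le_toENNReal (EReal.neg_le_neg_iff.2 ha)

theorem eint_congr {f g : α → EReal} (h : f =ᵐ[μ] g) : eint μ f = eint μ g :=
  le_antisymm (eint_mono (h.mono fun _ h => h.le)) (eint_mono (h.mono fun _ h => h.ge))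

/-- Both `(h - c)⁺ + c` and `(c - h)⁺ + h` are `max h c`; integrating and subtracting the finite
terms gives the formula even when `h` has infinite integral. It reduces extended integrals of
functions bounded below to `lintegral`. -/
theorem eint_sub_const [IsFiniteMeasure μ] {h : α → ℝ≥0∞} (hh : AEMeasurable h μ) {c : ℝ≥0∞}
    (hc : c ≠ ∞) : eint μ (fun a => (h a : EReal) - (c : EReal)) =
      ((∫⁻ a, h a ∂μ : ℝ≥0∞) : EReal) - ((c * μ Set.univ : ℝ≥0∞) : EReal) := by
  have h1 : ∀ a, ((h a : EReal) - (c : EReal)).toENNReal = h a - c := fun a => by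
    rw [EReal.toENNReal_sub (EReal.coe_ennreal_nonneg _)]
    simp
  have h2 : ∀ a, (-((h a : EReal) - (c : EReal))).toENNReal = c - h a := fun a => by
    rw [EReal.neg_sub (Or.inr (by simp)) (Or.inr (by simp [hc])), add_comm,
      ← sub_eq_add_neg, EReal.toENNReal_sub (EReal.coe_ennreal_nonneg _)]
    simp
  rw [eint]
  simp only [h1, h2]
  set A := ∫⁻ a, (h a - c) ∂μ
  set B := ∫⁻ a, (c - h a) ∂μ
  set H := ∫⁻ a, h a ∂μ
  have hM : c * μ Set.univ ≠ ∞ := ENNReal.mul_ne_top hc (measure_ne_top _ _)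
  have hB : B ≠ ∞ := by
    refine ne_top_of_le_ne_top hM ?_
    rw [← lintegral_const]
    exact lintegral_mono fun a => tsub_le_self
  have hAB : A + c * μ Set.univ = H + B := by
    rw [← lintegral_const, ← lintegral_add_right _ measurable_const, ← lintegral_add_left' hh]
    refine lintegral_congr fun a => ?_
    rw [tsub_add_eq_max, add_tsub_eq_max]
  clear_value A B H
  generalize c * μ Set.univ = M at *
  lift M to NNReal using hM
  lift B to NNReal using hB
  by_cases hA : A = ∞
  · have hH : H = ∞ := by
      rw [hA, top_add] at hAB
      simpa using hAB.symm
    rw [hA, hH]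
    simp
  · have hH : H ≠ ∞ := by
      intro hH
      rw [hH, top_add] at hAB
      simp [hA] at hAB
    lift A to NNReal using hA
    lift H to NNReal using hH
    have h3 : (A : ℝ) + M = H + B := by exact_mod_cast hAB
    have h4 : (A : ℝ) - B = H - M := by linarith
    simp only [EReal.coe_nnreal_eq_coe_real, ← EReal.coe_sub, h4]

theorem eint_real [IsFiniteMeasure μ] {f : α → ℝ} (hf : AEMeasurable f μ) {C : ℝ} (hC : 0 ≤ C)
    (hfC : ∀ᵐ a ∂μ, -C ≤ f a) : eint μ (fun a => (f a : EReal)) =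
      ((∫⁻ a, ENNReal.ofReal (f a + C) ∂μ : ℝ≥0∞) : EReal) -
        ((ENNReal.ofReal C * μ Set.univ : ℝ≥0∞) : EReal) := by
  rw [← eint_sub_const (hf.add_const C).ennreal_ofReal ENNReal.ofReal_ne_top]
  refine eint_congr ?_
  filter_upwards [hfC] with a ha
  rw [EReal.coe_ennreal_ofReal, EReal.coe_ennreal_ofReal, max_eq_left (by linarith),
    max_eq_left hC, ← EReal.coe_sub]
  simp

end Eint

/-! ### Averages over the probability space -/

section Avg

variable {Ω : Type*} [MeasurableSpace Ω] {d : ℕ} {P : Measure Ω} {Q : Set (Sp d)} {p : ℝ}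
  {F : Type*} [NormedAddCommGroup F] [NormedSpace ℝ F]

/-- The average over `Ω`, as a function on `Ω × ℝ^d`. -/
noncomputable def avg (P : Measure Ω) (Γ : Ω × Sp d → F) (x : Sp d) : F := ∫ ω, Γ (ω, x) ∂P

theorem aestronglyMeasurable_avg [SFinite P] {Γ : Ω × Sp d → F}
    (hΓ : AEStronglyMeasurable Γ (prodMeas P Q)) :
    AEStronglyMeasurable (avg P Γ) (volume.restrict Q) := by
  have := aestronglyMeasurable_integral_smul (μ := volume.restrict Q) (ν := P)
    (f := fun z => Γ z.swap) hΓ.prod_swap (w := fun _ => 1) aestronglyMeasurable_const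
  simp only [Prod.swap_prod_mk, one_smul] at this
  exact this

theorem eLpNorm_avg_le [IsProbabilityMeasure P] (hp : 1 < p) {Γ : Ω × Sp d → F}
    (hΓ : AEStronglyMeasurable Γ (prodMeas P Q)) :
    eLpNorm (avg P Γ) (ENNReal.ofReal p) (volume.restrict Q) ≤
      eLpNorm Γ (ENNReal.ofReal p) (prodMeas P Q) := by
  obtain ⟨q, hpq⟩ : ∃ q, p.HolderConjugate q := ⟨_, Real.HolderConjugate.conjExponent hp⟩
  have h1 := eLpNorm_integral_smul_le_mul (μ := volume.restrict Q) (ν := P) hpq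
    (f := fun z => Γ z.swap) hΓ.prod_swap (w := fun _ => 1) aestronglyMeasurable_const
  have h2 : eLpNorm (fun _ : Ω => (1 : ℝ)) (ENNReal.ofReal q) P = 1 := by
    rw [eLpNorm_const _ (by simpa using hpq.symm.pos) (IsProbabilityMeasure.ne_zero P)]
    simp
  rw [h2, one_mul, eLpNorm_swap hΓ] at h1
  simp only [Prod.swap_prod_mk, one_smul] at h1
  exact h1

theorem memLp_avg [IsProbabilityMeasure P] (hp : 1 < p) {Γ : Ω × Sp d → F}
    (hΓ : MemLp Γ (ENNReal.ofReal p) (prodMeas P Q)) :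
    MemLp (avg P Γ) (ENNReal.ofReal p) (volume.restrict Q) :=
  ⟨aestronglyMeasurable_avg hΓ.1, (eLpNorm_avg_le hp hΓ.1).trans_lt hΓ.2⟩

theorem avg_sub_ae [IsProbabilityMeasure P] (hp : 1 < p) {Γ Γ' : Ω × Sp d → F}
    (hΓ : MemLp Γ (ENNReal.ofReal p) (prodMeas P Q))
    (hΓ' : MemLp Γ' (ENNReal.ofReal p) (prodMeas P Q)) :
    avg P (fun z => Γ z - Γ' z) =ᵐ[volume.restrict Q] fun x => avg P Γ x - avg P Γ' x := by
  have hp1 : 1 ≤ ENNReal.ofReal p := by simpa using hp.le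
  filter_upwards [MemLp_section' (by linarith) hΓ, MemLp_section' (by linarith) hΓ'] with x h1 h2
  exact integral_sub (h1.integrable hp1) (h2.integrable hp1)

/-- Convergence in `L^p` gives almost everywhere convergence of a subsequence, together with its
averages. -/
theorem exists_subseq_tendsto_avg [IsProbabilityMeasure P] (hp : 1 < p) {Γ : ℕ → Ω × Sp d → F}
    {Γ₀ : Ω × Sp d → F} (hΓ : ∀ n, MemLp (Γ n) (ENNReal.ofReal p) (prodMeas P Q))
    (hΓ₀ : MemLp Γ₀ (ENNReal.ofReal p) (prodMeas P Q))
    (h : Tendsto (fun n => eLpNorm (fun z => Γ n z - Γ₀ z) (ENNReal.ofReal p) (prodMeas P Q))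
      atTop (𝓝 0)) :
    ∃ k : ℕ → ℕ, StrictMono k ∧ ∀ᵐ z ∂(prodMeas P Q),
      Tendsto (fun n => Γ (k n) z) atTop (𝓝 (Γ₀ z)) ∧
      Tendsto (fun n => avg P (Γ (k n)) z.2) atTop (𝓝 (avg P Γ₀ z.2)) := by
  have hp0 : ENNReal.ofReal p ≠ 0 := by simpa using (by linarith : 0 < p)
  obtain ⟨k₁, hk₁, h1⟩ := (tendstoInMeasure_of_tendsto_eLpNorm hp0 (fun n => (hΓ n).1) hΓ₀.1
    h).exists_seq_tendsto_ae
  have h2 : Tendsto (fun n => eLpNorm (avg P (Γ (k₁ n)) - avg P Γ₀) (ENNReal.ofReal p)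
      (volume.restrict Q)) atTop (𝓝 0) := by
    refine tendsto_of_tendsto_of_tendsto_of_le_of_le tendsto_const_nhds
      (h.comp hk₁.tendsto_atTop) (fun _ => zero_le) fun n => ?_
    refine le_trans (le_of_eq (eLpNorm_congr_ae (avg_sub_ae hp (hΓ _) hΓ₀).symm)) ?_
    exact eLpNorm_avg_le hp ((hΓ _).1.sub hΓ₀.1)
  obtain ⟨k₂, hk₂, h3⟩ := (tendstoInMeasure_of_tendsto_eLpNorm hp0
    (fun n => aestronglyMeasurable_avg (hΓ _).1) (aestronglyMeasurable_avg hΓ₀.1)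
    h2).exists_seq_tendsto_ae
  refine ⟨fun n => k₁ (k₂ n), hk₁.comp hk₂, ?_⟩
  filter_upwards [h1, Measure.quasiMeasurePreserving_snd.ae h3] with z hz1 hz2
  exact ⟨hz1.comp hk₂.tendsto_atTop, hz2⟩

end Avg

/-! ### The unfolded energy -/

section UnfoldedEnergy

variable {Ω : Type*} [MeasurableSpace Ω] {d : ℕ} {p : ℝ} {P : Measure Ω} {Q : Set (Sp d)}
  {V : Ω → Sp d → Sp d → ℝ} {C δ : ℝ} {lam : Ω → ℝ}

/-- The degenerate growth condition with constant `C` and weight `lam`. -/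
structure HasGrowth (p : ℝ) (P : Measure Ω) (Q : Set (Sp d)) (V : Ω → Sp d → Sp d → ℝ) (C : ℝ)
    (lam : Ω → ℝ) : Prop where
  pos : 0 < C
  integrable : Integrable lam P
  lam_pos : ∀ᵐ ω ∂P, 0 < lam ω
  dual : (∫⁻ ω, ENNReal.ofReal (lam ω) ^ (-(1 / (p - 1))) ∂P) ^ (p - 1) < ENNReal.ofReal C
  bound : ∀ᵐ z ∂(prodMeas P Q), ∀ F : Sp d,
    lam z.1 * ‖F‖ ^ p - C ≤ V z.1 z.2 F ∧ V z.1 z.2 F ≤ C * (lam z.1 * ‖F‖ ^ p + 1)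

theorem IsDegenerateIntegrand.exists_growth (hV : IsDegenerateIntegrand p P Q V) :
    ∃ C lam, HasGrowth p P Q V C lam := by
  obtain ⟨C, h1, lam, h2, h3, h4, h5⟩ := hV.growth
  exact ⟨C, lam, h1, h2, h3, h4, h5⟩

theorem IsDegenerateIntegrand.continuous (hV : IsDegenerateIntegrand p P Q V) :
    ∀ᵐ z ∂(prodMeas P Q), Continuous (V z.1 z.2) :=
  hV.convex.mono fun _ h => h.locallyLipschitz.continuous

/-- The energy density of a vector field, shifted by the growth constant. -/
noncomputable def density (p : ℝ) (P : Measure Ω) (V : Ω → Sp d → Sp d → ℝ) (C δ : ℝ)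
    (Γ : Ω × Sp d → Sp d) (z : Ω × Sp d) : ℝ :=
  V z.1 z.2 (Γ z) + C + δ * ‖Γ z - avg P Γ z.2‖ ^ p

/-- The energy of a vector field on `Ω × Q`, shifted by a constant. -/
noncomputable def uEnergy (p : ℝ) (P : Measure Ω) (Q : Set (Sp d)) (V : Ω → Sp d → Sp d → ℝ)
    (C δ : ℝ) (Γ : Ω × Sp d → Sp d) : ℝ≥0∞ :=
  ∫⁻ z, ENNReal.ofReal (density p P V C δ Γ z) ∂(prodMeas P Q)

theorem aemeasurable_density [SFinite P] (hV : IsDegenerateIntegrand p P Q V)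
    {Γ : Ω × Sp d → Sp d} (hΓ : AEStronglyMeasurable Γ (prodMeas P Q)) :
    AEMeasurable (density p P V C δ Γ) (prodMeas P Q) :=
  ((aemeasurable_caratheodory hV.measurable hV.continuous hΓ).add_const C).add
    (((hΓ.sub (aestronglyMeasurable_avg hΓ).comp_snd).norm.aemeasurable.pow_const p).const_mul δ)

theorem HasGrowth.le_density (hg : HasGrowth p P Q V C lam) (Γ : Ω × Sp d → Sp d) :
    ∀ᵐ z ∂(prodMeas P Q), lam z.1 * ‖Γ z‖ ^ p + δ * ‖Γ z - avg P Γ z.2‖ ^ p ≤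
      density p P V C δ Γ z := by
  filter_upwards [hg.bound] with z hz
  have := (hz (Γ z)).1
  simp only [density]
  linarith

theorem HasGrowth.lam_pos_prod [SFinite P] (hg : HasGrowth p P Q V C lam) :
    ∀ᵐ z ∂(prodMeas P Q), 0 < lam z.1 :=
  Measure.quasiMeasurePreserving_fst.ae hg.lam_pos

theorem avg_congr [SFinite P] {F : Type*} [NormedAddCommGroup F] [NormedSpace ℝ F]
    {Γ Γ' : Ω × Sp d → F} (h : Γ =ᵐ[prodMeas P Q] Γ') :
    ∀ᵐ x ∂(volume.restrict Q), avg P Γ x = avg P Γ' x := by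
  have h1 : ∀ᵐ z ∂((volume.restrict Q).prod P), Γ z.swap = Γ' z.swap :=
    Measure.measurePreserving_swap.quasiMeasurePreserving.ae h
  filter_upwards [Measure.ae_ae_of_ae_prod h1] with x hx
  exact integral_congr_ae hx

/-- At fixed `x`, unfolding is a single measure-preserving shift in `ω`. The nonlocal term of the
energy is thus unaffected by unfolding. -/
theorem avg_unf {τ : Sp d → Ω → Ω} (hτ : IsStationary P τ) {ε : ℝ} {Γ : Ω × Sp d → Sp d}
    (hΓ : AEStronglyMeasurable Γ (prodMeas P Q)) :
    ∀ᵐ x ∂(volume.restrict Q), avg P (unf τ ε Γ) x = avg P Γ x := by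
  have := hτ.prob
  have h1 : AEStronglyMeasurable (fun z : Sp d × Ω => Γ z.swap) ((volume.restrict Q).prod P) :=
    hΓ.prod_swap
  filter_upwards [h1.prodMk_left] with x hx
  exact integral_shift hτ (φ := fun ω => Γ (ω, x)) hx (-(ε⁻¹ • x))

theorem restrict_ac : volume.restrict Q ≪ volume :=
  (Measure.restrict_le_self (μ := volume) (s := Q)).absolutelyContinuous

theorem unf_nullPreserving {τ : Sp d → Ω → Ω} (hτ : IsStationary P τ) {ε : ℝ} (hε : 0 < ε) :
    NullPreserving (skew τ (-ε⁻¹)) (prodMeas P Q) :=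
  skew_nullPreserving hτ (neg_ne_zero.2 (inv_ne_zero hε.ne')) restrict_ac

theorem memLp_unf {τ : Sp d → Ω → Ω} (hτ : IsStationary P τ) (hp : 0 < p) {ε : ℝ} (hε : 0 < ε)
    {F : Type*} [NormedAddCommGroup F] [SecondCountableTopology F] {u : Ω × Sp d → F}
    (hu : MemLp u (ENNReal.ofReal p) (prodMeas P Q)) :
    MemLp (unf τ ε u) (ENNReal.ofReal p) (prodMeas P Q) := by
  rw [unf_eq_skew]
  exact (unf_nullPreserving hτ hε).memLp_comp hp hu

theorem eLpNorm_unf {τ : Sp d → Ω → Ω} (hτ : IsStationary P τ) (hp : 0 < p) {ε : ℝ} (hε : 0 < ε)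
    {F : Type*} [NormedAddCommGroup F] {u : Ω × Sp d → F}
    (hu : AEStronglyMeasurable u (prodMeas P Q)) :
    eLpNorm (unf τ ε u) (ENNReal.ofReal p) (prodMeas P Q) =
      eLpNorm u (ENNReal.ofReal p) (prodMeas P Q) := by
  rw [unf_eq_skew]
  exact (unf_nullPreserving hτ hε).eLpNorm_comp hp hu

/-- The energy of `u` in terms of its unfolded gradient. -/
theorem energy_eq {τ : Sp d → Ω → Ω} (hτ : IsStationary P τ) (hp : 1 < p)
    (hQ : Bornology.IsBounded Q) (hV : IsDegenerateIntegrand p P Q V)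
    (hg : HasGrowth p P Q V C lam) (hδ : 0 ≤ δ) {ε : ℝ} (hε : 0 < ε) {u : Ω × Sp d → ℝ}
    {G : Ω × Sp d → Sp d} (h : IsLpW10 p P Q u G) :
    energy p P τ Q V ε δ u = (uEnergy p P Q V C δ (unf τ ε G) : EReal) -
      ((ENNReal.ofReal C * prodMeas P Q Set.univ : ℝ≥0∞) : EReal) := by
  have := hτ.prob
  have := isFiniteMeasure_restrict hQ
  obtain ⟨q, hpq⟩ : ∃ q, p.HolderConjugate q := ⟨_, Real.HolderConjugate.conjExponent hp⟩
  have hskew : NullPreserving (skew τ ε⁻¹) (prodMeas P Q) :=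
    skew_nullPreserving hτ (inv_ne_zero hε.ne') restrict_ac
  have hTm := memLp_unf hτ (by linarith) hε h.memLp_grad
  have hD := aemeasurable_density (C := C) (δ := δ) hV hTm.1
  have hpos := hskew.ae ((hg.le_density (δ := δ) (unf τ ε G)).and hg.lam_pos_prod)
  -- The oscillating integrand at `(ω, x)` is the unfolded one at `(τ_{x/ε} ω, x)`, and this change
  -- of variables preserves `P ⊗ dx`.
  have hdens : ∀ᵐ z ∂(prodMeas P Q), V (τ (ε⁻¹ • z.2) z.1) z.2 (G z) +
      δ * ‖G z - ∫ ω, G (ω, z.2) ∂P‖ ^ p + C = density p P V C δ (unf τ ε G) (skew τ ε⁻¹ z) := by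
    filter_upwards [Measure.quasiMeasurePreserving_snd.ae (avg_unf (ε := ε) hτ h.memLp_grad.1)]
      with z hz
    have h1 : unf τ ε G (skew τ ε⁻¹ z) = G z := by
      rw [unf_eq_skew]
      simp only [skew_skew hτ]
    have h2 : avg P (unf τ ε G) (skew τ ε⁻¹ z).2 = ∫ ω, G (ω, z.2) ∂P := hz
    rw [density, h1, h2]
    simp only [skew]
    ring
  have hmain : eint (prodMeas P Q) (fun z => ((V (τ (ε⁻¹ • z.2) z.1) z.2 (G z) +
      δ * ‖G z - ∫ ω, G (ω, z.2) ∂P‖ ^ p : ℝ) : EReal)) =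
      (uEnergy p P Q V C δ (unf τ ε G) : EReal) -
      ((ENNReal.ofReal C * prodMeas P Q Set.univ : ℝ≥0∞) : EReal) := by
    rw [eint_real (C := C) ?_ hg.pos.le ?_]
    · rw [uEnergy, ← hskew.lintegral_comp hD.ennreal_ofReal]
      congr 2
      refine lintegral_congr_ae ?_
      filter_upwards [hdens] with z hz
      rw [hz]
    · refine ((hskew.aemeasurable hD).sub_const C).congr ?_
      filter_upwards [hdens] with z hz
      rw [← hz]
      ring
    · filter_upwards [hdens, hpos] with z hz hz2
      have h1 : 0 ≤ density p P V C δ (unf τ ε G) (skew τ ε⁻¹ z) := by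
        refine le_trans ?_ hz2.1
        have := hz2.2
        positivity
      linarith
  rw [← hmain]
  -- The infimum ranges over one class of functions equal almost everywhere, so all its terms agree.
  refine le_antisymm (iInf₂_le G h) (le_iInf₂ fun G' h' => le_of_eq ?_)
  have hGG := h.gradient_unique hpq hQ h' EventuallyEq.rfl
  refine eint_congr ?_
  filter_upwards [hGG, Measure.quasiMeasurePreserving_snd.ae (avg_congr hGG)] with z h1 h2
  have h3 : ∫ ω, G (ω, z.2) ∂P = ∫ ω, G' (ω, z.2) ∂P := h2
  rw [h1, h3]

/-! ### Coercivity -/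

theorem lintegral_lam_le (hg : HasGrowth p P Q V C lam) (hδ : 0 ≤ δ) (hp : 0 < p) [SFinite P]
    (Γ : Ω × Sp d → Sp d) :
    ∫⁻ z, ENNReal.ofReal (lam z.1) * ‖Γ z‖ₑ ^ p ∂(prodMeas P Q) ≤ uEnergy p P Q V C δ Γ := by
  refine lintegral_mono_ae ?_
  filter_upwards [hg.le_density (δ := δ) Γ, hg.lam_pos_prod] with z h1 h2
  rw [← ofReal_norm, ENNReal.ofReal_rpow_of_nonneg (norm_nonneg _) hp.le,
    ← ENNReal.ofReal_mul h2.le]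
  refine ENNReal.ofReal_le_ofReal (le_trans ?_ h1)
  have : 0 ≤ δ * ‖Γ z - avg P Γ z.2‖ ^ p := by positivity
  linarith

theorem lintegral_fluctuation_le (hg : HasGrowth p P Q V C lam) (hδ : 0 ≤ δ) (hp : 0 < p)
    [SFinite P] (Γ : Ω × Sp d → Sp d) :
    ENNReal.ofReal δ * ∫⁻ z, ‖Γ z - avg P Γ z.2‖ₑ ^ p ∂(prodMeas P Q) ≤
      uEnergy p P Q V C δ Γ := by
  rw [← lintegral_const_mul' _ _ ENNReal.ofReal_ne_top]
  refine lintegral_mono_ae ?_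
  filter_upwards [hg.le_density (δ := δ) Γ, hg.lam_pos_prod] with z h1 h2
  rw [← ofReal_norm, ENNReal.ofReal_rpow_of_nonneg (norm_nonneg _) hp.le,
    ← ENNReal.ofReal_mul hδ]
  refine ENNReal.ofReal_le_ofReal (le_trans ?_ h1)
  have : 0 ≤ lam z.1 * ‖Γ z‖ ^ p := by positivity
  linarith

/-- The weighted norm controls the average, by the integrability of `lam^{-1/(p-1)}`. -/
theorem enorm_integral_rpow_le (hg : HasGrowth p P Q V C lam) (hp : 1 < p) {f : Ω → Sp d}
    (hf : AEStronglyMeasurable f P) : ‖∫ ω, f ω ∂P‖ₑ ^ p ≤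
      ENNReal.ofReal C * ∫⁻ ω, ENNReal.ofReal (lam ω) * ‖f ω‖ₑ ^ p ∂P := by
  have hp0 : 0 < p := by linarith
  obtain ⟨q, hpq⟩ : ∃ q, p.HolderConjugate q := ⟨_, Real.HolderConjugate.conjExponent hp⟩
  have hq0 := hpq.symm.pos
  have hlm : AEMeasurable (fun ω => ENNReal.ofReal (lam ω)) P :=
    hg.integrable.1.aemeasurable.ennreal_ofReal
  -- Hölder for `λ^{1/p} |f|` and `λ^{-1/p}`; since `q / p = 1 / (p - 1)`, the second factor is the
  -- negative moment of `λ` assumed finite.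
  have h1 := ENNReal.lintegral_mul_le_Lp_mul_Lq P hpq
    ((hlm.pow_const (1 / p)).mul hf.enorm) (hlm.pow_const (-(1 / p)))
  have h2 : ∫⁻ ω, ‖f ω‖ₑ ∂P = ∫⁻ ω, ((fun ω => ENNReal.ofReal (lam ω) ^ (1 / p) * ‖f ω‖ₑ) *
      fun ω => ENNReal.ofReal (lam ω) ^ (-(1 / p))) ω ∂P := by
    refine lintegral_congr_ae ?_
    filter_upwards [hg.lam_pos] with ω hω
    simp only [Pi.mul_apply]
    rw [mul_right_comm, ← ENNReal.rpow_add _ _ (by simpa using hω) ENNReal.ofReal_ne_top]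
    simp
  have h3 : ∀ ω, (ENNReal.ofReal (lam ω) ^ (1 / p) * ‖f ω‖ₑ) ^ p =
      ENNReal.ofReal (lam ω) * ‖f ω‖ₑ ^ p := fun ω => by
    rw [ENNReal.mul_rpow_of_nonneg _ _ hp0.le, ← ENNReal.rpow_mul, one_div,
      inv_mul_cancel₀ hp0.ne', ENNReal.rpow_one]
  have h4 : ∀ ω, (ENNReal.ofReal (lam ω) ^ (-(1 / p))) ^ q =
      ENNReal.ofReal (lam ω) ^ (-(1 / (p - 1))) := fun ω => by
    rw [← ENNReal.rpow_mul]
    congr 1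
    rw [hpq.conjugate_eq]
    have : p - 1 ≠ 0 := by linarith
    field_simp
  simp only [Pi.mul_apply, h3, h4] at h1
  rw [lintegral_congr_ae (ae_of_all _ fun ω => rfl)] at h2
  simp only [Pi.mul_apply] at h2
  calc ‖∫ ω, f ω ∂P‖ₑ ^ p ≤ (∫⁻ ω, ‖f ω‖ₑ ∂P) ^ p :=
        ENNReal.rpow_le_rpow (enorm_integral_le_lintegral_enorm _) hp0.le
    _ ≤ ((∫⁻ ω, ENNReal.ofReal (lam ω) * ‖f ω‖ₑ ^ p ∂P) ^ (1 / p) *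
        (∫⁻ ω, ENNReal.ofReal (lam ω) ^ (-(1 / (p - 1))) ∂P) ^ (1 / q)) ^ p := by
      rw [h2]
      exact ENNReal.rpow_le_rpow h1 hp0.le
    _ = (∫⁻ ω, ENNReal.ofReal (lam ω) * ‖f ω‖ₑ ^ p ∂P) *
        (∫⁻ ω, ENNReal.ofReal (lam ω) ^ (-(1 / (p - 1))) ∂P) ^ (p - 1) := by
      rw [ENNReal.mul_rpow_of_nonneg _ _ hp0.le, ← ENNReal.rpow_mul, ← ENNReal.rpow_mul, one_div,
        inv_mul_cancel₀ hp0.ne', ENNReal.rpow_one]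
      congr 2
      rw [hpq.conjugate_eq]
      have : p - 1 ≠ 0 := by linarith
      field_simp
    _ ≤ ENNReal.ofReal C * ∫⁻ ω, ENNReal.ofReal (lam ω) * ‖f ω‖ₑ ^ p ∂P := by
      rw [mul_comm]
      gcongr
      exact hg.dual.le

theorem lintegral_avg_le (hg : HasGrowth p P Q V C lam) (hp : 1 < p) [SFinite P]
    {Γ : Ω × Sp d → Sp d} (hΓ : AEStronglyMeasurable Γ (prodMeas P Q)) :
    ∫⁻ x in Q, ‖avg P Γ x‖ₑ ^ p ≤ ENNReal.ofReal C *
      ∫⁻ z, ENNReal.ofReal (lam z.1) * ‖Γ z‖ₑ ^ p ∂(prodMeas P Q) := by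
  have hm : AEMeasurable (fun z : Ω × Sp d => ENNReal.ofReal (lam z.1) * ‖Γ z‖ₑ ^ p)
      (prodMeas P Q) :=
    hg.integrable.1.aemeasurable.ennreal_ofReal.comp_fst.mul (hΓ.enorm.pow_const p)
  rw [lintegral_prod_symm _ hm, ← lintegral_const_mul' _ _ ENNReal.ofReal_ne_top]
  have h1 : AEStronglyMeasurable (fun z : Sp d × Ω => Γ z.swap) ((volume.restrict Q).prod P) :=
    hΓ.prod_swap
  refine lintegral_mono_ae ?_
  filter_upwards [h1.prodMk_left] with x hx
  exact enorm_integral_rpow_le hg hp hx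

theorem eLpNorm_avg_snd [IsProbabilityMeasure P] {F : Type*} [NormedAddCommGroup F] {r : ℝ≥0∞}
    {f : Sp d → F} (hf : AEStronglyMeasurable f (volume.restrict Q)) :
    eLpNorm (fun z : Ω × Sp d => f z.2) r (prodMeas P Q) = eLpNorm f r (volume.restrict Q) :=
  eLpNorm_comp_measurePreserving hf measurePreserving_snd

/-- The weight may degenerate, so the bound on `λ |Γ|^p` alone gives no `L^p` bound. The `δ`-term
bounds `Γ - ⟨Γ⟩`, and the weighted bound together with the negative moment of `λ` bounds `⟨Γ⟩`; the
two summands of the constant are these two contributions. -/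
theorem exists_coercive [IsProbabilityMeasure P] (hg : HasGrowth p P Q V C lam) (hp : 1 < p)
    (hδ : 0 < δ) {c : ℝ≥0∞} (hc : c ≠ ∞) : ∃ M : ℝ≥0∞, M ≠ ∞ ∧ ∀ Γ : Ω × Sp d → Sp d,
      AEStronglyMeasurable Γ (prodMeas P Q) → uEnergy p P Q V C δ Γ ≤ c →
      eLpNorm Γ (ENNReal.ofReal p) (prodMeas P Q) ≤ M := by
  have hp0 : 0 < p := by linarith
  refine ⟨(c / ENNReal.ofReal δ) ^ (1 / p) + (ENNReal.ofReal C * c) ^ (1 / p), ?_,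
    fun Γ hΓ h => ?_⟩
  · refine ENNReal.add_ne_top.2 ⟨?_, ?_⟩
    · exact ENNReal.rpow_ne_top_of_nonneg (by positivity)
        (ENNReal.div_ne_top hc (by simpa using hδ))
    · exact ENNReal.rpow_ne_top_of_nonneg (by positivity)
        (ENNReal.mul_ne_top ENNReal.ofReal_ne_top hc)
  have hcancel : ∀ a : ℝ≥0∞, (a ^ (1 / p)) ^ p = a := fun a => by
    rw [← ENNReal.rpow_mul, one_div, inv_mul_cancel₀ hp0.ne', ENNReal.rpow_one]
  have hA := aestronglyMeasurable_avg hΓ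
  have h1 : eLpNorm (fun z => Γ z - avg P Γ z.2) (ENNReal.ofReal p) (prodMeas P Q) ≤
      (c / ENNReal.ofReal δ) ^ (1 / p) := by
    rw [eLpNorm_le_iff hp0, hcancel, ENNReal.le_div_iff_mul_le (by left; simpa using hδ)
      (by left; simp), mul_comm]
    exact (lintegral_fluctuation_le hg hδ.le hp0 Γ).trans h
  have h2 : eLpNorm (fun z : Ω × Sp d => avg P Γ z.2) (ENNReal.ofReal p) (prodMeas P Q) ≤
      (ENNReal.ofReal C * c) ^ (1 / p) := by
    rw [eLpNorm_avg_snd hA, eLpNorm_le_iff hp0, hcancel]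
    refine (lintegral_avg_le hg hp hΓ).trans ?_
    gcongr
    exact (lintegral_lam_le hg hδ.le hp0 Γ).trans h
  have h3 := eLpNorm_add_le (p := ENNReal.ofReal p) (hΓ.sub hA.comp_snd) (hA.comp_snd (μ := P))
    (by simpa using hp.le)
  have h4 : ((Γ - fun z : Ω × Sp d => avg P Γ z.2) + fun z : Ω × Sp d => avg P Γ z.2) = Γ := by
    ext1 z
    simp
  rw [h4] at h3
  exact h3.trans (add_le_add h1 h2)

/-! ### Lower semicontinuity and continuity -/

theorem tendsto_density (hV : IsDegenerateIntegrand p P Q V) (hp : 0 < p)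
    {Γ : ℕ → Ω × Sp d → Sp d} {Γ₀ : Ω × Sp d → Sp d}
    (h : ∀ᵐ z ∂(prodMeas P Q), Tendsto (fun n => Γ n z) atTop (𝓝 (Γ₀ z)) ∧
      Tendsto (fun n => avg P (Γ n) z.2) atTop (𝓝 (avg P Γ₀ z.2))) :
    ∀ᵐ z ∂(prodMeas P Q), Tendsto (fun n => ENNReal.ofReal (density p P V C δ (Γ n) z)) atTop
      (𝓝 (ENNReal.ofReal (density p P V C δ Γ₀ z))) := by
  filter_upwards [h, hV.continuous] with z hz hc
  refine (ENNReal.continuous_ofReal.tendsto _).comp ?_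
  refine (((hc.tendsto _).comp hz.1).add_const C).add (Tendsto.const_mul δ ?_)
  exact (hz.1.sub hz.2).norm.rpow_const (Or.inr hp.le)

/-- Strong lower semicontinuity: along a subsequence the fields and their averages converge almost
everywhere, hence so do the densities, and Fatou's lemma applies. -/
theorem uEnergy_le_of_tendsto [IsProbabilityMeasure P] (hV : IsDegenerateIntegrand p P Q V)
    (hp : 1 < p) {Γ : ℕ → Ω × Sp d → Sp d} {Γ₀ : Ω × Sp d → Sp d}
    (hΓ : ∀ n, MemLp (Γ n) (ENNReal.ofReal p) (prodMeas P Q))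
    (hΓ₀ : MemLp Γ₀ (ENNReal.ofReal p) (prodMeas P Q))
    (h : Tendsto (fun n => eLpNorm (fun z => Γ n z - Γ₀ z) (ENNReal.ofReal p) (prodMeas P Q))
      atTop (𝓝 0)) {c : ℝ≥0∞} (hc : ∀ n, uEnergy p P Q V C δ (Γ n) ≤ c) :
    uEnergy p P Q V C δ Γ₀ ≤ c := by
  obtain ⟨k, hk, hlim⟩ := exists_subseq_tendsto_avg hp hΓ hΓ₀ h
  have h1 := tendsto_density (C := C) (δ := δ) hV (by linarith) hlim
  calc uEnergy p P Q V C δ Γ₀ = ∫⁻ z, liminf (fun n => ENNReal.ofReal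
        (density p P V C δ (Γ (k n)) z)) atTop ∂(prodMeas P Q) := by
        refine lintegral_congr_ae ?_
        filter_upwards [h1] with z hz
        exact hz.liminf_eq.symm
    _ ≤ liminf (fun n => uEnergy p P Q V C δ (Γ (k n))) atTop :=
        lintegral_liminf_le' fun n => (aemeasurable_density hV (hΓ _).1).ennreal_ofReal
    _ ≤ c := by
        refine liminf_le_of_frequently_le' (Frequently.of_forall fun n => hc _)

/-- The average is linear in the field, so the nonlocal term is convex along with `V`. -/
theorem convex_uEnergy_le [IsProbabilityMeasure P] (hV : IsDegenerateIntegrand p P Q V)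
    (hg : HasGrowth p P Q V C lam) (hp : 1 < p) (hδ : 0 ≤ δ) (c : ℝ≥0∞) :
    Convex ℝ {Γ : Ω × Sp d → Sp d | MemLp Γ (ENNReal.ofReal p) (prodMeas P Q) ∧
      uEnergy p P Q V C δ Γ ≤ c} := by
  have hp0 : 0 < p := by linarith
  have hp1 : 1 ≤ ENNReal.ofReal p := by simpa using hp.le
  rintro Γ ⟨hΓ, h⟩ Γ' ⟨hΓ', h'⟩ a b ha hb hab
  refine ⟨(hΓ.const_smul a).add (hΓ'.const_smul b), ?_⟩
  have havg : ∀ᵐ x ∂(volume.restrict Q), avg P (a • Γ + b • Γ') x =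
      a • avg P Γ x + b • avg P Γ' x := by
    filter_upwards [MemLp_section' hp0 hΓ, MemLp_section' hp0 hΓ'] with x h1 h2
    simp only [avg, Pi.add_apply, Pi.smul_apply]
    have h3 := integral_add ((h1.integrable hp1).smul a) ((h2.integrable hp1).smul b)
    simp only [Pi.smul_apply] at h3
    rw [h3, integral_smul, integral_smul]
  have hpt : ∀ᵐ z ∂(prodMeas P Q), ENNReal.ofReal (density p P V C δ (a • Γ + b • Γ') z) ≤
      ENNReal.ofReal a * ENNReal.ofReal (density p P V C δ Γ z) +
        ENNReal.ofReal b * ENNReal.ofReal (density p P V C δ Γ' z) := by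
    filter_upwards [hV.convex, Measure.quasiMeasurePreserving_snd.ae havg, hg.le_density (δ := δ) Γ,
      hg.le_density (δ := δ) Γ', hg.lam_pos_prod] with z hc hz h1 h2 h3
    have h1' : 0 ≤ density p P V C δ Γ z := le_trans (by positivity) h1
    have h2' : 0 ≤ density p P V C δ Γ' z := le_trans (by positivity) h2
    rw [← ENNReal.ofReal_mul ha, ← ENNReal.ofReal_mul hb,
      ← ENNReal.ofReal_add (mul_nonneg ha h1') (mul_nonneg hb h2')]
    refine ENNReal.ofReal_le_ofReal ?_
    simp only [density]
    rw [hz]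
    have e1 := hc.2 (Set.mem_univ (Γ z)) (Set.mem_univ (Γ' z)) ha hb hab
    have e2 : ‖(a • Γ + b • Γ') z - (a • avg P Γ z.2 + b • avg P Γ' z.2)‖ ^ p ≤
        a * ‖Γ z - avg P Γ z.2‖ ^ p + b * ‖Γ' z - avg P Γ' z.2‖ ^ p := by
      have e3 : (a • Γ + b • Γ') z - (a • avg P Γ z.2 + b • avg P Γ' z.2) =
          a • (Γ z - avg P Γ z.2) + b • (Γ' z - avg P Γ' z.2) := by
        simp only [Pi.add_apply, Pi.smul_apply, smul_sub]
        abel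
      rw [e3]
      have e4 := (convexOn_rpow hp.le).2 (norm_nonneg (Γ z - avg P Γ z.2))
        (norm_nonneg (Γ' z - avg P Γ' z.2)) ha hb hab
      refine le_trans (Real.rpow_le_rpow (norm_nonneg _) ?_ hp0.le) e4
      refine (norm_add_le _ _).trans ?_
      rw [norm_smul, norm_smul, Real.norm_of_nonneg ha, Real.norm_of_nonneg hb]
      rfl
    simp only [smul_eq_mul, Pi.add_apply, Pi.smul_apply] at e1 e2 ⊢
    have e5 := mul_le_mul_of_nonneg_left e2 hδ
    have e6 : C = a * C + b * C := by rw [← add_mul, hab, one_mul]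
    nlinarith
  calc uEnergy p P Q V C δ (a • Γ + b • Γ') ≤ _ := lintegral_mono_ae hpt
    _ = ENNReal.ofReal a * uEnergy p P Q V C δ Γ + ENNReal.ofReal b * uEnergy p P Q V C δ Γ' := by
      rw [lintegral_add_left' ((aemeasurable_density hV hΓ.1).ennreal_ofReal.const_mul _),
        lintegral_const_mul' _ _ ENNReal.ofReal_ne_top,
        lintegral_const_mul' _ _ ENNReal.ofReal_ne_top]
      rfl
    _ ≤ ENNReal.ofReal a * c + ENNReal.ofReal b * c := by gcongr
    _ = c := by
      rw [← add_mul, ← ENNReal.ofReal_add ha hb, hab, ENNReal.ofReal_one, one_mul]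

/-- The unfolded energy is weakly lower semicontinuous. -/
theorem uEnergy_le_of_weak [IsProbabilityMeasure P] (hQ : Bornology.IsBounded Q)
    (hV : IsDegenerateIntegrand p P Q V) (hg : HasGrowth p P Q V C lam) (hp : 1 < p) (hδ : 0 ≤ δ)
    {Γ : ℕ → Ω × Sp d → Sp d} {Γ₀ : Ω × Sp d → Sp d}
    (h : WeakLpTendsto (ENNReal.ofReal p) (prodMeas P Q) Γ Γ₀) {c : ℝ≥0∞}
    (hc : ∀ n, uEnergy p P Q V C δ (Γ n) ≤ c) : uEnergy p P Q V C δ Γ₀ ≤ c := by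
  have := isFiniteMeasure_restrict hQ
  obtain ⟨q, hpq⟩ : ∃ q, p.HolderConjugate q := ⟨_, Real.HolderConjugate.conjExponent hp⟩
  have := hpq.ennrealOfReal
  set S := {Γ : Ω × Sp d → Sp d | MemLp Γ (ENNReal.ofReal p) (prodMeas P Q) ∧
      uEnergy p P Q V C δ Γ ≤ c}
  -- Mazur's argument: a half-space containing the convex sublevel set contains the weak limit, so
  -- the limit is a strong limit of members of the set.
  have hcl : Γ₀ ∈ LpClosure p (prodMeas P Q) S := by
    refine ⟨h.2.1, fun r hr => exists_approx_of_dual hpq (convex_uEnergy_le hV hg hp hδ c)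
      (fun s hs => hs.1) h.2.1 (fun ψ hψ a ha => ?_) hr⟩
    exact le_of_tendsto' (h.2.2 _ inferInstance ψ hψ) fun n => ha _ ⟨h.1 n, hc n⟩
  obtain ⟨-, s, hs, hlim⟩ := mem_lpClosure_iff_seq.1 hcl
  exact uEnergy_le_of_tendsto hV hp (fun n => (hs n).1) h.2.1 hlim fun n => (hs n).2

/-- Dominated convergence for the unfolded energy. -/
theorem tendsto_uEnergy [IsProbabilityMeasure P] (hV : IsDegenerateIntegrand p P Q V)
    (hg : HasGrowth p P Q V C lam) (hp : 1 < p) (hδ : 0 ≤ δ) (hQ : Bornology.IsBounded Q)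
    {Γ : ℕ → Ω × Sp d → Sp d} {Γ₀ : Ω × Sp d → Sp d}
    (hΓ : ∀ n, MemLp (Γ n) (ENNReal.ofReal p) (prodMeas P Q))
    (hΓ₀ : MemLp Γ₀ (ENNReal.ofReal p) (prodMeas P Q))
    (h : Tendsto (fun n => eLpNorm (fun z => Γ n z - Γ₀ z) (ENNReal.ofReal p) (prodMeas P Q))
      atTop (𝓝 0)) {H : Ω × Sp d → ℝ} (hH : MemLp H (ENNReal.ofReal p) (prodMeas P Q))
    (hlH : Integrable (fun z => lam z.1 * H z ^ p) (prodMeas P Q))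
    (hdom : ∀ n, ∀ᵐ z ∂(prodMeas P Q), ‖Γ n z‖ ≤ H z) :
    Tendsto (fun n => uEnergy p P Q V C δ (Γ n)) atTop (𝓝 (uEnergy p P Q V C δ Γ₀)) := by
  have hp0 : 0 < p := by linarith
  have := isFiniteMeasure_restrict hQ
  have hp1 : 1 ≤ ENNReal.ofReal p := by simpa using hp.le
  refine tendsto_of_subseq_tendsto fun ns hns => ?_
  obtain ⟨k, hk, hlim⟩ := exists_subseq_tendsto_avg hp (fun n => hΓ (ns n)) hΓ₀ (h.comp hns)
  refine ⟨k, ?_⟩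
  have hA := memLp_avg hp hH
  -- Upper growth bounds the density by this function as soon as the field is bounded by `H`; the
  -- average of the field is then bounded by that of `H`. Integrability of `λ H^p` is what makes `B`
  -- integrable.
  let B : Ω × Sp d → ℝ := fun z => C * (lam z.1 * H z ^ p + 1) + C +
    δ * (|H z| + |avg P H z.2|) ^ p
  have hBi : Integrable B (prodMeas P Q) := by
    have h1 : MemLp (fun z : Ω × Sp d => |H z| + |avg P H z.2|) (ENNReal.ofReal p)
        (prodMeas P Q) := hH.abs.add (hA.comp_snd P).abs
    have h2 := h1.integrable_norm_rpow (by simpa using hp0) ENNReal.ofReal_ne_top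
    rw [ENNReal.toReal_ofReal hp0.le] at h2
    have h3 : ∀ z : Ω × Sp d, ‖|H z| + |avg P H z.2|‖ = |H z| + |avg P H z.2| := fun z =>
      Real.norm_of_nonneg (by positivity)
    simp only [h3] at h2
    exact (((hlH.add (integrable_const 1)).const_mul C).add (integrable_const C)).add
      (h2.const_mul δ)
  refine tendsto_lintegral_of_dominated_convergence' (fun z => ENNReal.ofReal (B z))
    (fun n => (aemeasurable_density hV (hΓ _).1).ennreal_ofReal) (fun n => ?_)
    ?_ (tendsto_density hV hp0 hlim)
  · have hsec : ∀ᵐ x ∂(volume.restrict Q), ‖avg P (Γ (ns (k n))) x‖ ≤ |avg P H x| := by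
      have h1 : ∀ᵐ z ∂((volume.restrict Q).prod P), ‖Γ (ns (k n)) z.swap‖ ≤ H z.swap :=
        Measure.measurePreserving_swap.quasiMeasurePreserving.ae (hdom _)
      filter_upwards [Measure.ae_ae_of_ae_prod h1, MemLp_section' hp0 hH] with x h2 h3
      exact (norm_integral_le_of_norm_le (h3.integrable hp1) h2).trans (le_abs_self _)
    filter_upwards [hdom (ns (k n)), hg.bound, hg.lam_pos_prod,
      Measure.quasiMeasurePreserving_snd.ae hsec] with z h1 h2 h3 h4
    refine ENNReal.ofReal_le_ofReal ?_
    simp only [density, B]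
    have hC := hg.pos
    have e1 := (h2 (Γ (ns (k n)) z)).2
    have e2 : ‖Γ (ns (k n)) z‖ ^ p ≤ H z ^ p := Real.rpow_le_rpow (norm_nonneg _) h1 hp0.le
    have e3 : ‖Γ (ns (k n)) z - avg P (Γ (ns (k n))) z.2‖ ^ p ≤ (|H z| + |avg P H z.2|) ^ p :=
      Real.rpow_le_rpow (norm_nonneg _)
        ((norm_sub_le _ _).trans (add_le_add (h1.trans (le_abs_self _)) h4)) hp0.le
    have e4 := mul_le_mul_of_nonneg_left (mul_le_mul_of_nonneg_left e2 h3.le) hC.le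
    have e5 := mul_le_mul_of_nonneg_left e3 hδ
    linarith
  · have := hBi.lintegral_lt_top
    exact this.ne

end UnfoldedEnergy

theorem NullPreserving.integral_comp {α : Type*} [MeasurableSpace α] {μ : Measure α} {Φ : α → α}
    (h : NullPreserving Φ μ) {f : α → ℝ} (hf : Integrable f μ) :
    ∫ z, f (Φ z) ∂μ = ∫ z, f z ∂μ := by
  have h1 : Integrable (fun z => f (Φ z)) μ := by
    have := h.memLp_comp one_pos (by simpa using memLp_one_iff_integrable.2 hf)
    simpa [memLp_one_iff_integrable] using this
  rw [integral_eq_lintegral_pos_part_sub_lintegral_neg_part h1,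
    integral_eq_lintegral_pos_part_sub_lintegral_neg_part hf,
    h.lintegral_comp (f := fun z => ENNReal.ofReal (f z)) hf.1.aemeasurable.ennreal_ofReal,
    h.lintegral_comp (f := fun z => ENNReal.ofReal (-f z)) hf.1.aemeasurable.neg.ennreal_ofReal]

/-! ### Unfolded functions as functions on the probability space -/

section Unfolding

variable {Ω : Type*} [MeasurableSpace Ω] {d : ℕ} {p q : ℝ} {P : Measure Ω} {Q : Set (Sp d)}
  {τ : Sp d → Ω → Ω}

theorem IsStochGrad.congr (hτ : IsStationary P τ) {φ φ' : Ω → ℝ} {ψ ψ' : Ω → Sp d}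
    (h : IsStochGrad p P τ φ ψ) (hφ : φ =ᵐ[P] φ') (hψ : ψ =ᵐ[P] ψ') :
    IsStochGrad p P τ φ' ψ' where
  memLp := h.memLp.ae_eq hφ
  memLp_grad := h.memLp_grad.ae_eq hψ
  tendsto i := by
    refine (h.tendsto i).congr fun t => eLpNorm_congr_ae ?_
    filter_upwards [hφ, hψ, (hτ.preserving _).quasiMeasurePreserving.ae hφ] with ω h1 h2 h3
    rw [h1, h2, h3]

/-- Integrals over `Q` of unfolded functions are differentiable along the action. -/
theorem isStochGrad_integral_unf (hτ : IsStationary P τ) (hp : 1 < p)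
    (hQ : Bornology.IsBounded Q) {ε : ℝ} (hε : 0 < ε) {f : Ω × Sp d → ℝ × Sp d}
    (hf : f ∈ elemTensors p P Q) :
    IsStochGrad p P τ (fun ω => ∫ x in Q, (unf τ ε f (ω, x)).1)
      (fun ω => ε • ∫ x in Q, (unf τ ε f (ω, x)).2) := by
  have := hτ.prob
  have := isFiniteMeasure_restrict hQ
  have hp0 : 0 < p := by linarith
  have hp1 : 1 ≤ ENNReal.ofReal p := by simpa using hp.le
  have hsec : ∀ f ∈ elemTensors p P Q, ∀ᵐ ω ∂P,
      Integrable (fun x => (unf τ ε f (ω, x)).1) (volume.restrict Q) ∧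
        Integrable (fun x => (unf τ ε f (ω, x)).2) (volume.restrict Q) := fun f hf => by
    have h1 := memLp_unf hτ hp0 hε (memLp_elemTensors hp.le hf)
    filter_upwards [MemLp_section hp0 (memLp_fst h1), MemLp_section hp0 (memLp_snd h1)] with ω h2 h3
    exact ⟨h2.integrable hp1, h3.integrable hp1⟩
  induction hf using Submodule.span_induction with
  | mem f hf =>
    obtain ⟨φ, s, hφ, ⟨η, hη, hηQ, rfl⟩, rfl⟩ := hf
    have hε' : ε⁻¹ ≠ 0 := inv_ne_zero hε.ne'
    have hη0 : ∀ x, x ∉ Q → η x = 0 := fun x hx =>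
      image_eq_zero_of_notMem_tsupport fun h' => hx (hηQ h')
    have hg0 : ∀ x, x ∉ Q → gradient η x = 0 := fun x hx => by
      by_contra hne
      exact hx (hηQ (support_fderiv_subset ℝ (f := η) fun h0 => hne (by simp [gradient, h0])))
    -- For a tensor `φ ⊗ η`, the integral of the unfolding is the orbit average of `φ` with weight
    -- `η` and dilation `c = ε⁻¹`; the prefactor `c⁻¹` in its stochastic gradient is the announced
    -- `ε`.
    refine (isStochGrad_moll hτ hε' hp hη hφ).congr hτ (ae_of_all _ fun ω => ?_) ?_
    · simp only [moll, unf]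
      rw [setIntegral_eq_integral_of_forall_compl_eq_zero fun x hx => by simp [hη0 x hx]]
      simp [mul_comm]
    · have hi : ∀ i, ∀ᵐ ω ∂P, Integrable fun x => gradient η x i • φ (τ (-(ε⁻¹ • x)) ω) :=
        fun i => integrable_moll hτ hε' (hη.continuous_gradient_apply i)
          (hη.hasCompactSupport_gradient_apply i) (hφ.integrable hp1)
      filter_upwards [ae_all_iff.2 hi] with ω hω
      have h1 : Integrable fun x => φ (τ (-(ε⁻¹ • x)) ω) • gradient η x :=
        Integrable.of_eval_piLp fun i => by
          simpa [mul_comm] using hω i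
      simp only [unf]
      rw [setIntegral_eq_integral_of_forall_compl_eq_zero fun x hx => by simp [hg0 x hx]]
      ext i
      simp only [mollGrad, inv_inv, moll, PiLp.smul_apply, smul_eq_mul, Prod.smul_mk]
      congr 1
      have h2 := (EuclideanSpace.proj (𝕜 := ℝ) i).integral_comp_comm h1
      refine Eq.trans ?_ h2
      simp [mul_comm]
  | zero => simpa [unf] using IsStochGrad.zero (p := p) (P := P) (τ := τ)
  | add f g hf' hg' hf hg =>
    refine (hf.add hp.le hτ hg).congr hτ ?_ ?_
    · filter_upwards [hsec f hf', hsec g hg'] with ω h1 h2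
      exact (integral_add h1.1 h2.1).symm
    · filter_upwards [hsec f hf', hsec g hg'] with ω h1 h2
      rw [← smul_add]
      congr 1
      exact (integral_add h1.2 h2.2).symm
  | smul c f _ hf =>
    refine (hf.smul c).congr hτ (ae_of_all _ fun ω => ?_) (ae_of_all _ fun ω => ?_)
    · exact (integral_const_mul c _).symm
    · simp only
      rw [smul_comm]
      congr 1
      exact (integral_smul c _).symm

theorem IsLpW10.mem_lpClosure_unf (hτ : IsStationary P τ) (hp : 1 < p) {ε : ℝ} (hε : 0 < ε)
    {u : Ω × Sp d → ℝ} {G : Ω × Sp d → Sp d} (h : IsLpW10 p P Q u G) :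
    (fun z => (unf τ ε u z, unf τ ε G z)) ∈
      LpClosure p (prodMeas P Q) (unf τ ε '' (elemTensors p P Q : Set _)) := by
  have hp0 : 0 < p := by linarith
  have h0 := (isLpW10_iff hp.le).1 h
  exact map_mem_lpClosure (f := fun z => (u z, G z)) (unf τ ε) ENNReal.one_ne_top
    (fun s hs => memLp_elemTensors hp.le hs)
    (fun f s hf hs => by
      rw [one_mul]
      exact (eLpNorm_unf hτ hp0 hε (hf.1.sub hs.1)).le)
    (fun s hs => Set.mem_image_of_mem _ hs) h0 (memLp_unf hτ hp0 hε h0.1)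

/-- For elementary tensors, `ε` times the integral of the unfolded gradient over `Q` is a stochastic
gradient, which `ψ` annihilates; cancel `ε` and pass to the closure. -/
theorem IsLpW10.integral_inner_unf_eq_zero (hτ : IsStationary P τ) (hpq : p.HolderConjugate q)
    (hQ : Bornology.IsBounded Q) {ε : ℝ} (hε : 0 < ε) {u : Ω × Sp d → ℝ} {G : Ω × Sp d → Sp d}
    (h : IsLpW10 p P Q u G) {ψ : Ω → Sp d} (hψ : MemLp ψ (ENNReal.ofReal q) P)
    (h0 : ∀ s ∈ stochGrads hpq.lt.le hτ, ∫ ω, (inner ℝ (s ω) (ψ ω) : ℝ) ∂P = 0) :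
    ∫ z, (inner ℝ (unf τ ε G z) (ψ z.1) : ℝ) ∂(prodMeas P Q) = 0 := by
  have := hτ.prob
  have := isFiniteMeasure_restrict hQ
  have := hpq.ennrealOfReal
  have hp := hpq.lt
  have hp0 := hpq.pos
  obtain ⟨hm, s, hs, hlim⟩ := mem_lpClosure_iff_seq.1 (h.mem_lpClosure_unf hτ hp hε)
  choose t ht hts using hs
  have hsm : ∀ n, MemLp (s n) (ENNReal.ofReal p) (prodMeas P Q) := fun n => by
    rw [← hts n]
    exact memLp_unf hτ hp0 hε (memLp_elemTensors hp.le (ht n))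
  have h1 : ∀ n, ∫ z, (inner ℝ (s n z).2 (ψ z.1) : ℝ) ∂(prodMeas P Q) = 0 := fun n => by
    rw [← integral_inner_integral hpq (memLp_snd (hsm n)) hψ]
    have h2 := h0 _ ⟨_, isStochGrad_integral_unf hτ hp hQ hε (ht n)⟩
    rw [hts n] at h2
    simp only [inner_smul_left, conj_trivial, integral_const_mul] at h2
    exact (mul_eq_zero.1 h2).resolve_left hε.ne'
  have h3 : Tendsto (fun n => eLpNorm (fun z => (s n z).2 - unf τ ε G z) (ENNReal.ofReal p)
      (prodMeas P Q)) atTop (𝓝 0) :=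
    tendsto_of_tendsto_of_tendsto_of_le_of_le tendsto_const_nhds hlim (fun _ => zero_le)
      fun n => eLpNorm_snd_le (fun z => s n z - (unf τ ε u z, unf τ ε G z)) _
  have h4 := tendsto_integral_inner (fun n => memLp_snd (hsm n)) (memLp_snd hm)
    (hψ.comp_fst (volume.restrict Q)) h3
  simp only [h1] at h4
  exact (tendsto_nhds_unique h4 tendsto_const_nhds)

/-- Unfolded functions are almost invariant under the action. -/
theorem IsLpW10.abs_integral_unf_shift_le (hτ : IsStationary P τ) (hpq : p.HolderConjugate q)
    (hQ : Bornology.IsBounded Q) {ε : ℝ} (hε : 0 < ε) {u : Ω × Sp d → ℝ} {G : Ω × Sp d → Sp d}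
    (h : IsLpW10 p P Q u G) {ψ : Ω → ℝ} (hψ : MemLp ψ (ENNReal.ofReal q) P) (y : Sp d) :
    ENNReal.ofReal |∫ z, (inner ℝ (unf τ ε u z) (ψ (τ (-y) z.1) - ψ z.1) : ℝ) ∂(prodMeas P Q)| ≤
      ENNReal.ofReal ε * ((d * ‖y‖ₑ) * (eLpNorm (fun _ : Sp d => (1 : ℝ)) (ENNReal.ofReal q)
        (volume.restrict Q) * eLpNorm G (ENNReal.ofReal p) (prodMeas P Q)) *
          eLpNorm ψ (ENNReal.ofReal q) P) := by
  have := hτ.prob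
  have := isFiniteMeasure_restrict hQ
  have := hpq.ennrealOfReal
  have hp := hpq.lt
  have hp0 := hpq.pos
  obtain ⟨hm, s, hs, hlim⟩ := mem_lpClosure_iff_seq.1 (h.mem_lpClosure_unf hτ hp hε)
  choose t ht hts using hs
  have hsm : ∀ n, MemLp (s n) (ENNReal.ofReal p) (prodMeas P Q) := fun n => by
    rw [← hts n]
    exact memLp_unf hτ hp0 hε (memLp_elemTensors hp.le (ht n))
  have hψ' : MemLp (fun ω => ψ (τ (-y) ω) - ψ ω) (ENNReal.ofReal q) P :=
    (memLp_shift hτ hψ _).sub hψ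
  set m := eLpNorm (fun _ : Sp d => (1 : ℝ)) (ENNReal.ofReal q) (volume.restrict Q)
  have hmtop : m ≠ ∞ := (memLp_const (1 : ℝ)).2.ne
  have hle : ∀ n, ENNReal.ofReal |∫ z, (inner ℝ (s n z).1 (ψ (τ (-y) z.1) - ψ z.1) : ℝ)
      ∂(prodMeas P Q)| ≤ ENNReal.ofReal ε * ((d * ‖y‖ₑ) * (m *
        eLpNorm (fun z => (s n z).2) (ENNReal.ofReal p) (prodMeas P Q)) *
          eLpNorm ψ (ENNReal.ofReal q) P) := fun n => by
    have hgr := isStochGrad_integral_unf hτ hp hQ hε (ht n)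
    rw [hts n] at hgr
    set v : Ω → ℝ := fun ω => ∫ x in Q, (s n (ω, x)).1
    set K : Ω → Sp d := fun ω => ∫ x in Q, (s n (ω, x)).2
    have e1 := integral_inner_integral hpq (memLp_fst (hsm n)) hψ'
    have i1 := memLp_inner hgr.memLp (memLp_shift hτ hψ (-y))
    have i2 := memLp_inner hgr.memLp hψ
    have i3 := memLp_inner (memLp_shift hτ hgr.memLp y) hψ
    -- Stationarity moves the shift from `ψ`, which need not be regular, to `v`.
    have e2 : ∫ ω, (inner ℝ (v ω) (ψ (τ (-y) ω) - ψ ω) : ℝ) ∂P =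
        ∫ ω, (inner ℝ (v (τ y ω) - v ω) (ψ ω) : ℝ) ∂P := by
      simp only [inner_sub_right, inner_sub_left]
      rw [integral_sub i1 i2, integral_sub i3 i2, ← integral_shift hτ i1.1 y]
      simp only [← hτ.map_add, neg_add_cancel, hτ.map_zero]
    have e3 : eLpNorm K (ENNReal.ofReal p) P ≤ m *
        eLpNorm (fun z => (s n z).2) (ENNReal.ofReal p) (prodMeas P Q) := by
      have := eLpNorm_integral_smul_le_mul (μ := P) (ν := volume.restrict Q) hpq
        (memLp_snd (hsm n)).1 (w := fun _ => 1) aestronglyMeasurable_const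
      simpa using this
    refine le_trans (le_of_eq (congrArg (fun t => ENNReal.ofReal |t|) (e1.symm.trans e2))) ?_
    refine (abs_integral_inner_le ((memLp_shift hτ hgr.memLp y).sub hgr.memLp) hψ).trans ?_
    -- The stochastic gradient of `v` is `ε K`, so the Lipschitz bound along shifts carries the
    -- factor `ε`.
    have e4 := hgr.eLpNorm_sub_le hp.le hτ y
    have e5 : eLpNorm (fun ω => ε • K ω) (ENNReal.ofReal p) P =
        ENNReal.ofReal ε * eLpNorm K (ENNReal.ofReal p) P := by
      rw [← Real.enorm_of_nonneg hε.le]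
      exact eLpNorm_const_smul ε K _ _
    rw [e5] at e4
    calc _ ≤ (d * ‖y‖ₑ) * (ENNReal.ofReal ε * eLpNorm K (ENNReal.ofReal p) P) *
          eLpNorm ψ (ENNReal.ofReal q) P := by
          gcongr
          exact e4
      _ ≤ (d * ‖y‖ₑ) * (ENNReal.ofReal ε * (m *
        eLpNorm (fun z => (s n z).2) (ENNReal.ofReal p) (prodMeas P Q))) *
          eLpNorm ψ (ENNReal.ofReal q) P := by gcongr
      _ = _ := by ring
  have h3 : Tendsto (fun n => eLpNorm (fun z => (s n z).1 - unf τ ε u z) (ENNReal.ofReal p)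
      (prodMeas P Q)) atTop (𝓝 0) :=
    tendsto_of_tendsto_of_tendsto_of_le_of_le tendsto_const_nhds hlim (fun _ => zero_le)
      fun n => eLpNorm_fst_le (fun z => s n z - (unf τ ε u z, unf τ ε G z)) _
  have h4 := tendsto_integral_inner (fun n => memLp_fst (hsm n)) (memLp_fst hm)
    (hψ'.comp_fst (volume.restrict Q)) h3
  set a : ℕ → ℝ≥0∞ := fun n => eLpNorm (fun x => s n x - (unf τ ε u x, unf τ ε G x))
    (ENNReal.ofReal p) (prodMeas P Q)
  have h5 : ∀ n, eLpNorm (fun z => (s n z).2) (ENNReal.ofReal p) (prodMeas P Q) ≤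
      a n + eLpNorm G (ENNReal.ofReal p) (prodMeas P Q) := fun n => by
    have e1 := eLpNorm_add_le ((memLp_snd (hsm n)).1.sub (memLp_snd hm).1) (memLp_snd hm).1
      (by simpa using hp.le : 1 ≤ ENNReal.ofReal p)
    have e2 : ((fun z => (s n z).2) - unf τ ε G) + unf τ ε G = fun z => (s n z).2 := by
      ext1 z
      simp
    have e3 := eLpNorm_snd_le (μ := prodMeas P Q) (fun z => s n z - (unf τ ε u z, unf τ ε G z))
      (ENNReal.ofReal p)
    rw [← eLpNorm_unf hτ hp0 hε h.memLp_grad.1]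
    exact le_trans (le_of_eq (congrArg (fun f => eLpNorm f (ENNReal.ofReal p) (prodMeas P Q))
      e2.symm)) (e1.trans (add_le_add e3 le_rfl))
  have h6 : Tendsto (fun n => ENNReal.ofReal ε * ((d * ‖y‖ₑ) * (m *
      (a n + eLpNorm G (ENNReal.ofReal p) (prodMeas P Q))) * eLpNorm ψ (ENNReal.ofReal q) P)) atTop
      (𝓝 (ENNReal.ofReal ε * ((d * ‖y‖ₑ) * (m *
      (0 + eLpNorm G (ENNReal.ofReal p) (prodMeas P Q))) * eLpNorm ψ (ENNReal.ofReal q) P))) := by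
    refine ENNReal.Tendsto.const_mul (ENNReal.Tendsto.mul_const (ENNReal.Tendsto.const_mul
      (ENNReal.Tendsto.const_mul (hlim.add_const _) (Or.inr hmtop)) (Or.inr ?_)) (Or.inr hψ.2.ne))
      (Or.inr ENNReal.ofReal_ne_top)
    exact ENNReal.mul_ne_top (by simp) (by simp)
  rw [zero_add] at h6
  have h7 : Tendsto (fun n => ENNReal.ofReal |∫ z, (inner ℝ (s n z).1
      (ψ (τ (-y) z.1) - ψ z.1) : ℝ) ∂(prodMeas P Q)|) atTop (𝓝 (ENNReal.ofReal
        |∫ z, (inner ℝ (unf τ ε u z) (ψ (τ (-y) z.1) - ψ z.1) : ℝ) ∂(prodMeas P Q)|)) :=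
    (ENNReal.continuous_ofReal.tendsto _).comp h4.abs
  refine le_of_tendsto_of_tendsto' h7 h6 fun n => (hle n).trans ?_
  gcongr
  exact h5 n

/-- The average of a function in `L^p(Ω) ⊗ W^{1,p}_0(Q)` satisfies the same linear relations as
test functions and their gradients. -/
theorem IsLpW10.integral_unf_eq_zero_of_test (hτ : IsStationary P τ) (hpq : p.HolderConjugate q)
    (hQ : Bornology.IsBounded Q) {ε : ℝ} (hε : 0 < ε) {u : Ω × Sp d → ℝ} {G : Ω × Sp d → Sp d}
    (h : IsLpW10 p P Q u G) {ψ : Sp d → ℝ} {φ : Sp d → Sp d}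
    (hψ : MemLp ψ (ENNReal.ofReal q) (volume.restrict Q))
    (hφ : MemLp φ (ENNReal.ofReal q) (volume.restrict Q))
    (h0 : ∀ s ∈ testPairs Q, (∫ x in Q, (inner ℝ (s x).1 (ψ x) : ℝ)) +
      ∫ x in Q, (inner ℝ (s x).2 (φ x) : ℝ) = 0) :
    (∫ z, (inner ℝ (unf τ ε u z) (ψ z.2) : ℝ) ∂(prodMeas P Q)) +
      ∫ z, (inner ℝ (unf τ ε G z) (φ z.2) : ℝ) ∂(prodMeas P Q) = 0 := by
  have := hτ.prob
  have := isFiniteMeasure_restrict hQ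
  have := hpq.ennrealOfReal
  have hp := hpq.lt
  have hψs := hψ.comp_snd P
  have hφs := hφ.comp_snd P
  have hN := unf_nullPreserving (Q := Q) hτ hε
  -- Test functions of `x` alone are fixed by the skew shift, so unfolding disappears from the
  -- pairing.
  have e1 : ∫ z, (inner ℝ (unf τ ε u z) (ψ z.2) : ℝ) ∂(prodMeas P Q) =
      ∫ z, (inner ℝ (u z) (ψ z.2) : ℝ) ∂(prodMeas P Q) := by
    rw [← hN.integral_comp (memLp_inner h.memLp hψs), unf_eq_skew]
    rfl
  have e2 : ∫ z, (inner ℝ (unf τ ε G z) (φ z.2) : ℝ) ∂(prodMeas P Q) =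
      ∫ z, (inner ℝ (G z) (φ z.2) : ℝ) ∂(prodMeas P Q) := by
    rw [← hN.integral_comp (memLp_inner h.memLp_grad hφs), unf_eq_skew]
    rfl
  rw [e1, e2]
  obtain ⟨hm, s, hs, hlim⟩ := mem_lpClosure_iff_seq.1 ((isLpW10_iff hp.le).1 h)
  have hsm := fun n => memLp_elemTensors hp.le (hs n)
  have h1 : Tendsto (fun n => eLpNorm (fun z => (s n z).1 - u z) (ENNReal.ofReal p)
      (prodMeas P Q)) atTop (𝓝 0) :=
    tendsto_of_tendsto_of_tendsto_of_le_of_le tendsto_const_nhds hlim (fun _ => zero_le)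
      fun n => eLpNorm_fst_le (fun z => s n z - (u z, G z)) _
  have h2 : Tendsto (fun n => eLpNorm (fun z => (s n z).2 - G z) (ENNReal.ofReal p)
      (prodMeas P Q)) atTop (𝓝 0) :=
    tendsto_of_tendsto_of_tendsto_of_le_of_le tendsto_const_nhds hlim (fun _ => zero_le)
      fun n => eLpNorm_snd_le (fun z => s n z - (u z, G z)) _
  have h3 := (tendsto_integral_inner (fun n => memLp_fst (hsm n)) h.memLp hψs h1).add
    (tendsto_integral_inner (fun n => memLp_snd (hsm n)) h.memLp_grad hφs h2)
  have h4 : ∀ n, (∫ z, (inner ℝ (s n z).1 (ψ z.2) : ℝ) ∂(prodMeas P Q)) +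
      ∫ z, (inner ℝ (s n z).2 (φ z.2) : ℝ) ∂(prodMeas P Q) = 0 := fun n => by
    have i1 := memLp_inner (memLp_fst (hsm n)) hψs
    have i2 := memLp_inner (memLp_snd (hsm n)) hφs
    rw [integral_prod _ i1, integral_prod _ i2, ← integral_add i1.integral_prod_left
      i2.integral_prod_left]
    refine integral_eq_zero_of_ae (ae_of_all _ fun ω => ?_)
    exact h0 _ (section_elemTensors (hs n) ω)
  simp only [h4] at h3
  exact tendsto_nhds_unique h3 tendsto_const_nhds

end Unfolding

theorem real_inner_eq_mul (a b : ℝ) : inner ℝ a b = a * b := by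
  simp [mul_comm]

/-! ### Identification of the weak limits of unfolded functions and gradients -/

section Limit

variable {Ω : Type*} [MeasurableSpace Ω] {d : ℕ} {p q : ℝ} {P : Measure Ω} {Q : Set (Sp d)}
  {τ : Sp d → Ω → Ω}

/-- Products of a function of `ω` and a test function are in the dual space. -/
theorem memLp_test_smul [IsFiniteMeasure P] (hQ : Bornology.IsBounded Q) {F : Type*}
    [NormedAddCommGroup F] [InnerProductSpace ℝ F] {ψ : Ω → F}
    (hψ : MemLp ψ (ENNReal.ofReal q) P) {θ : Sp d → ℝ} (hθ : IsTest θ) :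
    MemLp (fun z : Ω × Sp d => θ z.2 • ψ z.1) (ENNReal.ofReal q) (prodMeas P Q) := by
  have := isFiniteMeasure_restrict hQ
  exact hθ.memLp_smul (hψ.comp_fst _)

theorem memLp_inner_gradient [IsFiniteMeasure P] (hQ : Bornology.IsBounded Q) {ψ : Ω → Sp d}
    (hψ : MemLp ψ (ENNReal.ofReal q) P) {θ : Sp d → ℝ} (hθ : IsTest θ) :
    MemLp (fun z : Ω × Sp d => (inner ℝ (gradient θ z.2) (ψ z.1) : ℝ)) (ENNReal.ofReal q)
      (prodMeas P Q) := by
  have := isFiniteMeasure_restrict hQ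
  obtain ⟨C, hC⟩ := hθ.continuous_gradient.bounded_above_of_compact_support
    hθ.hasCompactSupport_gradient
  have hgm : AEStronglyMeasurable (fun z : Ω × Sp d => gradient θ z.2) (prodMeas P Q) :=
    hθ.continuous_gradient.aestronglyMeasurable.comp_snd
  have hψ' := hψ.comp_fst (volume.restrict Q)
  refine hψ'.of_le_mul (c := C) (hgm.inner hψ'.1) (ae_of_all _ fun z => ?_)
  exact (norm_inner_le_norm _ _).trans (mul_le_mul_of_nonneg_right (hC _) (norm_nonneg _))

variable {ε : ℕ → ℝ} {u : ℕ → Ω × Sp d → ℝ} {G : ℕ → Ω × Sp d → Sp d} {U : Ω × Sp d → ℝ}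
  {Γ : Ω × Sp d → Sp d} {M : ℝ≥0∞}

/-- The data of a bounded sequence whose unfoldings converge weakly. -/
structure IsWeakLimit (p : ℝ) (P : Measure Ω) (Q : Set (Sp d)) (τ : Sp d → Ω → Ω) (ε : ℕ → ℝ)
    (u : ℕ → Ω × Sp d → ℝ) (G : ℕ → Ω × Sp d → Sp d) (U : Ω × Sp d → ℝ)
    (Γ : Ω × Sp d → Sp d) (M : ℝ≥0∞) : Prop where
  pos : ∀ n, 0 < ε n
  lim : Tendsto ε atTop (𝓝 0)
  mem : ∀ n, IsLpW10 p P Q (u n) (G n)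
  weak : WeakLpTendsto (ENNReal.ofReal p) (prodMeas P Q) (fun n => unf τ (ε n) (u n)) U
  weak_grad : WeakLpTendsto (ENNReal.ofReal p) (prodMeas P Q) (fun n => unf τ (ε n) (G n)) Γ
  top : M ≠ ∞
  bound : ∀ n, eLpNorm (u n) (ENNReal.ofReal p) (prodMeas P Q) ≤ M
  bound_grad : ∀ n, eLpNorm (G n) (ENNReal.ofReal p) (prodMeas P Q) ≤ M

/-- Almost invariance applied to `θ u_n`, whose gradients are bounded uniformly by the product rule;
the error is a fixed constant times `ε_n`. -/
theorem IsWeakLimit.integral_shift_eq_zero (h : IsWeakLimit p P Q τ ε u G U Γ M)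
    (hτ : IsStationary P τ) (hpq : p.HolderConjugate q) (hQ : Bornology.IsBounded Q)
    {θ : Sp d → ℝ} (hθ : IsTest θ) {ψ : Ω → ℝ} (hψ : MemLp ψ (ENNReal.ofReal q) P) (y : Sp d) :
    ∫ z, (inner ℝ (θ z.2 • U z) (ψ (τ (-y) z.1) - ψ z.1) : ℝ) ∂(prodMeas P Q) = 0 := by
  have := hτ.prob
  have := isFiniteMeasure_restrict hQ
  have := hpq.ennrealOfReal
  have hp := hpq.lt
  obtain ⟨C, hC⟩ := hθ.exists_bound
  obtain ⟨C', hC'⟩ := hθ.continuous_gradient.bounded_above_of_compact_support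
    hθ.hasCompactSupport_gradient
  have hgm : AEStronglyMeasurable (fun z : Ω × Sp d => gradient θ z.2) (prodMeas P Q) :=
    hθ.continuous_gradient.aestronglyMeasurable.comp_snd
  have hθm : AEStronglyMeasurable (fun z : Ω × Sp d => θ z.2) (prodMeas P Q) :=
    hθ.continuous.aestronglyMeasurable.comp_snd
  have hψ' : MemLp (fun ω => ψ (τ (-y) ω) - ψ ω) (ENNReal.ofReal q) P :=
    (memLp_shift hτ hψ _).sub hψ
  set m := eLpNorm (fun _ : Sp d => (1 : ℝ)) (ENNReal.ofReal q) (volume.restrict Q)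
  have hmtop : m ≠ ∞ := (memLp_const (1 : ℝ)).2.ne
  set B : ℝ≥0∞ := (d * ‖y‖ₑ) * (m * (ENNReal.ofReal C * M + ENNReal.ofReal C' * M)) *
    eLpNorm ψ (ENNReal.ofReal q) P with hB
  have hBtop : B ≠ ∞ := by
    refine ENNReal.mul_ne_top (ENNReal.mul_ne_top (ENNReal.mul_ne_top (by simp) (by simp))
      (ENNReal.mul_ne_top hmtop (ENNReal.add_ne_top.2 ⟨?_, ?_⟩))) hψ.2.ne <;>
    exact ENNReal.mul_ne_top ENNReal.ofReal_ne_top h.top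
  have h1 : ∀ n, ENNReal.ofReal |∫ z, (inner ℝ (unf τ (ε n) (u n) z)
      (θ z.2 • (ψ (τ (-y) z.1) - ψ z.1)) : ℝ) ∂(prodMeas P Q)| ≤
        ENNReal.ofReal (ε n) * B := fun n => by
    have e1 := ((h.mem n).mul_test hp.le hθ).abs_integral_unf_shift_le hτ hpq hQ (h.pos n) hψ y
    have e2 : eLpNorm (fun z => θ z.2 • G n z + u n z • gradient θ z.2) (ENNReal.ofReal p)
        (prodMeas P Q) ≤ ENNReal.ofReal C * M + ENNReal.ofReal C' * M := by
      refine (eLpNorm_add_le (hθm.smul (h.mem n).memLp_grad.1) ((h.mem n).memLp.1.smul hgm)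
        (by simpa using hp.le)).trans (add_le_add ?_ ?_)
      · refine (eLpNorm_le_mul_eLpNorm_of_ae_le_mul (c := C) (g := G n)
          (ae_of_all _ fun z => ?_) _).trans (by gcongr; exact h.bound_grad n)
        simp only [Pi.smul_apply', norm_smul]
        exact mul_le_mul_of_nonneg_right (hC _) (norm_nonneg _)
      · refine (eLpNorm_le_mul_eLpNorm_of_ae_le_mul (c := C') (g := u n)
          (ae_of_all _ fun z => ?_) _).trans (by gcongr; exact h.bound n)
        simp only [Pi.smul_apply', norm_smul]
        rw [mul_comm]
        exact mul_le_mul_of_nonneg_right (hC' _) (norm_nonneg _)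
    refine le_trans (le_of_eq ?_) (e1.trans ?_)
    · congr 2
      refine integral_congr_ae (ae_of_all _ fun z => ?_)
      simp only [unf, real_inner_eq_mul, smul_eq_mul]
      ring
    · rw [hB]
      gcongr
  have hlim := h.weak.2.2 _ this (fun z => θ z.2 • (ψ (τ (-y) z.1) - ψ z.1))
    (memLp_test_smul hQ hψ' hθ)
  have h2 : Tendsto (fun n => ENNReal.ofReal (ε n) * B) atTop (𝓝 0) := by
    have := ENNReal.Tendsto.mul_const (b := B)
      ((ENNReal.continuous_ofReal.tendsto _).comp h.lim) (Or.inr hBtop)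
    simpa using this
  have h3 := le_of_tendsto_of_tendsto' ((ENNReal.continuous_ofReal.tendsto _).comp hlim.abs) h2 h1
  rw [nonpos_iff_eq_zero, ENNReal.ofReal_eq_zero] at h3
  have h4 := abs_nonpos_iff.1 h3
  rw [← h4]
  refine integral_congr_ae (ae_of_all _ fun z => ?_)
  simp only [real_inner_eq_mul, smul_eq_mul]
  ring

/-- For each `y`, `U` is invariant under the shift by `y` up to a null set of `Ω × Q`. These null
sets depend on `y`, so ergodicity is applied not at fixed `x` but to the averages `∫ θ(x) U(·, x)
dx`, which are invariant random variables; varying `θ` recovers `U`. -/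
theorem IsWeakLimit.ae_eq_avg (h : IsWeakLimit p P Q τ ε u G U Γ M) (hτ : IsStationary P τ)
    (herg : IsErgodic P τ) (hpq : p.HolderConjugate q) (hQ : Bornology.IsBounded Q) :
    U =ᵐ[prodMeas P Q] fun z => avg P U z.2 := by
  have := hτ.prob
  have := isFiniteMeasure_restrict hQ
  have := hpq.ennrealOfReal
  have hp := hpq.lt
  have hp0 := hpq.pos
  have hp1 : 1 ≤ ENNReal.ofReal p := by simpa using hp.le
  have hU := h.weak.2.1
  have hpres : ∀ y, MeasurePreserving (fun z : Ω × Sp d => (τ y z.1, z.2)) (prodMeas P Q)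
      (prodMeas P Q) := fun y => (hτ.preserving y).prod (MeasurePreserving.id _)
  have hUy : ∀ y, MemLp (fun z => U (τ y z.1, z.2)) (ENNReal.ofReal p) (prodMeas P Q) :=
    fun y => hU.comp_measurePreserving (hpres y)
  have h1 : ∀ y, (fun z => U (τ y z.1, z.2) - U z) =ᵐ[prodMeas P Q] 0 := fun y => by
    refine ae_eq_zero_of_integral_test hpq hQ ((hUy y).sub hU) fun θ hθ ψ hψ => ?_
    rw [← h.integral_shift_eq_zero hτ hpq hQ hθ hψ y]
    have i1 : Integrable (fun z : Ω × Sp d => (inner ℝ (θ z.2 • U z) (ψ (τ (-y) z.1)) : ℝ))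
      (prodMeas P Q) := memLp_inner (hθ.memLp_smul hU) ((memLp_shift hτ hψ (-y)).comp_fst _)
    have i2 : Integrable (fun z : Ω × Sp d => (inner ℝ (θ z.2 • U z) (ψ z.1) : ℝ))
      (prodMeas P Q) := memLp_inner (hθ.memLp_smul hU) (hψ.comp_fst _)
    have i3 : Integrable (fun z : Ω × Sp d => (inner ℝ (θ z.2 • U (τ y z.1, z.2)) (ψ z.1) : ℝ))
      (prodMeas P Q) := memLp_inner (hθ.memLp_smul (hUy y)) (hψ.comp_fst _)
    have e1 := integral_map (hpres y).measurable.aemeasurable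
      (f := fun z : Ω × Sp d => (inner ℝ (θ z.2 • U z) (ψ (τ (-y) z.1)) : ℝ))
      (by rw [(hpres y).map_eq]; exact i1.1)
    rw [(hpres y).map_eq] at e1
    simp only [← hτ.map_add, neg_add_cancel, hτ.map_zero] at e1
    simp only [smul_sub, inner_sub_left, inner_sub_right]
    rw [integral_sub i3 i2, integral_sub i1 i2, e1]
  refine Eventually.mono (p := fun z => (U z - avg P U z.2) = 0)
    (ae_eq_zero_of_integral_test hpq hQ (hU.sub ((memLp_avg hp hU).comp_snd P))
      fun θ hθ ψ hψ => ?_) fun z hz => sub_eq_zero.1 hz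
  have hθU := hθ.memLp_smul hU
  have hA : MemLp (fun z : Ω × Sp d => θ z.2 • avg P U z.2) (ENNReal.ofReal p) (prodMeas P Q) :=
    hθ.memLp_smul (Q := Q) (P := P) ((memLp_avg hp hU).comp_snd P)
  set Uθ : Ω → ℝ := fun ω => ∫ x in Q, θ x • U (ω, x)
  have hUθm : AEStronglyMeasurable Uθ P :=
    aestronglyMeasurable_integral_smul hU.1 hθ.continuous.aestronglyMeasurable
  have hUθi : Integrable Uθ P := (hθU.integrable hp1).integral_prod_left
  have hinv : ∀ y, ∀ᵐ ω ∂P, Uθ (τ y ω) = Uθ ω := fun y => by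
    filter_upwards [Measure.ae_ae_of_ae_prod (h1 y)] with ω hω
    refine integral_congr_ae ?_
    filter_upwards [hω] with x hx
    rw [sub_eq_zero.1 hx]
  obtain ⟨c, hc⟩ := exists_const_of_invariant hτ herg hUθm.aemeasurable hinv
  have hc2 : c = ∫ x in Q, θ x • avg P U x := by
    have e1 : ∫ ω, Uθ ω ∂P = c := by
      rw [integral_congr_ae hc]
      simp
    have e2 := integral_integral_swap (f := fun ω x => θ x • U (ω, x)) (μ := P)
      (ν := volume.restrict Q) (hθU.integrable hp1)
    rw [← e1, e2]
    simp only [avg, integral_smul]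
  have e3 := integral_inner_integral hpq (hθU.sub hA) hψ
  have e4 : (fun z : Ω × Sp d => θ z.2 • U z) - (fun z => θ z.2 • avg P U z.2) =
      fun z => θ z.2 • (U z - avg P U z.2) := by
    ext1 z
    simp [mul_sub]
  rw [e4] at e3
  refine Eq.trans e3.symm (integral_eq_zero_of_ae ?_)
  filter_upwards [hc, MemLp_section hp0 hθU, MemLp_section hp0 hA] with ω h1 h2 h3
  have e5 := integral_sub (h2.integrable hp1) (h3.integrable hp1)
  have e6 : ∫ x in Q, θ x • (U (ω, x) - avg P U x) = 0 := by
    have : ∫ x in Q, θ x • U (ω, x) = c := h1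
    simp only [smul_sub]
    rw [e5, this, hc2, sub_self]
  simp only [e6, inner_zero_left, Pi.zero_apply]

theorem integral_inner_snd [IsFiniteMeasure P] (hpq : p.HolderConjugate q) {F : Type*}
    [NormedAddCommGroup F] [InnerProductSpace ℝ F] [CompleteSpace F] {f : Ω × Sp d → F}
    (hf : MemLp f (ENNReal.ofReal p) (prodMeas P Q)) (hQ : Bornology.IsBounded Q) {ψ : Sp d → F}
    (hψ : MemLp ψ (ENNReal.ofReal q) (volume.restrict Q)) :
    ∫ z, (inner ℝ (f z) (ψ z.2) : ℝ) ∂(prodMeas P Q) =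
      ∫ x in Q, (inner ℝ (avg P f x) (ψ x) : ℝ) := by
  have := isFiniteMeasure_restrict hQ
  have h1 := integral_inner_integral hpq (memLp_swap hf) hψ
  rw [← integral_prod_swap] at h1
  exact h1.symm

/-- By Hahn–Banach it suffices that every pair `(ψ, φ)` annihilating all `(η, ∇η)` annihilates the
averages. Such a relation holds for each unfolded `u_n` by `IsLpW10.integral_unf_eq_zero_of_test`
and survives weak convergence. -/
theorem IsWeakLimit.isW10_avg (h : IsWeakLimit p P Q τ ε u G U Γ M) (hτ : IsStationary P τ)
    (hpq : p.HolderConjugate q) (hQ : Bornology.IsBounded Q) :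
    IsW10 p Q (avg P U) (avg P Γ) := by
  have := hτ.prob
  have := isFiniteMeasure_restrict hQ
  have := hpq.ennrealOfReal
  have hp := hpq.lt
  have hU := memLp_avg hp h.weak.2.1
  have hΓ := memLp_avg hp h.weak_grad.2.1
  refine ⟨hU, hΓ, fun r hr => ?_⟩
  let S : Set ((Sp d → ℝ) × (Sp d → Sp d)) :=
    {s | (fun x => (s.1 x, s.2 x)) ∈ testPairs Q}
  have hS : Convex ℝ S := fun s hs t ht a b _ _ _ =>
    (testPairs Q).add_mem ((testPairs Q).smul_mem a hs) ((testPairs Q).smul_mem b ht)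
  have key : ∀ (ψ : Sp d → ℝ) (φ : Sp d → Sp d), MemLp ψ (ENNReal.ofReal q) (volume.restrict Q) →
      MemLp φ (ENNReal.ofReal q) (volume.restrict Q) → ∀ c : ℝ,
      (∀ s ∈ S, (∫ x in Q, (inner ℝ (s.1 x) (ψ x) : ℝ)) +
        ∫ x in Q, (inner ℝ (s.2 x) (φ x) : ℝ) ≤ c) →
      (∫ x in Q, (inner ℝ (avg P U x) (ψ x) : ℝ)) +
        ∫ x in Q, (inner ℝ (avg P Γ x) (φ x) : ℝ) ≤ c := fun ψ φ hψ hφ c hc => by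
    have hc0 : 0 ≤ c := by
      simpa using hc (0, 0) (testPairs Q).zero_mem
    -- Again, a functional bounded above on a subspace vanishes on it.
    have h0 : ∀ s ∈ testPairs Q, (∫ x in Q, (inner ℝ (s x).1 (ψ x) : ℝ)) +
        ∫ x in Q, (inner ℝ (s x).2 (φ x) : ℝ) = 0 := fun s hs => by
      by_contra hne
      set a := (∫ x in Q, (inner ℝ (s x).1 (ψ x) : ℝ)) + ∫ x in Q, (inner ℝ (s x).2 (φ x) : ℝ)
        with ha
      have h1 := hc (fun x => (((c + 1) / a) • s) x |>.1, fun x => (((c + 1) / a) • s) x |>.2)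
        ((testPairs Q).smul_mem _ hs)
      simp only [Pi.smul_apply, Prod.smul_fst, Prod.smul_snd, inner_smul_left, conj_trivial,
        integral_const_mul] at h1
      rw [← mul_add, ← ha, div_mul_cancel₀ _ hne] at h1
      linarith
    have hψs := hψ.comp_snd P
    have hφs := hφ.comp_snd P
    have h3 := (h.weak.2.2 _ this _ hψs).add (h.weak_grad.2.2 _ this _ hφs)
    have h4 := fun n => (h.mem n).integral_unf_eq_zero_of_test hτ hpq hQ (h.pos n) hψ hφ h0
    simp only [h4] at h3
    have h5 := tendsto_nhds_unique h3 tendsto_const_nhds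
    rw [integral_inner_snd hpq h.weak.2.1 hQ hψ, integral_inner_snd hpq h.weak_grad.2.1 hQ hφ]
      at h5
    rw [h5]
    exact hc0
  obtain ⟨s, ⟨η, hη, hηQ, hs⟩, h1, h2⟩ := exists_approx_pair_of_dual hpq hS
    (fun s hs => ⟨memLp_fst (memLp_testPairs hp.le hs), memLp_snd (memLp_testPairs hp.le hs)⟩)
    hU hΓ key hr
  have e1 : ∀ x, s.1 x = η x := fun x => congrArg Prod.fst (congrFun hs x)
  have e2 : ∀ x, s.2 x = gradient η x := fun x => congrArg Prod.snd (congrFun hs x)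
  simp only [e1] at h1
  simp only [e2] at h2
  exact ⟨η, hη.1, hη.2, hηQ, h1, h2⟩

theorem IsPot.of_annihilating (hτ : IsStationary P τ) (hp : 1 ≤ p) {χ : Ω → Sp d}
    (h : χ ∈ LpClosure p P (stochGrads hp hτ : Set (Ω → Sp d))) : IsPot p P τ χ :=
  isPot_iff_mem_lpClosure.2 h

theorem secondCountable_Lp [IsFiniteMeasure P] [IsSeparable P] {r : ℝ} {F : Type*}
    [NormedAddCommGroup F] [SecondCountableTopology F] [Fact (1 ≤ ENNReal.ofReal r)] :
    SecondCountableTopology (Lp F (ENNReal.ofReal r) P) := by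
  have : Fact (ENNReal.ofReal r ≠ ∞) := ⟨ENNReal.ofReal_ne_top⟩
  infer_instance

/-- Let `g j` run through annihilators of stochastic gradients. Passing to the limit in the relation
for `θ u_n` gives `∫ (θ Γ + U ∇θ) · g j = 0`, while the deterministic function `θ ⟨U⟩` has a
gradient of mean zero. As `U = ⟨U⟩`, the terms with `∇θ` cancel in the difference, leaving `∫ θ (Γ -
⟨Γ⟩) · g j = 0`. Countably many `j` leave almost every `x`. -/
theorem IsWeakLimit.ae_isPot (h : IsWeakLimit p P Q τ ε u G U Γ M) (hτ : IsStationary P τ)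
    (herg : IsErgodic P τ) (hpq : p.HolderConjugate q) (hQ : Bornology.IsBounded Q) :
    ∀ᵐ x ∂(volume.restrict Q), IsPot p P τ fun ω => Γ (ω, x) - avg P Γ x := by
  have := hτ.prob
  have := hτ.separable
  have := isFiniteMeasure_restrict hQ
  have := hpq.ennrealOfReal
  have hp := hpq.lt
  have hp0 := hpq.pos
  have := fact_one_le_ofReal hpq.symm.lt.le
  have : SecondCountableTopology (Lp (Sp d) (ENNReal.ofReal q) P) := secondCountable_Lp
  have hU := h.weak.2.1
  have hΓ := h.weak_grad.2.1
  obtain ⟨g, hgm, hg0, hg⟩ := exists_annihilating_seq hpq (stochGrads hp.le hτ)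
    fun s ⟨_, hs⟩ => hs.memLp_grad
  have hW := isLpW10_of_isW10 (P := P) hp.le (h.isW10_avg hτ hpq hQ)
  have hD : MemLp (fun z => Γ z - avg P Γ z.2) (ENNReal.ofReal p) (prodMeas P Q) :=
    hΓ.sub hW.memLp_grad
  have hj : ∀ j, ∀ᵐ x ∂(volume.restrict Q),
      ∫ ω, (inner ℝ (Γ (ω, x) - avg P Γ x) (g j ω) : ℝ) ∂P = 0 := fun j => by
    refine ae_integral_inner_eq_zero hpq hQ hD (hgm j) fun θ hθ => ?_
    have m1 := memLp_test_smul (Q := Q) hQ (hgm j) hθ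
    have m2 := memLp_inner_gradient (Q := Q) hQ (hgm j) hθ
    have hsplit : ∀ (H : Ω × Sp d → Sp d) (w : Ω × Sp d → ℝ),
        MemLp H (ENNReal.ofReal p) (prodMeas P Q) → MemLp w (ENNReal.ofReal p) (prodMeas P Q) →
        ∫ z, (inner ℝ (θ z.2 • H z + w z • gradient θ z.2) (g j z.1) : ℝ) ∂(prodMeas P Q) =
        (∫ z, (inner ℝ (H z) (θ z.2 • g j z.1) : ℝ) ∂(prodMeas P Q)) +
          ∫ z, (inner ℝ (w z) (inner ℝ (gradient θ z.2) (g j z.1) : ℝ) : ℝ) ∂(prodMeas P Q) :=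
        fun H w hH hw => by
      rw [← integral_add (memLp_inner hH m1) (memLp_inner hw m2)]
      refine integral_congr_ae (ae_of_all _ fun z => ?_)
      simp only [inner_add_left, inner_smul_left, inner_smul_right, conj_trivial,
        real_inner_eq_mul]
    have h1 := fun n => ((h.mem n).mul_test hp.le hθ).integral_inner_unf_eq_zero hτ hpq hQ
      (h.pos n) (hgm j) (hg0 j)
    have h2 : ∀ n, (∫ z, (inner ℝ (unf τ (ε n) (G n) z) (θ z.2 • g j z.1) : ℝ) ∂(prodMeas P Q)) +
        ∫ z, (inner ℝ (unf τ (ε n) (u n) z) (inner ℝ (gradient θ z.2) (g j z.1) : ℝ) : ℝ)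
          ∂(prodMeas P Q) = 0 := fun n => by
      rw [← hsplit _ _ (h.weak_grad.1 n) (h.weak.1 n)]
      exact h1 n
    have h3 := (h.weak_grad.2.2 _ ‹_› _ m1).add (h.weak.2.2 _ ‹_› _ m2)
    simp only [h2] at h3
    have h4 := tendsto_nhds_unique h3 tendsto_const_nhds
    rw [← hsplit _ _ hΓ hU] at h4
    have h5 := (hW.mul_test hp.le hθ).integral_inner_eq_zero hpq hQ (hgm j)
    have i1 : Integrable (fun z => (inner ℝ (θ z.2 • avg P Γ z.2 + avg P U z.2 • gradient θ z.2)
        (g j z.1) : ℝ)) (prodMeas P Q) :=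
      memLp_inner (hW.mul_test hp.le hθ).memLp_grad ((hgm j).comp_fst _)
    have i2 : Integrable (fun z => (inner ℝ (θ z.2 • (Γ z - avg P Γ z.2)) (g j z.1) : ℝ))
        (prodMeas P Q) := memLp_inner (hθ.memLp_smul hD) ((hgm j).comp_fst _)
    have h6 := integral_add i2 i1
    rw [h5, add_zero] at h6
    rw [← h6, ← h4]
    refine integral_congr_ae ?_
    filter_upwards [h.ae_eq_avg hτ herg hpq hQ] with z hz
    rw [← inner_add_left, hz, smul_sub]
    congr 1
    abel
  filter_upwards [ae_all_iff.2 hj, MemLp_section' hp0 hD] with x hx1 hx2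
  exact IsPot.of_annihilating hτ hp.le (hg _ hx2 hx1)

/-- Tensor approximation with the roles of `Ω` and `Q` exchanged: indicators in `x`, potential
fields in `ω`. -/
theorem isPotTensor_of_sections (hτ : IsStationary P τ) (hp : 1 ≤ p)
    (hQ : Bornology.IsBounded Q) {χ : Ω × Sp d → Sp d}
    (hχ : MemLp χ (ENNReal.ofReal p) (prodMeas P Q))
    (h : ∀ᵐ x ∂(volume.restrict Q), IsPot p P τ fun ω => χ (ω, x)) : IsPotTensor p P τ Q χ := by
  have := hτ.prob
  have := hτ.separable
  have := isFiniteMeasure_restrict hQ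
  have := fact_one_le_ofReal hp
  have : SecondCountableTopology (Lp (Sp d) (ENNReal.ofReal p) P) := secondCountable_Lp
  refine ⟨hχ, fun r hr => ?_⟩
  obtain ⟨n, A, s, hA, hs, hr⟩ := exists_tensor_approx (μ := volume.restrict Q) (ν := P)
    (S := {ξ | IsPot p P τ ξ}) hp
    ⟨fun _ => 0, isPot_iff_mem_lpClosure.2 (subset_lpClosure
      (S := {ψ | ∃ φ, IsStochGrad p P τ φ ψ}) (fun s ⟨_, hs⟩ => hs.memLp_grad)
      ⟨_, IsStochGrad.zero⟩)⟩ (fun s hs => hs.memLp) (memLp_swap hχ)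
    (h.mono fun x hx r hr => ⟨_, hx, by simpa using hr⟩) hr
  refine ⟨n, s, fun i => (A i).indicator fun _ => 1, hs,
    fun i => (memLp_const (1 : ℝ)).indicator (hA i), ?_⟩
  have hm : AEStronglyMeasurable (fun z : Ω × Sp d => χ z - ∑ i, (A i).indicator
      (fun _ => (1 : ℝ)) z.2 • s i z.1) (prodMeas P Q) := by
    refine hχ.1.sub (Finset.aestronglyMeasurable_fun_sum _ fun i _ => ?_)
    have h1 : AEStronglyMeasurable ((A i).indicator fun _ => (1 : ℝ)) (volume.restrict Q) :=
      aestronglyMeasurable_const.indicator (hA i)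
    exact (h1.comp_snd (μ := P)).smul ((hs i).memLp.1.comp_fst (ν := volume.restrict Q))
  rw [← eLpNorm_swap hm]
  exact hr

end Limit

theorem coe_sub_le_coe_iff {a K : ℝ≥0∞} (hK : K ≠ ∞) {c : ℝ} :
    (a : EReal) - (K : EReal) ≤ (c : EReal) ↔ (a : EReal) ≤ ((c + K.toReal : ℝ) : EReal) := by
  lift K to NNReal using hK
  by_cases ha : a = ∞
  · subst ha
    simp only [EReal.coe_ennreal_top, ENNReal.coe_toReal, EReal.coe_nnreal_eq_coe_real,
      EReal.top_sub_coe, top_le_iff]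
    simp only [EReal.coe_ne_top]
  · lift a to NNReal using ha
    simp only [EReal.coe_nnreal_eq_coe_real, ENNReal.coe_toReal]
    rw [← EReal.coe_sub, EReal.coe_le_coe_iff, EReal.coe_le_coe_iff]
    exact sub_le_iff_le_add

theorem coe_ennreal_le_coe_real {a : ℝ≥0∞} {r : ℝ} (h : (a : EReal) ≤ (r : EReal)) :
    0 ≤ r ∧ a ≤ ENNReal.ofReal r := by
  have h0 : 0 ≤ r := by
    have := (EReal.coe_ennreal_nonneg a).trans h
    exact_mod_cast this
  refine ⟨h0, EReal.coe_ennreal_le_coe_ennreal_iff.1 ?_⟩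
  rwa [EReal.coe_ennreal_ofReal, max_eq_left h0]

/-! ### Stability and uniqueness of weak limits -/

section WeakConvergence

variable {α F : Type*} [MeasurableSpace α] {μ : Measure α} [NormedAddCommGroup F]
  [InnerProductSpace ℝ F] {r : ℝ≥0∞} {u : ℕ → α → F} {u₀ u₁ : α → F}

theorem WeakLpTendsto.congr_right (h : WeakLpTendsto r μ u u₀) (he : u₀ =ᵐ[μ] u₁) :
    WeakLpTendsto r μ u u₁ := by
  refine ⟨h.1, (memLp_congr_ae he).1 h.2.1, fun q hq ψ hψ => ?_⟩
  have e : ∫ z, (inner ℝ (u₁ z) (ψ z) : ℝ) ∂μ = ∫ z, (inner ℝ (u₀ z) (ψ z) : ℝ) ∂μ :=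
    integral_congr_ae (he.mono fun z hz => by simp only [hz])
  rw [e]
  exact h.2.2 q hq ψ hψ

theorem WeakLpTendsto.subseq (h : WeakLpTendsto r μ u u₀) {k : ℕ → ℕ} (hk : StrictMono k) :
    WeakLpTendsto r μ (fun n => u (k n)) u₀ :=
  ⟨fun _ => h.1 _, h.2.1, fun q hq ψ hψ => (h.2.2 q hq ψ hψ).comp hk.tendsto_atTop⟩

theorem WeakLpTendsto.ae_eq [IsFiniteMeasure μ] {u : ℕ → α → ℝ} {u₀ u₁ : α → ℝ} (hr : 1 ≤ r)
    (h : WeakLpTendsto r μ u u₀) (h' : WeakLpTendsto 1 μ u u₁) : u₀ =ᵐ[μ] u₁ := by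
  refine Integrable.ae_eq_of_forall_setIntegral_eq _ _ (h.2.1.integrable hr)
    (h'.2.1.integrable le_rfl) fun s hs _ => ?_
  have hm : ∀ q : ℝ≥0∞, MemLp (s.indicator fun _ => (1 : ℝ)) q μ :=
    fun q => (memLp_const (1 : ℝ)).indicator hs
  have e : ∀ f : α → ℝ, ∫ z, (inner ℝ (f z) (s.indicator (fun _ => (1 : ℝ)) z) : ℝ) ∂μ =
      ∫ z in s, f z ∂μ := fun f => by
    rw [← integral_indicator hs]
    refine integral_congr_ae (ae_of_all _ fun z => ?_)
    by_cases hz : z ∈ s <;> simp [hz]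
  have : ENNReal.HolderConjugate r (ENNReal.conjExponent r) := .conjExponent hr
  have h1 := h.2.2 _ this _ (hm _)
  have h2 := h'.2.2 ∞ inferInstance _ (hm _)
  rw [← e, ← e]
  exact tendsto_nhds_unique h1 h2

end WeakConvergence

theorem IsW10.congr {d : ℕ} {p : ℝ} {Q : Set (Sp d)} (hp : 1 ≤ p) {u u' : Sp d → ℝ}
    {g g' : Sp d → Sp d} (h : IsW10 p Q u g) (hu : u =ᵐ[volume.restrict Q] u')
    (hg : g =ᵐ[volume.restrict Q] g') : IsW10 p Q u' g' := by
  rw [isW10_iff hp] at h ⊢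
  refine lpClosure_congr h ?_
  filter_upwards [hu, hg] with x h1 h2
  rw [h1, h2]

/-! ### Compactness and the liminf inequality -/

section Gamma

variable {Ω : Type*} [MeasurableSpace Ω] {d : ℕ} {p q : ℝ} {P : Measure Ω} {Q : Set (Sp d)}
  {τ : Sp d → Ω → Ω} {V : Ω → Sp d → Sp d → ℝ} {C δ : ℝ} {lam : Ω → ℝ}

/-- Coercivity bounds the unfolded gradients, and unfolding is isometric, so the gradients
themselves are bounded; Poincaré's inequality bounds the functions. Two successive subsequences then
converge. -/
theorem exists_weak_limit (hd : 0 < d) (hτ : IsStationary P τ) (hp : 1 < p)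
    (hQm : MeasurableSet Q) (hQ : Bornology.IsBounded Q) (hg : HasGrowth p P Q V C lam)
    (hδ : 0 < δ) {ε : ℕ → ℝ} (hε : ∀ n, 0 < ε n) (hlim : Tendsto ε atTop (𝓝 0))
    {u : ℕ → Ω × Sp d → ℝ} {G : ℕ → Ω × Sp d → Sp d} (h : ∀ n, IsLpW10 p P Q (u n) (G n))
    {c : ℝ≥0∞} (hc : c ≠ ∞) (hE : ∀ n, uEnergy p P Q V C δ (unf τ (ε n) (G n)) ≤ c) :
    ∃ (U : Ω × Sp d → ℝ) (Γ : Ω × Sp d → Sp d) (M : ℝ≥0∞) (k : ℕ → ℕ), StrictMono k ∧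
      IsWeakLimit p P Q τ (fun n => ε (k n)) (fun n => u (k n)) (fun n => G (k n)) U Γ M := by
  have := hτ.prob
  have := hτ.separable
  have := isFiniteMeasure_restrict hQ
  have hp0 : 0 < p := by linarith
  obtain ⟨q, hpq⟩ : ∃ q, p.HolderConjugate q := ⟨_, Real.HolderConjugate.conjExponent hp⟩
  have := fact_one_le_ofReal hpq.symm.lt.le
  have : Fact (ENNReal.ofReal q ≠ ∞) := ⟨ENNReal.ofReal_ne_top⟩
  have s1 : TopologicalSpace.SeparableSpace (Lp ℝ (ENNReal.ofReal q) (prodMeas P Q)) :=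
    separableSpace_Lp_prod hpq.symm.lt.le
  have s2 : TopologicalSpace.SeparableSpace (Lp (Sp d) (ENNReal.ofReal q) (prodMeas P Q)) :=
    separableSpace_Lp_prod hpq.symm.lt.le
  obtain ⟨M, hM, hcoer⟩ := exists_coercive (Q := Q) hg hp hδ hc
  obtain ⟨K, hK, hpoin⟩ := exists_poincare (P := P) hd hp hQm hQ
  have hGb : ∀ n, eLpNorm (G n) (ENNReal.ofReal p) (prodMeas P Q) ≤ M := fun n => by
    rw [← eLpNorm_unf hτ hp0 (hε n) (h n).memLp_grad.1]
    exact hcoer _ (memLp_unf hτ hp0 (hε n) (h n).memLp_grad).1 (hE n)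
  have hub : ∀ n, eLpNorm (u n) (ENNReal.ofReal p) (prodMeas P Q) ≤ K * M := fun n =>
    (hpoin _ _ (h n)).trans (by gcongr; exact hGb n)
  obtain ⟨U, k, hk, hU⟩ := exists_subseq_weakLpTendsto hpq
    (fun n => memLp_unf hτ hp0 (hε n) (h n).memLp) (ENNReal.mul_ne_top hK hM)
    (fun n => (eLpNorm_unf hτ hp0 (hε n) (h n).memLp.1).trans_le (hub n))
  obtain ⟨Γ, l, hl, hΓ⟩ := exists_subseq_weakLpTendsto hpq
    (fun n => memLp_unf hτ hp0 (hε (k n)) (h (k n)).memLp_grad) hM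
    (fun n => (eLpNorm_unf hτ hp0 (hε (k n)) (h (k n)).memLp_grad.1).trans_le (hGb (k n)))
  exact ⟨U, Γ, max (K * M) M, fun n => k (l n), hk.comp hl,
    ⟨fun n => hε _, hlim.comp (hk.comp hl).tendsto_atTop, fun n => h _, hU.subseq hl, hΓ,
      (max_lt (ENNReal.mul_ne_top hK hM).lt_top hM.lt_top).ne,
      fun n => (hub _).trans (le_max_left _ _), fun n => (hGb _).trans (le_max_right _ _)⟩⟩

theorem uEnergy_le_of_energy_le (hτ : IsStationary P τ) (hp : 1 < p) (hQ : Bornology.IsBounded Q)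
    (hV : IsDegenerateIntegrand p P Q V) (hg : HasGrowth p P Q V C lam) (hδ : 0 ≤ δ) {ε : ℝ}
    (hε : 0 < ε) {u : Ω × Sp d → ℝ} {G : Ω × Sp d → Sp d} (h : IsLpW10 p P Q u G) {c : ℝ}
    (hc : energy p P τ Q V ε δ u ≤ c) :
    0 ≤ c + (ENNReal.ofReal C * prodMeas P Q Set.univ).toReal ∧
    uEnergy p P Q V C δ (unf τ ε G) ≤
      ENNReal.ofReal (c + (ENNReal.ofReal C * prodMeas P Q Set.univ).toReal) := by
  have := hτ.prob
  have := isFiniteMeasure_restrict hQ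
  rw [energy_eq hτ hp hQ hV hg hδ hε h, coe_sub_le_coe_iff (ENNReal.mul_ne_top
    ENNReal.ofReal_ne_top (measure_ne_top _ _))] at hc
  exact coe_ennreal_le_coe_real hc

theorem exists_compactness (hd : 0 < d) (hτ : IsStationary P τ) (herg : IsErgodic P τ)
    (hp : 1 < p) (hQm : MeasurableSet Q) (hQ : Bornology.IsBounded Q)
    (hV : IsDegenerateIntegrand p P Q V) (hδ : 0 < δ) {ε : ℕ → ℝ} (hε : ∀ n, 0 < ε n)
    (hlim : Tendsto ε atTop (𝓝 0)) {u : ℕ → Ω × Sp d → ℝ} {G : ℕ → Ω × Sp d → Sp d}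
    (h : ∀ n, IsLpW10 p P Q (u n) (G n))
    (hE : limsup (fun n => energy p P τ Q V (ε n) δ (u n)) atTop < ⊤) :
    ∃ (u₀ : Sp d → ℝ) (g : Sp d → Sp d) (χ : Ω × Sp d → Sp d),
      IsW10 p Q u₀ g ∧ IsPotTensor p P τ Q χ ∧ ∃ k : ℕ → ℕ, StrictMono k ∧
        WeakLpTendsto (ENNReal.ofReal p) (prodMeas P Q)
          (fun n => unf τ (ε (k n)) (u (k n))) (fun z => u₀ z.2) ∧
        WeakLpTendsto (ENNReal.ofReal p) (prodMeas P Q)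
          (fun n => unf τ (ε (k n)) (G (k n))) (fun z => g z.2 + χ z) := by
  have := hτ.prob
  obtain ⟨q, hpq⟩ : ∃ q, p.HolderConjugate q := ⟨_, Real.HolderConjugate.conjExponent hp⟩
  obtain ⟨C, lam, hg⟩ := hV.exists_growth
  obtain ⟨c, hc1, -⟩ := EReal.lt_iff_exists_real_btwn.1 hE
  -- The energies are bounded only from some index on; the sequence is started there.
  obtain ⟨N, hN⟩ := eventually_atTop.1 (eventually_lt_of_limsup_lt hc1)
  have hmono : StrictMono fun n : ℕ => n + N := fun a b hab => Nat.add_lt_add_right hab N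
  obtain ⟨U, Γ, M, k, hk, hw⟩ := exists_weak_limit hd hτ hp hQm hQ hg hδ (fun n => hε (n + N))
    (hlim.comp hmono.tendsto_atTop) (fun n => h (n + N)) ENNReal.ofReal_ne_top
    (fun n => (uEnergy_le_of_energy_le hτ hp hQ hV hg hδ.le (hε _) (h (n + N))
      (hN (n + N) (Nat.le_add_left _ _)).le).2)
  have hW := hw.isW10_avg hτ hpq hQ
  have hχ : MemLp (fun z => Γ z - avg P Γ z.2) (ENNReal.ofReal p) (prodMeas P Q) :=
    hw.weak_grad.2.1.sub (isLpW10_of_isW10 hp.le hW).memLp_grad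
  refine ⟨avg P U, avg P Γ, fun z => Γ z - avg P Γ z.2, hW,
    isPotTensor_of_sections hτ hp.le hQ hχ (hw.ae_isPot hτ herg hpq hQ), fun n => k n + N,
    hmono.comp hk, hw.weak.congr_right (hw.ae_eq_avg hτ herg hpq hQ), ?_⟩
  simpa only [add_sub_cancel] using hw.weak_grad

/-- For almost every `x` the fluctuation `Γ(·, x) - ⟨Γ(·, x)⟩` competes in the cell problem with `F
= ⟨Γ(·, x)⟩`, and Tonelli sums up the cell energies. Measurability of the homogenized integrand is
not required, since `eint` is monotone without it. -/
theorem energyHom_le (hτ : IsStationary P τ) (hQ : Bornology.IsBounded Q)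
    (hV : IsDegenerateIntegrand p P Q V) (hg : HasGrowth p P Q V C lam) (hδ : 0 ≤ δ)
    {u₀ : Sp d → ℝ} {Γ : Ω × Sp d → Sp d} (hΓ : AEStronglyMeasurable Γ (prodMeas P Q))
    (hu : IsW10 p Q u₀ (avg P Γ))
    (hpot : ∀ᵐ x ∂(volume.restrict Q), IsPot p P τ fun ω => Γ (ω, x) - avg P Γ x) :
    energyHom p P τ Q V δ u₀ ≤ (uEnergy p P Q V C δ Γ : EReal) -
      ((ENNReal.ofReal C * prodMeas P Q Set.univ : ℝ≥0∞) : EReal) := by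
  have := hτ.prob
  have := isFiniteMeasure_restrict hQ
  have hD := aemeasurable_density (C := C) (δ := δ) hV hΓ
  have hD' : AEMeasurable (fun z : Sp d × Ω => density p P V C δ Γ z.swap)
      ((volume.restrict Q).prod P) :=
    hD.comp_quasiMeasurePreserving Measure.measurePreserving_swap.quasiMeasurePreserving
  have hpos : ∀ᵐ z ∂(prodMeas P Q), 0 ≤ density p P V C δ Γ z := by
    filter_upwards [hg.le_density (δ := δ) Γ, hg.lam_pos_prod] with z h1 h2
    refine le_trans ?_ h1
    positivity
  have hpos' : ∀ᵐ x ∂(volume.restrict Q), ∀ᵐ ω ∂P, 0 ≤ density p P V C δ Γ (ω, x) :=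
    Measure.ae_ae_of_ae_prod (Measure.measurePreserving_swap.quasiMeasurePreserving.ae hpos)
  have hsec : ∀ᵐ x ∂(volume.restrict Q), AEMeasurable (fun ω => density p P V C δ Γ (ω, x)) P :=
    hD'.aestronglyMeasurable.prodMk_left.mono fun x hx => hx.aemeasurable
  have hmeas : AEMeasurable (fun x => ∫⁻ ω, ENNReal.ofReal (density p P V C δ Γ (ω, x)) ∂P)
      (volume.restrict Q) := hD'.ennreal_ofReal.lintegral_prod_right'
  refine (iInf₂_le (avg P Γ) hu).trans (le_trans (eint_mono (g := fun x =>
    ((∫⁻ ω, ENNReal.ofReal (density p P V C δ Γ (ω, x)) ∂P : ℝ≥0∞) : EReal) -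
      ((ENNReal.ofReal C : ℝ≥0∞) : EReal)) ?_) (le_of_eq ?_))
  · filter_upwards [hpot, hpos', hsec] with x h1 h2 h3
    refine (iInf₂_le _ h1).trans (le_of_eq ?_)
    rw [eint_real (C := C) ?_ hg.pos.le ?_]
    · rw [measure_univ, mul_one]
      congr 3
      ext1 ω
      simp only [density, add_sub_cancel]
      congr 1
      ring
    · refine (h3.sub_const C).congr (ae_of_all _ fun ω => ?_)
      simp only [density, add_sub_cancel]
      ring
    · filter_upwards [h2] with ω h4
      simp only [density] at h4
      simp only [add_sub_cancel]
      linarith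
  · rw [eint_sub_const hmeas ENNReal.ofReal_ne_top, uEnergy, lintegral_prod_symm _
      hD.ennreal_ofReal, ← Set.univ_prod_univ, Measure.prod_prod,
      measure_univ (μ := P), one_mul]

theorem energyHom_congr (hp : 1 ≤ p) {u u' : Sp d → ℝ} (h : u =ᵐ[volume.restrict Q] u') :
    energyHom p P τ Q V δ u = energyHom p P τ Q V δ u' :=
  le_antisymm
    (le_iInf₂ fun g hg => iInf₂_le (α := EReal) g (hg.congr hp h.symm EventuallyEq.rfl))
    (le_iInf₂ fun g hg => iInf₂_le (α := EReal) g (hg.congr hp h EventuallyEq.rfl))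

/-- For a real `c` above the liminf, energies stay below `c` along a subsequence, which provides
gradients and weak limits in `L^p`. The weak `L^1` limit forces `U = u₀`, and weak lower
semicontinuity with `energyHom_le` gives the bound by `c`. -/
theorem energyHom_le_liminf (hd : 0 < d) (hτ : IsStationary P τ) (herg : IsErgodic P τ)
    (hp : 1 < p) (hQm : MeasurableSet Q) (hQ : Bornology.IsBounded Q)
    (hV : IsDegenerateIntegrand p P Q V) (hδ : 0 < δ) {ε : ℕ → ℝ} (hε : ∀ n, 0 < ε n)
    (hlim : Tendsto ε atTop (𝓝 0)) {u : ℕ → Ω × Sp d → ℝ} {u₀ : Sp d → ℝ}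
    (hw : WeakLpTendsto 1 (prodMeas P Q) (fun n => unf τ (ε n) (u n)) (fun z => u₀ z.2)) :
    energyHom p P τ Q V δ u₀ ≤
      liminf (fun n => energy p P τ Q V (ε n) δ (u n)) atTop := by
  have := hτ.prob
  have := isFiniteMeasure_restrict hQ
  obtain ⟨q, hpq⟩ : ∃ q, p.HolderConjugate q := ⟨_, Real.HolderConjugate.conjExponent hp⟩
  obtain ⟨C, lam, hg⟩ := hV.exists_growth
  refine EReal.le_of_forall_lt_iff_le.1 fun c hc => ?_
  obtain ⟨k, hk, hkc⟩ := extraction_of_frequently_atTop (frequently_lt_of_liminf_lt (by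
    isBoundedDefault) hc)
  have hG : ∀ n, ∃ G, IsLpW10 p P Q (u (k n)) G := fun n => by
    by_contra hne
    push Not at hne
    -- Without an admissible gradient the energy is an infimum over the empty set.
    have h1 : energy p P τ Q V (ε (k n)) δ (u (k n)) = ⊤ :=
      iInf₂_eq_top.2 fun G hG => absurd hG (hne G)
    exact absurd (hkc n) (by simp [h1])
  choose G hG using hG
  have hE := fun n => uEnergy_le_of_energy_le hτ hp hQ hV hg hδ.le (hε _) (hG n) (hkc n).le
  obtain ⟨U, Γ, M, l, hl, hwl⟩ := exists_weak_limit hd hτ hp hQm hQ hg hδ (fun n => hε (k n))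
    (hlim.comp hk.tendsto_atTop) hG ENNReal.ofReal_ne_top fun n => (hE n).2
  have h1 : U =ᵐ[prodMeas P Q] fun z => u₀ z.2 :=
    hwl.weak.ae_eq (by simpa using hp.le) (hw.subseq (hk.comp hl))
  have h2 : u₀ =ᵐ[volume.restrict Q] avg P U := by
    filter_upwards [avg_congr h1] with x hx
    rw [hx]
    simp [avg]
  rw [energyHom_congr hp.le h2]
  have h3 := uEnergy_le_of_weak hQ hV hg hp hδ.le hwl.weak_grad fun n => (hE _).2
  refine (energyHom_le hτ hQ hV hg hδ.le hwl.weak_grad.2.1.1 (hwl.isW10_avg hτ hpq hQ)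
    (hwl.ae_isPot hτ herg hpq hQ)).trans ?_
  rw [coe_sub_le_coe_iff (ENNReal.mul_ne_top ENNReal.ofReal_ne_top (measure_ne_top _ _))]
  refine (EReal.coe_ennreal_le_coe_ennreal_iff.2 h3).trans (le_of_eq ?_)
  rw [EReal.coe_ennreal_ofReal, max_eq_left (hE 0).1]

end Gamma

theorem add_rpow_le_mul {p : ℝ} (hp : 1 ≤ p) {a b : ℝ} (ha : 0 ≤ a) (hb : 0 ≤ b) :
    (a + b) ^ p ≤ 2 ^ (p - 1) * (a ^ p + b ^ p) := by
  have h := NNReal.rpow_add_le_mul_rpow_add_rpow ⟨a, ha⟩ ⟨b, hb⟩ hp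
  exact_mod_cast h

/-! ### Cell problems and a countable family of correctors -/

section Cell

variable {Ω : Type*} [MeasurableSpace Ω] {d : ℕ} {p : ℝ} {P : Measure Ω} {Q : Set (Sp d)}
  {τ : Sp d → Ω → Ω} {V : Ω → Sp d → Sp d → ℝ} {C δ : ℝ} {lam : Ω → ℝ} {x F : Sp d}

/-- The energy of a corrector in the cell problem at `x`, shifted by a constant. -/
noncomputable def cellE (p : ℝ) (P : Measure Ω) (V : Ω → Sp d → Sp d → ℝ) (C δ : ℝ)
    (x F : Sp d) (χ : Ω → Sp d) : ℝ≥0∞ :=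
  ∫⁻ ω, ENNReal.ofReal (V ω x (F + χ ω) + C + δ * ‖χ ω‖ ^ p) ∂P

/-- The properties of the integrand `V(·, x, ·)` that hold for almost every `x`. -/
structure IsRegularAt (p : ℝ) (P : Measure Ω) (V : Ω → Sp d → Sp d → ℝ) (C : ℝ) (lam : Ω → ℝ)
    (x : Sp d) : Prop where
  measurable : ∀ F, AEMeasurable (fun ω => V ω x F) P
  convex : ∀ᵐ ω ∂P, ConvexOn ℝ Set.univ (V ω x)
  bound : ∀ᵐ ω ∂P, ∀ F : Sp d,
    lam ω * ‖F‖ ^ p - C ≤ V ω x F ∧ V ω x F ≤ C * (lam ω * ‖F‖ ^ p + 1)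

theorem ae_ae_section {μ : Measure Ω} [SFinite μ] {α : Type*} [MeasurableSpace α] {ν : Measure α}
    [SFinite ν] {s : Ω × α → Prop} (h : ∀ᵐ z ∂(μ.prod ν), s z) : ∀ᵐ x ∂ν, ∀ᵐ ω ∂μ, s (ω, x) :=
  Measure.ae_ae_of_ae_prod (Measure.measurePreserving_swap.quasiMeasurePreserving.ae h)

theorem AEMeasurable_section {μ : Measure Ω} [SFinite μ] {α β : Type*} [MeasurableSpace α]
    {ν : Measure α} [SFinite ν] [MeasurableSpace β] {f : Ω × α → β}
    (h : AEMeasurable f (μ.prod ν)) : ∀ᵐ x ∂ν, AEMeasurable (fun ω => f (ω, x)) μ := by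
  have h1 : ∀ᵐ z ∂(μ.prod ν), f z = h.mk f z := h.ae_eq_mk
  filter_upwards [ae_ae_section h1] with x hx
  exact ⟨_, h.measurable_mk.comp measurable_prodMk_right, hx⟩

/-- The exceptional set of `x` must not depend on `F`: measurability is sliced on a countable dense
set of `F` and extended by continuity in `F`. -/
theorem ae_isRegularAt [IsFiniteMeasure P] (hV : IsDegenerateIntegrand p P Q V)
    (hg : HasGrowth p P Q V C lam) : ∀ᵐ x ∂(volume.restrict Q), IsRegularAt p P V C lam x := by
  have h1 : ∀ᵐ x ∂(volume.restrict Q), ∀ n, AEMeasurable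
      (fun ω => V ω x (TopologicalSpace.denseSeq (Sp d) n)) P :=
    ae_all_iff.2 fun n => AEMeasurable_section (hV.measurable _)
  filter_upwards [h1, ae_ae_section hV.convex, ae_ae_section hg.bound] with x h1 h2 h3
  refine ⟨fun F => ?_, h2, h3⟩
  obtain ⟨k, hk⟩ : ∃ k : ℕ → ℕ, Tendsto (fun n => TopologicalSpace.denseSeq (Sp d) (k n)) atTop
      (𝓝 F) := by
    obtain ⟨s, hs, hlim⟩ := mem_closure_iff_seq_limit.1
      (TopologicalSpace.denseRange_denseSeq (Sp d) F)
    choose k hk using hs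
    exact ⟨k, by simpa only [hk] using hlim⟩
  refine aemeasurable_of_tendsto_metrizable_ae atTop (fun n => h1 (k n)) ?_
  filter_upwards [h2] with ω hω
  exact (hω.locallyLipschitz.continuous.tendsto _).comp hk

theorem IsRegularAt.aemeasurable (h : IsRegularAt p P V C lam x) {χ : Ω → Sp d}
    (hχ : AEStronglyMeasurable χ P) :
    AEMeasurable (fun ω => V ω x (F + χ ω) + C + δ * ‖χ ω‖ ^ p) P := by
  have h1 : AEMeasurable (fun ω => V ω x (F + χ ω)) P :=
    aemeasurable_caratheodory h.measurable
      (h.convex.mono fun _ h => h.locallyLipschitz.continuous) (aestronglyMeasurable_const.add hχ)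
  exact (h1.add_const C).add ((hχ.norm.aemeasurable.pow_const p).const_mul δ)

theorem IsRegularAt.eint_eq [IsProbabilityMeasure P] (h : IsRegularAt p P V C lam x)
    (hg : HasGrowth p P Q V C lam) (hδ : 0 ≤ δ) {χ : Ω → Sp d} (hχ : AEStronglyMeasurable χ P) :
    eint P (fun ω => ((V ω x (F + χ ω) + δ * ‖χ ω‖ ^ p : ℝ) : EReal)) =
      (cellE p P V C δ x F χ : EReal) - ((ENNReal.ofReal C : ℝ≥0∞) : EReal) := by
  rw [eint_real (C := C) ?_ hg.pos.le ?_, measure_univ, mul_one, cellE]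
  · congr 3
    ext1 ω
    congr 1
    ring
  · refine ((h.aemeasurable (F := F) (δ := δ) hχ).sub_const C).congr (ae_of_all _ fun ω => ?_)
    simp only
    ring
  · filter_upwards [h.bound, hg.lam_pos] with ω h1 h2
    have h3 := (h1 (F + χ ω)).1
    have h4 : 0 ≤ lam ω * ‖F + χ ω‖ ^ p := by positivity
    have h5 : 0 ≤ δ * ‖χ ω‖ ^ p := by positivity
    linarith

theorem IsRegularAt.le_Vhom [IsProbabilityMeasure P] (h : IsRegularAt p P V C lam x)
    (hg : HasGrowth p P Q V C lam) (hδ : 0 ≤ δ) {I : ℝ≥0∞}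
    (hI : ∀ χ, IsPot p P τ χ → I ≤ cellE p P V C δ x F χ) :
    (I : EReal) - ((ENNReal.ofReal C : ℝ≥0∞) : EReal) ≤ Vhom p P τ V δ x F := by
  refine le_iInf₂ fun χ hχ => ?_
  rw [h.eint_eq hg hδ hχ.memLp.1]
  exact EReal.sub_le_sub (EReal.coe_ennreal_le_coe_ennreal_iff.2 (hI χ hχ)) le_rfl

/-- The weight `(1 + |λ|)^{1/p}`. -/
noncomputable def wgt (p : ℝ) (lam : Ω → ℝ) (ω : Ω) : ℝ := (1 + |lam ω|) ^ (1 / p)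

omit [MeasurableSpace Ω] in
theorem wgt_pos (ω : Ω) : 0 < wgt p lam ω := by
  unfold wgt
  positivity

omit [MeasurableSpace Ω] in
theorem wgt_norm_rpow (hp : 0 < p) (ω : Ω) (y : Sp d) :
    ‖wgt p lam ω • y‖ ^ p = (1 + |lam ω|) * ‖y‖ ^ p := by
  rw [norm_smul, Real.norm_of_nonneg (wgt_pos ω).le, Real.mul_rpow (wgt_pos ω).le (norm_nonneg _),
    wgt, ← Real.rpow_mul (by positivity), one_div, inv_mul_cancel₀ hp.ne', Real.rpow_one]

theorem enorm_rpow_eq_ofReal (hp : 0 < p) (y : Sp d) : ‖y‖ₑ ^ p = ENNReal.ofReal (‖y‖ ^ p) := by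
  rw [← ofReal_norm, ENNReal.ofReal_rpow_of_nonneg (norm_nonneg _) hp.le]

theorem aestronglyMeasurable_wgt (hl : AEMeasurable lam P) :
    AEStronglyMeasurable (wgt p lam) P :=
  ((hl.abs.const_add 1).pow_const _).aestronglyMeasurable

theorem norm_add_rpow_le (hp : 1 ≤ p) (F y : Sp d) :
    ‖F + y‖ ^ p ≤ 2 ^ (p - 1) * (‖F‖ ^ p + ‖y‖ ^ p) :=
  (Real.rpow_le_rpow (norm_nonneg _) (norm_add_le _ _) (by linarith)).trans
    (add_rpow_le_mul hp (norm_nonneg _) (norm_nonneg _))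

/-- Upper growth and `|F + y|^p ≤ 2^{p-1} (|F|^p + |y|^p)`. In the first constant, `2 C` collects
the `C` of the growth condition and the `C` of the energy shift. -/
theorem IsRegularAt.exists_cellE_le [IsFiniteMeasure P] (h : IsRegularAt p P V C lam x)
    (hg : HasGrowth p P Q V C lam) (hp : 1 ≤ p) (hδ : 0 ≤ δ) (F : Sp d) :
    ∃ A B : ℝ≥0∞, A ≠ ∞ ∧ B ≠ ∞ ∧ ∀ y : Ω → Sp d, cellE p P V C δ x F y ≤
      A + B * eLpNorm (fun ω => wgt p lam ω • y ω) (ENNReal.ofReal p) P ^ p := by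
  have hp0 : 0 < p := by linarith
  set k : ℝ := C * 2 ^ (p - 1) with hk
  have hC := hg.pos
  have hk0 : 0 ≤ k := by positivity
  have hint : Integrable (fun ω => 2 * C + k * ‖F‖ ^ p * lam ω) P :=
    (integrable_const _).add (hg.integrable.const_mul _)
  refine ⟨∫⁻ ω, ENNReal.ofReal (2 * C + k * ‖F‖ ^ p * lam ω) ∂P, ENNReal.ofReal (k + δ),
    ?_, ENNReal.ofReal_ne_top, fun y => ?_⟩
  · exact ((lintegral_mono fun ω => ENNReal.ofReal_le_ofReal (Real.le_norm_self _)).trans_lt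
      (hasFiniteIntegral_iff_norm _ |>.1 hint.2)).ne
  rw [eLpNorm_rpow_eq hp0, ← lintegral_const_mul' _ _ ENNReal.ofReal_ne_top,
    ← lintegral_add_left' hint.1.aemeasurable.ennreal_ofReal]
  refine lintegral_mono_ae ?_
  filter_upwards [h.bound, hg.lam_pos] with ω h1 h2
  rw [enorm_rpow_eq_ofReal hp0, wgt_norm_rpow hp0, ← ENNReal.ofReal_mul (by positivity),
    ← ENNReal.ofReal_add (by positivity) (by positivity), abs_of_pos h2]
  refine ENNReal.ofReal_le_ofReal ?_
  have h3 := (h1 (F + y ω)).2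
  have h4 := mul_le_mul_of_nonneg_left (norm_add_rpow_le hp F (y ω)) (mul_pos hC h2).le
  have h5 : 0 ≤ ‖y ω‖ ^ p := by positivity
  have h6 : C * lam ω * (2 ^ (p - 1) * (‖F‖ ^ p + ‖y ω‖ ^ p)) =
      k * ‖F‖ ^ p * lam ω + k * (lam ω * ‖y ω‖ ^ p) := by
    rw [hk]
    ring
  have h7 : 0 ≤ k * ‖y ω‖ ^ p := by positivity
  have h8 : 0 ≤ δ * (lam ω * ‖y ω‖ ^ p) := by positivity
  rw [h6] at h4
  nlinarith

/-- Lower growth bounds `λ |F + χ|^p`; removing the constant vector `F` costs a multiple of `λ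
|F|^p`, which is integrable. Correctors of finite energy therefore lie in the space weighted by `1 +
|λ|`. -/
theorem IsRegularAt.memLp_of_cellE_ne_top [IsFiniteMeasure P] (h : IsRegularAt p P V C lam x)
    (hg : HasGrowth p P Q V C lam) (hp : 1 ≤ p) (hδ : 0 ≤ δ) {χ : Ω → Sp d}
    (hχ : MemLp χ (ENNReal.ofReal p) P) (hfin : cellE p P V C δ x F χ ≠ ∞) :
    MemLp (fun ω => wgt p lam ω • χ ω) (ENNReal.ofReal p) P := by
  have hp0 : 0 < p := by linarith
  rw [memLp_iff_lintegral hp0]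
  refine ⟨(aestronglyMeasurable_wgt hg.integrable.1.aemeasurable).smul hχ.1, ?_⟩
  have hC := hg.pos
  set k : ℝ := 2 ^ (p - 1) with hk
  have hk0 : 0 ≤ k := by positivity
  have hm := h.aemeasurable (F := F) (δ := δ) hχ.1
  have hχm := (hχ.1.enorm.pow_const p)
  calc ∫⁻ ω, ‖wgt p lam ω • χ ω‖ₑ ^ p ∂P
      ≤ ∫⁻ ω, ‖χ ω‖ₑ ^ p + (ENNReal.ofReal k *
          ENNReal.ofReal (V ω x (F + χ ω) + C + δ * ‖χ ω‖ ^ p) +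
          ENNReal.ofReal (k * ‖F‖ ^ p * lam ω)) ∂P := by
        refine lintegral_mono_ae ?_
        filter_upwards [h.bound, hg.lam_pos] with ω h1 h2
        have h3 := (h1 (F + χ ω)).1
        have h4 : 0 ≤ lam ω * ‖F + χ ω‖ ^ p := by positivity
        have h5 : 0 ≤ δ * ‖χ ω‖ ^ p := by positivity
        rw [enorm_rpow_eq_ofReal hp0, enorm_rpow_eq_ofReal hp0, wgt_norm_rpow hp0,
          ← ENNReal.ofReal_mul hk0, ← ENNReal.ofReal_add (mul_nonneg hk0 (by linarith))
          (by positivity), ← ENNReal.ofReal_add (by positivity) (add_nonneg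
          (mul_nonneg hk0 (by linarith)) (by positivity)), abs_of_pos h2]
        refine ENNReal.ofReal_le_ofReal ?_
        have h6 := norm_add_rpow_le hp (F + χ ω) (-F)
        rw [show F + χ ω + -F = χ ω by abel, norm_neg] at h6
        have h7 := mul_le_mul_of_nonneg_left h6 h2.le
        have h8 : k * (lam ω * ‖F + χ ω‖ ^ p) ≤ k * (V ω x (F + χ ω) + C + δ * ‖χ ω‖ ^ p) :=
          mul_le_mul_of_nonneg_left (by linarith) hk0
        rw [← hk] at h7
        nlinarith
    _ < ∞ := by
        rw [lintegral_add_left' hχm, lintegral_add_left' (hm.ennreal_ofReal.const_mul _),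
          lintegral_const_mul' _ _ ENNReal.ofReal_ne_top]
        refine ENNReal.add_lt_top.2 ⟨((memLp_iff_lintegral hp0 _).1 hχ).2, ENNReal.add_lt_top.2
          ⟨ENNReal.mul_lt_top ENNReal.ofReal_lt_top (lt_top_iff_ne_top.2 hfin), ?_⟩⟩
        exact (lintegral_mono fun ω => ENNReal.ofReal_le_ofReal (Real.le_norm_self _)).trans_lt
          (hasFiniteIntegral_iff_norm _ |>.1 (hg.integrable.const_mul _).2)

/-- Convexity of the density, with the factor `1 - t` of the first term enlarged to `1` because
shifted densities are nonnegative. -/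
theorem IsRegularAt.cellE_convex_le [IsFiniteMeasure P] (h : IsRegularAt p P V C lam x)
    (hg : HasGrowth p P Q V C lam) (hp : 1 ≤ p) (hδ : 0 ≤ δ) {χ y : Ω → Sp d}
    (hχ : AEStronglyMeasurable χ P) {t : ℝ} (ht0 : 0 ≤ t) (ht1 : t ≤ 1) :
    cellE p P V C δ x F (fun ω => (1 - t) • χ ω + t • y ω) ≤
      cellE p P V C δ x F χ + ENNReal.ofReal t * cellE p P V C δ x F y := by
  have hm := (h.aemeasurable (F := F) (δ := δ) hχ).ennreal_ofReal
  simp only [cellE]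
  rw [← lintegral_const_mul' _ _ ENNReal.ofReal_ne_top, ← lintegral_add_left' hm]
  refine lintegral_mono_ae ?_
  filter_upwards [h.convex, h.bound, hg.lam_pos] with ω h1 h2 h3
  have ht : 0 ≤ 1 - t := by linarith
  have a1 := (h2 (F + χ ω)).1
  have a2 := (h2 (F + y ω)).1
  have a3 : 0 ≤ lam ω * ‖F + χ ω‖ ^ p := by positivity
  have a4 : 0 ≤ lam ω * ‖F + y ω‖ ^ p := by positivity
  have a5 : 0 ≤ δ * ‖χ ω‖ ^ p := by positivity
  have a6 : 0 ≤ δ * ‖y ω‖ ^ p := by positivity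
  rw [← ENNReal.ofReal_mul ht0, ← ENNReal.ofReal_add (by linarith)
    (mul_nonneg ht0 (by linarith))]
  refine ENNReal.ofReal_le_ofReal ?_
  have e1 := h1.2 (Set.mem_univ (F + χ ω)) (Set.mem_univ (F + y ω)) ht ht0 (by ring)
  rw [show (1 - t) • (F + χ ω) + t • (F + y ω) = F + ((1 - t) • χ ω + t • y ω) by module] at e1
  have e2 : ‖(1 - t) • χ ω + t • y ω‖ ^ p ≤ (1 - t) * ‖χ ω‖ ^ p + t * ‖y ω‖ ^ p := by
    refine le_trans (Real.rpow_le_rpow (norm_nonneg _) ?_ (by linarith)) ((convexOn_rpow hp).2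
      (norm_nonneg (χ ω)) (norm_nonneg (y ω)) ht ht0 (by ring))
    refine (norm_add_le _ _).trans ?_
    rw [norm_smul, norm_smul, Real.norm_of_nonneg ht, Real.norm_of_nonneg ht0]
    rfl
  have e3 := mul_le_mul_of_nonneg_left e2 hδ
  simp only [smul_eq_mul] at e1
  have e4 : 0 ≤ t * (V ω x (F + χ ω) + C + δ * ‖χ ω‖ ^ p) := mul_nonneg ht0 (by linarith)
  nlinarith

/-- A countable family of correctors with finite weighted norm that suffices for the cell
problem. -/
theorem exists_corrector_seq (hτ : IsStationary P τ) (hg : HasGrowth p P Q V C lam)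
    (hp : 1 ≤ p) (hδ : 0 ≤ δ) : ∃ χ : ℕ → Ω → Sp d, (∀ k, IsPot p P τ (χ k)) ∧
      (∀ k, MemLp (fun ω => wgt p lam ω • χ k ω) (ENNReal.ofReal p) P) ∧
      ∀ x, IsRegularAt p P V C lam x → ∀ F ξ, IsPot p P τ ξ →
        ⨅ k, cellE p P V C δ x F (χ k) ≤ cellE p P V C δ x F ξ := by
  have := hτ.prob
  have := hτ.separable
  have hp0 : 0 < p := by linarith
  have := fact_one_le_ofReal hp
  have : SecondCountableTopology (Lp (Sp d) (ENNReal.ofReal p) P) := secondCountable_Lp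
  -- Multiplication by the weight embeds the correctors of finite weighted norm into `L^p(P)`, where
  -- a dense sequence exists. The choice depends neither on `x` nor on `F`.
  let S : Set (Ω → Sp d) := {s | MemLp s (ENNReal.ofReal p) P ∧
    IsPot p P τ fun ω => (wgt p lam ω)⁻¹ • s ω}
  have hzero : IsPot p P τ fun _ => 0 := isPot_iff_mem_lpClosure.2 (subset_lpClosure
    (S := {ψ | ∃ φ, IsStochGrad p P τ φ ψ}) (fun s ⟨_, hs⟩ => hs.memLp_grad)
    ⟨_, IsStochGrad.zero⟩)
  obtain ⟨s, hs, hdense⟩ := exists_dense_seq (S := S) (p := ENNReal.ofReal p) (ν := P)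
    ⟨fun _ => 0, MemLp.zero', by simpa only [smul_zero] using hzero⟩ (fun s hs => hs.1)
  have hw : ∀ ω, wgt p lam ω ≠ 0 := fun ω => (wgt_pos ω).ne'
  refine ⟨fun k ω => (wgt p lam ω)⁻¹ • s k ω, fun k => (hs k).2, fun k => ?_,
    fun x hx F ξ hξ => ?_⟩
  · simpa only [smul_inv_smul₀ (hw _)] using (hs k).1
  by_cases hfin : cellE p P V C δ x F ξ = ∞
  · rw [hfin]
    exact le_top
  have hξw := hx.memLp_of_cellE_ne_top hg hp hδ hξ.memLp hfin
  obtain ⟨A, B, hA, hB, hAB⟩ := hx.exists_cellE_le (δ := δ) hg hp hδ F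
  set N := eLpNorm (fun ω => wgt p lam ω • ξ ω) (ENNReal.ofReal p) P with hN
  set M := A + B * (N + 1) ^ p
  have hM : M ≠ ∞ := ENNReal.add_ne_top.2 ⟨hA, ENNReal.mul_ne_top hB
    (ENNReal.rpow_ne_top_of_nonneg hp0.le (ENNReal.add_ne_top.2 ⟨hξw.2.ne, by simp⟩))⟩
  have hlim : Tendsto (fun t : ℝ => cellE p P V C δ x F ξ + ENNReal.ofReal t * M) (𝓝[>] 0)
      (𝓝 (cellE p P V C δ x F ξ)) := by
    have h1 : Tendsto (fun t : ℝ => ENNReal.ofReal t) (𝓝[>] 0) (𝓝 0) := by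
      have := (ENNReal.continuous_ofReal.tendsto 0).mono_left (nhdsWithin_le_nhds (s := Set.Ioi 0))
      simpa using this
    have h2 := (ENNReal.Tendsto.mul_const h1 (Or.inr hM)).const_add (cellE p P V C δ x F ξ)
    simpa using h2
  refine ge_of_tendsto hlim ?_
  filter_upwards [Ioo_mem_nhdsGT (zero_lt_one (α := ℝ))] with t ht
  have ht0 : (t : ℝ) ≠ 0 := ht.1.ne'
  obtain ⟨k, hk⟩ := hdense (fun ω => wgt p lam ω • ξ ω)
    ⟨hξw, by simpa only [inv_smul_smul₀ (hw _)] using hξ⟩ (ENNReal.ofReal t)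
    (ENNReal.ofReal_pos.2 ht.1)
  refine (iInf_le _ k).trans ?_
  -- The corrector with index `k` is `(1 - t) ξ + t y`. Being within `t` of `ξ` in weighted norm, it
  -- makes the weighted norm of `y` at most `N + 1`, so the energy of `y` is at most `M` and
  -- convexity gives an excess of at most `t M`.
  let y : Ω → Sp d := fun ω => ξ ω + t⁻¹ • ((wgt p lam ω)⁻¹ • s k ω - ξ ω)
  have e1 : (fun ω => (wgt p lam ω)⁻¹ • s k ω) = fun ω => (1 - t) • ξ ω + t • y ω := by
    ext1 ω
    simp only [y, smul_add, smul_smul, mul_inv_cancel₀ ht0, one_smul, sub_smul]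
    abel
  rw [e1]
  refine (hx.cellE_convex_le hg hp hδ hξ.memLp.1 ht.1.le ht.2.le).trans ?_
  gcongr
  refine (hAB y).trans ?_
  simp only [M]
  gcongr
  have e2 : (fun ω => wgt p lam ω • y ω) = (fun ω => wgt p lam ω • ξ ω) +
      (-t⁻¹) • (fun ω => wgt p lam ω • ξ ω - s k ω) := by
    ext1 ω
    change wgt p lam ω • y ω = wgt p lam ω • ξ ω + (-t⁻¹) • (wgt p lam ω • ξ ω - s k ω)
    simp only [y, smul_add, smul_comm (wgt p lam ω) t⁻¹, smul_sub, smul_inv_smul₀ (hw ω),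
      neg_smul]
    abel
  rw [e2]
  refine (eLpNorm_add_le hξw.1 ((hξw.1.sub (hs k).1.1).const_smul _) (by simpa using hp)).trans ?_
  refine add_le_add le_rfl ?_
  rw [eLpNorm_const_smul]
  calc ‖-t⁻¹‖ₑ * eLpNorm (fun ω => wgt p lam ω • ξ ω - s k ω) (ENNReal.ofReal p) P
      ≤ ENNReal.ofReal t⁻¹ * ENNReal.ofReal t := by
        rw [enorm_neg, ← ofReal_norm, Real.norm_of_nonneg (inv_nonneg.2 ht.1.le)]
        gcongr
    _ = 1 := by
        rw [← ENNReal.ofReal_mul (inv_nonneg.2 ht.1.le), inv_mul_cancel₀ ht0, ENNReal.ofReal_one]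

end Cell

/-! ### Dominated convergence in `L^p` norm -/

section DominatedConvergence

variable {α : Type*} [MeasurableSpace α] {μ : Measure α} {F : Type*} [NormedAddCommGroup F] {p : ℝ}

theorem tendsto_eLpNorm_of_dominated (hp : 0 < p) {f : ℕ → α → F} {H : α → ℝ}
    (hf : ∀ n, AEStronglyMeasurable (f n) μ) (hH : MemLp H (ENNReal.ofReal p) μ)
    (hdom : ∀ n, ∀ᵐ a ∂μ, ‖f n a‖ ≤ H a)
    (hlim : ∀ᵐ a ∂μ, Tendsto (fun n => f n a) atTop (𝓝 0)) :
    Tendsto (fun n => eLpNorm (f n) (ENNReal.ofReal p) μ) atTop (𝓝 0) := by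
  rw [tendsto_eLpNorm_iff hp]
  have h1 := tendsto_lintegral_of_dominated_convergence' (fun a => ‖H a‖ₑ ^ p)
    (F := fun n a => ‖f n a‖ₑ ^ p) (f := fun _ => 0) (μ := μ)
    (fun n => (hf n).enorm.pow_const p) (fun n => ?_) ((memLp_iff_lintegral hp _).1 hH).2.ne ?_
  · simpa using h1
  · filter_upwards [hdom n] with a ha
    refine ENNReal.rpow_le_rpow ?_ hp.le
    rw [← ofReal_norm, ← ofReal_norm]
    exact ENNReal.ofReal_le_ofReal (ha.trans (Real.le_norm_self _))
  · filter_upwards [hlim] with a ha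
    have h2 := (ENNReal.continuous_rpow_const (y := p)).tendsto (‖(0 : F)‖ₑ) |>.comp ha.enorm
    simpa [Function.comp_def, ENNReal.zero_rpow_of_pos hp] using h2

theorem exists_subseq_tendsto_zero (hp : 0 < p) {f : ℕ → α → F}
    (hf : ∀ n, AEStronglyMeasurable (f n) μ)
    (h : Tendsto (fun n => eLpNorm (f n) (ENNReal.ofReal p) μ) atTop (𝓝 0)) :
    ∃ k : ℕ → ℕ, StrictMono k ∧ ∀ᵐ a ∂μ, Tendsto (fun n => f (k n) a) atTop (𝓝 0) := by
  have h1 : Tendsto (fun n => eLpNorm (f n - fun _ => 0) (ENNReal.ofReal p) μ) atTop (𝓝 0) := by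
    refine h.congr fun n => congrArg (fun g => eLpNorm g _ _) ?_
    ext1 a
    simp
  exact (tendstoInMeasure_of_tendsto_eLpNorm (by simpa using hp) hf aestronglyMeasurable_const
    h1).exists_seq_tendsto_ae

end DominatedConvergence

/-! ### Oscillating potentials of potential fields -/

section Potential

variable {Ω : Type*} [MeasurableSpace Ω] {d : ℕ} {p : ℝ} {P : Measure Ω} {Q : Set (Sp d)}
  {τ : Sp d → Ω → Ω}

theorem eLpNorm_prod_le_of_sections [SFinite P] (hp : 0 < p) {F : Type*} [NormedAddCommGroup F]
    {f : Ω × Sp d → F} (hf : AEStronglyMeasurable f (prodMeas P Q)) {M : ℝ≥0∞}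
    (h : ∀ᵐ x ∂(volume.restrict Q), eLpNorm (fun ω => f (ω, x)) (ENNReal.ofReal p) P ≤ M) :
    eLpNorm f (ENNReal.ofReal p) (prodMeas P Q) ≤ M * volume Q ^ (1 / p) := by
  rw [← eLpNorm_swap hf, eLpNorm_le_iff hp, lintegral_enorm_rpow_prod hp hf.prod_swap,
    ENNReal.mul_rpow_of_nonneg _ _ hp.le, ← ENNReal.rpow_mul, one_div, inv_mul_cancel₀ hp.ne',
    ENNReal.rpow_one]
  calc ∫⁻ x in Q, eLpNorm (fun ω => f (Prod.swap (x, ω))) (ENNReal.ofReal p) P ^ p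
      ≤ ∫⁻ _ in Q, M ^ p := lintegral_mono_ae (h.mono fun x hx => ENNReal.rpow_le_rpow hx hp.le)
    _ = M ^ p * volume Q := by simp

theorem memLp_orbit (hτ : IsStationary P τ) (hp : 0 < p) {c : ℝ} (hc : c ≠ 0)
    (hQ : Bornology.IsBounded Q) {F : Type*} [NormedAddCommGroup F] [SecondCountableTopology F]
    {φ : Ω → F} (hφ : MemLp φ (ENNReal.ofReal p) P) :
    MemLp (fun z : Ω × Sp d => φ (τ (c • z.2) z.1)) (ENNReal.ofReal p) (prodMeas P Q) := by
  have := hτ.prob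
  have := isFiniteMeasure_restrict hQ
  exact (skew_nullPreserving hτ hc restrict_ac).memLp_comp hp (hφ.comp_fst (volume.restrict Q))

theorem eLpNorm_orbit_le (hτ : IsStationary P τ) (hp : 0 < p) {c : ℝ} (hc : c ≠ 0)
    {F : Type*} [NormedAddCommGroup F] {φ : Ω → F} (hφ : AEStronglyMeasurable φ P) :
    eLpNorm (fun z : Ω × Sp d => φ (τ (c • z.2) z.1)) (ENNReal.ofReal p) (prodMeas P Q) ≤
      eLpNorm φ (ENNReal.ofReal p) P * volume Q ^ (1 / p) := by
  have := hτ.prob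
  have h1 : AEStronglyMeasurable (fun z : Ω × Sp d => φ z.1) (prodMeas P Q) := hφ.comp_fst
  refine ((skew_nullPreserving hτ hc restrict_ac).eLpNorm_comp hp h1).trans_le ?_
  exact eLpNorm_prod_le_of_sections hp h1 (ae_of_all _ fun _ => le_rfl)

/-- The rescaled increment of a potential along the orbit. -/
noncomputable def incr (τ : Sp d → Ω → Ω) (ε : ℝ) (φ : Ω → ℝ) (z : Ω × Sp d) : ℝ :=
  ε * (φ (τ (ε⁻¹ • z.2) z.1) - φ z.1)

theorem memLp_incr (hτ : IsStationary P τ) (hp : 0 < p) {ε : ℝ} (hε : 0 < ε)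
    (hQ : Bornology.IsBounded Q) {φ : Ω → ℝ} (hφ : MemLp φ (ENNReal.ofReal p) P) :
    MemLp (incr τ ε φ) (ENNReal.ofReal p) (prodMeas P Q) := by
  have := hτ.prob
  have := isFiniteMeasure_restrict hQ
  exact ((memLp_orbit hτ hp (inv_ne_zero hε.ne') hQ hφ).sub
    (hφ.comp_fst (volume.restrict Q))).const_mul ε

/-- For a fixed `φ` the increment vanishes with `ε`, since both of its terms have the norm of `φ`.
-/
theorem eLpNorm_incr_le (hτ : IsStationary P τ) (hp : 1 ≤ p) {ε : ℝ} (hε : 0 < ε)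
    (hQ : Bornology.IsBounded Q) {φ : Ω → ℝ} (hφ : MemLp φ (ENNReal.ofReal p) P) :
    eLpNorm (incr τ ε φ) (ENNReal.ofReal p) (prodMeas P Q) ≤
      ENNReal.ofReal ε * (2 * eLpNorm φ (ENNReal.ofReal p) P * volume Q ^ (1 / p)) := by
  have := hτ.prob
  have hp0 : 0 < p := by linarith
  rw [← mul_assoc]
  refine eLpNorm_prod_le_of_sections hp0 (memLp_incr hτ hp0 hε hQ hφ).1 (ae_of_all _ fun x => ?_)
  have h1 : (fun ω => incr τ ε φ (ω, x)) = ε • ((fun ω => φ (τ (ε⁻¹ • x) ω)) - φ) := rfl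
  rw [h1, eLpNorm_const_smul, ← ofReal_norm, Real.norm_of_nonneg hε.le]
  gcongr
  refine (eLpNorm_sub_le (memLp_shift hτ hφ _).1 hφ.1 (by simpa using hp)).trans ?_
  rw [eLpNorm_shift hτ hφ.1, two_mul]

/-- Uniform in `ε`: the Lipschitz bound along the shift by `x / ε` costs `|x| / ε`, compensated by
the prefactor `ε`. Only the gradients enter, so convergence of the `φ` themselves is not needed. -/
theorem eLpNorm_incr_sub_le (hτ : IsStationary P τ) (hp : 1 ≤ p) {ε : ℝ} (hε : 0 < ε)
    (hQm : MeasurableSet Q) (hQ : Bornology.IsBounded Q) {R : ℝ} (hR : ∀ x ∈ Q, ‖x‖ ≤ R)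
    {φ φ' : Ω → ℝ} {ψ ψ' : Ω → Sp d} (h : IsStochGrad p P τ φ ψ) (h' : IsStochGrad p P τ φ' ψ') :
    eLpNorm (fun z => incr τ ε φ z - incr τ ε φ' z) (ENNReal.ofReal p) (prodMeas P Q) ≤
      d * ENNReal.ofReal R * eLpNorm (fun ω => ψ ω - ψ' ω) (ENNReal.ofReal p) P *
        volume Q ^ (1 / p) := by
  have := hτ.prob
  have hp0 : 0 < p := by linarith
  refine eLpNorm_prod_le_of_sections hp0 ((memLp_incr hτ hp0 hε hQ h.memLp).sub
    (memLp_incr hτ hp0 hε hQ h'.memLp)).1 ?_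
  filter_upwards [ae_restrict_mem hQm] with x hx
  have h1 : (fun ω => incr τ ε φ (ω, x) - incr τ ε φ' (ω, x)) =
      ε • fun ω => (φ (τ (ε⁻¹ • x) ω) - φ' (τ (ε⁻¹ • x) ω)) - (φ ω - φ' ω) := by
    ext1 ω
    simp only [incr, Pi.smul_apply, smul_eq_mul]
    ring
  change eLpNorm (fun ω => incr τ ε φ (ω, x) - incr τ ε φ' (ω, x)) _ _ ≤ _
  rw [h1, eLpNorm_const_smul, ← ofReal_norm, Real.norm_of_nonneg hε.le]
  have h2 := (h.sub hp hτ h').eLpNorm_sub_le hp hτ (ε⁻¹ • x)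
  calc ENNReal.ofReal ε * _ ≤ ENNReal.ofReal ε * (d * ‖ε⁻¹ • x‖ₑ *
        eLpNorm (fun ω => ψ ω - ψ' ω) (ENNReal.ofReal p) P) := by gcongr
    _ = d * (ENNReal.ofReal ε * ‖ε⁻¹ • x‖ₑ) *
        eLpNorm (fun ω => ψ ω - ψ' ω) (ENNReal.ofReal p) P := by ring
    _ = d * ENNReal.ofReal ‖x‖ * eLpNorm (fun ω => ψ ω - ψ' ω) (ENNReal.ofReal p) P := by
        rw [← ofReal_norm, norm_smul, ← ENNReal.ofReal_mul hε.le, norm_inv,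
          Real.norm_of_nonneg hε.le, mul_inv_cancel_left₀ hε.ne']
    _ ≤ _ := by
        gcongr
        exact hR x hx

/-- The oscillating test field with profile `w` and amplitude `η` for a smooth potential. -/
theorem IsSmoothGrad.isLpW10 (hτ : IsStationary P τ) (hp : 1 ≤ p) (hQ : Bornology.IsBounded Q)
    {ε : ℝ} (hε : 0 < ε) {φ : Ω → ℝ} {ψ : Ω → Sp d} (h : IsSmoothGrad p P τ φ ψ)
    {η : Sp d → ℝ} (hη : IsTest η) (hηQ : tsupport η ⊆ Q) :
    IsLpW10 p P Q (fun z => η z.2 * Real.sin (incr τ ε φ z))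
      (fun z => Real.sin (incr τ ε φ z) • gradient η z.2 +
        (η z.2 * Real.cos (incr τ ε φ z)) • ψ (τ (ε⁻¹ • z.2) z.1)) := by
  have := hτ.prob
  have := isFiniteMeasure_restrict hQ
  have hp0 : 0 < p := by linarith
  have hw := memLp_incr hτ hp0 hε hQ h.grad.memLp
  have hψ := memLp_orbit hτ hp0 (inv_ne_zero hε.ne') hQ h.grad.memLp_grad
  have hs : AEStronglyMeasurable (fun z => Real.sin (incr τ ε φ z)) (prodMeas P Q) :=
    Real.continuous_sin.comp_aestronglyMeasurable hw.1
  have hc : AEStronglyMeasurable (fun z => Real.cos (incr τ ε φ z)) (prodMeas P Q) :=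
    Real.continuous_cos.comp_aestronglyMeasurable hw.1
  have hs' : MemLp (fun z => Real.sin (incr τ ε φ z)) (ENNReal.ofReal p) (prodMeas P Q) :=
    MemLp.of_bound hs 1 (ae_of_all _ fun z => Real.abs_sin_le_one _)
  have hc' : MemLp (fun z => Real.cos (incr τ ε φ z) • ψ (τ (ε⁻¹ • z.2) z.1)) (ENNReal.ofReal p)
      (prodMeas P Q) := memLp_bdd_smul hc (C := 1) (fun z => Real.abs_cos_le_one _) hψ
  have hg : MemLp (fun z : Ω × Sp d => gradient η z.2) (ENNReal.ofReal p) (prodMeas P Q) :=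
    hη.memLp_gradient.comp_snd P
  refine isLpW10_of_sections hp (hη.memLp_smul hs') ?_ ?_
  · refine (memLp_bdd_smul hs (C := 1) (fun z => Real.abs_sin_le_one _) hg).add ?_
    have := hη.memLp_smul hc'
    simpa only [smul_smul] using this
  -- Almost every realization of the field is a smooth function with the compact support of `η`. By
  -- the chain rule, the `ε` in the increment cancels the `ε⁻¹` from the dilation.
  · filter_upwards [h.smooth] with ω hω
    have h1 : ContDiff ℝ ((⊤ : ℕ∞) : WithTop ℕ∞) fun x => φ (τ (ε⁻¹ • x) ω) :=
      hω.1.comp (contDiff_const_smul ε⁻¹)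
    have h2 : ContDiff ℝ ((⊤ : ℕ∞) : WithTop ℕ∞) fun x => incr τ ε φ (ω, x) :=
      contDiff_const.mul (h1.sub (contDiff_const (c := φ ω)))
    have h3 : ContDiff ℝ ((⊤ : ℕ∞) : WithTop ℕ∞) fun x => Real.sin (incr τ ε φ (ω, x)) :=
      Real.contDiff_sin.comp h2
    have d1 : Differentiable ℝ fun x => φ (τ x ω) := hω.1.differentiable (by simp)
    have d1' : Differentiable ℝ fun x => φ (τ (ε⁻¹ • x) ω) := h1.differentiable (by simp)
    have d2 : Differentiable ℝ fun x => incr τ ε φ (ω, x) := h2.differentiable (by simp)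
    have g1 : ∀ x, gradient (fun x => incr τ ε φ (ω, x)) x = ψ (τ (ε⁻¹ • x) ω) := fun x => by
      have e1 : (fun x => incr τ ε φ (ω, x)) =
          fun x => ε * φ (τ (ε⁻¹ • x) ω) + (fun _ => -(ε * φ ω)) x := by
        ext1 x
        simp only [incr]
        ring
      rw [e1, gradient_add (d1'.const_mul ε) (differentiable_const _), gradient_const_mul d1',
        gradient_comp_smul d1, hω.2, smul_smul, mul_inv_cancel₀ hε.ne', one_smul,
        gradient_fun_const, add_zero]
    refine ⟨fun x => η x * Real.sin (incr τ ε φ (ω, x)), ⟨hη.1.mul h3, hη.2.mul_right⟩,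
      (tsupport_mul_subset_left).trans hηQ, ?_⟩
    ext1 x
    refine Prod.ext rfl ?_
    change _ = gradient (fun x => η x * Real.sin (incr τ ε φ (ω, x))) x
    rw [gradient_mul hη.differentiable (h3.differentiable (by simp)),
      gradient_comp_deriv Real.differentiable_sin d2, g1, Real.deriv_sin, smul_smul, add_comm]

/-- Every potential field is the gradient of a field that becomes small on the scale `ε`; its
oscillating test fields are admissible. -/
theorem IsPot.exists_potential (hτ : IsStationary P τ) (hp : 1 < p) (hQm : MeasurableSet Q)
    (hQ : Bornology.IsBounded Q) {χ : Ω → Sp d} (hχ : IsPot p P τ χ) :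
    ∃ w : ℝ → Ω × Sp d → ℝ,
      (∀ ε, 0 < ε → MemLp (w ε) (ENNReal.ofReal p) (prodMeas P Q)) ∧
      Tendsto (fun ε => eLpNorm (w ε) (ENNReal.ofReal p) (prodMeas P Q)) (𝓝[>] 0) (𝓝 0) ∧
      ∀ ε, 0 < ε → ∀ η, IsTest η → tsupport η ⊆ Q →
        IsLpW10 p P Q (fun z => η z.2 * Real.sin (w ε z))
          (fun z => Real.sin (w ε z) • gradient η z.2 +
            (η z.2 * Real.cos (w ε z)) • χ (τ (ε⁻¹ • z.2) z.1)) := by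
  have := hτ.prob
  have := isFiniteMeasure_restrict hQ
  have hp0 : 0 < p := by linarith
  have hp1 : 1 ≤ ENNReal.ofReal p := by simpa using hp.le
  obtain ⟨R, hR⟩ := hQ.exists_norm_le
  have hv : volume Q ^ (1 / p) ≠ ∞ :=
    ENNReal.rpow_ne_top_of_nonneg (by positivity) hQ.measure_lt_top.ne
  set a : ℕ → ℝ≥0∞ := fun n => 2⁻¹ ^ n with ha
  have ha0 : ∀ n, 0 < a n := fun n => ENNReal.pow_pos (by simp) n
  have hatop : ∀ n, a n ≠ ∞ := fun n => ENNReal.pow_ne_top (by simp)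
  have hanti : ∀ {N n : ℕ}, N ≤ n → a n ≤ a N := fun h =>
    pow_le_pow_right_of_le_one' (by simp) h
  have hmem := hχ.mem_lpClosure_smoothGrads hτ hp
  have hex : ∀ n, ∃ (φ : Ω → ℝ) (ψ : Ω → Sp d), IsSmoothGrad p P τ φ ψ ∧
      eLpNorm (fun ω => χ ω - ψ ω) (ENNReal.ofReal p) P < a n := fun n => by
    obtain ⟨ψ, ⟨φ, h1⟩, h2⟩ := hmem.2 (a n) (ha0 n)
    exact ⟨φ, ψ, h1, h2⟩
  choose φ ψ hs hψ using hex
  have hψ' : ∀ n, eLpNorm (fun ω => ψ n ω - χ ω) (ENNReal.ofReal p) P ≤ a n := fun n => by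
    have := eLpNorm_sub_comm (ψ n) χ (ENNReal.ofReal p) P
    exact this.trans_le (hψ n).le
  set A : ℝ≥0∞ := d * ENNReal.ofReal R * volume Q ^ (1 / p) with hA
  have hAtop : A ≠ ∞ := ENNReal.mul_ne_top (ENNReal.mul_ne_top (by simp) (by simp)) hv
  -- Distances between increments with indices beyond `N` are at most `2 A a_N`; the additional `1`
  -- makes the Cauchy bound strict, also when `A = 0`.
  set B : ℕ → ℝ≥0∞ := fun n => (2 * A + 1) * a n with hB
  have hcau : ∀ ε, 0 < ε → ∀ N n m, N ≤ n → N ≤ m →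
      eLpNorm (incr τ ε (φ n) - incr τ ε (φ m)) (ENNReal.ofReal p) (prodMeas P Q) < B N :=
      fun ε hε N n m hn hm => by
    have h1 : eLpNorm (fun ω => ψ n ω - ψ m ω) (ENNReal.ofReal p) P ≤ 2 * a N := by
      refine (eLpNorm_triangle hp.le (hs n).grad.memLp_grad.1 hχ.memLp.1
        (hs m).grad.memLp_grad.1).trans ?_
      rw [two_mul]
      exact add_le_add ((hψ' n).trans (hanti hn)) ((hψ m).le.trans (hanti hm))
    have h2 : eLpNorm (incr τ ε (φ n) - incr τ ε (φ m)) (ENNReal.ofReal p) (prodMeas P Q) ≤ _ :=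
      eLpNorm_incr_sub_le hτ hp.le hε hQm hQ hR (hs n).grad (hs m).grad
    refine lt_of_le_of_lt (h2.trans (c := 2 * A * a N) ?_) ?_
    · rw [hA]
      calc _ ≤ d * ENNReal.ofReal R * (2 * a N) * volume Q ^ (1 / p) := by gcongr
        _ = _ := by ring
    · rw [hB]
      exact ENNReal.mul_lt_mul_left (ha0 N).ne' (hatop N)
        (ENNReal.lt_add_right (ENNReal.mul_ne_top (by simp) hAtop) one_ne_zero)
  have hBsum : ∑' n, B n ≠ ∞ := by
    rw [ENNReal.tsum_mul_left, ENNReal.tsum_geometric]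
    refine ENNReal.mul_ne_top (ENNReal.add_ne_top.2
      ⟨ENNReal.mul_ne_top (by simp) hAtop, by simp⟩) ?_
    simp
  -- The potential on scale `ε` is the `L^p` limit of the increments; for `ε ≤ 0` the value is
  -- irrelevant and set to `0`.
  have hlim : ∀ ε : ℝ, ∃ w : Ω × Sp d → ℝ, 0 < ε → MemLp w (ENNReal.ofReal p) (prodMeas P Q) ∧
      Tendsto (fun n => eLpNorm (incr τ ε (φ n) - w) (ENNReal.ofReal p) (prodMeas P Q)) atTop
        (𝓝 0) := fun ε => by
    by_cases hε : 0 < ε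
    · obtain ⟨w, h1, h2⟩ := Lp.cauchy_complete_eLpNorm hp1
        (fun n => memLp_incr hτ hp0 hε hQ (hs n).grad.memLp) hBsum (hcau ε hε)
      exact ⟨w, fun _ => ⟨h1, h2⟩⟩
    · exact ⟨0, fun h => absurd h hε⟩
  choose w hw using hlim
  have hwb : ∀ ε, 0 < ε → ∀ n, eLpNorm (w ε) (ENNReal.ofReal p) (prodMeas P Q) ≤
      eLpNorm (incr τ ε (φ n)) (ENNReal.ofReal p) (prodMeas P Q) + B n := fun ε hε n => by
    have hm := fun m => memLp_incr hτ hp0 hε hQ (hs m).grad.memLp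
    have h1 : ∀ᶠ m in atTop, eLpNorm (w ε) (ENNReal.ofReal p) (prodMeas P Q) ≤
        eLpNorm (incr τ ε (φ n)) (ENNReal.ofReal p) (prodMeas P Q) + B n +
        eLpNorm (incr τ ε (φ m) - w ε) (ENNReal.ofReal p) (prodMeas P Q) := by
      filter_upwards [eventually_ge_atTop n] with m hmn
      have e1 : w ε = incr τ ε (φ n) + ((incr τ ε (φ m) - incr τ ε (φ n)) -
          (incr τ ε (φ m) - w ε)) := by abel
      calc eLpNorm (w ε) (ENNReal.ofReal p) (prodMeas P Q)
          = eLpNorm (incr τ ε (φ n) + ((incr τ ε (φ m) - incr τ ε (φ n)) -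
          (incr τ ε (φ m) - w ε))) (ENNReal.ofReal p) (prodMeas P Q) := by rw [← e1]
        _ ≤ _ := (eLpNorm_add_le (hm n).1 (((hm m).1.sub (hm n).1).sub
            ((hm m).1.sub (hw ε hε).1.1)) hp1).trans (add_le_add le_rfl
            ((eLpNorm_sub_le ((hm m).1.sub (hm n).1) ((hm m).1.sub (hw ε hε).1.1) hp1).trans
              (add_le_add (hcau ε hε n m n hmn le_rfl).le le_rfl)))
        _ = _ := (add_assoc _ _ _).symm
    have h2 := ((hw ε hε).2.const_add
      (eLpNorm (incr τ ε (φ n)) (ENNReal.ofReal p) (prodMeas P Q) + B n))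
    rw [add_zero] at h2
    exact ge_of_tendsto h2 h1
  have hBlim : Tendsto B atTop (𝓝 0) := by
    have := ENNReal.Tendsto.const_mul (a := 2 * A + 1)
      (ENNReal.tendsto_pow_atTop_nhds_zero_of_lt_one (r := 2⁻¹) (by simp)) (Or.inr
      (ENNReal.add_ne_top.2 ⟨ENNReal.mul_ne_top (by simp) hAtop, by simp⟩))
    simpa using this
  refine ⟨w, fun ε hε => (hw ε hε).1, ?_, fun ε hε η hη hηQ => ?_⟩
  · rw [ENNReal.tendsto_nhds_zero]
    intro e he
    have he2 : 0 < e / 2 := ENNReal.half_pos he.ne'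
    -- First fix `n` so that the distance to the increment of `φ n` is small uniformly in `ε`, then
    -- let `ε → 0` for this one increment.
    obtain ⟨n, hn⟩ := (ENNReal.tendsto_nhds_zero.1 hBlim _ he2).exists
    have h1 : Tendsto (fun ε : ℝ => ENNReal.ofReal ε *
        (2 * eLpNorm (φ n) (ENNReal.ofReal p) P * volume Q ^ (1 / p))) (𝓝[>] 0) (𝓝 0) := by
      have h2 := (ENNReal.continuous_ofReal.tendsto 0).mono_left
        (nhdsWithin_le_nhds (s := Set.Ioi 0))
      have h3 := ENNReal.Tendsto.mul_const h2 (Or.inr (ENNReal.mul_ne_top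
        (ENNReal.mul_ne_top (ENNReal.ofNat_ne_top (n := 2)) (hs n).grad.memLp.2.ne) hv))
      simpa using h3
    filter_upwards [ENNReal.tendsto_nhds_zero.1 h1 _ he2, self_mem_nhdsWithin] with ε h2 hε
    exact (hwb ε hε n).trans ((add_le_add ((eLpNorm_incr_le hτ hp.le hε hQ
      (hs n).grad.memLp).trans h2) hn).trans_eq (ENNReal.add_halves e))
  · have hm := fun m => memLp_incr hτ hp0 hε hQ (hs m).grad.memLp
    obtain ⟨k, hk, hkw⟩ := exists_subseq_tendsto_zero hp0
      (fun n => ((hm n).sub (hw ε hε).1).1) (hw ε hε).2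
    have hc0 : ε⁻¹ ≠ 0 := inv_ne_zero hε.ne'
    have hsin : AEStronglyMeasurable (fun z => Real.sin (w ε z)) (prodMeas P Q) :=
      Real.continuous_sin.comp_aestronglyMeasurable (hw ε hε).1.1
    have hcos : AEStronglyMeasurable (fun z => Real.cos (w ε z)) (prodMeas P Q) :=
      Real.continuous_cos.comp_aestronglyMeasurable (hw ε hε).1.1
    have hsin' : MemLp (fun z => Real.sin (w ε z)) (ENNReal.ofReal p) (prodMeas P Q) :=
      MemLp.of_bound hsin 1 (ae_of_all _ fun z => Real.abs_sin_le_one _)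
    have hχo := memLp_orbit hτ hp0 hc0 hQ hχ.memLp
    have hg : MemLp (fun z : Ω × Sp d => gradient η z.2) (ENNReal.ofReal p) (prodMeas P Q) :=
      hη.memLp_gradient.comp_snd P
    have hη1 : MemLp (fun z : Ω × Sp d => η z.2) (ENNReal.ofReal p) (prodMeas P Q) :=
      hη.memLp.comp_snd P
    have hG₀ : MemLp (fun z => Real.sin (w ε z) • gradient η z.2 +
        (η z.2 * Real.cos (w ε z)) • χ (τ (ε⁻¹ • z.2) z.1)) (ENNReal.ofReal p)
        (prodMeas P Q) := by
      refine (memLp_bdd_smul hsin (C := 1) (fun z => Real.abs_sin_le_one _) hg).add ?_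
      have := hη.memLp_smul (memLp_bdd_smul hcos (C := 1) (fun z => Real.abs_cos_le_one _) hχo)
      simpa only [smul_smul] using this
    have hn := fun n => (hs (k n)).isLpW10 hτ hp.le hQ hε hη hηQ
    obtain ⟨Cη, hCη⟩ := hη.exists_bound
    have hχn := fun n => memLp_orbit (Q := Q) hτ hp0 hc0 hQ (hs (k n)).grad.memLp_grad
    refine IsLpW10.of_tendsto hp.le hn (hη.memLp_smul hsin') hG₀ ?_ ?_
    · refine tendsto_eLpNorm_of_dominated hp0 (H := fun z => 2 * ‖η z.2‖)
        (fun n => ((hn n).memLp.sub (hη.memLp_smul hsin')).1) (hη1.norm.const_mul 2)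
        (fun n => ae_of_all _ fun z => ?_) ?_
      · rw [← mul_sub, norm_mul, mul_comm]
        gcongr
        refine (norm_sub_le _ _).trans ?_
        have h1 := Real.abs_sin_le_one (incr τ ε (φ (k n)) z)
        have h2 := Real.abs_sin_le_one (w ε z)
        simp only [Real.norm_eq_abs]
        linarith
      · filter_upwards [hkw] with z hz
        have h1 : Tendsto (fun n => incr τ ε (φ (k n)) z) atTop (𝓝 (w ε z)) :=
          tendsto_sub_nhds_zero_iff.1 hz
        have h2 := ((Real.continuous_sin.tendsto _).comp h1).const_mul (η z.2)
        exact tendsto_sub_nhds_zero_iff.2 h2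
    -- The gradient error splits into a part with `χ` fixed and trigonometric factors converging,
    -- handled by dominated convergence, and a part with bounded factors times `ψ (k n) - χ`, small
    -- in `L^p`.
    · let D₁ : ℕ → Ω × Sp d → Sp d := fun n z =>
        (Real.sin (incr τ ε (φ (k n)) z) - Real.sin (w ε z)) • gradient η z.2 +
          (η z.2 * (Real.cos (incr τ ε (φ (k n)) z) - Real.cos (w ε z))) •
            χ (τ (ε⁻¹ • z.2) z.1)
      let D₂ : ℕ → Ω × Sp d → Sp d := fun n z =>
        (η z.2 * Real.cos (incr τ ε (φ (k n)) z)) •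
          (ψ (k n) (τ (ε⁻¹ • z.2) z.1) - χ (τ (ε⁻¹ • z.2) z.1))
      have hcosn : ∀ n, AEStronglyMeasurable (fun z => Real.cos (incr τ ε (φ (k n)) z))
          (prodMeas P Q) := fun n => Real.continuous_cos.comp_aestronglyMeasurable (hm _).1
      have hsinn : ∀ n, AEStronglyMeasurable (fun z => Real.sin (incr τ ε (φ (k n)) z))
          (prodMeas P Q) := fun n => Real.continuous_sin.comp_aestronglyMeasurable (hm _).1
      have hD₁m : ∀ n, AEStronglyMeasurable (D₁ n) (prodMeas P Q) := fun n =>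
        (((hsinn n).sub hsin).smul hg.1).add
          ((hη1.1.mul ((hcosn n).sub hcos)).smul hχo.1)
      have hD₂m : ∀ n, AEStronglyMeasurable (D₂ n) (prodMeas P Q) := fun n =>
        (hη1.1.mul (hcosn n)).smul ((hχn n).1.sub hχo.1)
      have h1 : Tendsto (fun n => eLpNorm (D₁ n) (ENNReal.ofReal p) (prodMeas P Q)) atTop
          (𝓝 0) := by
        refine tendsto_eLpNorm_of_dominated hp0 (H := fun z => 2 * ‖gradient η z.2‖ +
          (2 * Cη) * ‖χ (τ (ε⁻¹ • z.2) z.1)‖) hD₁m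
          ((hg.norm.const_mul 2).add (hχo.norm.const_mul _)) (fun n => ae_of_all _ fun z => ?_) ?_
        · have b1 := Real.abs_sin_le_one (incr τ ε (φ (k n)) z)
          have b2 := Real.abs_sin_le_one (w ε z)
          have b3 := Real.abs_cos_le_one (incr τ ε (φ (k n)) z)
          have b4 := Real.abs_cos_le_one (w ε z)
          have b5 := abs_sub (Real.sin (incr τ ε (φ (k n)) z)) (Real.sin (w ε z))
          have b6 := abs_sub (Real.cos (incr τ ε (φ (k n)) z)) (Real.cos (w ε z))
          refine (norm_add_le _ _).trans (add_le_add ?_ ?_)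
          · rw [norm_smul, Real.norm_eq_abs]
            gcongr
            linarith
          · rw [norm_smul, norm_mul, Real.norm_eq_abs, Real.norm_eq_abs]
            rw [mul_comm 2 Cη]
            have := hCη z.2
            have := abs_nonneg (η z.2)
            gcongr
            · linarith
            · linarith
        · filter_upwards [hkw] with z hz
          have h1 : Tendsto (fun n => incr τ ε (φ (k n)) z) atTop (𝓝 (w ε z)) :=
            tendsto_sub_nhds_zero_iff.1 hz
          have h2 := tendsto_sub_nhds_zero_iff.2 ((Real.continuous_sin.tendsto _).comp h1)
          have h3 := tendsto_sub_nhds_zero_iff.2 ((Real.continuous_cos.tendsto _).comp h1)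
          have h4 := (h2.smul_const (gradient η z.2)).add
            ((h3.const_mul (η z.2)).smul_const (χ (τ (ε⁻¹ • z.2) z.1)))
          simpa using h4
      have h2 : Tendsto (fun n => eLpNorm (D₂ n) (ENNReal.ofReal p) (prodMeas P Q)) atTop
          (𝓝 0) := by
        have hb : ∀ n, eLpNorm (D₂ n) (ENNReal.ofReal p) (prodMeas P Q) ≤
            ENNReal.ofReal Cη * (a (k n) * volume Q ^ (1 / p)) := fun n => by
          refine (eLpNorm_le_mul_eLpNorm_of_ae_le_mul (c := Cη)
            (g := fun z : Ω × Sp d => ψ (k n) (τ (ε⁻¹ • z.2) z.1) - χ (τ (ε⁻¹ • z.2) z.1))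
            (ae_of_all _ fun z => ?_) _).trans ?_
          · rw [norm_smul, norm_mul, Real.norm_eq_abs, Real.norm_eq_abs]
            gcongr
            have b1 := hCη z.2
            have b3 := Real.abs_cos_le_one (incr τ ε (φ (k n)) z)
            calc _ ≤ |η z.2| * 1 := by gcongr
              _ ≤ Cη := by linarith
          · gcongr
            refine (eLpNorm_orbit_le hτ hp0 hc0 (φ := fun ω => ψ (k n) ω - χ ω)
              ((hs (k n)).grad.memLp_grad.1.sub hχ.memLp.1)).trans ?_
            gcongr
            exact hψ' _
        have h3 := ENNReal.Tendsto.const_mul (a := ENNReal.ofReal Cη)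
          (ENNReal.Tendsto.mul_const ((ENNReal.tendsto_pow_atTop_nhds_zero_of_lt_one
          (r := 2⁻¹) (by simp)).comp hk.tendsto_atTop) (Or.inr hv))
          (Or.inr ENNReal.ofReal_ne_top)
        simp only [zero_mul, mul_zero] at h3
        exact tendsto_of_tendsto_of_tendsto_of_le_of_le tendsto_const_nhds h3
          (fun _ => zero_le) hb
      have h3 := h1.add h2
      rw [add_zero] at h3
      refine tendsto_of_tendsto_of_tendsto_of_le_of_le tendsto_const_nhds h3
        (fun _ => zero_le) fun n => ?_
      refine le_trans (le_of_eq ?_) (eLpNorm_add_le (hD₁m n) (hD₂m n) hp1)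
      congr 1
      ext1 z
      simp only [Pi.add_apply, D₁, D₂]
      module

end Potential

/-! ### Smooth cutoffs -/

section CutOff

variable {d : ℕ} {p : ℝ} {Q : Set (Sp d)}

theorem exists_test_between {K U : Set (Sp d)} (hK : IsCompact K) (hU : IsOpen U) (hKU : K ⊆ U) :
    ∃ η : Sp d → ℝ, IsTest η ∧ tsupport η ⊆ U ∧ (∀ x ∈ K, η x = 1) ∧
      ∀ x, 0 ≤ η x ∧ η x ≤ 1 := by
  obtain ⟨W, hWo, hKW, hWU, hWc⟩ := exists_open_between_and_isCompact_closure hK hU hKU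
  obtain ⟨η, h1, h2, h3, h4⟩ := exists_contMDiff_support_eq_eq_one_iff (n := ⊤)
    (modelWithCornersSelf ℝ (Sp d)) hWo hK.isClosed hKW
  have hts : tsupport η = closure W := by rw [tsupport, h3]
  refine ⟨η, ⟨h1.contDiff, ?_⟩, hts.trans_subset hWU, fun x hx => (h4 x).1 hx,
    fun x => h2 (Set.mem_range_self x)⟩
  rw [HasCompactSupport, hts]
  exact hWc

/-- By regularity of Lebesgue measure, `A ∩ Q` contains a compact `K` and `K` lies in an open `U`,
each with excess measure below `r ^ p / 2`. A cutoff between `K` and `U ∩ Q` differs from the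
indicator on `Q` only on these excess sets, by at most `1`. -/
theorem exists_cutoff (hp : 0 < p) (hQo : IsOpen Q) (hQ : Bornology.IsBounded Q) {A : Set (Sp d)}
    (hA : MeasurableSet A) {r : ℝ≥0∞} (hr : 0 < r) :
    ∃ η : Sp d → ℝ, IsTest η ∧ tsupport η ⊆ Q ∧ (∀ x, |η x| ≤ 1) ∧
      eLpNorm (fun x => η x - A.indicator (fun _ => (1 : ℝ)) x) (ENNReal.ofReal p)
        (volume.restrict Q) ≤ r := by
  have hAQ := hA.inter hQo.measurableSet
  have hfin : volume (A ∩ Q) ≠ ∞ :=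
    ne_top_of_le_ne_top hQ.measure_lt_top.ne (measure_mono Set.inter_subset_right)
  set s : ℝ≥0∞ := r ^ p / 2 with hs
  have hs0 : s ≠ 0 := (ENNReal.half_pos (ENNReal.rpow_pos_of_nonneg hr hp.le).ne').ne'
  obtain ⟨K, hKA, hK, hKs⟩ := hAQ.exists_isCompact_sdiff_lt hfin hs0
  obtain ⟨U, hKU, hU, -, hUs⟩ := hK.measurableSet.exists_isOpen_sdiff_lt
    (hK.measure_lt_top (μ := volume)).ne hs0
  obtain ⟨η, h1, h2, h3, h4⟩ := exists_test_between hK (hU.inter hQo)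
    (Set.subset_inter hKU (hKA.trans Set.inter_subset_right))
  refine ⟨η, h1, h2.trans Set.inter_subset_right,
    fun x => abs_le.2 ⟨by linarith [(h4 x).1], (h4 x).2⟩, ?_⟩
  let S : Set (Sp d) := (U \ K) ∪ ((A ∩ Q) \ K)
  have hS : MeasurableSet S := (hU.measurableSet.diff hK.measurableSet).union
    (hAQ.diff hK.measurableSet)
  have hSv : volume S ≤ r ^ p :=
    (measure_union_le _ _).trans ((add_le_add hUs.le hKs.le).trans_eq (ENNReal.add_halves _))
  rw [eLpNorm_le_iff hp]
  calc ∫⁻ x in Q, ‖η x - A.indicator (fun _ => (1 : ℝ)) x‖ₑ ^ p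
      ≤ ∫⁻ x in Q, S.indicator (fun _ => 1) x := by
        refine lintegral_mono_ae ?_
        filter_upwards [ae_restrict_mem hQo.measurableSet] with x hx
        have hb : ‖η x - A.indicator (fun _ => (1 : ℝ)) x‖ₑ ≤ 1 := by
          rw [← ofReal_norm, ← ENNReal.ofReal_one]
          refine ENNReal.ofReal_le_ofReal ?_
          have := h4 x
          by_cases hxA : x ∈ A <;> simp only [hxA, Set.indicator_of_mem, not_false_eq_true,
            Set.indicator_of_notMem, Real.norm_eq_abs, abs_le] <;> constructor <;> linarith
        by_cases hxS : x ∈ S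
        · rw [Set.indicator_of_mem hxS]
          exact ENNReal.rpow_le_one hb hp.le
        · rw [Set.indicator_of_notMem hxS]
          have hxS' : (x ∈ U → x ∈ K) ∧ (x ∈ A → x ∈ K) := by
            simp only [S, Set.mem_union, Set.mem_sdiff, Set.mem_inter_iff, hx, and_true,
              not_or, not_and, not_not] at hxS
            exact hxS
          have : η x - A.indicator (fun _ => (1 : ℝ)) x = 0 := by
            by_cases hxK : x ∈ K
            · rw [h3 x hxK, Set.indicator_of_mem (hKA hxK).1, sub_self]
            · rw [Set.indicator_of_notMem fun h => hxK (hxS'.2 h), sub_zero]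
              by_contra hne
              exact hxK (hxS'.1 (h2 (subset_tsupport η hne)).1)
          rw [this, enorm_zero, ENNReal.zero_rpow_of_pos hp]
    _ ≤ ∫⁻ x, S.indicator (fun _ => 1) x := lintegral_mono' Measure.restrict_le_self le_rfl
    _ = volume S := by rw [lintegral_indicator hS]; simp
    _ ≤ r ^ p := hSv

end CutOff

/-! ### Recovery fields for simple corrector fields -/

section Recovery

variable {Ω : Type*} [MeasurableSpace Ω] {d : ℕ} {p : ℝ} {P : Measure Ω} {Q : Set (Sp d)}
  {τ : Sp d → Ω → Ω} {V : Ω → Sp d → Sp d → ℝ} {C δ : ℝ} {lam : Ω → ℝ}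

theorem memLp_wgt [IsFiniteMeasure P] (hg : HasGrowth p P Q V C lam) (hp : 0 < p) :
    MemLp (wgt p lam) (ENNReal.ofReal p) P := by
  refine (memLp_iff_lintegral hp _).2
    ⟨aestronglyMeasurable_wgt hg.integrable.1.aemeasurable, ?_⟩
  have h1 : Integrable (fun ω => 1 + |lam ω|) P := (integrable_const _).add hg.integrable.abs
  refine lt_of_le_of_lt (lintegral_mono fun ω => le_of_eq ?_) h1.2
  rw [← ofReal_norm, ← ofReal_norm, ENNReal.ofReal_rpow_of_nonneg (norm_nonneg _) hp.le,
    Real.norm_of_nonneg (wgt_pos ω).le, wgt, ← Real.rpow_mul (by positivity), one_div,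
    inv_mul_cancel₀ hp.ne', Real.rpow_one, Real.norm_of_nonneg (by positivity)]

/-- The `p`-th power of the weight is `1 + |λ|`, which dominates `|λ|`. -/
theorem integrable_lam_mul_rpow [IsFiniteMeasure P] (hg : HasGrowth p P Q V C lam) (hp : 0 < p)
    {H : Ω × Sp d → ℝ} (hH0 : ∀ z, 0 ≤ H z) (hHm : AEStronglyMeasurable H (prodMeas P Q))
    (hH : MemLp (fun z => wgt p lam z.1 * H z) (ENNReal.ofReal p) (prodMeas P Q)) :
    Integrable (fun z => lam z.1 * H z ^ p) (prodMeas P Q) := by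
  have h1 := hH.integrable_norm_rpow (by simpa using hp) ENNReal.ofReal_ne_top
  rw [ENNReal.toReal_ofReal hp.le] at h1
  have hl : AEStronglyMeasurable (fun z : Ω × Sp d => lam z.1) (prodMeas P Q) :=
    hg.integrable.1.comp_fst
  refine h1.mono' (hl.mul (hHm.aemeasurable.pow_const p).aestronglyMeasurable)
    (ae_of_all _ fun z => ?_)
  have h2 : ‖wgt p lam z.1 * H z‖ ^ p = (1 + |lam z.1|) * H z ^ p := by
    rw [Real.norm_of_nonneg (mul_nonneg (wgt_pos _).le (hH0 z)), Real.mul_rpow (wgt_pos _).le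
      (hH0 z), wgt, ← Real.rpow_mul (by positivity), one_div, inv_mul_cancel₀ hp.ne',
      Real.rpow_one]
  have h3 : 0 ≤ H z ^ p := Real.rpow_nonneg (hH0 z) p
  rw [h2, norm_mul, Real.norm_eq_abs, Real.norm_of_nonneg h3]
  nlinarith

theorem memLp_wgt_bound [IsFiniteMeasure P] (hQ : Bornology.IsBounded Q)
    (hg : HasGrowth p P Q V C lam) (hp : 1 ≤ p) {g : Sp d → Sp d}
    (hgp : MemLp g (ENNReal.ofReal p) (volume.restrict Q)) {ι : Type*} [Fintype ι]
    {χ : ι → Ω → Sp d} (hχw : ∀ i, MemLp (fun ω => wgt p lam ω • χ i ω) (ENNReal.ofReal p) P)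
    (D E : ι → ℝ) :
    MemLp (fun z : Ω × Sp d => wgt p lam z.1 * (‖g z.2‖ + ∑ i, (D i + E i * ‖χ i z.1‖)))
      (ENNReal.ofReal p) (prodMeas P Q) := by
  have := isFiniteMeasure_restrict hQ
  have hp0 : 0 < p := by linarith
  have hw := memLp_wgt hg hp0
  have h1 : MemLp (fun z : Ω × Sp d => wgt p lam z.1 • ‖g z.2‖) (ENNReal.ofReal p)
      (prodMeas P Q) := memLp_tensor hp0 hw hgp.norm
  have h2 : ∀ i, MemLp (fun z : Ω × Sp d => D i * wgt p lam z.1 + E i * ‖wgt p lam z.1 • χ i z.1‖)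
      (ENNReal.ofReal p) (prodMeas P Q) := fun i =>
    (MemLp.comp_fst (hw.const_mul (D i)) (volume.restrict Q)).add
      (MemLp.comp_fst ((hχw i).norm.const_mul (E i)) (volume.restrict Q))
  have h3 := h1.add (memLp_finsetSum Finset.univ fun i _ => h2 i)
  refine (memLp_congr_ae (ae_of_all _ fun z => ?_)).1 h3
  simp only [Pi.add_apply, smul_eq_mul, norm_smul, Real.norm_of_nonneg (wgt_pos _).le]
  rw [mul_add, Finset.mul_sum]
  refine congrArg₂ _ rfl (Finset.sum_congr rfl fun i _ => ?_)
  ring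

/-- Oscillating fields whose unfolded gradients converge strongly to a simple corrector field. -/
theorem exists_recovery (hτ : IsStationary P τ) (hp : 1 < p) (hQm : MeasurableSet Q)
    (hQ : Bornology.IsBounded Q) (hV : IsDegenerateIntegrand p P Q V)
    (hg : HasGrowth p P Q V C lam) (hδ : 0 ≤ δ) {u₀ : Sp d → ℝ} {g : Sp d → Sp d}
    (hu : IsW10 p Q u₀ g) {ι : Type*} [Fintype ι] {η : ι → Sp d → ℝ} {χ : ι → Ω → Sp d}
    (hη : ∀ i, IsTest (η i)) (hηQ : ∀ i, tsupport (η i) ⊆ Q) (hχ : ∀ i, IsPot p P τ (χ i))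
    (hχw : ∀ i, MemLp (fun ω => wgt p lam ω • χ i ω) (ENNReal.ofReal p) P) :
    ∃ (u : ℝ → Ω × Sp d → ℝ) (G : ℝ → Ω × Sp d → Sp d),
      (∀ ε, 0 < ε → IsLpW10 p P Q (u ε) (G ε)) ∧
      Tendsto (fun ε => eLpNorm (fun z => unf τ ε (u ε) z - u₀ z.2) (ENNReal.ofReal p)
        (prodMeas P Q)) (𝓝[>] 0) (𝓝 0) ∧
      Tendsto (fun ε => uEnergy p P Q V C δ (unf τ ε (G ε))) (𝓝[>] 0)
        (𝓝 (uEnergy p P Q V C δ fun z => g z.2 + ∑ i, η i z.2 • χ i z.1)) := by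
  have := hτ.prob
  have := isFiniteMeasure_restrict hQ
  have hp0 : 0 < p := by linarith
  have hp1 : 1 ≤ ENNReal.ofReal p := by simpa using hp.le
  choose w hw hw0 hwW using fun i => (hχ i).exists_potential hτ hp hQm hQ
  choose E hE using fun i => (hη i).exists_bound
  choose D hD using fun i => (hη i).continuous_gradient.bounded_above_of_compact_support
    (hη i).hasCompactSupport_gradient
  have hE0 : ∀ i, 0 ≤ E i := fun i => (abs_nonneg _).trans (hE i 0)
  have hu' := isLpW10_of_isW10 (P := P) hp.le hu
  -- One function controlling all unfolded potentials, so a single subsequence makes them all tend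
  -- to zero almost everywhere.
  let W : ℝ → Ω × Sp d → ℝ := fun ε z => ∑ i, |unf τ ε (w i ε) z|
  have hwm : ∀ i ε, 0 < ε → MemLp (unf τ ε (w i ε)) (ENNReal.ofReal p) (prodMeas P Q) :=
    fun i ε hε => memLp_unf hτ hp0 hε (hw i ε hε)
  have hWm : ∀ ε, 0 < ε → MemLp (W ε) (ENNReal.ofReal p) (prodMeas P Q) := fun ε hε =>
    memLp_finsetSum _ fun i _ => (hwm i ε hε).norm
  have hW0 : Tendsto (fun ε => eLpNorm (W ε) (ENNReal.ofReal p) (prodMeas P Q)) (𝓝[>] 0)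
      (𝓝 0) := by
    have h1 := tendsto_finsetSum Finset.univ fun i _ => hw0 i
    rw [Finset.sum_const_zero] at h1
    refine tendsto_of_tendsto_of_tendsto_of_le_of_le' tendsto_const_nhds h1
      (Eventually.of_forall fun _ => zero_le) ?_
    filter_upwards [self_mem_nhdsWithin] with ε hε
    have e1 : W ε = ∑ i, fun z => |unf τ ε (w i ε) z| := by
      ext1 z
      simp only [W, Finset.sum_apply]
    rw [e1]
    refine (eLpNorm_sum_le (fun i _ => (hwm i ε hε).norm.1) hp1).trans
      (Finset.sum_le_sum fun i _ => ?_)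
    rw [← eLpNorm_unf hτ hp0 hε (hw i ε hε).1]
    exact (eLpNorm_norm _).le
  -- With `w` in place of `sin w` the gradient would contain `w ∇η`, and `λ |w|^p` need not be
  -- integrable. The sine is bounded, is at most `|w|`, and has derivative tending to `1` as `w →
  -- 0`, so the limit field is unchanged.
  let u : ℝ → Ω × Sp d → ℝ := fun ε z => u₀ z.2 + ∑ i, η i z.2 * Real.sin (w i ε z)
  let G : ℝ → Ω × Sp d → Sp d := fun ε z => g z.2 + ∑ i, (Real.sin (w i ε z) • gradient (η i) z.2 +
    (η i z.2 * Real.cos (w i ε z)) • χ i (τ (ε⁻¹ • z.2) z.1))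
  have hmem : ∀ ε, 0 < ε → IsLpW10 p P Q (u ε) (G ε) := fun ε hε =>
    hu'.add hp.le (IsLpW10.sum hp.le Finset.univ fun i _ => hwW i ε hε (η i) (hη i) (hηQ i))
  have hGu : ∀ ε z, unf τ ε (G ε) z = g z.2 + ∑ i,
      (Real.sin (unf τ ε (w i ε) z) • gradient (η i) z.2 +
        (η i z.2 * Real.cos (unf τ ε (w i ε) z)) • χ i z.1) := fun ε z => by
    simp only [unf, G, ← hτ.map_add, add_neg_cancel, hτ.map_zero]
  refine ⟨u, G, hmem, ?_, ?_⟩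
  · have h1 := ENNReal.Tendsto.const_mul (a := ENNReal.ofReal (∑ i, E i)) hW0
      (Or.inr ENNReal.ofReal_ne_top)
    rw [mul_zero] at h1
    refine tendsto_of_tendsto_of_tendsto_of_le_of_le tendsto_const_nhds h1
      (fun _ => zero_le) fun ε => ?_
    refine eLpNorm_le_mul_eLpNorm_of_ae_le_mul (ae_of_all _ fun z => ?_) _
    have e1 : unf τ ε (u ε) z - u₀ z.2 = ∑ i, η i z.2 * Real.sin (unf τ ε (w i ε) z) := by
      simp only [unf, u, add_sub_cancel_left]
    have hWz : 0 ≤ W ε z := Finset.sum_nonneg fun i _ => abs_nonneg _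
    rw [e1, Real.norm_of_nonneg hWz, Finset.sum_mul]
    refine (norm_sum_le _ _).trans (Finset.sum_le_sum fun i _ => ?_)
    rw [norm_mul]
    refine mul_le_mul (hE i _) ?_ (norm_nonneg _) (hE0 i)
    exact Real.abs_sin_le_abs.trans
      (Finset.single_le_sum (f := fun i => |unf τ ε (w i ε) z|) (fun i _ => abs_nonneg _)
        (Finset.mem_univ i))
  · set Γ₀ : Ω × Sp d → Sp d := fun z => g z.2 + ∑ i, η i z.2 • χ i z.1 with hΓ₀
    have hΓ₀m : MemLp Γ₀ (ENNReal.ofReal p) (prodMeas P Q) :=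
      hu'.memLp_grad.add (memLp_finsetSum _ fun i _ =>
        (hη i).memLp_smul ((hχ i).memLp.comp_fst (volume.restrict Q)))
    -- A majorant independent of `ε`, with `D i` bounding `∇η_i` and `E i` bounding `η_i`; it is
    -- integrable against `λ` because the correctors have finite weighted norm.
    set H : Ω × Sp d → ℝ := fun z => ‖g z.2‖ + ∑ i, (D i + E i * ‖χ i z.1‖) with hH
    have hD0 : ∀ i, 0 ≤ D i := fun i => (norm_nonneg _).trans (hD i 0)
    have hH0 : ∀ z, 0 ≤ H z := fun z => add_nonneg (norm_nonneg _) (Finset.sum_nonneg fun i _ =>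
      add_nonneg (hD0 i) (mul_nonneg (hE0 i) (norm_nonneg _)))
    have hHm : MemLp H (ENNReal.ofReal p) (prodMeas P Q) :=
      hu'.memLp_grad.norm.add (memLp_finsetSum _ fun i _ =>
        (memLp_const (D i)).add (((hχ i).memLp.comp_fst (volume.restrict Q)).norm.const_mul (E i)))
    have hlH := integrable_lam_mul_rpow hg hp0 hH0 hHm.1
      (memLp_wgt_bound hQ hg hp.le hu.memLp_grad hχw D E)
    have hdom : ∀ ε z, ‖unf τ ε (G ε) z‖ ≤ H z := fun ε z => by
      rw [hGu]
      refine (norm_add_le _ _).trans (add_le_add le_rfl ((norm_sum_le _ _).trans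
        (Finset.sum_le_sum fun i _ => (norm_add_le _ _).trans (add_le_add ?_ ?_))))
      · rw [norm_smul, Real.norm_eq_abs]
        calc _ ≤ 1 * ‖gradient (η i) z.2‖ := by
              gcongr
              exact Real.abs_sin_le_one _
          _ ≤ D i := by rw [one_mul]; exact hD i _
      · rw [norm_smul, norm_mul, Real.norm_eq_abs, Real.norm_eq_abs]
        gcongr
        calc _ ≤ E i * 1 := mul_le_mul (hE i _) (Real.abs_cos_le_one _) (abs_nonneg _) (hE0 i)
          _ = E i := mul_one _
    have hdom₀ : ∀ z, ‖Γ₀ z‖ ≤ H z := fun z => by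
      refine (norm_add_le _ _).trans (add_le_add le_rfl ((norm_sum_le _ _).trans
        (Finset.sum_le_sum fun i _ => ?_)))
      rw [norm_smul, Real.norm_eq_abs]
      have := mul_le_mul_of_nonneg_right (hE i z.2) (norm_nonneg (χ i z.1))
      linarith [hD0 i]
    refine tendsto_of_subseq_tendsto fun ns hns => ?_
    obtain ⟨N, hN⟩ := eventually_atTop.1 (hns.eventually self_mem_nhdsWithin)
    have hpos : ∀ n, 0 < ns (n + N) := fun n => hN _ (Nat.le_add_left _ _)
    have hW1 : Tendsto (fun n => eLpNorm (W (ns (n + N))) (ENNReal.ofReal p) (prodMeas P Q)) atTop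
        (𝓝 0) := (hW0.comp hns).comp (tendsto_add_atTop_nat N)
    obtain ⟨k, hk, hkW⟩ := exists_subseq_tendsto_zero hp0 (fun n => (hWm _ (hpos n)).1) hW1
    refine ⟨fun n => k n + N, ?_⟩
    have hGm : ∀ n, MemLp (unf τ (ns (k n + N)) (G (ns (k n + N)))) (ENNReal.ofReal p)
        (prodMeas P Q) := fun n => memLp_unf hτ hp0 (hpos _) (hmem _ (hpos _)).memLp_grad
    refine tendsto_uEnergy hV hg hp hδ hQ hGm hΓ₀m ?_ hHm hlH
      (fun n => ae_of_all _ fun z => hdom _ z)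
    refine tendsto_eLpNorm_of_dominated hp0 (H := fun z => 2 * H z)
      (fun n => ((hGm n).sub hΓ₀m).1) (hHm.const_mul 2) (fun n => ae_of_all _ fun z => ?_) ?_
    · have := norm_sub_le (unf τ (ns (k n + N)) (G (ns (k n + N))) z) (Γ₀ z)
      linarith [hdom (ns (k n + N)) z, hdom₀ z]
    · filter_upwards [hkW] with z hz
      have h1 : ∀ i, Tendsto (fun n => unf τ (ns (k n + N)) (w i (ns (k n + N))) z) atTop
          (𝓝 0) := fun i => squeeze_zero_norm (fun n => Finset.single_le_sum
        (f := fun i => |unf τ (ns (k n + N)) (w i (ns (k n + N))) z|)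
        (fun i _ => abs_nonneg _) (Finset.mem_univ i)) hz
      have h2 : Tendsto (fun n => unf τ (ns (k n + N)) (G (ns (k n + N))) z) atTop (𝓝 (Γ₀ z)) := by
        simp only [hGu]
        refine tendsto_const_nhds.add (tendsto_finsetSum _ fun i _ => ?_)
        have e1 := ((Real.continuous_sin.tendsto _).comp (h1 i)).smul_const (gradient (η i) z.2)
        have e2 := (((Real.continuous_cos.tendsto _).comp (h1 i)).const_mul
          (η i z.2)).smul_const (χ i z.1)
        have e3 := e1.add e2
        simpa using e3
      exact tendsto_sub_nhds_zero_iff.2 h2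

end Recovery

theorem coe_sub_lt_coe_iff {a K : ℝ≥0∞} (hK : K ≠ ∞) {c : ℝ} :
    (a : EReal) - (K : EReal) < (c : EReal) ↔ a < ENNReal.ofReal (c + K.toReal) := by
  lift K to NNReal using hK
  by_cases ha : a = ∞
  · subst ha
    simp [EReal.coe_nnreal_eq_coe_real]
  · rw [ENNReal.lt_ofReal_iff_toReal_lt ha]
    lift a to NNReal using ha
    simp only [EReal.coe_nnreal_eq_coe_real, ENNReal.coe_toReal]
    rw [← EReal.coe_sub, EReal.coe_lt_coe_iff]
    exact sub_lt_iff_lt_add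

/-- A measurable choice of an index at which the first members of a sequence are minimal. -/
theorem exists_measurable_argmin {α : Type*} [MeasurableSpace α] {e : ℕ → α → ℝ≥0∞}
    (he : ∀ n, Measurable (e n)) : ∃ κ : ℕ → α → ℕ, (∀ n, Measurable (κ n)) ∧
      (∀ n x, κ n x ≤ n) ∧ (∀ x, Antitone fun n => e (κ n x) x) ∧ ∀ n x, e (κ n x) x ≤ e n x := by
  have hcomp : ∀ κ : α → ℕ, Measurable κ → Measurable fun x => e (κ x) x := fun κ hκ =>
    (measurable_from_prod_countable_right (f := fun z : ℕ × α => e z.1 z.2) he).comp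
      (hκ.prodMk measurable_id)
  -- Running minimum: the index is replaced only on strict improvement, which is a measurable
  -- condition.
  let κ : ℕ → α → ℕ := Nat.rec (fun _ => 0) fun n k x => if e (n + 1) x < e (k x) x then n + 1
    else k x
  have hs : ∀ n x, κ (n + 1) x = if e (n + 1) x < e (κ n x) x then n + 1 else κ n x :=
    fun _ _ => rfl
  have hm : ∀ n, Measurable (κ n) := fun n => by
    induction n with
    | zero => exact measurable_const
    | succ n ih => exact Measurable.ite (measurableSet_lt (he _) (hcomp _ ih)) measurable_const ih
  refine ⟨κ, hm, fun n x => ?_, fun x => antitone_nat_of_succ_le fun n => ?_, fun n x => ?_⟩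
  · induction n with
    | zero => exact le_rfl
    | succ n ih =>
      rw [hs]
      split_ifs
      · exact le_rfl
      · exact ih.trans n.le_succ
  · rw [hs]
    split_ifs with h
    · exact h.le
    · exact le_rfl
  · cases n with
    | zero => exact le_rfl
    | succ n =>
      rw [hs]
      split_ifs with h
      · exact le_rfl
      · exact not_lt.1 h

/-! ### Nearly optimal corrector fields and the upper bound -/

section UpperBound

variable {Ω : Type*} [MeasurableSpace Ω] {d : ℕ} {p : ℝ} {P : Measure Ω} {Q : Set (Sp d)}
  {τ : Sp d → Ω → Ω} {V : Ω → Sp d → Sp d → ℝ} {C δ : ℝ} {lam : Ω → ℝ}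

/-- As `Θ` has mean zero in `ω`, the average of `g + Θ` is `g` and its fluctuation is `Θ`; the
nonlocal energy then decouples into cell energies by Tonelli. -/
theorem uEnergy_add_corrector [IsProbabilityMeasure P] (hV : IsDegenerateIntegrand p P Q V)
    {g : Sp d → Sp d} (hgm : AEStronglyMeasurable g (volume.restrict Q)) {Θ : Ω × Sp d → Sp d}
    (hΘ : AEStronglyMeasurable Θ (prodMeas P Q)) (hi : ∀ x, Integrable (fun ω => Θ (ω, x)) P)
    (h0 : ∀ x, ∫ ω, Θ (ω, x) ∂P = 0) :
    AEMeasurable (fun x => cellE p P V C δ x (g x) fun ω => Θ (ω, x)) (volume.restrict Q) ∧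
    uEnergy p P Q V C δ (fun z => g z.2 + Θ z) =
      ∫⁻ x in Q, cellE p P V C δ x (g x) fun ω => Θ (ω, x) := by
  have hm : AEMeasurable (fun z => ENNReal.ofReal (density p P V C δ (fun z => g z.2 + Θ z) z))
      (prodMeas P Q) := (aemeasurable_density hV (hgm.comp_snd.add hΘ)).ennreal_ofReal
  have he : ∀ x, ∫⁻ ω, ENNReal.ofReal (density p P V C δ (fun z => g z.2 + Θ z) (ω, x)) ∂P =
      cellE p P V C δ x (g x) fun ω => Θ (ω, x) := fun x => by
    have h1 : avg P (fun z => g z.2 + Θ z) x = g x := by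
      simp only [avg]
      rw [integral_add (integrable_const _) (hi x), h0, integral_const, probReal_univ, one_smul,
        add_zero]
    simp only [density, cellE, h1, add_sub_cancel_left]
  refine ⟨?_, ?_⟩
  · simp only [← he]
    exact (hm.comp_quasiMeasurePreserving
      Measure.measurePreserving_swap.quasiMeasurePreserving).lintegral_prod_right'
  · rw [uEnergy, lintegral_prod_symm _ hm]
    exact lintegral_congr he

theorem uEnergy_ne_top [IsProbabilityMeasure P] (hp : 1 < p) (hQ : Bornology.IsBounded Q)
    (hg : HasGrowth p P Q V C lam) {Γ : Ω × Sp d → Sp d}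
    (hΓ : MemLp Γ (ENNReal.ofReal p) (prodMeas P Q))
    (hl : Integrable (fun z => lam z.1 * ‖Γ z‖ ^ p) (prodMeas P Q)) :
    uEnergy p P Q V C δ Γ ≠ ∞ := by
  have := isFiniteMeasure_restrict hQ
  have hp0 : 0 < p := by linarith
  have h1 : MemLp (fun z => Γ z - avg P Γ z.2) (ENNReal.ofReal p) (prodMeas P Q) :=
    hΓ.sub ((memLp_avg hp hΓ).comp_snd P)
  have h2 := h1.integrable_norm_rpow (by simpa using hp0) ENNReal.ofReal_ne_top
  rw [ENNReal.toReal_ofReal hp0.le] at h2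
  have h3 : Integrable (fun z => C * (lam z.1 * ‖Γ z‖ ^ p + 1) + C +
      δ * ‖Γ z - avg P Γ z.2‖ ^ p) (prodMeas P Q) :=
    (((hl.add (integrable_const 1)).const_mul C).add (integrable_const C)).add (h2.const_mul δ)
  refine ne_top_of_le_ne_top h3.2.ne (lintegral_mono_ae ?_)
  filter_upwards [hg.bound] with z hz
  rw [← ofReal_norm]
  refine ENNReal.ofReal_le_ofReal (le_trans ?_ (Real.le_norm_self _))
  simp only [density]
  linarith [(hz (Γ z)).2]

theorem integrable_bound [IsFiniteMeasure P] (hp : 1 ≤ p) (hQ : Bornology.IsBounded Q)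
    (hg : HasGrowth p P Q V C lam) {g : Sp d → Sp d}
    (hgp : MemLp g (ENNReal.ofReal p) (volume.restrict Q)) {ι : Type*} [Fintype ι]
    {χ : ι → Ω → Sp d} (hχ : ∀ i, MemLp (χ i) (ENNReal.ofReal p) P)
    (hχw : ∀ i, MemLp (fun ω => wgt p lam ω • χ i ω) (ENNReal.ofReal p) P) :
    MemLp (fun z : Ω × Sp d => ‖g z.2‖ + ∑ i, ‖χ i z.1‖) (ENNReal.ofReal p) (prodMeas P Q) ∧
      Integrable (fun z : Ω × Sp d => lam z.1 * (‖g z.2‖ + ∑ i, ‖χ i z.1‖) ^ p)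
        (prodMeas P Q) := by
  have := isFiniteMeasure_restrict hQ
  have hHm : MemLp (fun z : Ω × Sp d => ‖g z.2‖ + ∑ i, ‖χ i z.1‖) (ENNReal.ofReal p)
      (prodMeas P Q) := (hgp.comp_snd P).norm.add (memLp_finsetSum _ fun i _ =>
        ((hχ i).comp_fst (volume.restrict Q)).norm)
  have h1 := memLp_wgt_bound hQ hg hp hgp hχw (fun _ => 0) fun _ => 1
  simp only [zero_add, one_mul] at h1
  exact ⟨hHm, integrable_lam_mul_rpow hg (by linarith) (fun z => by positivity) hHm.1 h1⟩

/-- The energy of a simple field of correctors is almost attained with smooth amplitudes. -/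
theorem exists_smooth_amplitudes [IsProbabilityMeasure P] (hp : 1 < p) (hQo : IsOpen Q)
    (hQ : Bornology.IsBounded Q) (hV : IsDegenerateIntegrand p P Q V)
    (hg : HasGrowth p P Q V C lam) (hδ : 0 ≤ δ) {g : Sp d → Sp d}
    (hgp : MemLp g (ENNReal.ofReal p) (volume.restrict Q)) {ι : Type*} [Fintype ι]
    {χ : ι → Ω → Sp d} (hχ : ∀ i, MemLp (χ i) (ENNReal.ofReal p) P)
    (hχw : ∀ i, MemLp (fun ω => wgt p lam ω • χ i ω) (ENNReal.ofReal p) P)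
    {A : ι → Set (Sp d)} (hA : ∀ i, MeasurableSet (A i)) {c : ℝ≥0∞}
    (hc : uEnergy p P Q V C δ (fun z => g z.2 +
      ∑ i, (A i).indicator (fun _ => (1 : ℝ)) z.2 • χ i z.1) < c) :
    ∃ η : ι → Sp d → ℝ, (∀ i, IsTest (η i)) ∧ (∀ i, tsupport (η i) ⊆ Q) ∧
      uEnergy p P Q V C δ (fun z => g z.2 + ∑ i, η i z.2 • χ i z.1) < c := by
  have := isFiniteMeasure_restrict hQ
  have hp0 : 0 < p := by linarith
  have hp1 : 1 ≤ ENNReal.ofReal p := by simpa using hp.le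
  have hgs : MemLp (fun z : Ω × Sp d => g z.2) (ENNReal.ofReal p) (prodMeas P Q) :=
    hgp.comp_snd P
  have hχs : ∀ i, MemLp (fun z : Ω × Sp d => χ i z.1) (ENNReal.ofReal p) (prodMeas P Q) :=
    fun i => (hχ i).comp_fst _
  have hind : ∀ i, AEStronglyMeasurable ((A i).indicator fun _ => (1 : ℝ))
      (volume.restrict Q) := fun i => aestronglyMeasurable_const.indicator (hA i)
  have hΘm : MemLp (fun z : Ω × Sp d => ∑ i, (A i).indicator (fun _ => (1 : ℝ)) z.2 • χ i z.1)
      (ENNReal.ofReal p) (prodMeas P Q) := memLp_finsetSum _ fun i _ =>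
    memLp_bdd_smul (w := fun z : Ω × Sp d => (A i).indicator (fun _ => (1 : ℝ)) z.2)
      (hind i).comp_snd (C := 1) (fun z => by by_cases h : z.2 ∈ A i <;> simp [h]) (hχs i)
  -- Cutoffs converging in `L^p(Q)` to the indicators, with error `2⁻¹ ^ n`. Their bound by `1`
  -- provides a common majorant, so the energies converge and the strict inequality persists.
  choose η hη hηQ hηb hηA using fun (n : ℕ) (i : ι) => exists_cutoff (p := p) hp0 hQo hQ
    (hA i) (r := 2⁻¹ ^ n) (ENNReal.pow_pos (by simp) n)
  obtain ⟨hHm, hlH⟩ := integrable_bound hp.le hQ hg hgp hχ hχw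
  have hηχ : ∀ n i, MemLp (fun z : Ω × Sp d => η n i z.2 • χ i z.1) (ENNReal.ofReal p)
      (prodMeas P Q) := fun n i => (hη n i).memLp_smul (hχs i)
  have hΓn : ∀ n, MemLp (fun z : Ω × Sp d => g z.2 + ∑ i, η n i z.2 • χ i z.1)
      (ENNReal.ofReal p) (prodMeas P Q) := fun n =>
    hgs.add (memLp_finsetSum _ fun i _ => hηχ n i)
  have hlim := tendsto_uEnergy hV hg hp hδ hQ hΓn (hgs.add hΘm) ?_ hHm hlH
    (fun n => ae_of_all _ fun z => ?_)
  · obtain ⟨n, hn⟩ := (hlim.eventually (gt_mem_nhds hc)).exists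
    exact ⟨η n, hη n, hηQ n, hn⟩
  · have hdm : ∀ n i, AEStronglyMeasurable (fun x => η n i x -
        (A i).indicator (fun _ => (1 : ℝ)) x) (volume.restrict Q) := fun n i =>
      (hη n i).continuous.aestronglyMeasurable.sub (hind i)
    have h1 : ∀ n, eLpNorm (fun z : Ω × Sp d => (g z.2 + ∑ i, η n i z.2 • χ i z.1) -
        (g z.2 + ∑ i, (A i).indicator (fun _ => (1 : ℝ)) z.2 • χ i z.1)) (ENNReal.ofReal p) (prodMeas P Q) ≤
        ∑ i, 2⁻¹ ^ n * eLpNorm (χ i) (ENNReal.ofReal p) P := fun n => by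
      have e1 : (fun z : Ω × Sp d => (g z.2 + ∑ i, η n i z.2 • χ i z.1) -
          (g z.2 + ∑ i, (A i).indicator (fun _ => (1 : ℝ)) z.2 • χ i z.1)) = ∑ i, fun z : Ω × Sp d =>
          (η n i z.2 - (A i).indicator (fun _ => (1 : ℝ)) z.2) • χ i z.1 := by
        ext1 z
        simp only [Finset.sum_apply, sub_smul, Finset.sum_sub_distrib,
          add_sub_add_left_eq_sub]
      have e2 : ∀ i, AEStronglyMeasurable (fun z : Sp d × Ω =>
          (η n i z.1 - (A i).indicator (fun _ => (1 : ℝ)) z.1) • χ i z.2)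
          ((volume.restrict Q).prod P) := fun i =>
        aestronglyMeasurable_tensor (hdm n i) (hχ i).1
      rw [e1]
      refine (eLpNorm_sum_le (fun i _ => (e2 i).prod_swap) hp1).trans
        (Finset.sum_le_sum fun i _ => ?_)
      have e3 := eLpNorm_swap (p := ENNReal.ofReal p) (e2 i)
      rw [e3, eLpNorm_tensor hp0 (hdm n i) (hχ i).1]
      gcongr
      exact hηA n i
    refine tendsto_of_tendsto_of_tendsto_of_le_of_le tendsto_const_nhds ?_ (fun _ => zero_le) h1
    have h2 := tendsto_finsetSum (Finset.univ : Finset ι) fun i _ =>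
      ENNReal.Tendsto.mul_const (b := eLpNorm (χ i) (ENNReal.ofReal p) P)
        (ENNReal.tendsto_pow_atTop_nhds_zero_of_lt_one (r := 2⁻¹) (by simp))
        (Or.inr (hχ i).2.ne)
    simpa using h2
  · refine (norm_add_le _ _).trans (add_le_add le_rfl ((norm_sum_le _ _).trans
      (Finset.sum_le_sum fun i _ => ?_)))
    rw [norm_smul]
    exact mul_le_of_le_one_left (norm_nonneg _) (hηb n i _)

/-- Simple fields of correctors with smooth amplitudes approximate the infimum in the cell
problems. -/
theorem exists_simple_corrector (hτ : IsStationary P τ) (hp : 1 < p) (hQo : IsOpen Q)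
    (hQ : Bornology.IsBounded Q) (hV : IsDegenerateIntegrand p P Q V)
    (hg : HasGrowth p P Q V C lam) (hδ : 0 ≤ δ) {g : Sp d → Sp d}
    (hgp : MemLp g (ENNReal.ofReal p) (volume.restrict Q)) {χ : ℕ → Ω → Sp d}
    (hχ : ∀ k, IsPot p P τ (χ k))
    (hχw : ∀ k, MemLp (fun ω => wgt p lam ω • χ k ω) (ENNReal.ofReal p) P) {c : ℝ≥0∞}
    (hc : ∫⁻ x in Q, ⨅ k, cellE p P V C δ x (g x) (χ k) < c) :
    ∃ (n : ℕ) (η : Fin n → Sp d → ℝ), (∀ i, IsTest (η i)) ∧ (∀ i, tsupport (η i) ⊆ Q) ∧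
      uEnergy p P Q V C δ (fun z => g z.2 + ∑ i, η i z.2 • χ i z.1) < c := by
  have := hτ.prob
  have := isFiniteMeasure_restrict hQ
  have hp0 : 0 < p := by linarith
  have hp1 : 1 ≤ ENNReal.ofReal p := by simpa using hp.le
  have hint : ∀ k, Integrable (χ k) P := fun k => (hχ k).memLp.integrable hp1
  have hzero : ∀ k, ∫ ω, χ k ω ∂P = 0 := fun k => (hχ k).integral_eq_zero hp.le hτ
  have hgs : MemLp (fun z : Ω × Sp d => g z.2) (ENNReal.ofReal p) (prodMeas P Q) :=
    hgp.comp_snd P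
  have hχs : ∀ k, MemLp (fun z : Ω × Sp d => χ k z.1) (ENNReal.ofReal p) (prodMeas P Q) :=
    fun k => (hχ k).memLp.comp_fst _
  have hbase := fun k => uEnergy_add_corrector (C := C) (δ := δ) hV hgp.1 (hχs k).1
    (fun _ => hint k) (fun _ => hzero k)
  -- Genuinely measurable versions of the cell energies, as required for a measurable choice of
  -- corrector.
  obtain ⟨e, hem, hee⟩ : ∃ e : ℕ → Sp d → ℝ≥0∞, (∀ k, Measurable (e k)) ∧
      ∀ᵐ x ∂(volume.restrict Q), ∀ k, cellE p P V C δ x (g x) (χ k) = e k x :=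
    ⟨fun k => (hbase k).1.mk, fun k => (hbase k).1.measurable_mk,
      ae_all_iff.2 fun k => (hbase k).1.ae_eq_mk⟩
  obtain ⟨κ, hκm, hκn, hκa, hκe⟩ := exists_measurable_argmin hem
  have hfm : ∀ n, Measurable fun x => e (κ n x) x := fun n =>
    (measurable_from_prod_countable_right (f := fun z : ℕ × Sp d => e z.1 z.2) hem).comp
      ((hκm n).prodMk measurable_id)
  -- Monotone convergence for decreasing sequences needs one finite integral. At stage `0` the
  -- choice is `χ 0`, whose weighted norm is finite.
  have hfin : ∫⁻ x in Q, e (κ 0 x) x ≠ ∞ := by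
    have h1 : ∫⁻ x in Q, e (κ 0 x) x = uEnergy p P Q V C δ (fun z => g z.2 + χ 0 z.1) := by
      rw [(hbase 0).2]
      refine lintegral_congr_ae ?_
      filter_upwards [hee] with x hx
      rw [Nat.le_zero.1 (hκn 0 x), ← hx]
    have h4 := (integrable_bound hp.le hQ hg hgp (χ := fun _ : Unit => χ 0) (fun _ => (hχ 0).memLp)
      fun _ => hχw 0).2
    have h5 : MemLp (fun z : Ω × Sp d => g z.2 + χ 0 z.1) (ENNReal.ofReal p) (prodMeas P Q) :=
      hgs.add (hχs 0)
    rw [h1]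
    refine uEnergy_ne_top hp hQ hg h5 (h4.mono' ?_ ?_)
    · exact hg.integrable.1.comp_fst.mul (h5.1.norm.aemeasurable.pow_const p).aestronglyMeasurable
    · filter_upwards [hg.lam_pos_prod] with z hz
      rw [Real.norm_of_nonneg (by positivity)]
      gcongr
      refine (norm_add_le _ _).trans (le_of_eq ?_)
      simp
  obtain ⟨N, hN⟩ : ∃ N, ∫⁻ x in Q, e (κ N x) x < c := by
    have h1 := lintegral_iInf (μ := volume.restrict Q) hfm (fun m n h x => hκa x h) hfin
    rw [← iInf_lt_iff, ← h1]
    refine lt_of_le_of_lt (lintegral_mono_ae ?_) hc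
    filter_upwards [hee] with x hx
    simp only [hx]
    exact iInf_mono fun n => hκe n x
  -- At stage `N` the chosen index is at most `N`, so these `N + 1` sets partition the space and the
  -- selected field is a finite sum.
  let A : Fin (N + 1) → Set (Sp d) := fun i => {x | κ N x = i}
  have hA : ∀ i, MeasurableSet (A i) := fun i => hκm N (measurableSet_singleton _)
  let Θ : Ω × Sp d → Sp d := fun z => ∑ i, (A i).indicator (fun _ => (1 : ℝ)) z.2 • χ i z.1
  have hΘx : ∀ x ω, Θ (ω, x) = χ (κ N x) ω := fun x ω => by
    have hlt : κ N x < N + 1 := Nat.lt_succ_of_le (hκn N x)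
    simp only [Θ]
    rw [Finset.sum_eq_single ⟨κ N x, hlt⟩]
    · have hmem : x ∈ A ⟨κ N x, hlt⟩ := rfl
      rw [Set.indicator_of_mem hmem, one_smul]
    · intro i _ hi
      rw [Set.indicator_of_notMem, zero_smul]
      exact fun h : x ∈ A i => hi (Fin.ext (Eq.symm h))
    · exact fun h => absurd (Finset.mem_univ _) h
  have hind : ∀ i, MemLp ((A i).indicator fun _ => (1 : ℝ)) (ENNReal.ofReal p)
      (volume.restrict Q) := fun i => (memLp_const (1 : ℝ)).indicator (hA i)
  have hΘm : MemLp Θ (ENNReal.ofReal p) (prodMeas P Q) := memLp_finsetSum _ fun i _ =>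
    memLp_bdd_smul (w := fun z : Ω × Sp d => (A i).indicator (fun _ => (1 : ℝ)) z.2)
      (hind i).1.comp_snd (C := 1) (fun z => by
        by_cases h : z.2 ∈ A i <;> simp [h]) (hχs i)
  have hΘE : uEnergy p P Q V C δ (fun z => g z.2 + Θ z) < c := by
    rw [(uEnergy_add_corrector hV hgp.1 hΘm.1 (fun x => by simpa only [hΘx] using hint _)
      (fun x => by simpa only [hΘx] using hzero _)).2]
    refine lt_of_le_of_lt (le_of_eq (lintegral_congr_ae ?_)) hN
    filter_upwards [hee] with x hx
    simp only [hΘx]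
    exact hx _
  obtain ⟨η, hη, hηQ, hE⟩ := exists_smooth_amplitudes hp hQo hQ hV hg hδ hgp
    (χ := fun i : Fin (N + 1) => χ i) (fun i => (hχ i).memLp) (fun i => hχw i) hA hΘE
  exact ⟨N + 1, η, hη, hηQ, hE⟩

/-- For every energy level above the homogenized energy there is a family below that level. -/
theorem exists_upper_family (hτ : IsStationary P τ) (hp : 1 < p) (hQo : IsOpen Q)
    (hQ : Bornology.IsBounded Q) (hV : IsDegenerateIntegrand p P Q V) (hδ : 0 ≤ δ)
    {u₀ : Sp d → ℝ} {c : EReal} (hc : energyHom p P τ Q V δ u₀ < c) :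
    ∃ u : ℝ → Ω × Sp d → ℝ, (∀ ε, 0 < ε → MemLp (u ε) (ENNReal.ofReal p) (prodMeas P Q)) ∧
      Tendsto (fun ε => eLpNorm (fun z => unf τ ε (u ε) z - u₀ z.2) (ENNReal.ofReal p)
        (prodMeas P Q)) (𝓝[>] 0) (𝓝 0) ∧
      ∀ᶠ ε in 𝓝[>] 0, energy p P τ Q V ε δ (u ε) < c := by
  have := hτ.prob
  have := isFiniteMeasure_restrict hQ
  obtain ⟨C, lam, hg⟩ := hV.exists_growth
  obtain ⟨g, hg1⟩ := iInf_lt_iff.1 hc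
  obtain ⟨hu, hgc⟩ := iInf_lt_iff.1 hg1
  obtain ⟨χ, hχ, hχw, hχi⟩ := exists_corrector_seq hτ hg hp.le hδ
  have hint : ∀ k, Integrable (χ k) P := fun k => (hχ k).memLp.integrable (by simpa using hp.le)
  have hzero : ∀ k, ∫ ω, χ k ω ∂P = 0 := fun k => (hχ k).integral_eq_zero hp.le hτ
  have hcm := fun k => (uEnergy_add_corrector (C := C) (δ := δ) hV hu.memLp_grad.1
    ((hχ k).memLp.comp_fst _).1 (fun _ => hint k) (fun _ => hzero k)).1
  have hK : ENNReal.ofReal C * prodMeas P Q Set.univ ≠ ∞ :=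
    ENNReal.mul_ne_top ENNReal.ofReal_ne_top (measure_ne_top _ _)
  -- The countable infimum of cell energies is measurable and, at almost every `x`, lies below the
  -- homogenized integrand shifted by `C`.
  have h1 : ((∫⁻ x in Q, ⨅ k, cellE p P V C δ x (g x) (χ k) : ℝ≥0∞) : EReal) -
      ((ENNReal.ofReal C * prodMeas P Q Set.univ : ℝ≥0∞) : EReal) < c := by
    refine lt_of_le_of_lt ?_ hgc
    rw [← Set.univ_prod_univ, Measure.prod_prod, measure_univ (μ := P), one_mul,
      ← eint_sub_const (AEMeasurable.iInf hcm) ENNReal.ofReal_ne_top]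
    refine eint_mono ?_
    filter_upwards [ae_isRegularAt hV hg] with x hx
    exact hx.le_Vhom hg hδ fun ξ hξ => hχi x hx _ ξ hξ
  obtain ⟨c', hc1, hc2⟩ := EReal.lt_iff_exists_real_btwn.1 h1
  have h3 : ∫⁻ x in Q, ⨅ k, cellE p P V C δ x (g x) (χ k) <
      ENNReal.ofReal (c' + (ENNReal.ofReal C * prodMeas P Q Set.univ).toReal) := by
    exact (coe_sub_lt_coe_iff hK).1 hc1
  obtain ⟨n, η, hη, hηQ, hE⟩ := exists_simple_corrector hτ hp hQo hQ hV hg hδ hu.memLp_grad hχ hχw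
    h3
  obtain ⟨u, G, hmem, hlim, hElim⟩ := exists_recovery (ι := Fin n) hτ hp hQo.measurableSet hQ hV hg
    hδ hu hη hηQ (fun i => hχ i) (fun i => hχw i)
  refine ⟨u, fun ε hε => (hmem ε hε).memLp, hlim, ?_⟩
  filter_upwards [hElim.eventually (gt_mem_nhds hE), self_mem_nhdsWithin] with ε h4 hε
  rw [energy_eq hτ hp hQ hV hg hδ hε (hmem ε hε)]
  exact ((coe_sub_lt_coe_iff hK).2 h4).trans hc2

end UpperBound

/-- Diagonal selection from countably many properties that hold eventually. -/
theorem exists_diagonal {A : ℕ → ℝ → Prop} (h : ∀ m, ∀ᶠ ε in 𝓝[>] (0 : ℝ), A m ε) :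
    ∃ k : ℝ → ℕ, ∀ m, ∀ᶠ ε in 𝓝[>] (0 : ℝ), m ≤ k ε ∧ A (k ε) ε := by
  classical
  -- The largest admissible index up to a cap that tends to infinity as `ε → 0`.
  refine ⟨fun ε => Nat.findGreatest (fun m => A m ε) ⌊ε⁻¹⌋₊, fun m => ?_⟩
  filter_upwards [h m, tendsto_inv_nhdsGT_zero.eventually_ge_atTop (m : ℝ)] with ε h1 h2
  have h3 : m ≤ ⌊ε⁻¹⌋₊ := Nat.le_floor h2
  exact ⟨Nat.le_findGreatest h3 h1, Nat.findGreatest_spec (P := fun m => A m ε) h3 h1⟩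

/-! ### Convergence of energies along recovery families -/

variable {Ω : Type*} [MeasurableSpace Ω] {d : ℕ} {p : ℝ} {P : Measure Ω} {Q : Set (Sp d)}
  {τ : Sp d → Ω → Ω} {V : Ω → Sp d → Sp d → ℝ} {δ : ℝ}

/-- The upper half is assumed. If the lower half failed, some sequence of `ε` would keep the energy
below a level under the homogenized energy, contradicting the liminf inequality, which applies
because strong convergence implies weak convergence. -/
theorem tendsto_energy (hd : 0 < d) (hτ : IsStationary P τ) (herg : IsErgodic P τ)
    (hp : 1 < p) (hQm : MeasurableSet Q) (hQ : Bornology.IsBounded Q)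
    (hV : IsDegenerateIntegrand p P Q V) (hδ : 0 < δ) {u : ℝ → Ω × Sp d → ℝ} {u₀ : Sp d → ℝ}
    (hu : ∀ ε, 0 < ε → MemLp (u ε) 1 (prodMeas P Q)) (hu₀ : MemLp u₀ 1 (volume.restrict Q))
    (hlim : Tendsto (fun ε => eLpNorm (fun z => unf τ ε (u ε) z - u₀ z.2) 1
      (prodMeas P Q)) (𝓝[>] 0) (𝓝 0))
    (hup : ∀ c, energyHom p P τ Q V δ u₀ < c →
      ∀ᶠ ε in 𝓝[>] 0, energy p P τ Q V ε δ (u ε) < c) :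
    Tendsto (fun ε => energy p P τ Q V ε δ (u ε)) (𝓝[>] 0)
      (𝓝 (energyHom p P τ Q V δ u₀)) := by
  have := hτ.prob
  refine tendsto_order.2 ⟨fun a ha => ?_, hup⟩
  by_contra hcon
  rw [not_eventually] at hcon
  obtain ⟨ε, hε, hεa⟩ := exists_seq_forall_of_frequently
    (hcon.and_eventually (self_mem_nhdsWithin : Set.Ioi (0 : ℝ) ∈ 𝓝[>] 0))
  have hpos : ∀ n, 0 < ε n := fun n => (hεa n).2
  have hm : ∀ n, MemLp (unf τ (ε n) (u (ε n))) 1 (prodMeas P Q) := fun n => by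
    have := memLp_unf hτ one_pos (hpos n) (u := u (ε n)) (Q := Q)
      (by simpa using hu _ (hpos n))
    simpa using this
  have h0 : MemLp (fun z : Ω × Sp d => u₀ z.2) 1 (prodMeas P Q) := hu₀.comp_snd _
  have hw : WeakLpTendsto 1 (prodMeas P Q) (fun n => unf τ (ε n) (u (ε n)))
      (fun z => u₀ z.2) := ⟨hm, h0, fun q hq ψ hψ =>
    have := hq
    tendsto_integral_inner hm h0 hψ (hlim.comp hε)⟩
  refine absurd (energyHom_le_liminf hd hτ herg hp hQm hQ hV hδ hpos
    (hε.mono_right nhdsWithin_le_nhds) hw) (not_le.2 (lt_of_le_of_lt ?_ ha))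
  exact liminf_le_of_frequently_le' (Frequently.of_forall fun n => not_lt.1 (hεa n).1)

/-- If the homogenized energy is `⊤`, the constant family works. Otherwise choose levels decreasing
to it, a family below each level, and a diagonal index growing as `ε → 0` that keeps both the energy
bound and `L^1` closeness `1 / (m + 1)`. -/
theorem exists_recovery_family (hd : 0 < d) (hτ : IsStationary P τ) (herg : IsErgodic P τ)
    (hp : 1 < p) (hQo : IsOpen Q) (hQ : Bornology.IsBounded Q)
    (hV : IsDegenerateIntegrand p P Q V) (hδ : 0 < δ) {u₀ : Sp d → ℝ}
    (hu₀ : MemLp u₀ 1 (volume.restrict Q)) :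
    ∃ u : ℝ → Ω × Sp d → ℝ, (∀ ε, 0 < ε → MemLp (u ε) 1 (prodMeas P Q)) ∧
      Tendsto (fun ε => eLpNorm (fun z => unf τ ε (u ε) z - u₀ z.2) 1 (prodMeas P Q))
        (𝓝[>] 0) (𝓝 0) ∧
      Tendsto (fun ε => energy p P τ Q V ε δ (u ε)) (𝓝[>] 0)
        (𝓝 (energyHom p P τ Q V δ u₀)) := by
  have := hτ.prob
  have := isFiniteMeasure_restrict hQ
  have h0 : MemLp (fun z : Ω × Sp d => u₀ z.2) 1 (prodMeas P Q) := hu₀.comp_snd _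
  suffices ∃ u : ℝ → Ω × Sp d → ℝ, (∀ ε, 0 < ε → MemLp (u ε) 1 (prodMeas P Q)) ∧
      Tendsto (fun ε => eLpNorm (fun z => unf τ ε (u ε) z - u₀ z.2) 1 (prodMeas P Q))
        (𝓝[>] 0) (𝓝 0) ∧
      ∀ c, energyHom p P τ Q V δ u₀ < c →
        ∀ᶠ ε in 𝓝[>] 0, energy p P τ Q V ε δ (u ε) < c by
    obtain ⟨u, h1, h2, h3⟩ := this
    exact ⟨u, h1, h2, tendsto_energy hd hτ herg hp hQo.measurableSet hQ hV hδ h1 hu₀ h2 h3⟩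
  rcases eq_or_ne (energyHom p P τ Q V δ u₀) ⊤ with htop | htop
  · refine ⟨fun _ z => u₀ z.2, fun _ _ => h0, ?_, fun c hc => ?_⟩
    · simp [unf]
    · exact absurd hc (by simp [htop])
  obtain ⟨c, -, hc, hclim⟩ := exists_seq_strictAnti_tendsto' (lt_top_iff_ne_top.2 htop)
  choose v hv hvlim hvc using fun m =>
    exists_upper_family hτ hp hQo hQ hV hδ.le (hc m).1
  have hp1 : (1 : ℝ≥0∞) ≤ ENNReal.ofReal p := by simpa using hp.le
  have hmem : ∀ m ε, 0 < ε → MemLp (v m ε) 1 (prodMeas P Q) := fun m ε hε =>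
    (hv m ε hε).mono_exponent hp1
  have h1lim : ∀ m, Tendsto (fun ε => eLpNorm (fun z => unf τ ε (v m ε) z - u₀ z.2) 1
      (prodMeas P Q)) (𝓝[>] 0) (𝓝 0) := fun m => by
    have hK : prodMeas P Q Set.univ ^
        (1 / (1 : ℝ≥0∞).toReal - 1 / (ENNReal.ofReal p).toReal) ≠ ∞ := by
      refine ENNReal.rpow_ne_top_of_nonneg ?_ (measure_ne_top _ _)
      rw [ENNReal.toReal_ofReal (by linarith), ENNReal.toReal_one, sub_nonneg]
      exact one_div_le_one_div_of_le one_pos hp.le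
    have h2 := ENNReal.Tendsto.mul_const (hvlim m) (Or.inr hK)
    rw [zero_mul] at h2
    refine tendsto_of_tendsto_of_tendsto_of_le_of_le' tendsto_const_nhds h2
      (Eventually.of_forall fun _ => zero_le) ?_
    filter_upwards [self_mem_nhdsWithin] with ε hε
    refine eLpNorm_le_eLpNorm_mul_rpow_measure_univ hp1 ?_
    exact (memLp_unf hτ (by linarith) hε (hv m ε hε)).1.sub h0.1
  obtain ⟨k, hk⟩ := exists_diagonal (A := fun m ε => energy p P τ Q V ε δ (v m ε) < c m ∧
      eLpNorm (fun z => unf τ ε (v m ε) z - u₀ z.2) 1 (prodMeas P Q) < ((m : ℝ≥0∞) + 1)⁻¹)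
    fun m => (hvc m).and ((h1lim m).eventually_lt_const (by simp))
  have hktop : Tendsto k (𝓝[>] 0) atTop :=
    tendsto_atTop.2 fun m => (hk m).mono fun _ h => h.1
  refine ⟨fun ε => v (k ε) ε, fun ε hε => hmem _ ε hε, ?_, fun a ha => ?_⟩
  · have h2 : Tendsto (fun m : ℕ => ((m : ℝ≥0∞) + 1)⁻¹) atTop (𝓝 0) := by
      have := (tendsto_add_atTop_iff_nat 1).2 ENNReal.tendsto_inv_nat_nhds_zero
      simpa using this
    exact tendsto_of_tendsto_of_tendsto_of_le_of_le' tendsto_const_nhds (h2.comp hktop)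
      (Eventually.of_forall fun _ => zero_le) ((hk 0).mono fun _ h => h.2.2.le)
  · filter_upwards [hk 0, hktop.eventually (hclim.eventually_lt_const ha)] with ε h1 h2
    exact h1.2.1.trans h2

end VarReg

theorem theorem4p7 {Ω : Type*} [MeasurableSpace Ω] {d : ℕ} (hd : 0 < d)
    (P : Measure Ω) (τ : VarReg.Sp d → Ω → Ω)
    (hτ : VarReg.IsStationary P τ) (herg : VarReg.IsErgodic P τ)
    (p : ℝ) (hp : 1 < p)
    (Q : Set (VarReg.Sp d)) (hQo : IsOpen Q) (hQb : Bornology.IsBounded Q)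
    (V : Ω → VarReg.Sp d → VarReg.Sp d → ℝ) (hV : VarReg.IsDegenerateIntegrand p P Q V)
    (δ : ℝ) (hδ : 0 < δ) :
    -- (i) compactness
    (∀ (ε : ℕ → ℝ), (∀ n, 0 < ε n) → Tendsto ε atTop (𝓝 0) →
      ∀ (u : ℕ → Ω × VarReg.Sp d → ℝ) (G : ℕ → Ω × VarReg.Sp d → VarReg.Sp d),
        (∀ n, VarReg.IsLpW10 p P Q (u n) (G n)) →
        limsup (fun n => VarReg.energy p P τ Q V (ε n) δ (u n)) atTop < ⊤ →
        ∃ (u₀ : VarReg.Sp d → ℝ) (g : VarReg.Sp d → VarReg.Sp d)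
          (χ : Ω × VarReg.Sp d → VarReg.Sp d),
          VarReg.IsW10 p Q u₀ g ∧ VarReg.IsPotTensor p P τ Q χ ∧
          ∃ k : ℕ → ℕ, StrictMono k ∧
            VarReg.WeakLpTendsto (ENNReal.ofReal p) (VarReg.prodMeas P Q)
              (fun n => VarReg.unf τ (ε (k n)) (u (k n))) (fun z => u₀ z.2) ∧
            VarReg.WeakLpTendsto (ENNReal.ofReal p) (VarReg.prodMeas P Q)
              (fun n => VarReg.unf τ (ε (k n)) (G (k n))) (fun z => g z.2 + χ z)) ∧
    -- (ii) liminf inequality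
    (∀ (ε : ℕ → ℝ), (∀ n, 0 < ε n) → Tendsto ε atTop (𝓝 0) →
      ∀ (u : ℕ → Ω × VarReg.Sp d → ℝ) (u₀ : VarReg.Sp d → ℝ),
        (∀ n, MemLp (u n) 1 (VarReg.prodMeas P Q)) → MemLp u₀ 1 (volume.restrict Q) →
        VarReg.WeakLpTendsto 1 (VarReg.prodMeas P Q)
          (fun n => VarReg.unf τ (ε n) (u n)) (fun z => u₀ z.2) →
        VarReg.energyHom p P τ Q V δ u₀ ≤
          liminf (fun n => VarReg.energy p P τ Q V (ε n) δ (u n)) atTop) ∧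
    -- (iii) recovery sequences
    (∀ u₀ : VarReg.Sp d → ℝ, MemLp u₀ 1 (volume.restrict Q) →
      ∃ u : ℝ → Ω × VarReg.Sp d → ℝ,
        (∀ ε, 0 < ε → MemLp (u ε) 1 (VarReg.prodMeas P Q)) ∧
        Tendsto (fun ε => eLpNorm (fun z => VarReg.unf τ ε (u ε) z - u₀ z.2) 1
          (VarReg.prodMeas P Q)) (𝓝[>] 0) (𝓝 0) ∧
        Tendsto (fun ε => VarReg.energy p P τ Q V ε δ (u ε)) (𝓝[>] 0)
          (𝓝 (VarReg.energyHom p P τ Q V δ u₀))) := by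
  refine ⟨fun ε hε hlim u G h hE => ?_, fun ε hε hlim u u₀ _ _ hw => ?_, fun u₀ hu₀ => ?_⟩
  · exact VarReg.exists_compactness hd hτ herg hp hQo.measurableSet hQb hV hδ hε hlim h hE
  · exact VarReg.energyHom_le_liminf hd hτ herg hp hQo.measurableSet hQb hV hδ hε hlim hw
  · exact VarReg.exists_recovery_family hd hτ herg hp hQo hQb hV hδ hu₀
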